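/- **Setting.** Fix $d\ge 1$, $\alpha,\beta,M>0$ and $C_1,C_2\in\mathbb R$. Fix a compactly supported, boundary-corrected (Cohen–Daubechies–Vial type) orthonormal tensor-product wavelet basis $\{\Phi_{J_0m},\Psi^{\iota}_{lm}: l\ge J_0\}$ of $L^2([0,1]^d)$ of regularity $S>\alpha\vee\beta$ (its spaces $V_j=\mathrm{span}\{\Phi_{jm}\}_m$, $j\ge J_0$, of dimension $k=2^{jd}$, are nested and reproduce the polynomials of degree $\le S-1$ in each variable). Let $K_{V_k}$ be the orthogonal projection kernel onto the space $V_j$ with $2^{jd}=k$. Let $H(a,M)$ be the set of uniformly continuous $h$ on $[0,1]^d$ with $$\sup_m 2^{J_0(a+d/2)}|\langle h,\Phi_{J_0m}\rangle|+\sup_{l\ge J_0,m,\iota}2^{l(a+d/2)}|\langle h,\Psi^\iota_{lm}\rangle|\le M .$$ Let $\mathcal P$ be the set of laws $\mathbb P$ of $(X,A,Y)$ with $X\sim\mathrm{Uniform}([0,1]^d)$, $A,Y\in[C_1,C_2]$ a.s., $p(x)=\mathbb E[A\mid X=x]\in H(\alpha,M)$ and $b(x)=\mathbb E[Y\mid X=x]\in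 H(\beta,M)$. Assume that the model is non-degenerate: for some $M_0<M$ and $\delta>0$ there are $p_0\in H(\alpha,M_0)$ and $b_0\in H(\beta,M_0)$ with values in $[C_1+\delta,C_2-\delta]$ (for instance, $C_1<0<C_2$). The target is $\psi(\mathbb P)=\mathbb E_{\mathbb P}[\mathrm{Cov}_{\mathbb P}(A,Y\mid X)]$. Let $\mathcal D_1,\mathcal D_2,\mathcal D_3$ be disjoint i.i.d. samples of size $n$ from $\mathbb P$. For $k_1,k_2\in\{2^{jd}:j\ge J_0\}$ (which may depend on $n$) put $\hat p(x)=\frac1n\sum_{i\in\mathcal D_1}A_iK_{V_{k_1}}(X_i,x)$ and $\hat b(x)=\frac1n\sum_{i\in\mathcal D_1}Y_iK_{V_{k_2}}(X_i,x)$ (single sample splitting: both use $\mathcal D_1$), and $$\hat\psi^{\mathrm{INT}}=\tfrac1n\sum_{i\in\mathcal D_2}A_iY_i-\int_{[0,1]^d}\hat p\,\hat b\,dx,\qquad \hat\psi^{\mathrm{MC}}=\tfrac1n\sum_{i\in\mathcal D_2}A_iY_i-\tfrac1n\sum_{i\in\mathcal D_3}\hat p(X_i)\hat b(X_i),$$ $$\hat\psi^{\mathrm{IF}}=\tfrac1n\sum_{i\in\mathcal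 D_2}(A_i-\hat p(X_i))(Y_i-\hat b(X_i)).$$ Write $k_{\min}=k_1\wedge k_2$ and $k_{\max}=k_1\vee k_2$; $a_n\lesssim b_n$ means $a_n\le Cb_n$ for some $C>0$ and all large $n$, and $a_n\asymp b_n$ means $a_n\lesssim b_n\lesssim a_n$. The risk of $\hat\psi$ is $\sup_{\mathbb P\in\mathcal P}\mathbb E_{\mathbb P}(\hat\psi-\psi(\mathbb P))^2$; the minimax risk $R_{mn}$ is the infimum of the risk over all measurable estimators based on $mn$ i.i.d. observations. An estimator that uses $m$ subsamples of size $n$ ($m=2$ for INT and IF, $m=3$ for MC) is minimax rate optimal if its risk is $\lesssim R_{mn}$. **Claim.** For every fixed $m\ge2$, $R_{mn}\asymp n^{-1}$ if $\frac{\alpha+\beta}2\ge\frac d4$, and $R_{mn}\asymp n^{-\frac{4\alpha+4\beta}{2\alpha+2\beta+d}}$ if $\frac{\alpha+\beta}2<\frac d4$. Moreover: If $\frac{\alpha+\beta}{2}\ge\frac d2$, then 1. $\hat\psi^{\mathrm{INT}}$ is minimax rate optimal when $n^{\frac{d}{2\alpha+2\beta}}\lesssim k_{\min}\lesssim\sqrt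 n$; 2. $\hat\psi^{\mathrm{MC}}$ is minimax rate optimal when $n^{\frac{d}{2\alpha+2\beta}}\lesssim k_{\min}\lesssim\sqrt n$ and $k_{\max}\lesssim n$; 3. $\hat\psi^{\mathrm{IF}}$ is minimax rate optimal when $k_{\min}\lesssim\sqrt n$ and $n^{\frac{d}{2\alpha+2\beta}}\lesssim k_{\max}\lesssim n$. If $\frac{\alpha+\beta}{2}<\frac d2$, then 1. $\hat\psi^{\mathrm{INT}}$ is not minimax rate optimal for any choice of $k_1,k_2$. Its best rate is $n^{-\frac{2\alpha+2\beta}{\alpha+\beta+d}}$: its risk is $\gtrsim$ this rate for every choice of $k_1,k_2$, and $\asymp$ this rate when $k_{\min}\asymp n^{\frac d{\alpha+\beta+d}}$; 2. $\hat\psi^{\mathrm{MC}}$ is not minimax rate optimal for any choice of $k_1,k_2$. Its best rate is $n^{-\frac{2\alpha+2\beta}{\alpha+\beta+d}}$: its risk is $\gtrsim$ this rate for every choice of $k_1,k_2$, and $\asymp$ this rate when $k_{\min}\asymp n^{\frac d{\alpha+\beta+d}}$ and $k_{\max}\lesssim n^{\frac{2d}{\alpha+\beta+d}}$; 3. $\hat\psi^{\mathrm{IF}}$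 is minimax rate optimal when $k_{\min}\lesssim\sqrt n$ and $n^{\frac{d}{2\alpha+2\beta}}\lesssim k_{\max}\lesssim n$ if $\frac d4\le\frac{\alpha+\beta}2<\frac d2$, and when $k_{\min}\lesssim n^{\frac d{2\alpha+2\beta+d}}$ and $k_{\max}\asymp n^{\frac{2d}{2\alpha+2\beta+d}}$ if $\frac{\alpha+\beta}2<\frac d4$. -/

import Mathlib

open MeasureTheory
open scoped ENNReal NNReal

noncomputable section

/-! ### Asymptotic comparison of nonnegative sequences -/

/-- `a ≲ b`: there are `C > 0` and `n₀` with `a n ≤ C * b n` for all `n ≥ n₀`. -/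
def AsympLE (a b : ℕ → ℝ≥0∞) : Prop :=
  ∃ C : ℝ≥0, 0 < C ∧ ∃ n₀ : ℕ, ∀ n ≥ n₀, a n ≤ C * b n

/-- `a ≍ b`: both `a ≲ b` and `b ≲ a`. -/
def AsympEq (a b : ℕ → ℝ≥0∞) : Prop := AsympLE a b ∧ AsympLE b a

/-- The sequence `n ↦ n ^ e`. -/
def powSeq (e : ℝ) (n : ℕ) : ℝ≥0∞ := ENNReal.ofReal ((n : ℝ) ^ e)

/-! ### Cohen-Daubechies-Vial type wavelet bases of `L²([0,1])` and of `L²([0,1]^d)` -/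

/-- A bounded measurable function of compact support. -/
def IsGenerator (g : ℝ → ℝ) : Prop :=
  Measurable g ∧ (∃ C : ℝ, ∀ x, |g x| ≤ C) ∧ HasCompactSupport g

/-- One interior generating function, together with `S` generating functions for each of the two
endpoints of the interval. -/
structure IntervalGenerators (S : ℕ) where
  interior : ℝ → ℝ
  left : Fin S → ℝ → ℝ
  right : Fin S → ℝ → ℝ
  isGenerator_interior : IsGenerator interior
  isGenerator_left : ∀ i, IsGenerator (left i)
  isGenerator_right : ∀ i, IsGenerator (right i)

/-- The `2 ^ j` functions of level `j`: the translated and dilated interior function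
`2^{j/2} g (2^j x - m)` for `S ≤ m < 2^j - S`, the dilated left edge functions for `m < S`, and the
dilated (and reflected) right edge functions for the last `S` indices. -/
def IntervalGenerators.level {S : ℕ} (G : IntervalGenerators S) (j : ℕ) (m : Fin (2 ^ j))
    (x : ℝ) : ℝ :=
  Real.sqrt (2 ^ j) *
    (if h : (m : ℕ) < S then G.left ⟨m, h⟩ (2 ^ j * x)
     else if h : (m.rev : ℕ) < S then G.right ⟨m.rev, h⟩ (2 ^ j * (1 - x))
     else G.interior (2 ^ j * x - m))

/-- The `L²([0,1])` inner product. -/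
def innerI (f g : ℝ → ℝ) : ℝ := ∫ x in Set.Icc (0 : ℝ) 1, f x * g x

/-- A compactly supported, boundary corrected (Cohen-Daubechies-Vial type) orthonormal wavelet
basis of `L²([0,1])` of regularity `S`, with coarsest level `J₀`. The scaling functions of level
`j` span `V_j`, and `V_{j+1}` is the orthogonal sum of `V_j` and the span of the wavelets of
level `j`; the spaces `V_j` contain the polynomials of degree at most `S - 1` (equivalently, the
wavelets have `S` vanishing moments). -/
structure CDVBasis (S : ℕ) where
  J₀ : ℕ
  one_le_J₀ : 1 ≤ J₀
  two_mul_le : 2 * S ≤ 2 ^ J₀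
  /-- scaling functions -/
  father : IntervalGenerators S
  /-- wavelet functions -/
  mother : IntervalGenerators S
  orthonormal_father : ∀ j ≥ J₀, ∀ m m' : Fin (2 ^ j),
    innerI (father.level j m) (father.level j m') = if m = m' then 1 else 0
  orthonormal_mother : ∀ j ≥ J₀, ∀ m m' : Fin (2 ^ j),
    innerI (mother.level j m) (mother.level j m') = if m = m' then 1 else 0
  father_orthogonal_mother : ∀ j ≥ J₀, ∀ m m' : Fin (2 ^ j),
    innerI (father.level j m) (mother.level j m') = 0
  two_scale_father : ∀ j ≥ J₀, ∀ m : Fin (2 ^ j), ∃ c : Fin (2 ^ (j + 1)) → ℝ,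
    ∀ᵐ x ∂(volume.restrict (Set.Icc (0 : ℝ) 1)),
      father.level j m x = ∑ m', c m' * father.level (j + 1) m' x
  two_scale_mother : ∀ j ≥ J₀, ∀ m : Fin (2 ^ j), ∃ c : Fin (2 ^ (j + 1)) → ℝ,
    ∀ᵐ x ∂(volume.restrict (Set.Icc (0 : ℝ) 1)),
      mother.level j m x = ∑ m', c m' * father.level (j + 1) m' x
  polynomials : ∀ r < S, ∃ c : Fin (2 ^ J₀) → ℝ,
    ∀ᵐ x ∂(volume.restrict (Set.Icc (0 : ℝ) 1)), x ^ r = ∑ m, c m * father.level J₀ m x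
  complete : ∀ f : ℝ → ℝ, MemLp f 2 (volume.restrict (Set.Icc (0 : ℝ) 1)) →
    (∀ j ≥ J₀, ∀ m, innerI f (father.level j m) = 0) →
    ∀ᵐ x ∂(volume.restrict (Set.Icc (0 : ℝ) 1)), f x = 0

/-- The unit cube `[0,1]^d`. -/
def cube (d : ℕ) : Set (Fin d → ℝ) := Set.Icc 0 1

/-- The `L²([0,1]^d)` inner product. -/
def innerC {d : ℕ} (f g : (Fin d → ℝ) → ℝ) : ℝ := ∫ x in cube d, f x * g x

namespace CDVBasis

variable {S : ℕ} (B : CDVBasis S) {d : ℕ}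

/-- The tensor product scaling functions `Φ_{j m}`. -/
def Phi (j : ℕ) (m : Fin d → Fin (2 ^ j)) (x : Fin d → ℝ) : ℝ :=
  ∏ i, B.father.level j (m i) (x i)

/-- The tensor product wavelets `Ψ^ι_{j m}`; the value `ι i = true` selects the wavelet, and
`ι i = false` the scaling function, in the `i`-th coordinate. -/
def Psi (j : ℕ) (ι : Fin d → Bool) (m : Fin d → Fin (2 ^ j)) (x : Fin d → ℝ) : ℝ :=
  ∏ i, (if ι i then B.mother.level j (m i) (x i) else B.father.level j (m i) (x i))

/-- The orthogonal projection kernel onto `V_j = span {Φ_{j m}}`, a space of dimension `2^{jd}`. -/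
def projKernel (j : ℕ) (x y : Fin d → ℝ) : ℝ :=
  ∑ m : Fin d → Fin (2 ^ j), B.Phi j m x * B.Phi j m y

/-- The Hölder norm of exponent `a`, in terms of wavelet coefficients. -/
def holderNorm (a : ℝ) (h : (Fin d → ℝ) → ℝ) : ℝ≥0∞ :=
  (⨆ m : Fin d → Fin (2 ^ B.J₀),
    ENNReal.ofReal ((2 : ℝ) ^ ((B.J₀ : ℝ) * (a + d / 2)) * |innerC h (B.Phi B.J₀ m)|)) +
  ⨆ (l : ℕ) (_ : B.J₀ ≤ l) (ι : Fin d → Bool) (_ : ∃ i, ι i = true) (m : Fin d → Fin (2 ^ l)),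
    ENNReal.ofReal ((2 : ℝ) ^ ((l : ℝ) * (a + d / 2)) * |innerC h (B.Psi l ι m)|)

/-- The Hölder ball `H(a, M)`. -/
def holderBall (d : ℕ) (a M : ℝ) : Set ((Fin d → ℝ) → ℝ) :=
  {h | UniformContinuousOn h (cube d) ∧ B.holderNorm a h ≤ ENNReal.ofReal M}

end CDVBasis

/-! ### The model and the functional -/

/-- An observation `(X, A, Y)`. -/
abbrev Obs (d : ℕ) : Type := (Fin d → ℝ) × ℝ × ℝ

/-- The covariates `X`. -/
def obsX {d : ℕ} (o : Obs d) : Fin d → ℝ := o.1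

/-- The variable `A`. -/
def obsA {d : ℕ} (o : Obs d) : ℝ := o.2.1

/-- The variable `Y`. -/
def obsY {d : ℕ} (o : Obs d) : ℝ := o.2.2

/-- The σ-algebra generated by `X`. -/
abbrev sigmaX (d : ℕ) : MeasurableSpace (Obs d) := MeasurableSpace.comap obsX inferInstance

/-- The conditional covariance of `A` and `Y` given `X`. -/
def condCovAY {d : ℕ} (P : Measure (Obs d)) : Obs d → ℝ :=
  P[(obsA - P[obsA | sigmaX d]) * (obsY - P[obsY | sigmaX d]) | sigmaX d]

/-- The functional `ψ(P) = E[Cov(A, Y | X)]`. -/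
def psi {d : ℕ} (P : Measure (Obs d)) : ℝ := ∫ o, condCovAY P o ∂P

/-- The class of laws of `(X, A, Y)` with `X` uniform on `[0,1]^d`, with `A, Y ∈ [C₁, C₂]` almost
surely, and with regression functions `p ∈ H(α, M)` and `b ∈ H(β, M)`. -/
def CDVBasis.model {S : ℕ} (B : CDVBasis S) (d : ℕ) (α β M C₁ C₂ : ℝ) : Set (Measure (Obs d)) :=
  {P | IsProbabilityMeasure P ∧
    P.map obsX = volume.restrict (cube d) ∧
    (∀ᵐ o ∂P, obsA o ∈ Set.Icc C₁ C₂ ∧ obsY o ∈ Set.Icc C₁ C₂) ∧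
    (∃ p ∈ B.holderBall d α M, (fun o => p (obsX o)) =ᵐ[P] P[obsA | sigmaX d]) ∧
    (∃ b ∈ B.holderBall d β M, (fun o => b (obsX o)) =ᵐ[P] P[obsY | sigmaX d])}

/-! ### Samples, risks, and minimax rate optimality -/

/-- A sample of size `m * n`, split into `m` disjoint subsamples of size `n`. -/
abbrev Sample (d m n : ℕ) : Type := Fin m → Fin n → Obs d

/-- The law of `m * n` independent observations from `P`. -/
def sampleLaw {d : ℕ} (m n : ℕ) (P : Measure (Obs d)) : Measure (Sample d m n) :=
  Measure.pi fun _ => Measure.pi fun _ => P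

/-- The maximal mean squared error over `Q` of the estimator `T` of `ψ(P)`. -/
def worstRisk {d : ℕ} (Q : Set (Measure (Obs d))) (m n : ℕ) (T : Sample d m n → ℝ) : ℝ≥0∞ :=
  ⨆ P ∈ Q, ∫⁻ ω, ENNReal.ofReal ((T ω - psi P) ^ 2) ∂(sampleLaw m n P)

/-- The minimax risk for estimating `ψ(P)` over `Q` from `m * n` observations. -/
def minimaxRisk {d : ℕ} (Q : Set (Measure (Obs d))) (m n : ℕ) : ℝ≥0∞ :=
  ⨅ (T : Sample d m n → ℝ) (_ : Measurable T), worstRisk Q m n T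

/-- A sequence of estimators is minimax rate optimal if its maximal risk is at most of the order of
the minimax risk. -/
def MinimaxRateOptimal {d : ℕ} (Q : Set (Measure (Obs d))) (m : ℕ)
    (T : ∀ n, Sample d m n → ℝ) : Prop :=
  AsympLE (fun n => worstRisk Q m n (T n)) (fun n => minimaxRisk Q m n)

/-! ### The estimators, with single sample splitting -/

namespace CDVBasis

variable {S : ℕ} (B : CDVBasis S) {d n : ℕ}

/-- The approximate wavelet projection estimator of `p` with resolution `2^{jd}`, from `D`. -/
def pHat (j : ℕ) (D : Fin n → Obs d) (x : Fin d → ℝ) : ℝ :=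
  (1 / n : ℝ) * ∑ i, obsA (D i) * B.projKernel j (obsX (D i)) x

/-- The approximate wavelet projection estimator of `b` with resolution `2^{jd}`, from `D`. -/
def bHat (j : ℕ) (D : Fin n → Obs d) (x : Fin d → ℝ) : ℝ :=
  (1 / n : ℝ) * ∑ i, obsY (D i) * B.projKernel j (obsX (D i)) x

/-- The integral-based plug-in estimator; both nuisance functions are estimated from `ω 0`. -/
def psiINT (j₁ j₂ : ℕ) (ω : Sample d 2 n) : ℝ :=
  (1 / n : ℝ) * ∑ i, obsA (ω 1 i) * obsY (ω 1 i)
    - ∫ x in cube d, B.pHat j₁ (ω 0) x * B.bHat j₂ (ω 0) x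

/-- The Monte Carlo-based plug-in estimator; both nuisance functions are estimated from `ω 0`. -/
def psiMC (j₁ j₂ : ℕ) (ω : Sample d 3 n) : ℝ :=
  (1 / n : ℝ) * ∑ i, obsA (ω 1 i) * obsY (ω 1 i)
    - (1 / n : ℝ) * ∑ i, B.pHat j₁ (ω 0) (obsX (ω 2 i)) * B.bHat j₂ (ω 0) (obsX (ω 2 i))

/-- The first-order bias-corrected estimator; both nuisance functions are estimated from `ω 0`. -/
def psiIF (j₁ j₂ : ℕ) (ω : Sample d 2 n) : ℝ :=
  (1 / n : ℝ) * ∑ i, (obsA (ω 1 i) - B.pHat j₁ (ω 0) (obsX (ω 1 i)))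
    * (obsY (ω 1 i) - B.bHat j₂ (ω 0) (obsX (ω 1 i)))

end CDVBasis

/-- The smaller one, `k_min`, of the resolutions `2^{d j₁(n)}` and `2^{d j₂(n)}`. -/
def kMin (d : ℕ) (j₁ j₂ : ℕ → ℕ) (n : ℕ) : ℝ≥0∞ := min (2 ^ (d * j₁ n)) (2 ^ (d * j₂ n))

/-- The larger one, `k_max`, of the resolutions `2^{d j₁(n)}` and `2^{d j₂(n)}`. -/
def kMax (d : ℕ) (j₁ j₂ : ℕ → ℕ) (n : ℕ) : ℝ≥0∞ := max (2 ^ (d * j₁ n)) (2 ^ (d * j₂ n))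

end

/-!
The three estimators have mean squared errors that split into explicit terms, and the lower bounds
match these terms. Throughout, `k` and `K` are the smaller and the larger of the two dimensions
`k₁` and `k₂`, and `s = α + β`.

*Upper bounds.* The projection kernel is bounded by a multiple of the dimension, is localised at the
scale of the level, and has uniformly bounded integrals (`CDVBasis.exists_projKernel_bound`). Since
`V_j` and `V_{j'}` are nested, the inner product of the two projection estimators is an inner
product of empirical coefficients at the smaller level. Expanding it around the true coefficients
gives the exact approximation error of `∫ p b`, two linear terms with mean square `O(1 / n)`, and a
quadratic term with mean square `O((k / n) ^ 2)` (`exists_integral_sq_quadErr_le`). For the plug-in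
estimators INT and MC the approximation error is that of the smaller space. For IF the first-order
correction replaces it by that of the larger space, because
`⟪Π₁ p, b⟫ + ⟪Π₂ p, b⟫ - ⟪Π_min p, b⟫ = ⟪Π_max p, b⟫`. Averages over a further subsample add a
noise term `(1 / n) (1 + K / n) (1 + k / n + (k / n) ^ 2)`. This yields `exists_risk_INT_le`,
`exists_risk_MC_le` and `exists_risk_IF_le`; decay of the wavelet coefficients and convergence of
the projections bound the squared approximation error by a multiple of `dim ^ (-2 s / d)`
(`exists_sq_integral_sub_projInner_le`), and `isBigO_rateBound` turns the sum into rates.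

*Minimax lower bounds.* All alternatives are laws under which `A` and `Y` live on the two endpoints
`C₁` and `C₂`, coded as `-1` and `1`; such a law has an explicit density that is affine in each of
the regression functions of `A`, `Y` and `A Y` (`obsLaw`). The parametric rate comes from a constant
shift of the conditional covariance (`exists_minimaxRisk_ge_parametric`). For `s < d / 2` the rate
comes from two mixtures over random signs attached to the dyadic cells of one level: in the first,
bumps are added to the smoother of the regression functions only, in the second to both, with a
common sign, so that the functional changes by the product of the two heights. In the likelihood of
a cell the signs can be reversed together, so only the even part of the perturbation survives,
and it takes two observations in the same cell to notice anything (`abs_evenProd_sub_le`). Hence the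
two mixtures overlap (`integral_min_mixDensity_ge`) and Le Cam's bound
`ofReal_sq_sub_le_of_overlap` gives `exists_minimaxRisk_ge_nonparametric`.

*The plug-in estimators.* Their risk is at least their squared bias, and the bias is an explicit
bilinear polynomial in the perturbations of the regression functions
(`CDVBasis.IsCenter.exists_pluginBias_eq`). Perturbing both regression functions by a signed sum of
bumps that is far from `V_j` (`exists_bumpSum_projInner_le`) and taking a second difference isolates
the approximation error, of order `2 ^ (-j s)`; shifting the conditional covariance isolates the
contribution `k / n` of the diagonal of the kernel, which is present because both estimators use the
same subsample. No resolution makes both of them smaller than `n ^ (-s / (s + d))`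
(`CDVBasis.IsCenter.exists_sq_pluginBias_ge`), which is slower than the minimax rate when `s < d`.
-/

/-! ### Boundedness and localisation of wavelets on the interval -/

theorem IsGenerator.exists_bound {g : ℝ → ℝ} (hg : IsGenerator g) :
    ∃ R : ℕ, ∀ x, |g x| ≤ R ∧ (g x ≠ 0 → |x| ≤ R) := by
  obtain ⟨-, ⟨C, hC⟩, hs⟩ := hg
  obtain ⟨r, hr⟩ := hs.isBounded.subset_closedBall (0 : ℝ)
  refine ⟨⌈max C r⌉₊, fun x => ⟨(hC x).trans ((le_max_left _ _).trans (Nat.le_ceil _)), fun hx => ?_⟩⟩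
  have := hr (subset_tsupport g hx)
  rw [Metric.mem_closedBall, Real.dist_eq, sub_zero] at this
  exact this.trans ((le_max_right _ _).trans (Nat.le_ceil _))

namespace IntervalGenerators

variable {S : ℕ} (G : IntervalGenerators S)

theorem measurable_level (j : ℕ) (m : Fin (2 ^ j)) : Measurable (G.level j m) := by
  unfold level
  refine Measurable.const_mul ?_ _
  split_ifs with h h'
  · exact (G.isGenerator_left _).1.comp (by fun_prop)
  · exact (G.isGenerator_right _).1.comp (by fun_prop)
  · exact G.isGenerator_interior.1.comp (by fun_prop)

theorem exists_common_bound : ∃ R : ℕ,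
    (∀ x, |G.interior x| ≤ R ∧ (G.interior x ≠ 0 → |x| ≤ R)) ∧
    (∀ i x, |G.left i x| ≤ R ∧ (G.left i x ≠ 0 → |x| ≤ R)) ∧
    (∀ i x, |G.right i x| ≤ R ∧ (G.right i x ≠ 0 → |x| ≤ R)) := by
  obtain ⟨R₁, h₁⟩ := G.isGenerator_interior.exists_bound
  choose R₂ h₂ using fun i => (G.isGenerator_left i).exists_bound
  choose R₃ h₃ using fun i => (G.isGenerator_right i).exists_bound
  refine ⟨R₁ + ∑ i, R₂ i + ∑ i, R₃ i, fun x => ?_, fun i x => ?_, fun i x => ?_⟩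
  · have : (R₁ : ℝ) ≤ ((R₁ + ∑ i, R₂ i + ∑ i, R₃ i : ℕ) : ℝ) := by exact_mod_cast (by omega)
    exact ⟨(h₁ x).1.trans this, fun h => ((h₁ x).2 h).trans this⟩
  · have : (R₂ i : ℝ) ≤ ((R₁ + ∑ i, R₂ i + ∑ i, R₃ i : ℕ) : ℝ) := by
      have := Finset.single_le_sum (f := R₂) (fun _ _ => Nat.zero_le _) (Finset.mem_univ i)
      exact_mod_cast (by omega)
    exact ⟨(h₂ i x).1.trans this, fun h => ((h₂ i x).2 h).trans this⟩
  · have : (R₃ i : ℝ) ≤ ((R₁ + ∑ i, R₂ i + ∑ i, R₃ i : ℕ) : ℝ) := by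
      have := Finset.single_le_sum (f := R₃) (fun _ _ => Nat.zero_le _) (Finset.mem_univ i)
      exact_mod_cast (by omega)
    exact ⟨(h₃ i x).1.trans this, fun h => ((h₃ i x).2 h).trans this⟩

/-- At every point a bounded number of the functions of one level are nonzero, so the sum of their
absolute values is of the order of a single one; and the functions of level `j` have supports of
diameter of the order of `2^{-j}`. -/
theorem exists_level_bound : ∃ C : ℝ, 1 ≤ C ∧ ∀ j,
    (∀ x, ∑ m, |G.level j m x| ≤ C * √(2 ^ j)) ∧
    (∀ m x y, G.level j m x ≠ 0 → G.level j m y ≠ 0 → |x - y| ≤ C / 2 ^ j) := by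
  obtain ⟨R, h₁, h₂, h₃⟩ := G.exists_common_bound
  refine ⟨(2 * S + 2 * R + 1) * (R + 1), ?_, fun j => ⟨fun x => ?_, fun m x y hx hy => ?_⟩⟩
  · have : (0 : ℝ) ≤ S := by positivity
    have : (0 : ℝ) ≤ R := by positivity
    nlinarith
  · set T : Finset (Fin (2 ^ j)) := Finset.univ.filter (fun m => G.level j m x ≠ 0) with hT
    -- besides the `2 * S` boundary functions, only the translates within distance `R` contribute
    have hcard : T.card ≤ 2 * S + 2 * R + 1 := by
      have hsub : T ⊆ (Finset.univ.filter fun m : Fin (2 ^ j) => (m : ℕ) < S) ∪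
          ((Finset.univ.filter fun m : Fin (2 ^ j) => (m.rev : ℕ) < S) ∪
          (Finset.univ.filter fun m : Fin (2 ^ j) => |2 ^ j * x - (m : ℕ)| ≤ R)) := by
        intro m hm
        simp only [hT, Finset.mem_filter, Finset.mem_univ, true_and, Finset.mem_union] at hm ⊢
        by_cases a : (m : ℕ) < S
        · exact Or.inl a
        by_cases b : (m.rev : ℕ) < S
        · exact Or.inr (Or.inl b)
        refine Or.inr (Or.inr ?_)
        rw [level, dif_neg a, dif_neg b] at hm
        exact (h₁ _).2 (right_ne_zero_of_mul hm)
      have c1 : (Finset.univ.filter fun m : Fin (2 ^ j) => (m : ℕ) < S).card ≤ S := by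
        have := Finset.card_le_card_of_injOn (s := Finset.univ.filter fun m : Fin (2 ^ j) => (m : ℕ) < S)
          (t := Finset.range S) (fun m => (m : ℕ)) (by intro m; simp)
          (Fin.val_injective.injOn)
        simpa using this
      have c2 : (Finset.univ.filter fun m : Fin (2 ^ j) => (m.rev : ℕ) < S).card ≤ S := by
        have := Finset.card_le_card_of_injOn
          (s := Finset.univ.filter fun m : Fin (2 ^ j) => (m.rev : ℕ) < S)
          (t := Finset.range S) (fun m => (m.rev : ℕ)) (by intro m; simp)
          ((Fin.val_injective.comp Fin.rev_injective).injOn)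
        simpa using this
      have c3 : (Finset.univ.filter fun m : Fin (2 ^ j) => |2 ^ j * x - (m : ℕ)| ≤ R).card
          ≤ 2 * R + 1 := by
        have := Finset.card_le_card_of_injOn
          (s := Finset.univ.filter fun m : Fin (2 ^ j) => |2 ^ j * x - (m : ℕ)| ≤ R)
          (t := Finset.Icc (⌈2 ^ j * x⌉ - R) (⌊2 ^ j * x⌋ + R)) (fun m => ((m : ℕ) : ℤ))
          (by
            intro m hm
            simp only [Finset.coe_filter, Finset.mem_univ, true_and, Set.mem_ofPred_eq] at hm
            rw [abs_le] at hm
            simp only [Finset.coe_Icc, Set.mem_Icc]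
            constructor
            · rw [sub_le_iff_le_add]
              refine Int.ceil_le.2 ?_
              push_cast; linarith
            · rw [← sub_le_iff_le_add]
              refine Int.le_floor.2 ?_
              push_cast; linarith)
          (by intro a _ b _ hab; exact Fin.ext (by simpa using hab))
        refine this.trans ?_
        rw [Int.card_Icc]
        have := Int.floor_le_ceil (2 ^ j * x)
        omega
      calc T.card ≤ _ := Finset.card_le_card hsub
        _ ≤ _ := Finset.card_union_le _ _
        _ ≤ S + (S + (2 * R + 1)) := by
          gcongr
          exact (Finset.card_union_le _ _).trans (by gcongr)
        _ = _ := by ring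
    have hb : ∀ m, |G.level j m x| ≤ √(2 ^ j) * R := by
      intro m
      rw [level, abs_mul, abs_of_nonneg (Real.sqrt_nonneg _)]
      gcongr
      split_ifs
      · exact (h₂ _ _).1
      · exact (h₃ _ _).1
      · exact (h₁ _).1
    calc ∑ m, |G.level j m x| = ∑ m ∈ T, |G.level j m x| := by
          rw [hT, Finset.sum_filter_of_ne]
          intro m _ hm h0
          simp [h0] at hm
      _ ≤ T.card • (√(2 ^ j) * R) := Finset.sum_le_card_nsmul _ _ _ (fun m _ => hb m)
      _ ≤ (2 * S + 2 * R + 1 : ℕ) • (√(2 ^ j) * R) := by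
          gcongr
      _ ≤ (2 * S + 2 * R + 1) * (R + 1) * √(2 ^ j) := by
          rw [nsmul_eq_mul]; push_cast
          have : (0:ℝ) ≤ (2 * S + 2 * R + 1) * √(2 ^ j) := by positivity
          nlinarith
  · have hR : (0 : ℝ) ≤ R := by positivity
    have hS : (0 : ℝ) ≤ S := by positivity
    have hj : (0 : ℝ) < 2 ^ j := by positivity
    rw [le_div_iff₀ hj]
    have key : |x - y| * 2 ^ j ≤ 2 * R := by
      rw [level] at hx hy
      have hx' := right_ne_zero_of_mul hx
      have hy' := right_ne_zero_of_mul hy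
      rw [show |x - y| * 2 ^ j = |(x - y) * 2 ^ j| by rw [abs_mul, abs_of_pos hj]]
      split_ifs at hx' hy'
      · have := abs_le.1 ((h₂ _ _).2 hx')
        have := abs_le.1 ((h₂ _ _).2 hy')
        rw [abs_le]; constructor <;> linarith
      · have := abs_le.1 ((h₃ _ _).2 hx')
        have := abs_le.1 ((h₃ _ _).2 hy')
        rw [abs_le]; constructor <;> linarith
      · have := abs_le.1 ((h₁ _).2 hx')
        have := abs_le.1 ((h₁ _).2 hy')
        rw [abs_le]; constructor <;> linarith
    nlinarith [mul_nonneg hS hR]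

end IntervalGenerators

theorem sq_sqrt_two_pow (j : ℕ) : √((2 : ℝ) ^ j) * √(2 ^ j) = 2 ^ j :=
  Real.mul_self_sqrt (by positivity)

/-- Integrals over an interval of a function dominated by a constant whose support has diameter at
most `D`. -/
theorem setIntegral_abs_le_of_support {f : ℝ → ℝ} {c D : ℝ} (hD : 0 ≤ D)
    (hc : ∀ x, |f x| ≤ c) (hs : ∀ x y, f x ≠ 0 → f y ≠ 0 → |x - y| ≤ D) :
    ∫ x in Set.Icc (0 : ℝ) 1, |f x| ≤ c * (2 * D) := by
  have hc0 : 0 ≤ c := (abs_nonneg _).trans (hc 0)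
  by_cases hne : ∃ x₁, f x₁ ≠ 0
  · obtain ⟨x₁, hx₁⟩ := hne
    have hle : ∀ x, |f x| ≤ (Set.Icc (x₁ - D) (x₁ + D)).indicator (fun _ => c) x := by
      intro x
      by_cases hx : f x = 0
      · rw [hx, abs_zero]; exact Set.indicator_nonneg (fun _ _ => hc0) _
      · have := abs_le.1 (hs x x₁ hx hx₁)
        rw [Set.indicator_of_mem (by constructor <;> linarith)]
        exact hc x
    calc ∫ x in Set.Icc (0 : ℝ) 1, |f x|
        ≤ ∫ x in Set.Icc (0 : ℝ) 1, (Set.Icc (x₁ - D) (x₁ + D)).indicator (fun _ => c) x := by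
          refine integral_mono_of_nonneg (Filter.Eventually.of_forall fun x => abs_nonneg _) ?_
            (Filter.Eventually.of_forall hle)
          exact (integrable_const c).indicator measurableSet_Icc
      _ ≤ ∫ x, (Set.Icc (x₁ - D) (x₁ + D)).indicator (fun _ => c) x := by
          refine setIntegral_le_integral ?_ ?_
          · refine (integrable_indicator_iff measurableSet_Icc).2 ?_
            exact integrableOn_const (by simp)
          · exact Filter.Eventually.of_forall fun x => Set.indicator_nonneg (fun _ _ => hc0) _
      _ = c * (2 * D) := by
          rw [integral_indicator measurableSet_Icc, setIntegral_const, smul_eq_mul]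
          simp [Measure.real]
          rw [ENNReal.toReal_ofReal (by linarith)]; ring
  · push Not at hne
    simp only [hne, abs_zero, integral_zero]
    positivity

theorem IntervalGenerators.exists_level_bound' {S : ℕ} (G : IntervalGenerators S) :
    ∃ C : ℝ, 1 ≤ C ∧ ∀ j,
    (∀ x, ∑ m, |G.level j m x| ≤ C * √(2 ^ j)) ∧
    (∀ m x, |G.level j m x| ≤ C * √(2 ^ j)) ∧
    (∀ m x y, G.level j m x ≠ 0 → G.level j m y ≠ 0 → |x - y| ≤ C / 2 ^ j) ∧
    (∀ m, ∫ x in Set.Icc (0 : ℝ) 1, |G.level j m x| ≤ C / √(2 ^ j)) := by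
  obtain ⟨C, hC, h⟩ := G.exists_level_bound
  have hle : C ≤ 2 * C ^ 2 := by nlinarith
  have hs : ∀ j m x, |G.level j m x| ≤ C * √(2 ^ j) := fun j m x =>
    (Finset.single_le_sum (f := fun m => |G.level j m x|) (fun _ _ => abs_nonneg _)
      (Finset.mem_univ m)).trans ((h j).1 x)
  refine ⟨2 * C ^ 2, by nlinarith, fun j => ⟨fun x => ((h j).1 x).trans (by gcongr),
    fun m x => (hs j m x).trans (by gcongr),
    fun m x y hx hy => ((h j).2 m x y hx hy).trans (by gcongr), fun m => ?_⟩⟩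
  refine (setIntegral_abs_le_of_support (by positivity) (hs j m) ((h j).2 m)).trans (le_of_eq ?_)
  have h2 : √((2 : ℝ) ^ j) ≠ 0 := by positivity
  have h3 := sq_sqrt_two_pow j
  have h4 : (2 : ℝ) ^ j ≠ 0 := by positivity
  field_simp
  linear_combination h3

/-! ### The multiscale structure on the interval -/

/-- Lebesgue measure on `[0,1]`. -/
noncomputable abbrev unitVol : Measure ℝ := volume.restrict (Set.Icc (0 : ℝ) 1)

instance : IsProbabilityMeasure unitVol := ⟨by simp [unitVol]⟩

theorem IntervalGenerators.memLp_level {S : ℕ} (G : IntervalGenerators S) (j : ℕ)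
    (m : Fin (2 ^ j)) : MemLp (G.level j m) ⊤ unitVol := by
  obtain ⟨C, -, h⟩ := G.exists_level_bound'
  exact memLp_top_of_bound (G.measurable_level j m).aestronglyMeasurable _
    (Filter.Eventually.of_forall fun x => by rw [Real.norm_eq_abs]; exact (h j).2.1 m x)

/-- Products of essentially bounded functions are integrable. -/
theorem MeasureTheory.MemLp.integrable_mul_top {Ω : Type*} {mΩ : MeasurableSpace Ω} {μ : Measure Ω}
    [IsFiniteMeasure μ] {f g : Ω → ℝ} (hf : MemLp f ⊤ μ) (hg : MemLp g ⊤ μ) :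
    Integrable (fun x => f x * g x) μ :=
  (MemLp.mul' (p := ⊤) (q := ⊤) (r := ⊤) hg hf).integrable le_top

theorem integral_sum_mul_sum {Ω I J : Type*} [Fintype I] [Fintype J] {mΩ : MeasurableSpace Ω}
    {μ : Measure Ω} {f : I → Ω → ℝ} {g : J → Ω → ℝ}
    (h : ∀ i j, Integrable (fun x => f i x * g j x) μ) (a : I → ℝ) (b : J → ℝ) :
    ∫ x, (∑ i, a i * f i x) * (∑ j, b j * g j x) ∂μ
      = ∑ i, ∑ j, a i * b j * ∫ x, f i x * g j x ∂μ := by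
  have : ∀ x, (∑ i, a i * f i x) * (∑ j, b j * g j x)
      = ∑ i, ∑ j, a i * b j * (f i x * g j x) := by
    intro x
    rw [Finset.sum_mul_sum]
    exact Finset.sum_congr rfl fun i _ => Finset.sum_congr rfl fun j _ => by ring
  simp_rw [this]
  rw [integral_finsetSum _ fun i _ => integrable_finsetSum _ fun j _ => (h i j).const_mul _]
  refine Finset.sum_congr rfl fun i _ => ?_
  rw [integral_finsetSum _ fun j _ => (h i j).const_mul _]
  exact Finset.sum_congr rfl fun j _ => integral_const_mul _ _

namespace CDVBasis

variable {S : ℕ} (B : CDVBasis S)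

theorem exists_nested {j j' : ℕ} (hj : B.J₀ ≤ j) (hjj' : j ≤ j') :
    ∃ c : Fin (2 ^ j) → Fin (2 ^ j') → ℝ, ∀ᵐ x ∂unitVol, ∀ m,
      B.father.level j m x = ∑ m', c m m' * B.father.level j' m' x := by
  induction j', hjj' using Nat.le_induction with
  | base =>
    exact ⟨fun m m' => if m = m' then 1 else 0, Filter.Eventually.of_forall fun x m => by simp⟩
  | succ k hk ih =>
    obtain ⟨c, hc⟩ := ih
    choose c' hc' using B.two_scale_father k (hj.trans hk)
    refine ⟨fun m m' => ∑ i, c m i * c' i m', ?_⟩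
    filter_upwards [hc, ae_all_iff.2 hc'] with x h1 h2 m
    rw [h1]
    simp_rw [h2, Finset.sum_mul, Finset.mul_sum]
    rw [Finset.sum_comm]
    exact Finset.sum_congr rfl fun i _ => Finset.sum_congr rfl fun k _ => by ring

/-- The wavelets have `S` vanishing moments. -/
theorem mother_moment {l : ℕ} (hl : B.J₀ ≤ l) (m : Fin (2 ^ l)) {r : ℕ} (hr : r < S) :
    ∫ x, x ^ r * B.mother.level l m x ∂unitVol = 0 := by
  obtain ⟨a, ha⟩ := B.polynomials r hr
  obtain ⟨c, hc⟩ := B.exists_nested le_rfl hl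
  have h1 : ∀ᵐ x ∂unitVol, x ^ r * B.mother.level l m x
      = (∑ m', (∑ i, a i * c i m') * B.father.level l m' x) *
        ∑ _i : Unit, 1 * B.mother.level l m x := by
    filter_upwards [ha, hc] with x h1 h2
    rw [h1]
    simp only [Finset.univ_unique, Finset.sum_singleton, one_mul]
    congr 1
    simp_rw [h2, Finset.sum_mul, Finset.mul_sum]
    rw [Finset.sum_comm]
    exact Finset.sum_congr rfl fun i _ => Finset.sum_congr rfl fun k _ => by ring
  rw [integral_congr_ae h1, integral_sum_mul_sum (f := fun m' => B.father.level l m')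
    (g := fun _ : Unit => B.mother.level l m)
    fun i _ => (B.father.memLp_level l i).integrable_mul_top (B.mother.memLp_level l m)]
  refine Finset.sum_eq_zero fun i _ => Finset.sum_eq_zero fun _ _ => ?_
  have := B.father_orthogonal_mother l hl i m
  rw [innerI] at this
  rw [this, mul_zero]

/-- The scaling functions (`false`) and the wavelets (`true`) of level `j`, which together span
`V_{j+1}`. -/
noncomputable def pairLevel (j : ℕ) (r : Bool × Fin (2 ^ j)) : ℝ → ℝ :=
  if r.1 then B.mother.level j r.2 else B.father.level j r.2

theorem measurable_pairLevel (j : ℕ) (r : Bool × Fin (2 ^ j)) : Measurable (B.pairLevel j r) := by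
  unfold pairLevel; split_ifs
  · exact B.mother.measurable_level j r.2
  · exact B.father.measurable_level j r.2

theorem memLp_pairLevel (j : ℕ) (r : Bool × Fin (2 ^ j)) : MemLp (B.pairLevel j r) ⊤ unitVol := by
  unfold pairLevel; split_ifs
  · exact B.mother.memLp_level j r.2
  · exact B.father.memLp_level j r.2

theorem integral_pairLevel {j : ℕ} (hj : B.J₀ ≤ j) (r r' : Bool × Fin (2 ^ j)) :
    ∫ x, B.pairLevel j r x * B.pairLevel j r' x ∂unitVol = if r = r' then 1 else 0 := by
  obtain ⟨a, m⟩ := r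
  obtain ⟨a', m'⟩ := r'
  have h1 := B.orthonormal_father j hj m m'
  have h2 := B.orthonormal_mother j hj m m'
  have h3 := B.father_orthogonal_mother j hj m m'
  have h4 := B.father_orthogonal_mother j hj m' m
  rw [innerI] at h1 h2 h3 h4
  simp_rw [mul_comm (B.father.level j m' _)] at h4
  cases a <;> cases a' <;> simp [pairLevel, h1, h2, h3, h4]

theorem integral_father {j : ℕ} (hj : B.J₀ ≤ j) (m m' : Fin (2 ^ j)) :
    ∫ x, B.father.level j m x * B.father.level j m' x ∂unitVol = if m = m' then 1 else 0 :=
  B.orthonormal_father j hj m m'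

/-- The scaling functions of level `j + 1` are obtained from the scaling functions and the wavelets
of level `j` by an orthogonal matrix: the coefficient matrix has orthonormal rows and is square. -/
theorem exists_orthogonal {j : ℕ} (hj : B.J₀ ≤ j) :
    ∃ c : Bool × Fin (2 ^ j) → Fin (2 ^ (j + 1)) → ℝ,
      (∀ r r', ∑ m', c r m' * c r' m' = if r = r' then 1 else 0) ∧
      ∀ᵐ x ∂unitVol, ∀ m', B.father.level (j + 1) m' x = ∑ r, c r m' * B.pairLevel j r x := by
  have hex : ∀ r, ∃ c : Fin (2 ^ (j + 1)) → ℝ, ∀ᵐ x ∂unitVol,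
      B.pairLevel j r x = ∑ m', c m' * B.father.level (j + 1) m' x := by
    rintro ⟨a, m⟩
    cases a
    · simpa [pairLevel] using B.two_scale_father j hj m
    · simpa [pairLevel] using B.two_scale_mother j hj m
  choose c hc using hex
  have horth : ∀ r r', ∑ m', c r m' * c r' m' = if r = r' then 1 else 0 := by
    intro r r'
    rw [← B.integral_pairLevel hj r r']
    have : ∀ᵐ x ∂unitVol, B.pairLevel j r x * B.pairLevel j r' x =
        (∑ m', c r m' * B.father.level (j + 1) m' x) *
          ∑ m', c r' m' * B.father.level (j + 1) m' x := by
      filter_upwards [hc r, hc r'] with x h1 h2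
      rw [h1, h2]
    rw [integral_congr_ae this, integral_sum_mul_sum fun i i' =>
      (B.father.memLp_level (j + 1) i).integrable_mul_top (B.father.memLp_level (j + 1) i')]
    simp [B.integral_father (hj.trans (Nat.le_succ j))]
  refine ⟨c, horth, ?_⟩
  -- the matrix is square, so that a right inverse is a left inverse
  set M : Matrix (Bool × Fin (2 ^ j)) (Fin (2 ^ (j + 1))) ℝ := Matrix.of c with hM
  have h1 : M * M.transpose = 1 := by
    ext r r'
    rw [Matrix.mul_apply, Matrix.one_apply, ← horth r r']
    rfl
  have h2 : M.transpose * M = 1 := by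
    refine (Matrix.mul_eq_one_comm_of_card_eq _ _ _ ?_).1 h1
    simp [pow_succ, mul_comm]
  filter_upwards [ae_all_iff.2 hc] with x hx m'
  simp_rw [hx, Finset.mul_sum]
  rw [Finset.sum_comm]
  have h3 : ∀ k, ∑ r, c r m' * c r k = if m' = k then 1 else 0 := by
    intro k
    have := congrFun (congrFun h2 m') k
    rw [Matrix.mul_apply, Matrix.one_apply] at this
    exact this
  simp_rw [← mul_assoc, ← Finset.sum_mul, h3]
  simp

end CDVBasis

/-! ### Tensor products on the unit cube -/

/-- Lebesgue measure on the unit cube, as a product measure. -/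
noncomputable abbrev cubeVol (d : ℕ) : Measure (Fin d → ℝ) := Measure.pi fun _ => unitVol

theorem restrict_cube_eq (d : ℕ) : volume.restrict (cube d) = cubeVol d := by
  rw [cube, ← Set.pi_univ_Icc, volume_pi, Measure.restrict_pi_pi]
  rfl

theorem ae_cubeVol_of_ae {d : ℕ} {p : ℝ → Prop} (h : ∀ᵐ t ∂unitVol, p t) :
    ∀ᵐ x ∂cubeVol d, ∀ i, p (x i) :=
  ae_all_iff.2 fun i => (Measure.quasiMeasurePreserving_eval (fun _ : Fin d => unitVol) i).ae h

theorem ae_mem_cube (d : ℕ) : ∀ᵐ x ∂cubeVol d, x ∈ cube d := by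
  rw [← restrict_cube_eq]
  exact ae_restrict_mem (by rw [cube]; exact measurableSet_Icc)

theorem innerC_eq {d : ℕ} (f g : (Fin d → ℝ) → ℝ) :
    innerC f g = ∫ x, f x * g x ∂cubeVol d := by
  rw [innerC, restrict_cube_eq]

theorem integral_cubeVol_prod {d : ℕ} (f : Fin d → ℝ → ℝ) :
    ∫ x, ∏ i, f i (x i) ∂cubeVol d = ∏ i, ∫ t, f i t ∂unitVol :=
  integral_fintype_prod_eq_prod (𝕜 := ℝ) f

theorem sum_prod_pi {d : ℕ} {J : Type*} [Fintype J] (f : Fin d → J → ℝ) :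
    ∑ m : Fin d → J, ∏ i, f i (m i) = ∏ i, ∑ k, f i k := by
  classical
  rw [Finset.prod_univ_sum, Fintype.piFinset_univ]

theorem prod_ite_eq_pi {d : ℕ} {J : Type*} [DecidableEq J] (m m' : Fin d → J) :
    ∏ i, (if m i = m' i then (1 : ℝ) else 0) = if m = m' then 1 else 0 := by
  classical
  rw [Finset.prod_ite_zero]
  simp [funext_iff]

theorem sqrt_pow_mul_sqrt_pow (j d : ℕ) : √((2 : ℝ) ^ j) ^ d * √(2 ^ j) ^ d = (2 ^ j) ^ d := by
  rw [← mul_pow, sq_sqrt_two_pow]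

namespace CDVBasis

variable {S : ℕ} (B : CDVBasis S) {d : ℕ}

theorem Psi_eq (j : ℕ) (ι : Fin d → Bool) (m : Fin d → Fin (2 ^ j)) (x : Fin d → ℝ) :
    B.Psi j ι m x = ∏ i, B.pairLevel j (ι i, m i) (x i) := by
  unfold Psi pairLevel
  refine Finset.prod_congr rfl fun i _ => ?_
  cases ι i <;> simp

theorem Phi_eq_Psi (j : ℕ) (m : Fin d → Fin (2 ^ j)) :
    B.Phi j m = B.Psi j (fun _ => false) m := by
  ext x; simp [Phi, Psi]

theorem measurable_Psi (j : ℕ) (ι : Fin d → Bool) (m : Fin d → Fin (2 ^ j)) :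
    Measurable (B.Psi j ι m) := by
  have : B.Psi j ι m = fun x => ∏ i, B.pairLevel j (ι i, m i) (x i) := funext (B.Psi_eq j ι m)
  rw [this]
  exact Finset.measurable_fun_prod _ fun i _ =>
    (B.measurable_pairLevel j _).comp (measurable_pi_apply i)

theorem measurable_Phi (j : ℕ) (m : Fin d → Fin (2 ^ j)) : Measurable (B.Phi j m) := by
  rw [Phi_eq_Psi]; exact B.measurable_Psi j _ m

theorem exists_pair_bound : ∃ C : ℝ, 1 ≤ C ∧ ∀ j,
    (∀ a x, ∑ m, |B.pairLevel j (a, m) x| ≤ C * √(2 ^ j)) ∧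
    (∀ r x, |B.pairLevel j r x| ≤ C * √(2 ^ j)) ∧
    (∀ r x y, B.pairLevel j r x ≠ 0 → B.pairLevel j r y ≠ 0 → |x - y| ≤ C / 2 ^ j) ∧
    (∀ r, ∫ x, |B.pairLevel j r x| ∂unitVol ≤ C / √(2 ^ j)) := by
  obtain ⟨C₁, h₁, H₁⟩ := B.father.exists_level_bound'
  obtain ⟨C₂, h₂, H₂⟩ := B.mother.exists_level_bound'
  refine ⟨max C₁ C₂, h₁.trans (le_max_left _ _), fun j => ?_⟩
  obtain ⟨a1, a2, a3, a4⟩ := H₁ j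
  obtain ⟨b1, b2, b3, b4⟩ := H₂ j
  have hl := le_max_left C₁ C₂
  have hr := le_max_right C₁ C₂
  refine ⟨?_, ?_, ?_, ?_⟩
  · rintro (_ | _) x
    · exact (a1 x).trans (by gcongr)
    · exact (b1 x).trans (by gcongr)
  · rintro ⟨_ | _, m⟩ x
    · exact (a2 m x).trans (by gcongr)
    · exact (b2 m x).trans (by gcongr)
  · rintro ⟨_ | _, m⟩ x y hx hy
    · exact (a3 m x y hx hy).trans (by gcongr)
    · exact (b3 m x y hx hy).trans (by gcongr)
  · rintro ⟨_ | _, m⟩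
    · exact (a4 m).trans (by gcongr)
    · exact (b4 m).trans (by gcongr)

/-- Size and localisation of the tensor product functions. -/
theorem exists_Psi_bound (d : ℕ) : ∃ C : ℝ, 1 ≤ C ∧ ∀ j,
    (∀ ι x, ∑ m, |B.Psi (d := d) j ι m x| ≤ C * √(2 ^ j) ^ d) ∧
    (∀ ι m x, |B.Psi (d := d) j ι m x| ≤ C * √(2 ^ j) ^ d) ∧
    (∀ ι m x y, B.Psi (d := d) j ι m x ≠ 0 → B.Psi j ι m y ≠ 0 → dist x y ≤ C / 2 ^ j) ∧
    (∀ ι m, ∫ x, |B.Psi (d := d) j ι m x| ∂cubeVol d ≤ C / √(2 ^ j) ^ d) := by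
  obtain ⟨C, hC, H⟩ := B.exists_pair_bound
  have hCd : (1 : ℝ) ≤ C ^ d := one_le_pow₀ hC
  refine ⟨C * C ^ d, by nlinarith, fun j => ?_⟩
  obtain ⟨a1, a2, a3, a4⟩ := H j
  have h1 : ∀ ι x, ∑ m, |B.Psi (d := d) j ι m x| ≤ C * C ^ d * √(2 ^ j) ^ d := by
    intro ι x
    simp_rw [Psi_eq, Finset.abs_prod]
    rw [sum_prod_pi (fun i k => |B.pairLevel j (ι i, k) (x i)|)]
    calc _ ≤ ∏ _i : Fin d, C * √(2 ^ j) :=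
          Finset.prod_le_prod (fun i _ => Finset.sum_nonneg fun _ _ => abs_nonneg _)
            fun i _ => a1 _ _
      _ = 1 * (C ^ d * √(2 ^ j) ^ d) := by simp [mul_pow]
      _ ≤ _ := by rw [mul_assoc]; gcongr
  refine ⟨h1, fun ι m x => ?_, fun ι m x y hx hy => ?_, fun ι m => ?_⟩
  · exact (Finset.single_le_sum (f := fun m => |B.Psi (d := d) j ι m x|)
      (fun _ _ => abs_nonneg _) (Finset.mem_univ m)).trans (h1 ι x)
  · rw [Psi_eq, Finset.prod_ne_zero_iff] at hx hy
    have : C ≤ C * C ^ d := by nlinarith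
    refine (dist_pi_le_iff (by positivity)).2 fun i => ?_
    rw [Real.dist_eq]
    exact (a3 _ _ _ (hx i (Finset.mem_univ i)) (hy i (Finset.mem_univ i))).trans (by gcongr)
  · simp_rw [Psi_eq, Finset.abs_prod]
    rw [integral_cubeVol_prod (fun i t => |B.pairLevel j (ι i, m i) t|)]
    calc _ ≤ ∏ _i : Fin d, C / √(2 ^ j) :=
          Finset.prod_le_prod (fun i _ => integral_nonneg fun _ => abs_nonneg _)
            fun i _ => a4 _
      _ = 1 * (C ^ d / √(2 ^ j) ^ d) := by simp
      _ ≤ _ := by rw [mul_div_assoc]; gcongr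

theorem memLp_Psi (j : ℕ) (ι : Fin d → Bool) (m : Fin d → Fin (2 ^ j)) :
    MemLp (B.Psi j ι m) ⊤ (cubeVol d) := by
  obtain ⟨C, -, h⟩ := B.exists_Psi_bound d
  exact memLp_top_of_bound (B.measurable_Psi j ι m).aestronglyMeasurable _
    (Filter.Eventually.of_forall fun x => by rw [Real.norm_eq_abs]; exact (h j).2.1 ι m x)

theorem memLp_Phi (j : ℕ) (m : Fin d → Fin (2 ^ j)) : MemLp (B.Phi j m) ⊤ (cubeVol d) := by
  rw [Phi_eq_Psi]; exact B.memLp_Psi j _ m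

theorem integral_Phi_mul_Phi {j : ℕ} (hj : B.J₀ ≤ j) (m m' : Fin d → Fin (2 ^ j)) :
    ∫ x, B.Phi j m x * B.Phi j m' x ∂cubeVol d = if m = m' then 1 else 0 := by
  simp_rw [Phi, ← Finset.prod_mul_distrib]
  rw [integral_cubeVol_prod (fun i t => B.father.level j (m i) t * B.father.level j (m' i) t)]
  simp_rw [B.integral_father hj]
  exact prod_ite_eq_pi m m'

theorem exists_Phi_nested {j j' : ℕ} (hj : B.J₀ ≤ j) (hjj' : j ≤ j') :
    ∃ c : (Fin d → Fin (2 ^ j)) → (Fin d → Fin (2 ^ j')) → ℝ, ∀ᵐ x ∂cubeVol d, ∀ m,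
      B.Phi j m x = ∑ m', c m m' * B.Phi j' m' x := by
  obtain ⟨c, hc⟩ := B.exists_nested hj hjj'
  refine ⟨fun m m' => ∏ i, c (m i) (m' i), ?_⟩
  filter_upwards [ae_cubeVol_of_ae hc] with x hx m
  simp_rw [Phi, ← Finset.prod_mul_distrib]
  rw [sum_prod_pi (fun i k => c (m i) k * B.father.level j' k (x i))]
  exact Finset.prod_congr rfl fun i _ => hx i (m i)

theorem exists_Phi_orthogonal {j : ℕ} (hj : B.J₀ ≤ j) :
    ∃ c : (Fin d → Bool) × (Fin d → Fin (2 ^ j)) → (Fin d → Fin (2 ^ (j + 1))) → ℝ,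
      (∀ r r', ∑ m', c r m' * c r' m' = if r = r' then 1 else 0) ∧
      ∀ᵐ x ∂cubeVol d, ∀ m', B.Phi (j + 1) m' x = ∑ r, c r m' * B.Psi j r.1 r.2 x := by
  obtain ⟨c, horth, hc⟩ := B.exists_orthogonal hj
  refine ⟨fun r m' => ∏ i, c (r.1 i, r.2 i) (m' i), fun r r' => ?_, ?_⟩
  · simp_rw [← Finset.prod_mul_distrib]
    rw [sum_prod_pi (fun i k => c (r.1 i, r.2 i) k * c (r'.1 i, r'.2 i) k)]
    simp_rw [horth]
    rw [prod_ite_eq_pi (fun i => (r.1 i, r.2 i)) (fun i => (r'.1 i, r'.2 i))]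
    congr 1
    simp [funext_iff, Prod.ext_iff, forall_and]
  · filter_upwards [ae_cubeVol_of_ae hc] with x hx m'
    have h1 : B.Phi (j + 1) m' x
        = ∏ i, ∑ r : Bool × Fin (2 ^ j), c r (m' i) * B.pairLevel j r (x i) :=
      Finset.prod_congr rfl fun i _ => hx i (m' i)
    rw [h1, ← sum_prod_pi (fun i r => c r (m' i) * B.pairLevel j r (x i)),
      ← (Equiv.arrowProdEquivProdArrow (Fin d) (fun _ => Bool) (fun _ => Fin (2 ^ j))).sum_comp]
    refine Finset.sum_congr rfl fun r _ => ?_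
    rw [Finset.prod_mul_distrib, Psi_eq]
    rfl

/-! ### The projection kernel -/

theorem projKernel_comm (j : ℕ) (x y : Fin d → ℝ) : B.projKernel j x y = B.projKernel j y x :=
  Finset.sum_congr rfl fun _ _ => mul_comm _ _

/-- Size, localisation and integrals of the projection kernel. -/
theorem exists_projKernel_bound (d : ℕ) : ∃ C : ℝ, 1 ≤ C ∧ ∀ j,
    (∀ x y, |B.projKernel (d := d) j x y| ≤ C * (2 ^ j) ^ d) ∧
    (∀ x y, B.projKernel (d := d) j x y ≠ 0 → dist x y ≤ C / 2 ^ j) ∧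
    (∀ x, ∫ y, |B.projKernel (d := d) j x y| ∂cubeVol d ≤ C) := by
  obtain ⟨C, hC, H⟩ := B.exists_Psi_bound d
  refine ⟨C * C, by nlinarith, fun j => ?_⟩
  obtain ⟨a1, a2, a3, a4⟩ := H j
  refine ⟨fun x y => ?_, fun x y hxy => ?_, fun x => ?_⟩
  · calc |B.projKernel j x y| ≤ ∑ m, |B.Phi j m x * B.Phi j m y| := Finset.abs_sum_le_sum_abs _ _
      _ ≤ ∑ m, |B.Phi j m x| * (C * √(2 ^ j) ^ d) := by
          refine Finset.sum_le_sum fun m _ => ?_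
          rw [abs_mul]
          gcongr
          rw [Phi_eq_Psi]; exact a2 _ _ _
      _ ≤ (C * √(2 ^ j) ^ d) * (C * √(2 ^ j) ^ d) := by
          rw [← Finset.sum_mul]
          gcongr
          simp_rw [Phi_eq_Psi]
          exact a1 _ _
      _ = _ := by rw [← sqrt_pow_mul_sqrt_pow j d]; ring
  · obtain ⟨m, -, hm⟩ := Finset.exists_ne_zero_of_sum_ne_zero hxy
    have := a3 (fun _ => false) m x y
    rw [← Phi_eq_Psi] at this
    refine (this (left_ne_zero_of_mul hm) (right_ne_zero_of_mul hm)).trans ?_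
    gcongr; nlinarith
  · have hi : ∀ m, Integrable (fun y => |B.Phi (d := d) j m y|) (cubeVol d) := fun m =>
      ((B.memLp_Phi j m).integrable le_top).abs
    calc ∫ y, |B.projKernel j x y| ∂cubeVol d
        ≤ ∫ y, ∑ m, |B.Phi j m x| * |B.Phi j m y| ∂cubeVol d := by
          refine integral_mono_of_nonneg (Filter.Eventually.of_forall fun y => abs_nonneg _)
            (integrable_finsetSum _ fun m _ => (hi m).const_mul _)
            (Filter.Eventually.of_forall fun y => ?_)
          refine (Finset.abs_sum_le_sum_abs _ _).trans (le_of_eq ?_)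
          exact Finset.sum_congr rfl fun m _ => abs_mul _ _
      _ = ∑ m, |B.Phi j m x| * ∫ y, |B.Phi j m y| ∂cubeVol d := by
          rw [integral_finsetSum _ fun m _ => (hi m).const_mul _]
          exact Finset.sum_congr rfl fun m _ => integral_const_mul _ _
      _ ≤ ∑ m, |B.Phi j m x| * (C / √(2 ^ j) ^ d) := by
          gcongr with m
          rw [Phi_eq_Psi]; exact a4 _ _
      _ ≤ (C * √(2 ^ j) ^ d) * (C / √(2 ^ j) ^ d) := by
          rw [← Finset.sum_mul]
          gcongr
          simp_rw [Phi_eq_Psi]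
          exact a1 _ _
      _ = C * C := by
          have : √((2 : ℝ) ^ j) ^ d ≠ 0 := by positivity
          field_simp

/-- The projection kernel reproduces constants. -/
theorem integral_projKernel (hS : 0 < S) {j : ℕ} (hj : B.J₀ ≤ j) :
    ∀ᵐ x ∂cubeVol d, ∫ y, B.projKernel j x y ∂cubeVol d = 1 := by
  obtain ⟨a, ha⟩ := B.polynomials 0 hS
  obtain ⟨c, hc⟩ := B.exists_nested le_rfl hj
  have h1 : ∀ᵐ t ∂unitVol, ∑ m, (∑ i, a i * c i m) * B.father.level j m t = 1 := by
    filter_upwards [ha, hc] with t h1 h2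
    rw [pow_zero] at h1
    rw [h1]
    simp_rw [h2, Finset.sum_mul, Finset.mul_sum]
    rw [Finset.sum_comm]
    exact Finset.sum_congr rfl fun i _ => Finset.sum_congr rfl fun k _ => by ring
  -- the coefficients of the constant `1` are the integrals of the scaling functions
  have h2 : ∀ m, ∫ t, B.father.level j m t ∂unitVol = ∑ i, a i * c i m := by
    intro m
    have h3 : ∀ᵐ t ∂unitVol, B.father.level j m t =
        (∑ m', (∑ i, a i * c i m') * B.father.level j m' t) *
          ∑ _i : Unit, 1 * B.father.level j m t := by
      filter_upwards [h1] with t ht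
      rw [ht]; simp
    rw [integral_congr_ae h3, integral_sum_mul_sum (f := fun m' => B.father.level j m')
      (g := fun _ : Unit => B.father.level j m)
      fun i _ => (B.father.memLp_level j i).integrable_mul_top (B.father.memLp_level j m)]
    simp [B.integral_father hj]
  filter_upwards [ae_cubeVol_of_ae h1] with x hx
  unfold projKernel
  rw [integral_finsetSum _ fun m _ => ((B.memLp_Phi j m).integrable le_top).const_mul _]
  simp_rw [integral_const_mul]
  have h4 : ∀ m : Fin d → Fin (2 ^ j), B.Phi j m x * ∫ y, B.Phi j m y ∂cubeVol d
      = ∏ i, (∑ k, a k * c k (m i)) * B.father.level j (m i) (x i) := by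
    intro m
    unfold Phi
    rw [integral_cubeVol_prod, ← Finset.prod_mul_distrib]
    exact Finset.prod_congr rfl fun i _ => by rw [h2, mul_comm]
  simp_rw [h4]
  rw [sum_prod_pi (fun i k => (∑ l, a l * c l k) * B.father.level j k (x i))]
  exact Finset.prod_eq_one fun i _ => hx i

end CDVBasis

/-! ### Approximation of Hölder functions by projections -/

namespace CDVBasis

variable {S : ℕ} (B : CDVBasis S) {d : ℕ}

/-- The orthogonal projection of `f` onto `V_j`. -/
noncomputable def proj (j : ℕ) (f : (Fin d → ℝ) → ℝ) (x : Fin d → ℝ) : ℝ :=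
  ∑ m, innerC f (B.Phi j m) * B.Phi j m x

/-- The `L²` inner product of the projections of `f` and `g` onto `V_j`. -/
noncomputable def projInner (j : ℕ) (f g : (Fin d → ℝ) → ℝ) : ℝ :=
  ∑ m, innerC f (B.Phi j m) * innerC g (B.Phi j m)

theorem measurable_proj (j : ℕ) (f : (Fin d → ℝ) → ℝ) : Measurable (B.proj j f) :=
  Finset.measurable_fun_sum _ fun m _ => (B.measurable_Phi j m).const_mul _

theorem memLp_proj (j : ℕ) (f : (Fin d → ℝ) → ℝ) : MemLp (B.proj j f) ⊤ (cubeVol d) :=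
  memLp_finsetSum _ fun m _ => (B.memLp_Phi j m).const_mul _

theorem projInner_comm (j : ℕ) (f g : (Fin d → ℝ) → ℝ) :
    B.projInner j f g = B.projInner j g f :=
  Finset.sum_congr rfl fun _ _ => mul_comm _ _

theorem projInner_self_nonneg (j : ℕ) (f : (Fin d → ℝ) → ℝ) : 0 ≤ B.projInner j f f :=
  Finset.sum_nonneg fun _ _ => mul_self_nonneg _

theorem integral_mul_proj {j : ℕ} {f : (Fin d → ℝ) → ℝ} (g : (Fin d → ℝ) → ℝ)
    (hf : MemLp f ⊤ (cubeVol d)) :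
    ∫ x, f x * B.proj j g x ∂cubeVol d = B.projInner j f g := by
  unfold proj projInner
  simp_rw [Finset.mul_sum]
  rw [integral_finsetSum]
  · refine Finset.sum_congr rfl fun m _ => ?_
    rw [innerC_eq f, ← integral_mul_const]
    exact integral_congr_ae (Filter.Eventually.of_forall fun x => by ring)
  · intro m _
    exact hf.integrable_mul_top ((B.memLp_Phi j m).const_mul _)

theorem integral_proj_mul_proj {j : ℕ} (hj : B.J₀ ≤ j) (f g : (Fin d → ℝ) → ℝ) :
    ∫ x, B.proj j f x * B.proj j g x ∂cubeVol d = B.projInner j f g := by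
  unfold proj projInner
  rw [integral_sum_mul_sum fun i i' =>
    (B.memLp_Phi j i).integrable_mul_top (B.memLp_Phi j i')]
  simp [B.integral_Phi_mul_Phi hj]

theorem integral_sub_proj_mul {j : ℕ} (hj : B.J₀ ≤ j) {f g : (Fin d → ℝ) → ℝ}
    (hf : MemLp f ⊤ (cubeVol d)) (hg : MemLp g ⊤ (cubeVol d)) :
    ∫ x, (f x - B.proj j f x) * (g x - B.proj j g x) ∂cubeVol d
      = ∫ x, f x * g x ∂cubeVol d - B.projInner j f g := by
  have e : ∀ x, (f x - B.proj j f x) * (g x - B.proj j g x) =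
      f x * g x - f x * B.proj j g x - (g x * B.proj j f x - B.proj j f x * B.proj j g x) := by
    intro x; ring
  simp_rw [e]
  have hpf := B.memLp_proj j f
  have hpg := B.memLp_proj j g
  have i1 := hf.integrable_mul_top hg
  have i2 := hf.integrable_mul_top hpg
  have i3 := hg.integrable_mul_top hpf
  have i4 := hpf.integrable_mul_top hpg
  have i12 : Integrable (fun x => f x * g x - f x * B.proj j g x) (cubeVol d) := i1.sub i2
  have i34 : Integrable (fun x => g x * B.proj j f x - B.proj j f x * B.proj j g x)
    (cubeVol d) := i3.sub i4
  rw [integral_sub i12 i34, integral_sub i1 i2, integral_sub i3 i4,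
    B.integral_mul_proj g hf, B.integral_mul_proj f hg, B.integral_proj_mul_proj hj,
    B.projInner_comm j g f]
  ring

/-- Bessel's inequality. -/
theorem projInner_self_le {j : ℕ} (hj : B.J₀ ≤ j) {f : (Fin d → ℝ) → ℝ}
    (hf : MemLp f ⊤ (cubeVol d)) : B.projInner j f f ≤ ∫ x, f x * f x ∂cubeVol d := by
  have := B.integral_sub_proj_mul hj hf hf
  have h2 : 0 ≤ ∫ x, (f x - B.proj j f x) * (f x - B.proj j f x) ∂cubeVol d :=
    integral_nonneg fun x => mul_self_nonneg _
  linarith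

theorem sq_integral_mul_le {Ω : Type*} {mΩ : MeasurableSpace Ω} {μ : Measure Ω}
    {f g : Ω → ℝ} (hff : Integrable (fun x => f x * f x) μ)
    (hgg : Integrable (fun x => g x * g x) μ) (hfg : Integrable (fun x => f x * g x) μ) :
    (∫ x, f x * g x ∂μ) ^ 2 ≤ (∫ x, f x * f x ∂μ) * ∫ x, g x * g x ∂μ := by
  set a := ∫ x, f x * f x ∂μ
  set b := ∫ x, f x * g x ∂μ
  set c := ∫ x, g x * g x ∂μ
  have key : ∀ t : ℝ, 0 ≤ a * (t * t) + (2 * b) * t + c := by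
    intro t
    have h : ∫ x, (t * f x + g x) * (t * f x + g x) ∂μ = a * (t * t) + (2 * b) * t + c := by
      have e : ∀ x, (t * f x + g x) * (t * f x + g x)
          = t * t * (f x * f x) + 2 * t * (f x * g x) + g x * g x := by intro x; ring
      simp_rw [e]
      have i1 : Integrable (fun x => t * t * (f x * f x) + 2 * t * (f x * g x)) μ :=
        (hff.const_mul _).add (hfg.const_mul _)
      rw [integral_add i1 hgg,
        integral_add (hff.const_mul _) (hfg.const_mul _), integral_const_mul, integral_const_mul]
      ring
    rw [← h]
    exact integral_nonneg fun x => mul_self_nonneg _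
  have := discrim_le_zero key
  rw [discrim] at this
  nlinarith

theorem sq_integral_sub_projInner_le {j : ℕ} (hj : B.J₀ ≤ j) {f g : (Fin d → ℝ) → ℝ}
    (hf : MemLp f ⊤ (cubeVol d)) (hg : MemLp g ⊤ (cubeVol d)) :
    (∫ x, f x * g x ∂cubeVol d - B.projInner j f g) ^ 2 ≤
      (∫ x, f x * f x ∂cubeVol d - B.projInner j f f) *
        (∫ x, g x * g x ∂cubeVol d - B.projInner j g g) := by
  have h1 := hf.sub (B.memLp_proj j f)
  have h2 := hg.sub (B.memLp_proj j g)
  rw [← B.integral_sub_proj_mul hj hf hg, ← B.integral_sub_proj_mul hj hf hf,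
    ← B.integral_sub_proj_mul hj hg hg]
  exact sq_integral_mul_le (h1.integrable_mul_top h1) (h2.integrable_mul_top h2)
    (h1.integrable_mul_top h2)

theorem proj_eq_integral {j : ℕ} {f : (Fin d → ℝ) → ℝ} (hf : MemLp f ⊤ (cubeVol d))
    (x : Fin d → ℝ) : B.proj j f x = ∫ y, B.projKernel j x y * f y ∂cubeVol d := by
  unfold proj projKernel
  simp_rw [Finset.sum_mul]
  rw [integral_finsetSum]
  · refine Finset.sum_congr rfl fun m _ => ?_
    rw [innerC_eq, mul_comm, ← integral_const_mul]
    exact integral_congr_ae (Filter.Eventually.of_forall fun y => by ring)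
  · intro m _
    exact ((B.memLp_Phi j m).const_mul _).integrable_mul_top hf

theorem _root_.UniformContinuousOn.memLp_cubeVol {f : (Fin d → ℝ) → ℝ}
    (hf : UniformContinuousOn f (cube d)) : MemLp f ⊤ (cubeVol d) := by
  obtain ⟨C, hC⟩ := (isCompact_Icc (a := (0 : Fin d → ℝ)) (b := 1)).exists_bound_of_continuousOn
    hf.continuousOn
  refine memLp_top_of_bound ?_ C ?_
  · rw [← restrict_cube_eq]
    exact hf.continuousOn.aestronglyMeasurable measurableSet_Icc
  · filter_upwards [ae_mem_cube d] with x hx using hC x hx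

/-- The projections of a uniformly continuous function converge to it uniformly: the kernel is
localised at scale `2^{-j}` and reproduces constants. -/
theorem eventually_abs_sub_proj_le (hS : 0 < S) {f : (Fin d → ℝ) → ℝ}
    (hf : UniformContinuousOn f (cube d)) {ε : ℝ} (hε : 0 < ε) :
    ∀ᶠ j in Filter.atTop, ∀ᵐ x ∂cubeVol d, |f x - B.proj j f x| ≤ ε := by
  obtain ⟨C, hC, H⟩ := B.exists_projKernel_bound d
  have hC0 : 0 < C := by linarith
  obtain ⟨δ, hδ, hδf⟩ := Metric.uniformContinuousOn_iff.1 hf (ε / C) (by positivity)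
  have hlim : Filter.Tendsto (fun j : ℕ => C / (2 : ℝ) ^ j) Filter.atTop (nhds 0) :=
    tendsto_const_nhds.div_atTop (tendsto_pow_atTop_atTop_of_one_lt one_lt_two)
  filter_upwards [hlim.eventually (gt_mem_nhds hδ), Filter.eventually_ge_atTop B.J₀] with j hj hJ
  obtain ⟨-, b2, b3⟩ := H j
  filter_upwards [B.integral_projKernel hS hJ, ae_mem_cube d] with x hx hxc
  have hfm := hf.memLp_cubeVol
  have hK : MemLp (fun y => B.projKernel j x y) ⊤ (cubeVol d) :=
    memLp_finsetSum _ fun m _ => (B.memLp_Phi j m).const_mul _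
  have e : f x - B.proj j f x = ∫ y, B.projKernel j x y * (f x - f y) ∂cubeVol d := by
    simp_rw [mul_sub]
    rw [integral_sub ((hK.integrable le_top).mul_const _) (hK.integrable_mul_top hfm),
      integral_mul_const, hx, one_mul, B.proj_eq_integral hfm]
  rw [e]
  calc |∫ y, B.projKernel j x y * (f x - f y) ∂cubeVol d|
      ≤ ∫ y, |B.projKernel j x y * (f x - f y)| ∂cubeVol d := abs_integral_le_integral_abs
    _ ≤ ∫ y, |B.projKernel j x y| * (ε / C) ∂cubeVol d := by
        refine integral_mono_of_nonneg (Filter.Eventually.of_forall fun y => abs_nonneg _)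
          ((hK.integrable le_top).abs.mul_const _) ?_
        filter_upwards [ae_mem_cube d] with y hy
        rw [abs_mul]
        by_cases h0 : B.projKernel j x y = 0
        · simp [h0]
        · gcongr
          have := hδf x hxc y hy ((b2 x y h0).trans_lt hj)
          rw [Real.dist_eq] at this
          exact this.le
    _ ≤ C * (ε / C) := by
        rw [integral_mul_const]
        gcongr
        exact b3 x
    _ = ε := by field_simp

theorem tendsto_projInner_self (hS : 0 < S) {f : (Fin d → ℝ) → ℝ}
    (hf : UniformContinuousOn f (cube d)) :
    Filter.Tendsto (fun j => B.projInner j f f) Filter.atTop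
      (nhds (∫ x, f x * f x ∂cubeVol d)) := by
  have hfm := hf.memLp_cubeVol
  rw [Metric.tendsto_atTop']
  intro ε hε
  set D := ∫ x, |f x| ∂cubeVol d with hD
  have hD0 : 0 ≤ D := integral_nonneg fun _ => abs_nonneg _
  obtain ⟨N, hN⟩ := Filter.eventually_atTop.1
    (B.eventually_abs_sub_proj_le hS hf (ε := ε / (D + 1)) (by positivity))
  refine ⟨N, fun j hj => ?_⟩
  have hp := B.memLp_proj j f
  rw [Real.dist_eq, abs_sub_comm, ← B.integral_mul_proj f hfm,
    ← integral_sub (hfm.integrable_mul_top hfm) (hfm.integrable_mul_top hp)]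
  calc |∫ x, f x * f x - f x * B.proj j f x ∂cubeVol d|
      ≤ ∫ x, |f x * f x - f x * B.proj j f x| ∂cubeVol d := abs_integral_le_integral_abs
    _ ≤ ∫ x, |f x| * (ε / (D + 1)) ∂cubeVol d := by
        refine integral_mono_of_nonneg (Filter.Eventually.of_forall fun y => abs_nonneg _)
          ((hfm.integrable le_top).abs.mul_const _) ?_
        filter_upwards [hN j hj.le] with x hx
        rw [← mul_sub, abs_mul]
        gcongr
    _ = D * (ε / (D + 1)) := by rw [integral_mul_const]
    _ < (D + 1) * (ε / (D + 1)) := by gcongr; linarith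
    _ = ε := by field_simp

theorem innerC_sum_right {J : Type*} [Fintype J] {f : (Fin d → ℝ) → ℝ}
    (hf : MemLp f ⊤ (cubeVol d)) {g : J → (Fin d → ℝ) → ℝ} (hg : ∀ i, MemLp (g i) ⊤ (cubeVol d))
    (c : J → ℝ) {h : (Fin d → ℝ) → ℝ} (hh : ∀ᵐ x ∂cubeVol d, h x = ∑ i, c i * g i x) :
    innerC f h = ∑ i, c i * innerC f (g i) := by
  simp_rw [innerC_eq]
  have : ∀ᵐ x ∂cubeVol d, f x * h x = ∑ i, c i * (f x * g i x) := by
    filter_upwards [hh] with x hx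
    rw [hx, Finset.mul_sum]
    exact Finset.sum_congr rfl fun i _ => by ring
  rw [integral_congr_ae this, integral_finsetSum _ fun i _ =>
    (hf.integrable_mul_top (hg i)).const_mul _]
  exact Finset.sum_congr rfl fun i _ => integral_const_mul _ _

theorem _root_.sum_sq_of_orthonormal_rows {R K : Type*} [Fintype R] [Fintype K] [DecidableEq R]
    {c : R → K → ℝ} (horth : ∀ r r', ∑ k, c r k * c r' k = if r = r' then 1 else 0) (v : R → ℝ) :
    ∑ k, (∑ r, c r k * v r) ^ 2 = ∑ r, v r ^ 2 := by
  simp_rw [sq, Finset.sum_mul_sum]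
  rw [Finset.sum_comm]
  refine Finset.sum_congr rfl fun r _ => ?_
  rw [Finset.sum_comm]
  have h2 : ∀ r', ∑ k, c r k * v r * (c r' k * v r') = if r = r' then v r * v r' else 0 := by
    intro r'
    have h3 : ∀ k, c r k * v r * (c r' k * v r') = (c r k * c r' k) * (v r * v r') := by
      intro k; ring
    simp_rw [h3]
    rw [← Finset.sum_mul, horth r r']
    simp
  simp_rw [h2]
  simp

/-- The wavelet coefficients of level `j` account for the increment from `V_j` to `V_{j+1}`. -/
theorem projInner_succ {j : ℕ} (hj : B.J₀ ≤ j) {f : (Fin d → ℝ) → ℝ}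
    (hf : MemLp f ⊤ (cubeVol d)) :
    B.projInner (j + 1) f f = ∑ ι, ∑ m, innerC f (B.Psi j ι m) ^ 2 := by
  obtain ⟨c, horth, hc⟩ := B.exists_Phi_orthogonal (d := d) hj
  have h1 : ∀ m', innerC f (B.Phi (j + 1) m') = ∑ r : (Fin d → Bool) × (Fin d → Fin (2 ^ j)),
      c r m' * innerC f (B.Psi j r.1 r.2) := by
    intro m'
    refine innerC_sum_right hf (g := fun r => B.Psi j r.1 r.2) (fun r => B.memLp_Psi j r.1 r.2)
      (fun r => c r m') ?_
    filter_upwards [hc] with x hx using hx m'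
  have h2 := sum_sq_of_orthonormal_rows horth (fun r => innerC f (B.Psi j r.1 r.2))
  have h3 : B.projInner (j + 1) f f = ∑ m', innerC f (B.Phi (j + 1) m') ^ 2 :=
    Finset.sum_congr rfl fun m' _ => (sq _).symm
  rw [h3]
  simp_rw [h1]
  rw [h2, Fintype.sum_prod_type]

theorem ofReal_le_of_holderBall {a M : ℝ} {h : (Fin d → ℝ) → ℝ} (hh : h ∈ B.holderBall d a M)
    {l : ℕ} (hl : B.J₀ ≤ l) {ι : Fin d → Bool} (hι : ∃ i, ι i = true) (m : Fin d → Fin (2 ^ l)) :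
    (2 : ℝ) ^ ((l : ℝ) * (a + d / 2)) * |innerC h (B.Psi l ι m)| ≤ max M 0 := by
  have h1 := (le_add_self).trans hh.2
  have h2 := iSup₂_le_iff.1 h1 l hl
  have h3 := iSup₂_le_iff.1 h2 ι hι
  have h4 := iSup_le_iff.1 h3 m
  have := ENNReal.ofReal_le_ofReal_iff'.1 h4
  rcases this with h | h
  · exact h.trans (le_max_left _ _)
  · exact h.trans (le_max_right _ _)

/-- The increments of the squared norms of the projections of a Hölder function decay
geometrically. -/
theorem projInner_succ_le {a M : ℝ} (hM : 0 ≤ M) {h : (Fin d → ℝ) → ℝ}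
    (hh : h ∈ B.holderBall d a M) {l : ℕ} (hl : B.J₀ ≤ l) :
    B.projInner (l + 1) h h ≤ B.projInner l h h + 2 ^ d * M ^ 2 * ((2 : ℝ) ^ (-(2 * a))) ^ l := by
  have hm := hh.1.memLp_cubeVol
  rw [B.projInner_succ hl hm, ← Finset.add_sum_erase _ _ (Finset.mem_univ (fun _ => false))]
  refine add_le_add (le_of_eq ?_) ?_
  · unfold projInner
    exact Finset.sum_congr rfl fun m _ => by rw [← Phi_eq_Psi, sq]
  · have hb : ∀ ι ∈ (Finset.univ : Finset (Fin d → Bool)).erase (fun _ => false),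
        ∑ m, innerC h (B.Psi l ι m) ^ 2 ≤ M ^ 2 * ((2 : ℝ) ^ (-(2 * a))) ^ l := by
      intro ι hι
      have hex : ∃ i, ι i = true := by
        by_contra hcon
        push Not at hcon
        exact (Finset.mem_erase.1 hι).1 (funext fun i => by simpa using hcon i)
      have hp : (0 : ℝ) < (2 : ℝ) ^ ((l : ℝ) * (a + d / 2)) := by positivity
      have hc : ∀ m, innerC h (B.Psi l ι m) ^ 2
          ≤ M ^ 2 / ((2 : ℝ) ^ ((l : ℝ) * (a + d / 2))) ^ 2 := by
        intro m
        have := B.ofReal_le_of_holderBall hh hl hex m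
        rw [max_eq_left hM] at this
        rw [le_div_iff₀ (by positivity), ← sq_abs, ← mul_pow]
        exact pow_le_pow_left₀ (by positivity) (by linarith) 2
      refine (Finset.sum_le_card_nsmul _ _ _ fun m _ => hc m).trans (le_of_eq ?_)
      rw [nsmul_eq_mul]
      -- there are `2 ^ (l * d)` translates, which cancels the normalisation of the wavelets
      have e1 : ((Finset.univ : Finset (Fin d → Fin (2 ^ l))).card : ℝ) = (2 : ℝ) ^ ((l : ℝ) * d) := by
        simp only [Finset.card_univ, Fintype.card_pi, Fintype.card_fin, Finset.prod_const]
        push_cast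
        rw [Real.rpow_mul (by norm_num), Real.rpow_natCast, Real.rpow_natCast]
      have e2 : ((2 : ℝ) ^ ((l : ℝ) * (a + d / 2))) ^ 2
          = (2 : ℝ) ^ ((l : ℝ) * d) * (2 : ℝ) ^ (2 * a * l) := by
        rw [← Real.rpow_natCast _ 2, ← Real.rpow_mul (by norm_num), ← Real.rpow_add (by norm_num)]
        congr 1; push_cast; ring
      have e3 : ((2 : ℝ) ^ (-(2 * a))) ^ l = ((2 : ℝ) ^ (2 * a * l))⁻¹ := by
        rw [← Real.rpow_natCast _ l, ← Real.rpow_mul (by norm_num), ← Real.rpow_neg (by norm_num)]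
        congr 1; ring
      rw [e1, e2, e3]
      field_simp
    refine (Finset.sum_le_card_nsmul _ _ _ hb).trans ?_
    rw [nsmul_eq_mul, mul_assoc]
    gcongr
    have := Finset.card_le_univ ((Finset.univ : Finset (Fin d → Bool)).erase (fun _ => false))
    simp only [Fintype.card_pi, Fintype.card_bool, Finset.prod_const, Finset.card_univ,
      Fintype.card_fin] at this
    exact_mod_cast this

/-- The squared `L²` distance of a Hölder function of exponent `a` from `V_j` is `O(2^{-2ja})`. -/
theorem exists_approx (hS : 0 < S) {a : ℝ} (ha : 0 < a) (d : ℕ) {M : ℝ} (hM : 0 ≤ M) :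
    ∃ C : ℝ, 0 < C ∧ ∀ h ∈ B.holderBall d a M, ∀ j, B.J₀ ≤ j →
      ∫ x, h x * h x ∂cubeVol d - B.projInner j h h ≤ C * ((2 : ℝ) ^ (-(2 * a))) ^ j := by
  set q : ℝ := (2 : ℝ) ^ (-(2 * a)) with hq
  have hq0 : 0 < q := by positivity
  have hq1 : q < 1 := Real.rpow_lt_one_of_one_lt_of_neg one_lt_two (by linarith)
  have hq2 : 0 < 1 - q := by linarith
  refine ⟨2 ^ d * M ^ 2 / (1 - q) + 1, by positivity, fun h hh j hj => ?_⟩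
  set A := 2 ^ d * M ^ 2 with hA
  have hA0 : 0 ≤ A := by positivity
  -- the tail of the geometric series is carried along in the induction
  have hind : ∀ r, B.projInner (j + r) h h + A / (1 - q) * q ^ (j + r)
      ≤ B.projInner j h h + A / (1 - q) * q ^ j := by
    intro r
    induction r with
    | zero => simp
    | succ r ih =>
      have := B.projInner_succ_le hM hh (l := j + r) (hj.trans (Nat.le_add_right _ _))
      have e : A * q ^ (j + r) + A / (1 - q) * q ^ (j + r + 1) = A / (1 - q) * q ^ (j + r) := by
        field_simp; ring
      rw [← add_assoc]
      linarith
  have hlim := B.tendsto_projInner_self hS hh.1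
  have : ∫ x, h x * h x ∂cubeVol d ≤ B.projInner j h h + A / (1 - q) * q ^ j := by
    refine le_of_tendsto hlim ?_
    filter_upwards [Filter.eventually_ge_atTop j] with J hJ
    obtain ⟨r, rfl⟩ := Nat.exists_eq_add_of_le hJ
    have := hind r
    have : 0 ≤ A / (1 - q) * q ^ (j + r) := by positivity
    linarith
  have h3 : 0 < q ^ j := by positivity
  nlinarith

end CDVBasis

/-! ### Moments of sums of independent variables -/

section Moments

open ProbabilityTheory

variable {Z J I : Type*} [MeasurableSpace Z] [Fintype J] [Fintype I] {P : Measure Z}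
  [IsProbabilityMeasure P]

theorem MeasureTheory.MemLp.mul_top {Ω : Type*} {mΩ : MeasurableSpace Ω} {μ : Measure Ω}
    {f g : Ω → ℝ} (hf : MemLp f ⊤ μ) (hg : MemLp g ⊤ μ) : MemLp (fun x => f x * g x) ⊤ μ :=
  MemLp.mul' (p := ⊤) (q := ⊤) (r := ⊤) hg hf

theorem MeasureTheory.MemLp.sq_top {Ω : Type*} {mΩ : MeasurableSpace Ω} {μ : Measure Ω}
    {f : Ω → ℝ} (hf : MemLp f ⊤ μ) : MemLp (fun x => f x ^ 2) ⊤ μ := by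
  simp_rw [sq]; exact hf.mul_top hf

theorem memLp_eval {f : Z → ℝ} (hf : MemLp f ⊤ P) (i : J) :
    MemLp (fun ω : J → Z => f (ω i)) ⊤ (Measure.pi fun _ => P) :=
  hf.comp_measurePreserving (measurePreserving_eval (fun _ : J => P) i)

theorem integral_eval {f : Z → ℝ} (hf : AEStronglyMeasurable f P) (i : J) :
    ∫ ω : J → Z, f (ω i) ∂(Measure.pi fun _ => P) = ∫ z, f z ∂P := by
  have h := measurePreserving_eval (fun _ : J => P) i
  rw [← h.map_eq] at hf
  have := integral_map h.measurable.aemeasurable hf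
  rw [h.map_eq] at this
  exact this.symm

theorem lintegral_eval {f : Z → ℝ≥0∞} (hf : Measurable f) (i : J) :
    ∫⁻ ω : J → Z, f (ω i) ∂(Measure.pi fun _ => P) = ∫⁻ z, f z ∂P :=
  (measurePreserving_eval (fun _ : J => P) i).lintegral_comp hf

theorem ae_eval {p : Z → Prop} (h : ∀ᵐ z ∂P, p z) :
    ∀ᵐ ω ∂(Measure.pi fun _ : J => P), ∀ i, p (ω i) :=
  ae_all_iff.2 fun i => (Measure.quasiMeasurePreserving_eval (fun _ : J => P) i).ae h

theorem iIndepFun_eval : iIndepFun (fun (i : J) (ω : J → Z) => ω i) (Measure.pi fun _ => P) :=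
  iIndepFun_pi (X := fun _ z => z) fun _ => aemeasurable_id

theorem map_pair_eval {i j : J} (hij : i ≠ j) :
    (Measure.pi fun _ : J => P).map (fun ω => (ω i, ω j)) = P.prod P := by
  have h := (iIndepFun_eval (P := P)).indepFun hij
  have h2 := h.map_prod_eq_prod_map_map (measurable_pi_apply i).aemeasurable
    (measurable_pi_apply j).aemeasurable
  rwa [(measurePreserving_eval (fun _ : J => P) i).map_eq,
    (measurePreserving_eval (fun _ : J => P) j).map_eq] at h2

/-- The square of `|S + x| ^ 2 = q + 2 * c + r`, where `c = ⟪S, x⟫`: the right side is arranged so that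
the only term that is not a function of the norms, `q * c`, integrates to zero. -/
theorem sq_add_le_of_sq_le {q c r R : ℝ} (hq : 0 ≤ q) (hr : 0 ≤ r) (hrR : r ≤ R)
    (hc : c ^ 2 ≤ q * r) : (q + 2 * c + r) ^ 2 ≤ q ^ 2 + 8 * R * q + 3 * R ^ 2 + 4 * (q * c) := by
  have h1 : q * r ≤ R * q := by nlinarith
  have h2 : r ^ 2 ≤ R ^ 2 := by nlinarith
  nlinarith [sq_nonneg (c - r)]

/-- Second and fourth moments of the Euclidean norm of a sum of independent centred vectors. -/
theorem integral_normSq_sum (u : I → Z → ℝ) (hu : ∀ m, Measurable (u m))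
    (hb : ∀ m, MemLp (u m) ⊤ P) (h0 : ∀ m, ∫ z, u m z ∂P = 0) {R : ℝ} (hR0 : 0 ≤ R)
    (hR : ∀ᵐ z ∂P, ∑ m, u m z ^ 2 ≤ R) (s : Finset J) :
    ∫ ω : J → Z, ∑ m, (∑ i ∈ s, u m (ω i)) ^ 2 ∂(Measure.pi fun _ => P)
      = s.card * ∫ z, ∑ m, u m z ^ 2 ∂P ∧
    ∫ ω : J → Z, (∑ m, (∑ i ∈ s, u m (ω i)) ^ 2) ^ 2 ∂(Measure.pi fun _ => P)
      ≤ 4 * (s.card : ℝ) ^ 2 * R ^ 2 := by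
  classical
  set μ : Measure (J → Z) := Measure.pi fun _ => P with hμ
  induction s using Finset.induction_on with
  | empty => simp
  | insert a s ha ih =>
    obtain ⟨ih1, ih2⟩ := ih
    have hSm : ∀ m, MemLp (fun ω : J → Z => ∑ i ∈ s, u m (ω i)) ⊤ μ := fun m =>
      memLp_finsetSum _ fun i _ => memLp_eval (hb m) i
    have hum : ∀ m, MemLp (fun ω : J → Z => u m (ω a)) ⊤ μ := fun m => memLp_eval (hb m) a
    -- the squared norm of the old sum, its inner product with the new vector, the new squared norm
    set q : (J → Z) → ℝ := fun ω => ∑ m, (∑ i ∈ s, u m (ω i)) ^ 2 with hq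
    set c : (J → Z) → ℝ := fun ω => ∑ m, (∑ i ∈ s, u m (ω i)) * u m (ω a) with hc
    set r : (J → Z) → ℝ := fun ω => ∑ m, u m (ω a) ^ 2 with hr
    have hqm : MemLp q ⊤ μ := memLp_finsetSum _ fun m _ => (hSm m).sq_top
    have hcm : MemLp c ⊤ μ := memLp_finsetSum _ fun m _ => (hSm m).mul_top (hum m)
    have hrm : MemLp r ⊤ μ := memLp_finsetSum _ fun m _ => (hum m).sq_top
    have hexp : ∀ ω, ∑ m, (∑ i ∈ insert a s, u m (ω i)) ^ 2 = q ω + 2 * c ω + r ω := by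
      intro ω
      simp only [hq, hc, hr, Finset.sum_insert ha, Finset.mul_sum]
      rw [← Finset.sum_add_distrib, ← Finset.sum_add_distrib]
      exact Finset.sum_congr rfl fun m _ => by ring
    have hind : IndepFun (fun ω : J → Z => fun m => ∑ i ∈ s, u m (ω i))
        (fun ω : J → Z => fun m => u m (ω a)) μ := by
      have h1 : iIndepFun (fun (i : J) (ω : J → Z) => fun m => u m (ω i)) μ :=
        iIndepFun_eval.comp (fun _ z m => u m z) fun _ => measurable_pi_lambda _ hu
      have h2 := h1.indepFun_finsetSum_of_notMem (s := s) (i := a)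
        (fun i => measurable_pi_lambda _ fun m => (hu m).comp (measurable_pi_apply i)) ha
      convert h2 using 1
      ext ω m
      simp
    -- a coordinate of the new vector is centred, also against functions of the old sum
    have hz : ∀ m (φ : (I → ℝ) → ℝ), Measurable φ →
        ∫ ω, φ (fun m => ∑ i ∈ s, u m (ω i)) * u m (ω a) ∂μ = 0 := by
      intro m φ hφ
      have := (hind.comp hφ (measurable_pi_apply m)).integral_fun_mul_eq_mul_integral
        (hφ.comp (measurable_pi_lambda _ fun m => Finset.measurable_fun_sum _ fun i _ =>
          (hu m).comp (measurable_pi_apply i))).aestronglyMeasurable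
        (hum m).aestronglyMeasurable
      simp only [Function.comp_apply] at this
      rw [this, integral_eval (hb m).aestronglyMeasurable, h0, mul_zero]
    have hc0 : ∫ ω, c ω ∂μ = 0 := by
      rw [hc, integral_finsetSum _ fun m _ => (hSm m).integrable_mul_top (hum m)]
      exact Finset.sum_eq_zero fun m _ => hz m (fun v => v m) (measurable_pi_apply m)
    have hqc0 : ∫ ω, q ω * c ω ∂μ = 0 := by
      simp only [hc, Finset.mul_sum]
      rw [integral_finsetSum _ fun m _ => hqm.integrable_mul_top ((hSm m).mul_top (hum m))]
      refine Finset.sum_eq_zero fun m _ => ?_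
      rw [← hz m (fun v => (∑ m, v m ^ 2) * v m) (by fun_prop)]
      exact integral_congr_ae (Filter.Eventually.of_forall fun ω => by simp only [hq]; ring)
    have hr1 : ∫ ω, r ω ∂μ = ∫ z, ∑ m, u m z ^ 2 ∂P :=
      integral_eval (f := fun z => ∑ m, u m z ^ 2)
        (memLp_finsetSum _ fun m _ => (hb m).sq_top).aestronglyMeasurable a
    have hint : ∀ {f : (J → Z) → ℝ}, MemLp f ⊤ μ → Integrable f μ := fun h => h.integrable le_top
    have h1R : ∫ z, ∑ m, u m z ^ 2 ∂P ≤ R := by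
      have := integral_mono_ae
        ((memLp_finsetSum _ fun m _ => (hb m).sq_top : MemLp (fun z => ∑ m, u m z ^ 2) ⊤ P).integrable
          le_top) (integrable_const R) hR
      simpa using this
    simp_rw [hexp]
    rw [Finset.card_insert_of_notMem ha]
    constructor
    · have i1 : Integrable (fun ω => q ω + 2 * c ω) μ := (hint hqm).add ((hint hcm).const_mul 2)
      rw [integral_add i1 (hint hrm), integral_add (hint hqm) ((hint hcm).const_mul 2),
        integral_const_mul, hc0, hr1, ih1]
      push_cast; ring
    · have i1 : Integrable (fun ω => q ω ^ 2 + 8 * R * q ω) μ :=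
        (hint hqm.sq_top).add ((hint hqm).const_mul _)
      have i2 : Integrable (fun ω => q ω ^ 2 + 8 * R * q ω + 3 * R ^ 2) μ :=
        i1.add (integrable_const _)
      have i3 : Integrable (fun ω => 4 * (q ω * c ω)) μ := (hint (hqm.mul_top hcm)).const_mul _
      have i4 : MemLp (fun ω => q ω + 2 * c ω + r ω) ⊤ μ := (hqm.add (hcm.const_mul 2)).add hrm
      calc ∫ ω, (q ω + 2 * c ω + r ω) ^ 2 ∂μ
          ≤ ∫ ω, q ω ^ 2 + 8 * R * q ω + 3 * R ^ 2 + 4 * (q ω * c ω) ∂μ := by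
            refine integral_mono_ae (hint i4.sq_top) (i2.add i3) ?_
            filter_upwards [ae_eval (J := J) hR] with ω hω
            exact sq_add_le_of_sq_le (Finset.sum_nonneg fun _ _ => sq_nonneg _)
              (Finset.sum_nonneg fun _ _ => sq_nonneg _) (hω a)
              (Finset.sum_mul_sq_le_sq_mul_sq _ _ _)
        _ = ∫ ω, q ω ^ 2 ∂μ + 8 * R * (s.card * ∫ z, ∑ m, u m z ^ 2 ∂P) + 3 * R ^ 2 := by
            rw [integral_add i2 i3, integral_add i1 (integrable_const _),
              integral_add (hint hqm.sq_top) ((hint hqm).const_mul _), integral_const_mul,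
              integral_const_mul, integral_const_mul 4, hqc0, ih1]
            simp
        _ ≤ 4 * (s.card : ℝ) ^ 2 * R ^ 2 + 8 * R * (s.card * R) + 3 * R ^ 2 := by gcongr
        _ ≤ _ := by push_cast; nlinarith [sq_nonneg R]

/-- The mean square of a sum of independent centred variables. -/
theorem integral_sq_sum {g : Z → ℝ} (hg : Measurable g) (hb : MemLp g ⊤ P)
    (h0 : ∫ z, g z ∂P = 0) :
    ∫ ω : J → Z, (∑ i, g (ω i)) ^ 2 ∂(Measure.pi fun _ => P)
      = Fintype.card J * ∫ z, g z ^ 2 ∂P := by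
  obtain ⟨C, hC⟩ : ∃ C : ℝ, ∀ᵐ z ∂P, |g z| ≤ C := by
    refine ⟨(eLpNormEssSup g P).toReal, ?_⟩
    have h := hb.2
    rw [eLpNorm_exponent_top] at h
    filter_upwards [ae_le_eLpNormEssSup (f := g) (μ := P)] with z hz
    rw [← Real.norm_eq_abs, ← toReal_enorm]
    exact ENNReal.toReal_mono h.ne hz
  have := (integral_normSq_sum (J := J) (fun _ : Unit => g) (fun _ => hg) (fun _ => hb)
    (fun _ => h0) (R := C ^ 2) (sq_nonneg _)
    (by filter_upwards [hC] with z hz; simpa using sq_le_sq.2 (hz.trans (le_abs_self C)))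
    Finset.univ).1
  simpa using this

/-- The mean square of a bilinear form in two sums of independent centred vectors. -/
theorem integral_sq_inner_sum_le (u v : I → Z → ℝ) (hu : ∀ m, Measurable (u m))
    (hv : ∀ m, Measurable (v m)) (hub : ∀ m, MemLp (u m) ⊤ P) (hvb : ∀ m, MemLp (v m) ⊤ P)
    (hu0 : ∀ m, ∫ z, u m z ∂P = 0) (hv0 : ∀ m, ∫ z, v m z ∂P = 0) {R : ℝ} (hR0 : 0 ≤ R)
    (huR : ∀ᵐ z ∂P, ∑ m, u m z ^ 2 ≤ R) (hvR : ∀ᵐ z ∂P, ∑ m, v m z ^ 2 ≤ R) :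
    ∫ ω : J → Z, (∑ m, (∑ i, u m (ω i)) * ∑ i, v m (ω i)) ^ 2 ∂(Measure.pi fun _ => P)
      ≤ 4 * (Fintype.card J : ℝ) ^ 2 * R ^ 2 := by
  set μ : Measure (J → Z) := Measure.pi fun _ => P with hμ
  have hS : ∀ m, MemLp (fun ω : J → Z => ∑ i, u m (ω i)) ⊤ μ := fun m =>
    memLp_finsetSum _ fun i _ => memLp_eval (hub m) i
  have hT : ∀ m, MemLp (fun ω : J → Z => ∑ i, v m (ω i)) ⊤ μ := fun m =>
    memLp_finsetSum _ fun i _ => memLp_eval (hvb m) i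
  have h1 := (integral_normSq_sum (J := J) u hu hub hu0 hR0 huR Finset.univ).2
  have h2 := (integral_normSq_sum (J := J) v hv hvb hv0 hR0 hvR Finset.univ).2
  rw [Finset.card_univ] at h1 h2
  have hqS : MemLp (fun ω : J → Z => ∑ m, (∑ i, u m (ω i)) ^ 2) ⊤ μ :=
    memLp_finsetSum _ fun m _ => (hS m).sq_top
  have hqT : MemLp (fun ω : J → Z => ∑ m, (∑ i, v m (ω i)) ^ 2) ⊤ μ :=
    memLp_finsetSum _ fun m _ => (hT m).sq_top
  have hST : MemLp (fun ω : J → Z => ∑ m, (∑ i, u m (ω i)) * ∑ i, v m (ω i)) ⊤ μ :=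
    memLp_finsetSum _ fun m _ => (hS m).mul_top (hT m)
  have i1 := (hqS.sq_top.integrable le_top).const_mul (1 / 2)
  have i2 := (hqT.sq_top.integrable le_top).const_mul (1 / 2)
  calc _ ≤ ∫ ω : J → Z, 1 / 2 * (∑ m, (∑ i, u m (ω i)) ^ 2) ^ 2
        + 1 / 2 * (∑ m, (∑ i, v m (ω i)) ^ 2) ^ 2 ∂μ := by
        refine integral_mono (hST.sq_top.integrable le_top) (i1.add i2) fun ω => ?_
        have := Finset.sum_mul_sq_le_sq_mul_sq Finset.univ (fun m => ∑ i, u m (ω i))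
          (fun m => ∑ i, v m (ω i))
        refine this.trans ?_
        nlinarith [sq_nonneg (∑ m, (∑ i, u m (ω i)) ^ 2 - ∑ m, (∑ i, v m (ω i)) ^ 2)]
    _ ≤ _ := by
        rw [integral_add i1 i2, integral_const_mul, integral_const_mul]
        linarith

theorem ENNReal.sq_add_le (x y : ℝ≥0∞) : (x + y) ^ 2 ≤ 4 * (x ^ 2 + y ^ 2) := by
  rcases le_total x y with h | h
  · calc (x + y) ^ 2 ≤ (y + y) ^ 2 := by gcongr
      _ = 4 * y ^ 2 := by ring
      _ ≤ _ := by gcongr; exact le_add_self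
  · calc (x + y) ^ 2 ≤ (x + x) ^ 2 := by gcongr
      _ = 4 * x ^ 2 := by ring
      _ ≤ _ := by gcongr; exact le_self_add

theorem lintegral_pair_le {U : Z → ℝ≥0∞} (hU : Measurable U) {a₁ a₂ : ℝ≥0∞}
    (h₁ : ∫⁻ z, U z ∂P ≤ a₁) (h₂ : ∫⁻ z, U z ^ 2 ∂P ≤ a₂) (i i' : J) [Decidable (i = i')] :
    ∫⁻ ω : J → Z, U (ω i) * U (ω i') ∂(Measure.pi fun _ => P)
      ≤ (if i = i' then a₂ else 0) + a₁ ^ 2 := by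
  split_ifs with h
  · subst h
    refine le_trans ?_ le_self_add
    simp_rw [← sq]
    rw [lintegral_eval (hU.pow_const 2)]
    exact h₂
  · rw [zero_add]
    have hi := ((iIndepFun_eval (P := P)).indepFun h).comp hU hU
    have := lintegral_mul_eq_lintegral_mul_lintegral_of_indepFun''
      (hU.comp (measurable_pi_apply i)).aemeasurable
      (hU.comp (measurable_pi_apply i')).aemeasurable hi
    simp only [Function.comp_apply] at this
    rw [this, lintegral_eval hU, lintegral_eval hU, sq]
    gcongr

theorem sum_ite_add_const (a b : ℝ≥0∞) [DecidableEq J] :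
    ∑ i : J, ∑ i' : J, ((if i = i' then a else 0) + b)
      = Fintype.card J * a + (Fintype.card J : ℝ≥0∞) ^ 2 * b := by
  simp [Finset.sum_add_distrib]
  ring

theorem lintegral_sq_sum_le {U : Z → ℝ≥0∞} (hU : Measurable U) {a₁ a₂ : ℝ≥0∞}
    (h₁ : ∫⁻ z, U z ∂P ≤ a₁) (h₂ : ∫⁻ z, U z ^ 2 ∂P ≤ a₂) :
    ∫⁻ ω : J → Z, (∑ i, U (ω i)) ^ 2 ∂(Measure.pi fun _ => P)
      ≤ Fintype.card J * a₂ + (Fintype.card J : ℝ≥0∞) ^ 2 * a₁ ^ 2 := by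
  classical
  have hm : ∀ i i' : J, Measurable fun ω : J → Z => U (ω i) * U (ω i') := fun i i' =>
    (hU.comp (measurable_pi_apply i)).mul (hU.comp (measurable_pi_apply i'))
  simp_rw [sq (∑ i, _), Finset.sum_mul_sum]
  rw [lintegral_finsetSum _ fun i _ => Finset.measurable_fun_sum _ fun i' _ => hm i i']
  rw [← sum_ite_add_const]
  refine Finset.sum_le_sum fun i _ => ?_
  rw [lintegral_finsetSum _ fun i' _ => hm i i']
  exact Finset.sum_le_sum fun i' _ => lintegral_pair_le hU h₁ h₂ i i'

/-- A mixed fourth moment of two sums of independent nonnegative variables, one of which has bounded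
summands: leaving out the indices of the two factors of the other sum costs at most `2 * b`. -/
theorem lintegral_sq_sum_mul_sq_sum_le {U V : Z → ℝ≥0∞} (hU : Measurable U) (hV : Measurable V)
    {a₁ a₂ v₁ v₂ b : ℝ≥0∞}
    (h₁ : ∫⁻ z, U z ∂P ≤ a₁) (h₂ : ∫⁻ z, U z ^ 2 ∂P ≤ a₂)
    (hv₁ : ∫⁻ z, V z ∂P ≤ v₁) (hv₂ : ∫⁻ z, V z ^ 2 ∂P ≤ v₂) (hb : ∀ z, V z ≤ b) :
    ∫⁻ ω : J → Z, (∑ i, U (ω i)) ^ 2 * (∑ i, V (ω i)) ^ 2 ∂(Measure.pi fun _ => P)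
      ≤ (Fintype.card J * a₂ + (Fintype.card J : ℝ≥0∞) ^ 2 * a₁ ^ 2) *
        (4 * ((2 * b) ^ 2 + (Fintype.card J * v₂ + (Fintype.card J : ℝ≥0∞) ^ 2 * v₁ ^ 2))) := by
  classical
  have hUi : ∀ i : J, Measurable fun ω : J → Z => U (ω i) := fun i =>
    hU.comp (measurable_pi_apply i)
  have hVi : ∀ i : J, Measurable fun ω : J → Z => V (ω i) := fun i =>
    hV.comp (measurable_pi_apply i)
  have hVs : Measurable fun ω : J → Z => (∑ i, V (ω i)) ^ 2 :=
    (Finset.measurable_fun_sum _ fun i _ => hVi i).pow_const 2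
  have hm : ∀ i i' : J, Measurable fun ω : J → Z => U (ω i) * U (ω i') * (∑ j, V (ω j)) ^ 2 :=
    fun i i' => ((hUi i).mul (hUi i')).mul hVs
  simp_rw [sq (∑ i, U _), Finset.sum_mul_sum, Finset.sum_mul]
  rw [lintegral_finsetSum _ fun i _ => Finset.measurable_fun_sum _ fun i' _ => hm i i']
  rw [← sum_ite_add_const, Finset.sum_mul]
  refine Finset.sum_le_sum fun i _ => ?_
  rw [lintegral_finsetSum _ fun i' _ => hm i i', Finset.sum_mul]
  refine Finset.sum_le_sum fun i' _ => ?_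
  -- on the complement of `{i, i'}` the second sum is independent of the two factors `U`
  set T : Finset J := {i, i'} with hT
  have hrest : Measurable fun ω : J → Z => (∑ j ∈ Tᶜ, V (ω j)) ^ 2 :=
    (Finset.measurable_fun_sum _ fun i _ => hVi i).pow_const 2
  have hle : ∀ ω : J → Z, (∑ j, V (ω j)) ^ 2 ≤ 4 * ((2 * b) ^ 2 + (∑ j ∈ Tᶜ, V (ω j)) ^ 2) := by
    intro ω
    refine le_trans ?_ (ENNReal.sq_add_le _ _)
    gcongr
    rw [← Finset.sum_add_sum_compl T]
    gcongr
    refine (Finset.sum_le_card_nsmul T _ b fun j _ => hb _).trans ?_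
    rw [nsmul_eq_mul]
    gcongr
    exact_mod_cast Finset.card_le_two
  have hind : IndepFun (fun ω : J → Z => U (ω i) * U (ω i'))
      (fun ω : J → Z => (∑ j ∈ Tᶜ, V (ω j)) ^ 2) (Measure.pi fun _ => P) := by
    have h := (iIndepFun_eval (J := J) (P := P)).indepFun_finset T Tᶜ disjoint_compl_right
      (fun i => measurable_pi_apply i)
    have hi : i ∈ T := by simp [hT]
    have hi' : i' ∈ T := by simp [hT]
    have := h.comp (φ := fun w : T → Z => U (w ⟨i, hi⟩) * U (w ⟨i', hi'⟩))
      (ψ := fun w : (Tᶜ : Finset J) → Z => (∑ j, V (w j)) ^ 2)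
      ((hU.comp (measurable_pi_apply _)).mul (hU.comp (measurable_pi_apply _)))
      ((Finset.measurable_fun_sum _ fun j _ => hV.comp (measurable_pi_apply j)).pow_const 2)
    have e : ∀ ω : J → Z, ∑ j ∈ Tᶜ, V (ω j) = ∑ j : (Tᶜ : Finset J), V (ω j) := fun ω =>
      (Finset.sum_coe_sort (Tᶜ) (fun j => V (ω j))).symm
    simp_rw [e]
    exact this
  calc _ ≤ ∫⁻ ω : J → Z, U (ω i) * U (ω i') * (4 * (2 * b) ^ 2)
          + 4 * (U (ω i) * U (ω i') * (∑ j ∈ Tᶜ, V (ω j)) ^ 2) ∂(Measure.pi fun _ => P) := by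
        refine lintegral_mono fun ω => ?_
        refine (mul_le_mul_right (hle ω) _).trans (le_of_eq ?_)
        ring
    _ = (∫⁻ ω : J → Z, U (ω i) * U (ω i') ∂(Measure.pi fun _ => P)) *
          (4 * ((2 * b) ^ 2 + ∫⁻ ω : J → Z, (∑ j ∈ Tᶜ, V (ω j)) ^ 2 ∂(Measure.pi fun _ => P))) := by
        have hUU : Measurable fun ω : J → Z => U (ω i) * U (ω i') := (hUi i).mul (hUi i')
        have hUUr : Measurable fun ω : J → Z => U (ω i) * U (ω i') * (∑ j ∈ Tᶜ, V (ω j)) ^ 2 :=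
          hUU.mul hrest
        rw [lintegral_add_left (hUU.mul_const _), lintegral_mul_const _ hUU,
          lintegral_const_mul _ hUUr,
          lintegral_mul_eq_lintegral_mul_lintegral_of_indepFun''
            hUU.aemeasurable hrest.aemeasurable hind]
        ring
    _ ≤ _ := by
        gcongr
        · exact lintegral_pair_le hU h₁ h₂ i i'
        · refine le_trans (lintegral_mono fun ω => ?_) (lintegral_sq_sum_le hV hv₁ hv₂)
          gcongr
          exact Finset.subset_univ _

end Moments

/-! ### Laws with given regression functions -/

theorem measurable_obsX {d : ℕ} : Measurable (obsX (d := d)) := measurable_fst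

theorem measurable_obsA {d : ℕ} : Measurable (obsA (d := d)) := measurable_fst.comp measurable_snd

theorem measurable_obsY {d : ℕ} : Measurable (obsY (d := d)) := measurable_snd.comp measurable_snd

/-- The variable `f` is essentially bounded by `C`, and `r` is its regression function on the
covariate `X`, which is uniformly distributed on the cube. -/
structure IsRegression {d : ℕ} (P : Measure (Obs d)) (C : ℝ) (f : Obs d → ℝ)
    (r : (Fin d → ℝ) → ℝ) : Prop where
  measurable : Measurable f
  bound : ∀ᵐ o ∂P, |f o| ≤ C
  memLp : MemLp r ⊤ (cubeVol d)
  integral_mul : ∀ g, MemLp g ⊤ (cubeVol d) →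
    ∫ o, f o * g (obsX o) ∂P = ∫ x, r x * g x ∂cubeVol d

/-- What the risk bounds use about a law of `(X, A, Y)`. -/
structure IsRegressionLaw {d : ℕ} (P : Measure (Obs d)) (C : ℝ) (p b : (Fin d → ℝ) → ℝ) :
    Prop where
  isProb : IsProbabilityMeasure P
  mp : MeasurePreserving obsX P (cubeVol d)
  regA : IsRegression P C obsA p
  regY : IsRegression P C obsY b
  psi_eq : psi P = ∫ o, obsA o * obsY o ∂P - ∫ x, p x * b x ∂cubeVol d

section Regression

variable {d : ℕ} {P : Measure (Obs d)} {C : ℝ}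

theorem IsRegression.memLp_var {f : Obs d → ℝ} {r : (Fin d → ℝ) → ℝ} (h : IsRegression P C f r) :
    MemLp f ⊤ P :=
  memLp_top_of_bound h.measurable.aestronglyMeasurable C
    (by simpa only [Real.norm_eq_abs] using h.bound)

variable [IsProbabilityMeasure P]

/-- Regression contracts the `L²` norm. -/
theorem IsRegression.integral_sq_le (hX : MeasurePreserving obsX P (cubeVol d)) {f : Obs d → ℝ}
    {r : (Fin d → ℝ) → ℝ} (h : IsRegression P C f r) : ∫ x, r x * r x ∂cubeVol d ≤ C ^ 2 := by
  have h1 := h.integral_mul r h.memLp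
  have hrX : MemLp (fun o => r (obsX o)) ⊤ P := h.memLp.comp_measurePreserving hX
  have h2 : ∫ o, r (obsX o) * r (obsX o) ∂P = ∫ x, r x * r x ∂cubeVol d := by
    have hm : AEStronglyMeasurable (fun x => r x * r x) (P.map obsX) := by
      rw [hX.map_eq]; exact h.memLp.1.mul h.memLp.1
    rw [← integral_map measurable_obsX.aemeasurable hm, hX.map_eq]
  have i1 := hrX.integrable_mul_top hrX
  have i2 : Integrable (fun _ : Obs d => 1 / 2 * C ^ 2) P := integrable_const _
  have h3 : ∫ o, f o * r (obsX o) ∂P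
      ≤ ∫ o, 1 / 2 * C ^ 2 + 1 / 2 * (r (obsX o) * r (obsX o)) ∂P := by
    refine integral_mono_ae (h.memLp_var.integrable_mul_top hrX)
      (i2.add (i1.const_mul _)) ?_
    filter_upwards [h.bound] with o ho
    have := sq_le_sq.2 (ho.trans (le_abs_self C))
    nlinarith [sq_nonneg (f o - r (obsX o))]
  rw [integral_add i2 (i1.const_mul _)] at h3
  simp only [integral_const_mul, h2, h1, integral_const, probReal_univ, smul_eq_mul,
    one_mul] at h3
  linarith

theorem integral_mul_of_condExp {f : Obs d → ℝ} (hf : MemLp f ⊤ P)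
    (hX : MeasurePreserving obsX P (cubeVol d)) {r g : (Fin d → ℝ) → ℝ}
    (hr : MemLp r ⊤ (cubeVol d)) (hrf : (fun o => r (obsX o)) =ᵐ[P] P[f | sigmaX d])
    (hg : MemLp g ⊤ (cubeVol d)) :
    ∫ o, f o * g (obsX o) ∂P = ∫ x, r x * g x ∂cubeVol d := by
  obtain ⟨g', hg'm, hg'⟩ : ∃ g', Measurable g' ∧ g =ᵐ[cubeVol d] g' :=
    ⟨hg.1.mk g, hg.1.stronglyMeasurable_mk.measurable, hg.1.ae_eq_mk⟩
  have hg't : MemLp g' ⊤ (cubeVol d) := (memLp_congr_ae hg').1 hg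
  have hgX : (fun o => g (obsX o)) =ᵐ[P] fun o => g' (obsX o) :=
    hX.quasiMeasurePreserving.ae_eq_comp hg'
  have hm : sigmaX d ≤ (inferInstance : MeasurableSpace (Obs d)) := measurable_obsX.comap_le
  have hsm : StronglyMeasurable[sigmaX d] fun o => g' (obsX o) :=
    (hg'm.comp (comap_measurable obsX)).stronglyMeasurable
  have hgX' : MemLp (fun o => g' (obsX o)) ⊤ P := hg't.comp_measurePreserving hX
  have h1 : P[(fun o => f o * g' (obsX o)) | sigmaX d]
      =ᵐ[P] fun o => (P[f | sigmaX d]) o * g' (obsX o) :=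
    condExp_mul_of_stronglyMeasurable_right hsm (hf.integrable_mul_top hgX')
      (hf.integrable le_top)
  calc ∫ o, f o * g (obsX o) ∂P = ∫ o, f o * g' (obsX o) ∂P :=
        integral_congr_ae (by filter_upwards [hgX] with o ho; rw [ho])
    _ = ∫ o, (P[(fun o => f o * g' (obsX o)) | sigmaX d]) o ∂P := (integral_condExp hm).symm
    _ = ∫ o, r (obsX o) * g' (obsX o) ∂P :=
        integral_congr_ae (by filter_upwards [h1, hrf] with o h1 h2; rw [h1, ← h2])
    _ = ∫ x, r x * g' x ∂cubeVol d := by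
        have hm : AEStronglyMeasurable (fun x => r x * g' x) (P.map obsX) := by
          rw [hX.map_eq]; exact hr.1.mul hg't.1
        rw [← integral_map measurable_obsX.aemeasurable hm, hX.map_eq]
    _ = ∫ x, r x * g x ∂cubeVol d :=
        integral_congr_ae (by filter_upwards [hg'] with o ho; rw [ho])

end Regression

theorem isRegressionLaw_of_condExp {d : ℕ} {P : Measure (Obs d)} [IsProbabilityMeasure P] {C : ℝ}
    (hX : P.map obsX = volume.restrict (cube d)) (hA : ∀ᵐ o ∂P, |obsA o| ≤ C)
    (hY : ∀ᵐ o ∂P, |obsY o| ≤ C) {p b : (Fin d → ℝ) → ℝ}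
    (hp : MemLp p ⊤ (cubeVol d)) (hb : MemLp b ⊤ (cubeVol d))
    (hpA : (fun o => p (obsX o)) =ᵐ[P] P[obsA | sigmaX d])
    (hbY : (fun o => b (obsX o)) =ᵐ[P] P[obsY | sigmaX d]) : IsRegressionLaw P C p b := by
  have hmp : MeasurePreserving obsX P (cubeVol d) :=
    ⟨measurable_obsX, by rw [hX, restrict_cube_eq]⟩
  have hAm : MemLp (obsA (d := d)) ⊤ P := memLp_top_of_bound
    measurable_obsA.aestronglyMeasurable C (by simpa only [Real.norm_eq_abs] using hA)
  have hYm : MemLp (obsY (d := d)) ⊤ P := memLp_top_of_bound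
    measurable_obsY.aestronglyMeasurable C (by simpa only [Real.norm_eq_abs] using hY)
  have rA : IsRegression P C obsA p :=
    ⟨measurable_obsA, hA, hp, fun g hg => integral_mul_of_condExp hAm hmp hp hpA hg⟩
  have rY : IsRegression P C obsY b :=
    ⟨measurable_obsY, hY, hb, fun g hg => integral_mul_of_condExp hYm hmp hb hbY hg⟩
  refine ⟨inferInstance, hmp, rA, rY, ?_⟩
  have hm : sigmaX d ≤ (inferInstance : MeasurableSpace (Obs d)) := measurable_obsX.comap_le
  have hpX : MemLp (fun o => p (obsX o)) ⊤ P := hp.comp_measurePreserving hmp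
  have hbX : MemLp (fun o => b (obsX o)) ⊤ P := hb.comp_measurePreserving hmp
  have i1 := hAm.integrable_mul_top hYm
  have i2 := hAm.integrable_mul_top hbX
  have i3 := hYm.integrable_mul_top hpX
  have i4 := hpX.integrable_mul_top hbX
  have e4 : ∫ o, p (obsX o) * b (obsX o) ∂P = ∫ x, p x * b x ∂cubeVol d := by
    have hm : AEStronglyMeasurable (fun x => p x * b x) (P.map obsX) := by
      rw [hmp.map_eq]; exact hp.1.mul hb.1
    rw [← integral_map measurable_obsX.aemeasurable hm, hmp.map_eq]
  have i12 : Integrable (fun o => obsA o * obsY o - obsA o * b (obsX o)) P := i1.sub i2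
  have i34 : Integrable (fun o => obsY o * p (obsX o) - p (obsX o) * b (obsX o)) P := i3.sub i4
  unfold psi condCovAY
  rw [integral_condExp hm]
  calc _ = ∫ o, (obsA o * obsY o - obsA o * b (obsX o))
        - (obsY o * p (obsX o) - p (obsX o) * b (obsX o)) ∂P := by
        refine integral_congr_ae ?_
        filter_upwards [hpA, hbY] with o h1 h2
        simp only [Pi.mul_apply, Pi.sub_apply]
        rw [← h1, ← h2]; ring
    _ = _ := by
        rw [integral_sub i12 i34, integral_sub i1 i2, integral_sub i3 i4, e4,
          rA.integral_mul b hb, rY.integral_mul p hp]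
        simp_rw [mul_comm (b _)]
        ring

theorem CDVBasis.exists_isRegressionLaw {S : ℕ} (B : CDVBasis S) {d : ℕ} {α β M C₁ C₂ : ℝ}
    {P : Measure (Obs d)} (hP : P ∈ B.model d α β M C₁ C₂) :
    ∃ p ∈ B.holderBall d α M, ∃ b ∈ B.holderBall d β M,
      IsRegressionLaw P (max |C₁| |C₂|) p b := by
  obtain ⟨hprob, hX, hAY, ⟨p, hp, hpA⟩, ⟨b, hb, hbY⟩⟩ := hP
  refine ⟨p, hp, b, hb, isRegressionLaw_of_condExp hX ?_ ?_ hp.1.memLp_cubeVol hb.1.memLp_cubeVol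
    hpA hbY⟩
  · filter_upwards [hAY] with o ho using abs_le_max_abs_abs ho.1.1 ho.1.2
  · filter_upwards [hAY] with o ho using abs_le_max_abs_abs ho.2.1 ho.2.2

/-! ### Empirical wavelet coefficients -/

namespace CDVBasis

variable {S : ℕ} (B : CDVBasis S) {d n : ℕ}

/-- The empirical scaling coefficients of the regression function of the variable `f`. -/
noncomputable def empCoef (f : Obs d → ℝ) (j : ℕ) (D : Fin n → Obs d) (m : Fin d → Fin (2 ^ j)) :
    ℝ :=
  (1 / n : ℝ) * ∑ i, f (D i) * B.Phi j m (obsX (D i))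

/-- The projection estimator of the regression function of the variable `f`. -/
noncomputable def regHat (f : Obs d → ℝ) (j : ℕ) (D : Fin n → Obs d) (x : Fin d → ℝ) : ℝ :=
  (1 / n : ℝ) * ∑ i, f (D i) * B.projKernel j (obsX (D i)) x

theorem pHat_eq (j : ℕ) (D : Fin n → Obs d) : B.pHat j D = B.regHat obsA j D := rfl

theorem bHat_eq (j : ℕ) (D : Fin n → Obs d) : B.bHat j D = B.regHat obsY j D := rfl

theorem regHat_eq (f : Obs d → ℝ) (j : ℕ) (D : Fin n → Obs d) (x : Fin d → ℝ) :
    B.regHat f j D x = ∑ m, B.empCoef f j D m * B.Phi j m x := by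
  unfold regHat empCoef projKernel
  simp_rw [Finset.mul_sum, Finset.sum_mul]
  rw [Finset.sum_comm]
  exact Finset.sum_congr rfl fun m _ => Finset.sum_congr rfl fun i _ => by ring

theorem memLp_regHat (f : Obs d → ℝ) (j : ℕ) (D : Fin n → Obs d) :
    MemLp (B.regHat f j D) ⊤ (cubeVol d) := by
  have : B.regHat f j D = fun x => ∑ m, B.empCoef f j D m * B.Phi j m x :=
    funext (B.regHat_eq f j D)
  rw [this]
  exact memLp_finsetSum _ fun m _ => (B.memLp_Phi j m).const_mul _

theorem measurable_empCoef {f : Obs d → ℝ} (hf : Measurable f) (j : ℕ)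
    (m : Fin d → Fin (2 ^ j)) : Measurable fun D : Fin n → Obs d => B.empCoef f j D m :=
  (Finset.measurable_fun_sum _ fun i _ => (hf.comp (measurable_pi_apply i)).mul
    ((B.measurable_Phi j m).comp (measurable_obsX.comp (measurable_pi_apply i)))).const_mul _

theorem measurable_regHat {f : Obs d → ℝ} (hf : Measurable f) (j : ℕ) :
    Measurable fun z : (Fin n → Obs d) × (Fin d → ℝ) => B.regHat f j z.1 z.2 := by
  simp_rw [B.regHat_eq]
  exact Finset.measurable_fun_sum _ fun m _ =>
    ((B.measurable_empCoef hf j m).comp measurable_fst).mul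
      ((B.measurable_Phi j m).comp measurable_snd)

theorem integral_mul_regHat {g : (Fin d → ℝ) → ℝ} (hg : MemLp g ⊤ (cubeVol d)) (f : Obs d → ℝ)
    (j : ℕ) (D : Fin n → Obs d) :
    ∫ x, g x * B.regHat f j D x ∂cubeVol d = ∑ m, innerC g (B.Phi j m) * B.empCoef f j D m := by
  simp_rw [B.regHat_eq, Finset.mul_sum]
  rw [integral_finsetSum _ fun m _ => hg.integrable_mul_top ((B.memLp_Phi j m).const_mul _)]
  refine Finset.sum_congr rfl fun m _ => ?_
  rw [innerC_eq, ← integral_mul_const]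
  exact integral_congr_ae (Filter.Eventually.of_forall fun x => by ring)

variable {P : Measure (Obs d)} [IsProbabilityMeasure P]

/-- Since the spaces `V_j` are nested, the scaling coefficients of level `j` of the estimator of
level `j' ≥ j` are the empirical ones. -/
theorem integral_Phi_mul_regHat (hX : MeasurePreserving obsX P (cubeVol d)) {j j' : ℕ}
    (hj : B.J₀ ≤ j) (hjj' : j ≤ j') (f : Obs d → ℝ) :
    ∀ᵐ D ∂(Measure.pi fun _ : Fin n => P), ∀ m,
      ∫ x, B.Phi j m x * B.regHat f j' D x ∂cubeVol d = B.empCoef f j D m := by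
  obtain ⟨c, hc⟩ := B.exists_Phi_nested (d := d) hj hjj'
  have hcoef : ∀ m m', innerC (B.Phi j m) (B.Phi j' m') = c m m' := by
    intro m m'
    rw [innerC_eq]
    simp_rw [mul_comm (B.Phi j m _)]
    rw [← innerC_eq, innerC_sum_right (B.memLp_Phi j' m') (fun i => B.memLp_Phi j' i) (c m)
      (hc.mono fun x hx => hx m)]
    simp_rw [innerC_eq, B.integral_Phi_mul_Phi (hj.trans hjj')]
    simp
  have hcX : ∀ᵐ o ∂P, ∀ m, B.Phi j m (obsX o) = ∑ m', c m m' * B.Phi j' m' (obsX o) :=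
    hX.quasiMeasurePreserving.ae hc
  filter_upwards [ae_eval (J := Fin n) hcX] with D hD m
  rw [B.integral_mul_regHat (B.memLp_Phi j m)]
  simp_rw [hcoef]
  unfold empCoef
  simp_rw [hD _ m, Finset.mul_sum]
  rw [Finset.sum_comm]
  exact Finset.sum_congr rfl fun m _ => Finset.sum_congr rfl fun i _ => by ring

theorem integral_regHat_mul_regHat (hX : MeasurePreserving obsX P (cubeVol d)) {j₁ j₂ : ℕ}
    (h₁ : B.J₀ ≤ j₁) (h₂ : B.J₀ ≤ j₂) (f g : Obs d → ℝ) :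
    ∀ᵐ D ∂(Measure.pi fun _ : Fin n => P),
      ∫ x, B.regHat f j₁ D x * B.regHat g j₂ D x ∂cubeVol d
        = ∑ m, B.empCoef f (min j₁ j₂) D m * B.empCoef g (min j₁ j₂) D m := by
  have key : ∀ (f g : Obs d → ℝ) (j j' : ℕ), B.J₀ ≤ j → j ≤ j' →
      ∀ᵐ D ∂(Measure.pi fun _ : Fin n => P),
        ∫ x, B.regHat f j D x * B.regHat g j' D x ∂cubeVol d
          = ∑ m, B.empCoef f j D m * B.empCoef g j D m := by
    intro f g j j' hj hjj'
    filter_upwards [B.integral_Phi_mul_regHat hX hj hjj' g] with D hD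
    have : ∀ x, B.regHat f j D x * B.regHat g j' D x
        = ∑ m, B.empCoef f j D m * (B.Phi j m x * B.regHat g j' D x) := by
      intro x
      rw [B.regHat_eq f, Finset.sum_mul]
      exact Finset.sum_congr rfl fun m _ => by ring
    simp_rw [this]
    rw [integral_finsetSum _ fun m _ =>
      ((B.memLp_Phi j m).integrable_mul_top (B.memLp_regHat g j' D)).const_mul _]
    exact Finset.sum_congr rfl fun m _ => by rw [integral_const_mul, hD m]
  rcases le_total j₁ j₂ with h | h
  · rw [min_eq_left h]; exact key f g j₁ j₂ h₁ h
  · rw [min_eq_right h]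
    filter_upwards [key g f j₂ j₁ h₂ h] with D hD
    simp_rw [mul_comm (B.regHat f j₁ D _), hD, mul_comm]

end CDVBasis

/-! ### Mean squared errors of the components of the estimators -/

theorem lintegral_ofReal_sq_eq {Ω : Type*} {mΩ : MeasurableSpace Ω} {μ : Measure Ω}
    [IsFiniteMeasure μ] {F : Ω → ℝ} (hF : MemLp F ⊤ μ) :
    ∫⁻ ω, ENNReal.ofReal (F ω ^ 2) ∂μ = ENNReal.ofReal (∫ ω, F ω ^ 2 ∂μ) :=
  (ofReal_integral_eq_lintegral_ofReal (hF.sq_top.integrable le_top)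
    (Filter.Eventually.of_forall fun _ => sq_nonneg _)).symm

theorem lintegral_ofReal_sq_sum_le {Ω ι : Type*} [Fintype ι] {mΩ : MeasurableSpace Ω}
    {μ : Measure Ω} [IsFiniteMeasure μ] {F : ι → Ω → ℝ} {c : ι → ℝ} {H : Ω → ℝ}
    (hF : ∀ i, MemLp (F i) ⊤ μ) (hc : ∀ i, ∫ ω, F i ω ^ 2 ∂μ ≤ c i)
    (hH : ∀ᵐ ω ∂μ, H ω = ∑ i, F i ω) :
    ∫⁻ ω, ENNReal.ofReal (H ω ^ 2) ∂μ ≤ ENNReal.ofReal (Fintype.card ι * ∑ i, c i) := by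
  have hm : MemLp (fun ω => ∑ i, F i ω) ⊤ μ := memLp_finsetSum _ fun i _ => hF i
  rw [lintegral_congr_ae (g := fun ω => ENNReal.ofReal ((∑ i, F i ω) ^ 2))
    (hH.mono fun ω h => by simp only [h]), lintegral_ofReal_sq_eq hm]
  refine ENNReal.ofReal_le_ofReal ?_
  have hi : ∀ i ∈ Finset.univ, Integrable (fun ω => F i ω ^ 2) μ := fun i _ =>
    (hF i).sq_top.integrable le_top
  calc ∫ ω, (∑ i, F i ω) ^ 2 ∂μ ≤ ∫ ω, Fintype.card ι * ∑ i, F i ω ^ 2 ∂μ := by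
        refine integral_mono (hm.sq_top.integrable le_top)
          ((integrable_finsetSum _ hi).const_mul _) fun ω => ?_
        exact sq_sum_le_card_mul_sum_sq
    _ ≤ _ := by
        rw [integral_const_mul, integral_finsetSum _ hi]
        gcongr with i
        exact hc i

/-- The mean square error of an empirical mean. -/
theorem integral_sq_mean_sub_le {Z : Type*} [MeasurableSpace Z] {P : Measure Z}
    [IsProbabilityMeasure P] {n : ℕ} (hn : 0 < n) {φ : Z → ℝ} (hφ : Measurable φ)
    (hb : MemLp φ ⊤ P) :
    ∫ D : Fin n → Z, ((1 / n : ℝ) * ∑ i, φ (D i) - ∫ z, φ z ∂P) ^ 2 ∂(Measure.pi fun _ => P)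
      ≤ (1 / n : ℝ) * ∫ z, φ z ^ 2 ∂P := by
  have hn' : (n : ℝ) ≠ 0 := by positivity
  set c := ∫ z, φ z ∂P with hc
  have hi := hb.integrable (μ := P) le_top
  have h0 : ∫ z, (φ z - c) ∂P = 0 := by
    rw [integral_sub hi (integrable_const _)]; simp [hc]
  have h1 := integral_sq_sum (J := Fin n) (g := fun z => φ z - c) (hφ.sub_const c)
    (hb.sub (memLp_const c)) h0
  have h2 : ∀ D : Fin n → Z, ((1 / n : ℝ) * ∑ i, φ (D i) - c) ^ 2
      = (1 / n : ℝ) ^ 2 * (∑ i, (φ (D i) - c)) ^ 2 := by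
    intro D
    rw [Finset.sum_sub_distrib, ← mul_pow]
    simp only [Finset.sum_const, Finset.card_univ, Fintype.card_fin, nsmul_eq_mul]
    congr 1
    field_simp
  simp_rw [h2]
  rw [integral_const_mul, h1, Fintype.card_fin]
  have h3 : ∫ z, (φ z - c) ^ 2 ∂P ≤ ∫ z, φ z ^ 2 ∂P := by
    have e : ∀ z, (φ z - c) ^ 2 = φ z ^ 2 - 2 * c * φ z + c ^ 2 := fun z => by ring
    simp_rw [e]
    have i1 := (hb.sq_top.integrable (μ := P) le_top)
    have i2 : Integrable (fun z => φ z ^ 2 - 2 * c * φ z) P := i1.sub (hi.const_mul _)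
    rw [integral_add i2 (integrable_const _), integral_sub i1 (hi.const_mul _), integral_const_mul,
      ← hc]
    simp only [integral_const, probReal_univ, smul_eq_mul, one_mul]
    nlinarith [sq_nonneg c]
  calc (1 / n : ℝ) ^ 2 * (n * ∫ z, (φ z - c) ^ 2 ∂P) = (1 / n : ℝ) * ∫ z, (φ z - c) ^ 2 ∂P := by
        field_simp
    _ ≤ _ := by gcongr

/-- An empirical mean, over a second sample, of a function depending on a first sample. -/
theorem lintegral_sq_mean_sub_le {Ω Z : Type*} [MeasurableSpace Ω] [MeasurableSpace Z]
    {ν : Measure Ω} {P : Measure Z} [SFinite ν] [IsProbabilityMeasure P] {n : ℕ} (hn : 0 < n)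
    {φ : Ω → Z → ℝ} (hφ : Measurable fun w : Ω × Z => φ w.1 w.2) (hb : ∀ D, MemLp (φ D) ⊤ P) :
    ∫⁻ w : Ω × (Fin n → Z), ENNReal.ofReal
        (((1 / n : ℝ) * ∑ i, φ w.1 (w.2 i) - ∫ z, φ w.1 z ∂P) ^ 2)
        ∂(ν.prod (Measure.pi fun _ => P))
      ≤ ENNReal.ofReal (1 / n) * ∫⁻ D, ∫⁻ z, ENNReal.ofReal (φ D z ^ 2) ∂P ∂ν := by
  have hm1 : Measurable fun w : Ω × (Fin n → Z) => ∫ z, φ w.1 z ∂P :=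
    (hφ.stronglyMeasurable.integral_prod_right (ν := P)).measurable.comp measurable_fst
  have hm2 : Measurable fun w : Ω × (Fin n → Z) => ∑ i, φ w.1 (w.2 i) :=
    Finset.measurable_fun_sum _ fun i _ => hφ.comp
      (measurable_fst.prodMk ((measurable_pi_apply i).comp measurable_snd))
  have hm3 : Measurable fun w : Ω × (Fin n → Z) => ENNReal.ofReal
      (((1 / n : ℝ) * ∑ i, φ w.1 (w.2 i) - ∫ z, φ w.1 z ∂P) ^ 2) :=
    (((hm2.const_mul _).sub hm1).pow_const 2).ennreal_ofReal
  rw [lintegral_prod _ hm3.aemeasurable,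
    ← lintegral_const_mul' _ _ ENNReal.ofReal_ne_top]
  refine lintegral_mono fun D => ?_
  have hφD : Measurable (φ D) := hφ.comp (measurable_const.prodMk measurable_id)
  have hmem : MemLp (fun ω : Fin n → Z => (1 / n : ℝ) * ∑ i, φ D (ω i) - ∫ z, φ D z ∂P) ⊤
      (Measure.pi fun _ => P) :=
    ((memLp_finsetSum _ fun i _ => memLp_eval (hb D) i).const_mul _).sub (memLp_const _)
  simp only
  rw [lintegral_ofReal_sq_eq hmem, lintegral_ofReal_sq_eq (hb D),
    ← ENNReal.ofReal_mul (by positivity)]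
  exact ENNReal.ofReal_le_ofReal (integral_sq_mean_sub_le hn hφD (hb D))

theorem integral_comp_obsX {d : ℕ} {P : Measure (Obs d)}
    (hX : MeasurePreserving obsX P (cubeVol d)) {h : (Fin d → ℝ) → ℝ}
    (hh : AEStronglyMeasurable h (cubeVol d)) : ∫ o, h (obsX o) ∂P = ∫ x, h x ∂cubeVol d := by
  rw [← hX.map_eq] at hh
  rw [← integral_map measurable_obsX.aemeasurable hh, hX.map_eq]

namespace CDVBasis

variable {S : ℕ} (B : CDVBasis S) {d n : ℕ} {P : Measure (Obs d)} [IsProbabilityMeasure P]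
  {C : ℝ} {f g : Obs d → ℝ} {r s : (Fin d → ℝ) → ℝ}

/-- The stochastic error of the linear functional `∫ r g` of the regression function `r`. -/
noncomputable def linErr (n : ℕ) (f : Obs d → ℝ) (r g : (Fin d → ℝ) → ℝ) (D : Fin n → Obs d) : ℝ :=
  (1 / n : ℝ) * ∑ i, f (D i) * g (obsX (D i)) - ∫ x, r x * g x ∂cubeVol d

theorem memLp_linErr (hX : MeasurePreserving obsX P (cubeVol d)) (hf : IsRegression P C f r)
    {h : (Fin d → ℝ) → ℝ} (hh : MemLp h ⊤ (cubeVol d)) :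
    MemLp (linErr n f r h) ⊤ (Measure.pi fun _ => P) := by
  have : MemLp (fun o => f o * h (obsX o)) ⊤ P :=
    hf.memLp_var.mul_top (hh.comp_measurePreserving hX)
  exact ((memLp_finsetSum _ fun i _ => memLp_eval this i).const_mul _).sub (memLp_const _)

theorem integral_sq_linErr_le (hX : MeasurePreserving obsX P (cubeVol d))
    (hf : IsRegression P C f r) {h : (Fin d → ℝ) → ℝ} (hhm : Measurable h)
    (hh : MemLp h ⊤ (cubeVol d)) (hn : 0 < n) :
    ∫ D, linErr n f r h D ^ 2 ∂(Measure.pi fun _ => P)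
      ≤ (1 / n : ℝ) * (C ^ 2 * ∫ x, h x * h x ∂cubeVol d) := by
  have hhX : MemLp (fun o => h (obsX o)) ⊤ P := hh.comp_measurePreserving hX
  have hm : MemLp (fun o => f o * h (obsX o)) ⊤ P := hf.memLp_var.mul_top hhX
  have := integral_sq_mean_sub_le (P := P) hn (φ := fun o => f o * h (obsX o))
    (hf.measurable.mul (hhm.comp measurable_obsX)) hm
  rw [hf.integral_mul h hh] at this
  refine this.trans ?_
  gcongr
  have e := integral_comp_obsX hX (hh.mul_top hh).1
  rw [← e, ← integral_const_mul]
  refine integral_mono_ae (hm.sq_top.integrable le_top)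
    ((hhX.integrable_mul_top hhX).const_mul _) ?_
  filter_upwards [hf.bound] with o ho
  have := sq_le_sq.2 (ho.trans (le_abs_self C))
  rw [mul_pow, sq (h _)]
  gcongr
  exact mul_self_nonneg _

/-- The quadratic term of the expansion of the inner product of two projection estimators. -/
noncomputable def quadErr (j : ℕ) (f g : Obs d → ℝ) (r s : (Fin d → ℝ) → ℝ) (D : Fin n → Obs d) :
    ℝ :=
  ∑ m, (B.empCoef f j D m - innerC r (B.Phi j m)) * (B.empCoef g j D m - innerC s (B.Phi j m))

theorem memLp_empCoef (hX : MeasurePreserving obsX P (cubeVol d)) (hf : IsRegression P C f r)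
    (j : ℕ) (m : Fin d → Fin (2 ^ j)) :
    MemLp (fun D : Fin n → Obs d => B.empCoef f j D m) ⊤ (Measure.pi fun _ => P) := by
  have : MemLp (fun o => f o * B.Phi j m (obsX o)) ⊤ P :=
    hf.memLp_var.mul_top ((B.memLp_Phi j m).comp_measurePreserving hX)
  exact (memLp_finsetSum _ fun i _ => memLp_eval this i).const_mul _

theorem memLp_quadErr (hX : MeasurePreserving obsX P (cubeVol d)) (hf : IsRegression P C f r)
    (hg : IsRegression P C g s) (j : ℕ) :
    MemLp (fun D : Fin n → Obs d => B.quadErr j f g r s D) ⊤ (Measure.pi fun _ => P) :=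
  memLp_finsetSum _ fun m _ => ((B.memLp_empCoef hX hf j m).sub (memLp_const _)).mul_top
    ((B.memLp_empCoef hX hg j m).sub (memLp_const _))

/-- The mean square of the quadratic term is of the order of the square of its mean `2^{jd} / n`. -/
theorem exists_integral_sq_quadErr_le (d : ℕ) (C : ℝ) : ∃ C' : ℝ, 0 ≤ C' ∧
    ∀ (P : Measure (Obs d)) [IsProbabilityMeasure P] (f g : Obs d → ℝ) (r s : (Fin d → ℝ) → ℝ)
      (_ : MeasurePreserving obsX P (cubeVol d)) (_ : IsRegression P C f r)
      (_ : IsRegression P C g s) (j n : ℕ), B.J₀ ≤ j → 0 < n →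
    ∫ D : Fin n → Obs d, B.quadErr j f g r s D ^ 2 ∂(Measure.pi fun _ => P)
      ≤ C' * (((2 : ℝ) ^ j) ^ d / n) ^ 2 := by
  obtain ⟨K, hK, H⟩ := B.exists_projKernel_bound d
  refine ⟨4 * (4 * C ^ 2 * K) ^ 2, by positivity, ?_⟩
  intro P _ f g r s hX hf hg j n hj hn
  have hn' : (n : ℝ) ≠ 0 := by positivity
  set k : ℝ := ((2 : ℝ) ^ j) ^ d with hk
  have hk1 : 1 ≤ k := one_le_pow₀ (one_le_pow₀ (by norm_num))
  -- the summands of the empirical coefficients are centred vectors of squared norm `O(2 ^ (j * d))`: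
  -- the diagonal of the kernel bounds `∑ m, Φ m ^ 2`, Bessel's inequality the coefficients of `r`
  have aux : ∀ {f : Obs d → ℝ} {r : (Fin d → ℝ) → ℝ}, IsRegression P C f r →
      (∀ m, Measurable fun o => f o * B.Phi j m (obsX o) - innerC r (B.Phi j m)) ∧
      (∀ m, MemLp (fun o => f o * B.Phi j m (obsX o) - innerC r (B.Phi j m)) ⊤ P) ∧
      (∀ m, ∫ o, (f o * B.Phi j m (obsX o) - innerC r (B.Phi j m)) ∂P = 0) ∧
      (∀ᵐ o ∂P, ∑ m, (f o * B.Phi j m (obsX o) - innerC r (B.Phi j m)) ^ 2 ≤ 4 * C ^ 2 * K * k) := by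
    intro f r hf
    have hm : ∀ m, MemLp (fun o => f o * B.Phi j m (obsX o)) ⊤ P := fun m =>
      hf.memLp_var.mul_top ((B.memLp_Phi j m).comp_measurePreserving hX)
    refine ⟨fun m => (hf.measurable.mul ((B.measurable_Phi j m).comp measurable_obsX)).sub_const _,
      fun m => (hm m).sub (memLp_const _), fun m => ?_, ?_⟩
    · rw [integral_sub ((hm m).integrable le_top) (integrable_const _),
        hf.integral_mul _ (B.memLp_Phi j m), innerC_eq]
      simp
    · filter_upwards [hf.bound] with o ho
      have h1 : ∑ m, innerC r (B.Phi j m) ^ 2 ≤ C ^ 2 := by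
        refine le_trans (le_of_eq ?_) ((B.projInner_self_le hj hf.memLp).trans (hf.integral_sq_le hX))
        exact Finset.sum_congr rfl fun m _ => sq _
      have h2 : ∑ m, B.Phi j m (obsX o) ^ 2 ≤ K * k := by
        refine le_trans (le_of_eq ?_) ((le_abs_self _).trans ((H j).1 (obsX o) (obsX o)))
        exact Finset.sum_congr rfl fun m _ => sq _
      have h3 := sq_le_sq.2 (ho.trans (le_abs_self C))
      calc ∑ m, (f o * B.Phi j m (obsX o) - innerC r (B.Phi j m)) ^ 2
          ≤ ∑ m, (2 * f o ^ 2 * B.Phi j m (obsX o) ^ 2 + 2 * innerC r (B.Phi j m) ^ 2) := by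
            refine Finset.sum_le_sum fun m _ => ?_
            nlinarith [sq_nonneg (f o * B.Phi j m (obsX o) + innerC r (B.Phi j m))]
        _ = 2 * f o ^ 2 * ∑ m, B.Phi j m (obsX o) ^ 2 + 2 * ∑ m, innerC r (B.Phi j m) ^ 2 := by
            rw [Finset.sum_add_distrib, Finset.mul_sum, Finset.mul_sum]
        _ ≤ 2 * C ^ 2 * (K * k) + 2 * C ^ 2 := by gcongr
        _ ≤ _ := by
            have : 1 ≤ K * k := by nlinarith
            nlinarith [sq_nonneg C]
  obtain ⟨a1, a2, a3, a4⟩ := aux hf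
  obtain ⟨b1, b2, b3, b4⟩ := aux hg
  have key := integral_sq_inner_sum_le (J := Fin n) _ _ a1 b1 a2 b2 a3 b3 (by positivity) a4 b4
  have hemp : ∀ (f : Obs d → ℝ) (r : (Fin d → ℝ) → ℝ) (D : Fin n → Obs d) (m : Fin d → Fin (2 ^ j)),
      B.empCoef f j D m - innerC r (B.Phi j m)
        = (1 / n : ℝ) * ∑ i, (f (D i) * B.Phi j m (obsX (D i)) - innerC r (B.Phi j m)) := by
    intro f r D m
    unfold empCoef
    rw [Finset.sum_sub_distrib]
    simp only [Finset.sum_const, Finset.card_univ, Fintype.card_fin, nsmul_eq_mul]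
    field_simp
  have hq : ∀ D : Fin n → Obs d, B.quadErr j f g r s D ^ 2 = (1 / n : ℝ) ^ 4 *
      (∑ m, (∑ i, (f (D i) * B.Phi j m (obsX (D i)) - innerC r (B.Phi j m))) *
        ∑ i, (g (D i) * B.Phi j m (obsX (D i)) - innerC s (B.Phi j m))) ^ 2 := by
    intro D
    unfold quadErr
    simp_rw [hemp]
    rw [show (1 / n : ℝ) ^ 4 = ((1 / n : ℝ) ^ 2) ^ 2 by ring, ← mul_pow, Finset.mul_sum]
    congr 1
    exact Finset.sum_congr rfl fun m _ => by ring
  simp_rw [hq]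
  rw [integral_const_mul]
  refine (mul_le_mul_of_nonneg_left key (by positivity)).trans (le_of_eq ?_)
  rw [Fintype.card_fin]
  field_simp

theorem sum_empCoef_mul (j : ℕ) (f : Obs d → ℝ) (r s : (Fin d → ℝ) → ℝ)
    (hr : MemLp r ⊤ (cubeVol d)) (D : Fin n → Obs d) :
    ∑ m, innerC s (B.Phi j m) * B.empCoef f j D m
      = B.projInner j r s + linErr n f r (B.proj j s) D := by
  unfold linErr
  rw [B.integral_mul_proj s hr]
  unfold empCoef proj
  simp_rw [Finset.mul_sum]
  rw [Finset.sum_comm, add_sub_cancel]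
  exact Finset.sum_congr rfl fun i _ => Finset.sum_congr rfl fun m _ => by ring

/-- The expansion of the inner product of the two vectors of empirical coefficients around the true
coefficients. -/
theorem sum_empCoef_mul_empCoef (j : ℕ) (hr : MemLp r ⊤ (cubeVol d))
    (hs : MemLp s ⊤ (cubeVol d)) (D : Fin n → Obs d) :
    ∑ m, B.empCoef f j D m * B.empCoef g j D m
      = B.projInner j r s + linErr n f r (B.proj j s) D + linErr n g s (B.proj j r) D
        + B.quadErr j f g r s D := by
  have h1 := B.sum_empCoef_mul j f r s hr D
  have h2 := B.sum_empCoef_mul j g s r hs D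
  rw [B.projInner_comm] at h2
  have h3 : B.quadErr j f g r s D = ∑ m, B.empCoef f j D m * B.empCoef g j D m
      - ∑ m, innerC s (B.Phi j m) * B.empCoef f j D m
      - ∑ m, innerC r (B.Phi j m) * B.empCoef g j D m + B.projInner j r s := by
    unfold quadErr projInner
    rw [← Finset.sum_sub_distrib, ← Finset.sum_sub_distrib, ← Finset.sum_add_distrib]
    exact Finset.sum_congr rfl fun m _ => by ring
  linarith

end CDVBasis

theorem IsRegression.integral_sq_proj_le {S : ℕ} (B : CDVBasis S) {d : ℕ} {P : Measure (Obs d)}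
    [IsProbabilityMeasure P] {C : ℝ} {f : Obs d → ℝ} {r : (Fin d → ℝ) → ℝ}
    (hX : MeasurePreserving obsX P (cubeVol d)) (hf : IsRegression P C f r) {j : ℕ}
    (hj : B.J₀ ≤ j) : ∫ x, B.proj j r x * B.proj j r x ∂cubeVol d ≤ C ^ 2 := by
  rw [B.integral_proj_mul_proj hj]
  exact (B.projInner_self_le hj hf.memLp).trans (hf.integral_sq_le hX)

namespace CDVBasis

variable {S : ℕ} (B : CDVBasis S)

/-- The error of the plug-in estimator `∫ p̂ b̂` of `∫ p b`: its bias is governed by the smaller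
resolution. -/
theorem exists_plugin_error (d : ℕ) (C : ℝ) : ∃ C' : ℝ, 0 < C' ∧
    ∀ (P : Measure (Obs d)) (p b : (Fin d → ℝ) → ℝ) (_ : IsRegressionLaw P C p b)
      (j₁ j₂ n : ℕ), B.J₀ ≤ j₁ → B.J₀ ≤ j₂ → 0 < n →
    ∫⁻ D : Fin n → Obs d, ENNReal.ofReal ((∫ x, p x * b x ∂cubeVol d
        - ∫ x, B.regHat obsA j₁ D x * B.regHat obsY j₂ D x ∂cubeVol d) ^ 2) ∂(Measure.pi fun _ => P)
      ≤ ENNReal.ofReal (C' * (1 / n + (∫ x, p x * b x ∂cubeVol d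
          - B.projInner (min j₁ j₂) p b) ^ 2 + (((2 : ℝ) ^ min j₁ j₂) ^ d / n) ^ 2)) := by
  obtain ⟨C₁, hC₁, hquad⟩ := B.exists_integral_sq_quadErr_le d C
  refine ⟨4 * (1 + 2 * (C ^ 2 * C ^ 2) + C₁), by positivity, ?_⟩
  intro P p b hP j₁ j₂ n h₁ h₂ hn
  have := hP.isProb
  set j := min j₁ j₂ with hjdef
  have hj : B.J₀ ≤ j := le_min h₁ h₂
  set β := ∫ x, p x * b x ∂cubeVol d - B.projInner j p b with hβ
  refine (lintegral_ofReal_sq_sum_le (ι := Fin 4)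
    (F := ![fun _ => β, fun D => -linErr n obsA p (B.proj j b) D,
      fun D => -linErr n obsY b (B.proj j p) D, fun D => -B.quadErr j obsA obsY p b D])
    (c := ![β ^ 2, (1 / n : ℝ) * (C ^ 2 * C ^ 2), (1 / n : ℝ) * (C ^ 2 * C ^ 2),
      C₁ * (((2 : ℝ) ^ j) ^ d / n) ^ 2]) ?_ ?_ ?_).trans (ENNReal.ofReal_le_ofReal ?_)
  · intro i
    fin_cases i
    · exact memLp_const _
    · exact (memLp_linErr hP.mp hP.regA (B.memLp_proj j b)).neg
    · exact (memLp_linErr hP.mp hP.regY (B.memLp_proj j p)).neg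
    · exact (B.memLp_quadErr hP.mp hP.regA hP.regY j).neg
  · intro i
    fin_cases i
    · simp
    · simp only [Fin.mk_one, Matrix.cons_val_one, Matrix.cons_val_zero, neg_sq]
      refine (integral_sq_linErr_le hP.mp hP.regA (B.measurable_proj j b) (B.memLp_proj j b)
        hn).trans ?_
      gcongr
      exact hP.regY.integral_sq_proj_le B hP.mp hj
    · simp only [Fin.reduceFinMk, Matrix.cons_val, neg_sq]
      refine (integral_sq_linErr_le hP.mp hP.regY (B.measurable_proj j p) (B.memLp_proj j p)
        hn).trans ?_
      gcongr
      exact hP.regA.integral_sq_proj_le B hP.mp hj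
    · simp only [Fin.reduceFinMk, Matrix.cons_val, neg_sq]
      exact hquad P _ _ _ _ hP.mp hP.regA hP.regY j n hj hn
  · filter_upwards [B.integral_regHat_mul_regHat hP.mp h₁ h₂ obsA obsY] with D hD
    rw [hD, B.sum_empCoef_mul_empCoef _ hP.regA.memLp hP.regY.memLp]
    simp [Fin.sum_univ_four, hβ]
    ring
  · simp only [Fintype.card_fin, Fin.sum_univ_four, Matrix.cons_val]
    have h1 : (0 : ℝ) ≤ 1 / n := by positivity
    have h2 : 0 ≤ β ^ 2 := sq_nonneg _
    have h3 : 0 ≤ (((2 : ℝ) ^ j) ^ d / n) ^ 2 := sq_nonneg _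
    have h4 : 0 ≤ C ^ 2 * C ^ 2 := by positivity
    push_cast
    nlinarith [mul_nonneg h4 h2, mul_nonneg hC₁ h2, mul_nonneg hC₁ h1, mul_nonneg h4 h3]

/-- The conditional bias of the first-order corrected estimator: it involves the distances from the
larger of the two spaces, since the other projection is absorbed by orthogonality. -/
theorem exists_corrected_error (d : ℕ) (C : ℝ) : ∃ C' : ℝ, 0 < C' ∧
    ∀ (P : Measure (Obs d)) (p b : (Fin d → ℝ) → ℝ) (_ : IsRegressionLaw P C p b)
      (j₁ j₂ n : ℕ), B.J₀ ≤ j₁ → B.J₀ ≤ j₂ → 0 < n →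
    ∫⁻ D : Fin n → Obs d, ENNReal.ofReal ((∫ x, p x * b x ∂cubeVol d
        - ∫ x, p x * B.regHat obsY j₂ D x ∂cubeVol d - ∫ x, b x * B.regHat obsA j₁ D x ∂cubeVol d
        + ∫ x, B.regHat obsA j₁ D x * B.regHat obsY j₂ D x ∂cubeVol d) ^ 2) ∂(Measure.pi fun _ => P)
      ≤ ENNReal.ofReal (C' * (1 / n + (∫ x, p x * b x ∂cubeVol d
          - B.projInner (max j₁ j₂) p b) ^ 2 + (((2 : ℝ) ^ min j₁ j₂) ^ d / n) ^ 2)) := by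
  obtain ⟨C₁, hC₁, hquad⟩ := B.exists_integral_sq_quadErr_le d C
  refine ⟨6 * (1 + 4 * (C ^ 2 * C ^ 2) + C₁), by positivity, ?_⟩
  intro P p b hP j₁ j₂ n h₁ h₂ hn
  have := hP.isProb
  set j := min j₁ j₂ with hjdef
  have hj : B.J₀ ≤ j := le_min h₁ h₂
  set β := ∫ x, p x * b x ∂cubeVol d - B.projInner (max j₁ j₂) p b with hβ
  have hlinA : ∀ j, B.J₀ ≤ j → ∫ D, linErr n obsA p (B.proj j b) D ^ 2 ∂(Measure.pi fun _ => P)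
      ≤ (1 / n : ℝ) * (C ^ 2 * C ^ 2) := by
    intro j hj
    refine (integral_sq_linErr_le hP.mp hP.regA (B.measurable_proj j b) (B.memLp_proj j b)
      hn).trans ?_
    gcongr
    exact hP.regY.integral_sq_proj_le B hP.mp hj
  have hlinY : ∀ j, B.J₀ ≤ j → ∫ D, linErr n obsY b (B.proj j p) D ^ 2 ∂(Measure.pi fun _ => P)
      ≤ (1 / n : ℝ) * (C ^ 2 * C ^ 2) := by
    intro j hj
    refine (integral_sq_linErr_le hP.mp hP.regY (B.measurable_proj j p) (B.memLp_proj j p)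
      hn).trans ?_
    gcongr
    exact hP.regA.integral_sq_proj_le B hP.mp hj
  refine (lintegral_ofReal_sq_sum_le (ι := Fin 6)
    (F := ![fun _ => β, fun D => linErr n obsA p (B.proj j b) D,
      fun D => linErr n obsY b (B.proj j p) D, fun D => B.quadErr j obsA obsY p b D,
      fun D => -linErr n obsA p (B.proj j₁ b) D, fun D => -linErr n obsY b (B.proj j₂ p) D])
    (c := ![β ^ 2, (1 / n : ℝ) * (C ^ 2 * C ^ 2), (1 / n : ℝ) * (C ^ 2 * C ^ 2),
      C₁ * (((2 : ℝ) ^ j) ^ d / n) ^ 2, (1 / n : ℝ) * (C ^ 2 * C ^ 2),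
      (1 / n : ℝ) * (C ^ 2 * C ^ 2)]) ?_ ?_ ?_).trans (ENNReal.ofReal_le_ofReal ?_)
  · intro i
    fin_cases i
    · exact memLp_const _
    · exact memLp_linErr hP.mp hP.regA (B.memLp_proj j b)
    · exact memLp_linErr hP.mp hP.regY (B.memLp_proj j p)
    · exact B.memLp_quadErr hP.mp hP.regA hP.regY j
    · exact (memLp_linErr hP.mp hP.regA (B.memLp_proj j₁ b)).neg
    · exact (memLp_linErr hP.mp hP.regY (B.memLp_proj j₂ p)).neg
  · intro i
    fin_cases i
    · simp
    · exact hlinA j hj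
    · exact hlinY j hj
    · exact hquad P _ _ _ _ hP.mp hP.regA hP.regY j n hj hn
    · simpa only [Fin.reduceFinMk, Matrix.cons_val, neg_sq] using hlinA j₁ h₁
    · simpa only [Fin.reduceFinMk, Matrix.cons_val, neg_sq] using hlinY j₂ h₂
  · filter_upwards [B.integral_regHat_mul_regHat hP.mp h₁ h₂ obsA obsY] with D hD
    rw [hD, B.sum_empCoef_mul_empCoef _ hP.regA.memLp hP.regY.memLp,
      B.integral_mul_regHat hP.regA.memLp, B.integral_mul_regHat hP.regY.memLp,
      B.sum_empCoef_mul j₁ obsA p b hP.regA.memLp, B.sum_empCoef_mul j₂ obsY b p hP.regY.memLp,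
      B.projInner_comm j₂]
    -- one of the two levels is the smaller one and the other the larger one: the approximation
    -- error of the smaller space cancels
    have hmm : B.projInner j₁ p b + B.projInner j₂ p b
        = B.projInner j p b + B.projInner (max j₁ j₂) p b := by
      rcases le_total j₁ j₂ with h | h
      · rw [hjdef, min_eq_left h, max_eq_right h]
      · rw [hjdef, min_eq_right h, max_eq_left h, add_comm]
    simp only [Fin.sum_univ_six, Matrix.cons_val, hβ]
    linarith
  · simp only [Fintype.card_fin, Fin.sum_univ_six, Matrix.cons_val]
    have h1 : (0 : ℝ) ≤ 1 / n := by positivity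
    have h2 : 0 ≤ β ^ 2 := sq_nonneg _
    have h3 : 0 ≤ (((2 : ℝ) ^ j) ^ d / n) ^ 2 := sq_nonneg _
    have h4 : 0 ≤ C ^ 2 * C ^ 2 := by positivity
    push_cast
    nlinarith [mul_nonneg h4 h2, mul_nonneg hC₁ h2, mul_nonneg hC₁ h1, mul_nonneg h4 h3]

end CDVBasis

/-! ### Moments of the projection estimators -/

theorem lintegral_comp_obsX {d : ℕ} {P : Measure (Obs d)}
    (hX : MeasurePreserving obsX P (cubeVol d)) {h : (Fin d → ℝ) → ℝ≥0∞} (hh : Measurable h) :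
    ∫⁻ o, h (obsX o) ∂P = ∫⁻ x, h x ∂cubeVol d :=
  hX.lintegral_comp hh

theorem ofReal_sq_add_le (x y : ℝ) :
    ENNReal.ofReal ((x + y) ^ 2) ≤ 2 * ENNReal.ofReal (x ^ 2) + 2 * ENNReal.ofReal (y ^ 2) := by
  rw [show (2 : ℝ≥0∞) = ENNReal.ofReal 2 by simp, ← ENNReal.ofReal_mul (by norm_num),
    ← ENNReal.ofReal_mul (by norm_num), ← ENNReal.ofReal_add (by positivity) (by positivity)]
  exact ENNReal.ofReal_le_ofReal (by nlinarith [sq_nonneg (x - y)])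

namespace CDVBasis

variable {S : ℕ} (B : CDVBasis S) {d : ℕ}

theorem measurable_projKernel_left (j : ℕ) (x : Fin d → ℝ) :
    Measurable fun y => B.projKernel j y x :=
  Finset.measurable_fun_sum _ fun m _ => (B.measurable_Phi j m).mul_const _

/-- The dominating function of the summands of a projection estimator at the point `x`. -/
noncomputable def absKernel (j : ℕ) (x : Fin d → ℝ) (o : Obs d) : ℝ≥0∞ :=
  ENNReal.ofReal |B.projKernel j (obsX o) x|

theorem measurable_absKernel (j : ℕ) (x : Fin d → ℝ) : Measurable (B.absKernel j x) := by
  have h := B.measurable_projKernel_left j x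
  exact ENNReal.measurable_ofReal.comp
    (continuous_abs.measurable.comp (h.comp measurable_obsX))

/-- First and second moments of the kernel at a point, as a function of the covariate. -/
theorem lintegral_absKernel_le {P : Measure (Obs d)} (hX : MeasurePreserving obsX P (cubeVol d))
    {K : ℝ} (j : ℕ) (hK : ∀ x y, |B.projKernel (d := d) j x y| ≤ K * (2 ^ j) ^ d)
    (hK' : ∀ x, ∫ y, |B.projKernel (d := d) j x y| ∂cubeVol d ≤ K) (x : Fin d → ℝ) :
    ∫⁻ o, B.absKernel j x o ∂P ≤ ENNReal.ofReal K ∧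
    ∫⁻ o, B.absKernel j x o ^ 2 ∂P ≤ ENNReal.ofReal (K * (2 ^ j) ^ d * K) := by
  have hm := B.measurable_projKernel_left j x
  have hma : Measurable fun y => ENNReal.ofReal |B.projKernel j y x| :=
    ENNReal.measurable_ofReal.comp (continuous_abs.measurable.comp hm)
  have hb0 : 0 ≤ K * (2 ^ j) ^ d := (abs_nonneg _).trans (hK x x)
  have h1 : ∫⁻ o, B.absKernel j x o ∂P ≤ ENNReal.ofReal K := by
    unfold absKernel
    rw [lintegral_comp_obsX hX hma, ← ofReal_integral_eq_lintegral_ofReal]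
    · refine ENNReal.ofReal_le_ofReal (le_trans (le_of_eq ?_) (hK' x))
      simp_rw [B.projKernel_comm j x]
    · refine Integrable.of_bound (hm.norm.aestronglyMeasurable) (K * (2 ^ j) ^ d)
        (Filter.Eventually.of_forall fun y => ?_)
      rw [Real.norm_eq_abs, abs_abs]; exact hK y x
    · exact Filter.Eventually.of_forall fun _ => abs_nonneg _
  refine ⟨h1, ?_⟩
  rw [ENNReal.ofReal_mul hb0]
  calc ∫⁻ o, B.absKernel j x o ^ 2 ∂P
      ≤ ∫⁻ o, ENNReal.ofReal (K * (2 ^ j) ^ d) * B.absKernel j x o ∂P := by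
        refine lintegral_mono fun o => ?_
        rw [sq]
        gcongr
        exact ENNReal.ofReal_le_ofReal (hK _ _)
    _ ≤ _ := by
        rw [lintegral_const_mul _ (B.measurable_absKernel j x)]
        gcongr

theorem ae_sq_regHat_le {P : Measure (Obs d)} [IsProbabilityMeasure P] {C : ℝ} {f : Obs d → ℝ}
    (hf : ∀ᵐ o ∂P, |f o| ≤ C) (n j : ℕ) :
    ∀ᵐ D ∂(Measure.pi fun _ : Fin n => P), ∀ x, ENNReal.ofReal (B.regHat f j D x ^ 2)
      ≤ ENNReal.ofReal ((C / n) ^ 2) * (∑ i, B.absKernel j x (D i)) ^ 2 := by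
  filter_upwards [ae_eval (J := Fin n) hf] with D hD x
  unfold absKernel
  rw [← ENNReal.ofReal_sum_of_nonneg fun i _ => abs_nonneg _, ← ENNReal.ofReal_pow
    (Finset.sum_nonneg fun i _ => abs_nonneg _), ← ENNReal.ofReal_mul (sq_nonneg _), ← mul_pow]
  refine ENNReal.ofReal_le_ofReal (sq_le_sq.2 (le_trans ?_ (le_abs_self _)))
  unfold regHat
  rw [abs_mul, abs_of_nonneg (by positivity : (0 : ℝ) ≤ 1 / n), div_mul_eq_mul_div,
    div_mul_eq_mul_div, one_mul]
  gcongr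
  refine (Finset.abs_sum_le_sum_abs _ _).trans ?_
  rw [Finset.mul_sum]
  refine Finset.sum_le_sum fun i _ => ?_
  rw [abs_mul]
  gcongr
  exact hD i

theorem lintegral_swap_regHat {P : Measure (Obs d)} [IsProbabilityMeasure P] {n : ℕ}
    {F : (Fin n → Obs d) → (Fin d → ℝ) → ℝ} (hF : Measurable fun w : _ × _ => F w.1 w.2)
    {c : ℝ≥0∞} (h : ∀ x, ∫⁻ D, ENNReal.ofReal (F D x ^ 2) ∂(Measure.pi fun _ => P) ≤ c) :
    ∫⁻ D, ∫⁻ x, ENNReal.ofReal (F D x ^ 2) ∂cubeVol d ∂(Measure.pi fun _ => P) ≤ c := by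
  rw [lintegral_lintegral_swap (hF.pow_const 2).ennreal_ofReal.aemeasurable]
  refine (lintegral_mono h).trans ?_
  simp

/-- The mean square of the projection estimator, integrated over the cube. -/
theorem exists_lintegral_sq_regHat_le (d : ℕ) (C : ℝ) : ∃ C' : ℝ, 0 < C' ∧
    ∀ (P : Measure (Obs d)) [IsProbabilityMeasure P] (f : Obs d → ℝ)
      (_ : MeasurePreserving obsX P (cubeVol d)) (_ : Measurable f)
      (_ : ∀ᵐ o ∂P, |f o| ≤ C) (j n : ℕ), 0 < n →
    ∫⁻ D : Fin n → Obs d, ∫⁻ x, ENNReal.ofReal (B.regHat f j D x ^ 2) ∂cubeVol d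
      ∂(Measure.pi fun _ => P) ≤ ENNReal.ofReal (C' * (1 + ((2 : ℝ) ^ j) ^ d / n)) := by
  obtain ⟨K, hK, H⟩ := B.exists_projKernel_bound d
  refine ⟨C ^ 2 * K ^ 2 + 1, by positivity, ?_⟩
  intro P _ f hX hf hfC j n hn
  refine lintegral_swap_regHat (B.measurable_regHat hf j) fun x => ?_
  obtain ⟨h1, h2⟩ := B.lintegral_absKernel_le hX j (H j).1 (H j).2.2 x
  have key := lintegral_sq_sum_le (J := Fin n) (B.measurable_absKernel j x) h1 h2
  have hm : Measurable fun D : Fin n → Obs d => (∑ i, B.absKernel j x (D i)) ^ 2 :=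
    (Finset.measurable_fun_sum _ fun i _ =>
      (B.measurable_absKernel j x).comp (measurable_pi_apply i)).pow_const 2
  calc _ ≤ ∫⁻ D : Fin n → Obs d, ENNReal.ofReal ((C / n) ^ 2) *
        (∑ i, B.absKernel j x (D i)) ^ 2 ∂(Measure.pi fun _ => P) :=
        lintegral_mono_ae ((B.ae_sq_regHat_le hfC n j).mono fun D hD => hD x)
    _ ≤ ENNReal.ofReal ((C / n) ^ 2) * (n * ENNReal.ofReal (K * (2 ^ j) ^ d * K)
        + (n : ℝ≥0∞) ^ 2 * ENNReal.ofReal K ^ 2) := by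
        rw [lintegral_const_mul _ hm]
        gcongr
        simpa using key
    _ = ENNReal.ofReal ((C / n) ^ 2 * (n * (K * (2 ^ j) ^ d * K) + n ^ 2 * K ^ 2)) := by
        have : 0 ≤ K := by linarith
        simp (disch := positivity) only [ENNReal.ofReal_mul, ENNReal.ofReal_add,
          ENNReal.ofReal_pow, ENNReal.ofReal_natCast]
    _ ≤ _ := by
        refine ENNReal.ofReal_le_ofReal ?_
        have hn' : (n : ℝ) ≠ 0 := by positivity
        have e : (C / n) ^ 2 * (n * (K * (2 ^ j) ^ d * K) + n ^ 2 * K ^ 2)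
            = C ^ 2 * K ^ 2 * (1 + ((2 : ℝ) ^ j) ^ d / n) := by field_simp; ring
        rw [e]
        gcongr
        linarith

/-- The mean square of the product of two projection estimators built from the same subsample. The
level `j'` belongs to the factor whose summands are bounded pointwise. -/
theorem exists_lintegral_sq_regHat_mul_le (d : ℕ) (C : ℝ) : ∃ C' : ℝ, 0 < C' ∧
    ∀ (P : Measure (Obs d)) [IsProbabilityMeasure P] (f g : Obs d → ℝ)
      (_ : MeasurePreserving obsX P (cubeVol d)) (_ : Measurable f) (_ : Measurable g)
      (_ : ∀ᵐ o ∂P, |f o| ≤ C) (_ : ∀ᵐ o ∂P, |g o| ≤ C) (j j' n : ℕ), 0 < n →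
    ∫⁻ D : Fin n → Obs d, ∫⁻ x, ENNReal.ofReal ((B.regHat f j D x * B.regHat g j' D x) ^ 2)
      ∂cubeVol d ∂(Measure.pi fun _ => P)
      ≤ ENNReal.ofReal (C' * ((1 + ((2 : ℝ) ^ j) ^ d / n) *
        (1 + ((2 : ℝ) ^ j') ^ d / n + (((2 : ℝ) ^ j') ^ d / n) ^ 2))) := by
  obtain ⟨K, hK, H⟩ := B.exists_projKernel_bound d
  refine ⟨16 * C ^ 4 * K ^ 4 + 1, by positivity, ?_⟩
  intro P _ f g hX hf hg hfC hgC j j' n hn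
  refine lintegral_swap_regHat ((B.measurable_regHat hf j).mul (B.measurable_regHat hg j'))
    fun x => ?_
  obtain ⟨h1, h2⟩ := B.lintegral_absKernel_le hX j (H j).1 (H j).2.2 x
  obtain ⟨h3, h4⟩ := B.lintegral_absKernel_le hX j' (H j').1 (H j').2.2 x
  have key := lintegral_sq_sum_mul_sq_sum_le (J := Fin n) (B.measurable_absKernel j x)
    (B.measurable_absKernel j' x) h1 h2 h3 h4 (b := ENNReal.ofReal (K * (2 ^ j') ^ d))
    fun o => ENNReal.ofReal_le_ofReal ((H j').1 _ _)
  have hm : ∀ j, Measurable fun D : Fin n → Obs d => (∑ i, B.absKernel j x (D i)) ^ 2 := fun j =>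
    (Finset.measurable_fun_sum _ fun i _ =>
      (B.measurable_absKernel j x).comp (measurable_pi_apply i)).pow_const 2
  have hK0 : 0 ≤ K := by linarith
  set k : ℝ := ((2 : ℝ) ^ j) ^ d with hk
  set k' : ℝ := ((2 : ℝ) ^ j') ^ d with hk'
  have hk0 : 0 ≤ k := by positivity
  have hk0' : 0 ≤ k' := by positivity
  calc _ ≤ ∫⁻ D : Fin n → Obs d, ENNReal.ofReal ((C / n) ^ 2) * ENNReal.ofReal ((C / n) ^ 2) *
        ((∑ i, B.absKernel j x (D i)) ^ 2 * (∑ i, B.absKernel j' x (D i)) ^ 2)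
        ∂(Measure.pi fun _ => P) := by
        refine lintegral_mono_ae ?_
        filter_upwards [B.ae_sq_regHat_le hfC n j, B.ae_sq_regHat_le hgC n j'] with D hD hD'
        rw [mul_pow, ENNReal.ofReal_mul (sq_nonneg _)]
        refine (mul_le_mul' (hD x) (hD' x)).trans (le_of_eq ?_)
        ring
    _ ≤ ENNReal.ofReal ((C / n) ^ 2) * ENNReal.ofReal ((C / n) ^ 2) *
        ((n * ENNReal.ofReal (K * k * K) + (n : ℝ≥0∞) ^ 2 * ENNReal.ofReal K ^ 2) *
        (4 * ((2 * ENNReal.ofReal (K * k')) ^ 2 +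
          (n * ENNReal.ofReal (K * k' * K) + (n : ℝ≥0∞) ^ 2 * ENNReal.ofReal K ^ 2)))) := by
        have hmm : Measurable fun D : Fin n → Obs d =>
            (∑ i, B.absKernel j x (D i)) ^ 2 * (∑ i, B.absKernel j' x (D i)) ^ 2 :=
          (hm j).mul (hm j')
        rw [lintegral_const_mul _ hmm]
        gcongr
        simpa using key
    _ = ENNReal.ofReal ((C / n) ^ 2 * (C / n) ^ 2 * ((n * (K * k * K) + n ^ 2 * K ^ 2) *
        (4 * ((2 * (K * k')) ^ 2 + (n * (K * k' * K) + n ^ 2 * K ^ 2))))) := by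
        simp (disch := positivity) only [ENNReal.ofReal_mul, ENNReal.ofReal_add,
          ENNReal.ofReal_pow, ENNReal.ofReal_natCast, ENNReal.ofReal_ofNat]
    _ ≤ _ := by
        refine ENNReal.ofReal_le_ofReal ?_
        have hn' : (n : ℝ) ≠ 0 := by positivity
        have e : (C / n) ^ 2 * (C / n) ^ 2 * ((n * (K * k * K) + n ^ 2 * K ^ 2) *
            (4 * ((2 * (K * k')) ^ 2 + (n * (K * k' * K) + n ^ 2 * K ^ 2))))
            = C ^ 4 * K ^ 4 * ((1 + k / n) * (4 * (1 + k' / n + 4 * (k' / n) ^ 2))) := by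
          field_simp; ring
        rw [e]
        have h5 : 0 ≤ k / n := by positivity
        have h6 : 0 ≤ k' / n := by positivity
        have h7 : 4 * (1 + k' / n + 4 * (k' / n) ^ 2) ≤ 16 * (1 + k' / n + (k' / n) ^ 2) := by
          nlinarith
        have h8 : 0 ≤ C ^ 4 * K ^ 4 := by positivity
        calc _ ≤ C ^ 4 * K ^ 4 * ((1 + k / n) * (16 * (1 + k' / n + (k' / n) ^ 2))) := by gcongr
          _ = 16 * C ^ 4 * K ^ 4 * ((1 + k / n) * (1 + k' / n + (k' / n) ^ 2)) := by ring
          _ ≤ _ := by gcongr; linarith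

end CDVBasis

/-! ### Risk bounds -/

theorem lintegral_sampleLaw_eval {d m n : ℕ} {P : Measure (Obs d)} [IsProbabilityMeasure P]
    {F : (Fin n → Obs d) → ℝ≥0∞} (hF : Measurable F) (i : Fin m) :
    ∫⁻ ω, F (ω i) ∂(sampleLaw m n P) = ∫⁻ D, F D ∂(Measure.pi fun _ => P) :=
  lintegral_eval hF i

theorem lintegral_sampleLaw_pair {d m n : ℕ} {P : Measure (Obs d)} [IsProbabilityMeasure P]
    {F : (Fin n → Obs d) × (Fin n → Obs d) → ℝ≥0∞} (hF : Measurable F) {i j : Fin m}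
    (hij : i ≠ j) :
    ∫⁻ ω, F (ω i, ω j) ∂(sampleLaw m n P)
      = ∫⁻ w, F w ∂((Measure.pi fun _ => P).prod (Measure.pi fun _ => P)) := by
  rw [← map_pair_eval (J := Fin m) (P := Measure.pi fun _ : Fin n => P) hij,
    lintegral_map hF ((measurable_pi_apply i).prodMk (measurable_pi_apply j))]
  rfl

namespace CDVBasis

variable {S : ℕ} (B : CDVBasis S) {d : ℕ}

theorem measurable_integral_regHat_mul {n : ℕ} {f g : Obs d → ℝ} (hf : Measurable f)
    (hg : Measurable g) (j j' : ℕ) :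
    Measurable fun D : Fin n → Obs d => ∫ x, B.regHat f j D x * B.regHat g j' D x ∂cubeVol d :=
  (((B.measurable_regHat hf j).mul (B.measurable_regHat hg j')).stronglyMeasurable.integral_prod_right
    (ν := cubeVol d)).measurable

theorem measurable_integral_mul_regHat {n : ℕ} {g : (Fin d → ℝ) → ℝ} (hg : MemLp g ⊤ (cubeVol d))
    {f : Obs d → ℝ} (hf : Measurable f) (j : ℕ) :
    Measurable fun D : Fin n → Obs d => ∫ x, g x * B.regHat f j D x ∂cubeVol d := by
  simp_rw [B.integral_mul_regHat hg f j]
  exact Finset.measurable_fun_sum _ fun m _ => (B.measurable_empCoef hf j m).const_mul _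

end CDVBasis

theorem IsRegressionLaw.lintegral_sq_mean_AY_le {d : ℕ} {P : Measure (Obs d)} {C : ℝ}
    {p b : (Fin d → ℝ) → ℝ} (hP : IsRegressionLaw P C p b) {n : ℕ} (hn : 0 < n) :
    ∫⁻ D : Fin n → Obs d, ENNReal.ofReal (((1 / n : ℝ) * ∑ i, obsA (D i) * obsY (D i)
        - ∫ o, obsA o * obsY o ∂P) ^ 2) ∂(Measure.pi fun _ => P)
      ≤ ENNReal.ofReal (C ^ 4 * (1 / n)) := by
  have := hP.isProb
  have hm : MemLp (fun o => obsA o * obsY o) ⊤ P := hP.regA.memLp_var.mul_top hP.regY.memLp_var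
  have hmem : MemLp (fun D : Fin n → Obs d => (1 / n : ℝ) * ∑ i, obsA (D i) * obsY (D i)
      - ∫ o, obsA o * obsY o ∂P) ⊤ (Measure.pi fun _ => P) :=
    ((memLp_finsetSum _ fun i _ => memLp_eval hm i).const_mul _).sub (memLp_const _)
  rw [lintegral_ofReal_sq_eq hmem]
  refine ENNReal.ofReal_le_ofReal ((integral_sq_mean_sub_le hn
    (measurable_obsA.mul measurable_obsY) hm).trans ?_)
  rw [mul_comm (C ^ 4)]
  gcongr
  have : ∫ o, (obsA o * obsY o) ^ 2 ∂P ≤ ∫ _o, C ^ 4 ∂P := by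
    refine integral_mono_ae (hm.sq_top.integrable le_top) (integrable_const _) ?_
    filter_upwards [hP.regA.bound, hP.regY.bound] with o h1 h2
    have h1 := sq_le_sq.2 (h1.trans (le_abs_self C))
    have h2 := sq_le_sq.2 (h2.trans (le_abs_self C))
    calc (obsA o * obsY o) ^ 2 = obsA o ^ 2 * obsY o ^ 2 := mul_pow _ _ _
      _ ≤ C ^ 2 * C ^ 2 := by gcongr
      _ = C ^ 4 := by ring
  simpa using this

namespace CDVBasis

variable {S : ℕ} (B : CDVBasis S) {d : ℕ}

theorem measurable_mean_AY {n : ℕ} : Measurable fun D : Fin n → Obs d =>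
    (1 / n : ℝ) * ∑ i, obsA (D i) * obsY (D i) :=
  have h : ∀ i, Measurable fun D : Fin n → Obs d => obsA (D i) * obsY (D i) := fun i =>
    (measurable_obsA.comp (measurable_pi_apply i)).mul
      (measurable_obsY.comp (measurable_pi_apply i))
  (Finset.measurable_fun_sum _ fun i _ => h i).const_mul _

/-- The risk of the integral-based estimator: parametric noise, squared approximation error of the
smaller space, and the quadratic term. -/
theorem exists_risk_INT_le (d : ℕ) (C : ℝ) : ∃ C' : ℝ, 0 < C' ∧
    ∀ (P : Measure (Obs d)) (p b : (Fin d → ℝ) → ℝ) (_ : IsRegressionLaw P C p b)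
      (j₁ j₂ n : ℕ), B.J₀ ≤ j₁ → B.J₀ ≤ j₂ → 0 < n →
    ∫⁻ ω, ENNReal.ofReal ((B.psiINT j₁ j₂ ω - psi P) ^ 2) ∂(sampleLaw 2 n P)
      ≤ ENNReal.ofReal (C' * (1 / n + (∫ x, p x * b x ∂cubeVol d
          - B.projInner (min j₁ j₂) p b) ^ 2 + (((2 : ℝ) ^ min j₁ j₂) ^ d / n) ^ 2)) := by
  obtain ⟨C₁, hC₁, h⟩ := B.exists_plugin_error d C
  refine ⟨2 * C ^ 4 + 2 * C₁, by positivity, ?_⟩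
  intro P p b hP j₁ j₂ n h₁ h₂ hn
  have := hP.isProb
  have hplug := h P p b hP j₁ j₂ n h₁ h₂ hn
  have hmean := hP.lintegral_sq_mean_AY_le hn
  set E := ∫ x, p x * b x ∂cubeVol d with hE
  set q := ∫ o, obsA o * obsY o ∂P with hq
  set F : (Fin n → Obs d) → ℝ := fun D => (1 / n : ℝ) * ∑ i, obsA (D i) * obsY (D i) - q with hF
  set G : (Fin n → Obs d) → ℝ := fun D =>
    E - ∫ x, B.regHat obsA j₁ D x * B.regHat obsY j₂ D x ∂cubeVol d with hG
  have hFm : Measurable fun D => ENNReal.ofReal (F D ^ 2) :=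
    ((measurable_mean_AY.sub_const _).pow_const 2).ennreal_ofReal
  have hGm : Measurable fun D => ENNReal.ofReal (G D ^ 2) :=
    (((B.measurable_integral_regHat_mul measurable_obsA measurable_obsY j₁ j₂).const_sub _).pow_const
      2).ennreal_ofReal
  -- the error is the sum of the error of the mean of `A * Y` and the error of the plug-in term
  have hdec : ∀ ω : Sample d 2 n, B.psiINT j₁ j₂ ω - psi P = F (ω 1) + G (ω 0) := by
    intro ω
    simp only [psiINT, hF, hG, hP.psi_eq, pHat_eq, bHat_eq, restrict_cube_eq]
    ring
  simp_rw [hdec]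
  set R : ℝ := (E - B.projInner (min j₁ j₂) p b) ^ 2 with hR
  set Q : ℝ := (((2 : ℝ) ^ min j₁ j₂) ^ d / n) ^ 2 with hQ
  have hR0 : 0 ≤ R := sq_nonneg _
  have hQ0 : 0 ≤ Q := sq_nonneg _
  have hn0 : (0 : ℝ) ≤ 1 / n := by positivity
  calc _ ≤ ∫⁻ ω : Sample d 2 n, (2 * ENNReal.ofReal (F (ω 1) ^ 2)
        + 2 * ENNReal.ofReal (G (ω 0) ^ 2)) ∂(sampleLaw 2 n P) :=
        lintegral_mono fun ω => ofReal_sq_add_le _ _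
    _ = 2 * ∫⁻ D, ENNReal.ofReal (F D ^ 2) ∂(Measure.pi fun _ => P)
        + 2 * ∫⁻ D, ENNReal.ofReal (G D ^ 2) ∂(Measure.pi fun _ => P) := by
        have hF1 : Measurable fun ω : Sample d 2 n => ENNReal.ofReal (F (ω 1) ^ 2) :=
          hFm.comp (measurable_pi_apply 1)
        have hG0 : Measurable fun ω : Sample d 2 n => ENNReal.ofReal (G (ω 0) ^ 2) :=
          hGm.comp (measurable_pi_apply 0)
        rw [lintegral_add_left (hF1.const_mul 2), lintegral_const_mul _ hF1,
          lintegral_const_mul _ hG0, lintegral_sampleLaw_eval hFm, lintegral_sampleLaw_eval hGm]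
    _ ≤ 2 * ENNReal.ofReal (C ^ 4 * (1 / n)) + 2 * ENNReal.ofReal (C₁ * (1 / n + R + Q)) := by
        gcongr
    _ = ENNReal.ofReal (2 * (C ^ 4 * (1 / n)) + 2 * (C₁ * (1 / n + R + Q))) := by
        rw [ENNReal.ofReal_add (by positivity) (by positivity),
          ENNReal.ofReal_mul (p := 2) (by positivity), ENNReal.ofReal_mul (p := 2) (by positivity)]
        simp
    _ ≤ _ := by
        refine ENNReal.ofReal_le_ofReal ?_
        have : 0 ≤ C ^ 4 := by positivity
        nlinarith [mul_nonneg this hR0, mul_nonneg this hQ0]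

end CDVBasis

theorem measurable_mean_sub_integral {Ω Ω' : Type*} [MeasurableSpace Ω] [MeasurableSpace Ω']
    {P : Measure Ω} [SFinite P] {n : ℕ} {φ : Ω' → Ω → ℝ}
    (hφ : Measurable fun w : Ω' × Ω => φ w.1 w.2) :
    Measurable fun w : Ω' × (Fin n → Ω) =>
      (1 / n : ℝ) * ∑ i, φ w.1 (w.2 i) - ∫ z, φ w.1 z ∂P := by
  have h : ∀ i, Measurable fun w : Ω' × (Fin n → Ω) => φ w.1 (w.2 i) := fun i =>
    hφ.comp (measurable_fst.prodMk ((measurable_pi_apply i).comp measurable_snd))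
  have e2 : Measurable fun w : Ω' => ∫ z, φ w z ∂P :=
    (hφ.stronglyMeasurable.integral_prod_right (ν := P)).measurable
  exact ((Finset.measurable_fun_sum _ fun i _ => h i).const_mul _).sub (e2.comp measurable_fst)

namespace CDVBasis

variable {S : ℕ} (B : CDVBasis S) {d : ℕ}

/-- The second moment of the product of the two estimators, where the smaller resolution plays the
role of the bounded factor. -/
theorem exists_lintegral_sq_prod_le (d : ℕ) (C : ℝ) : ∃ C' : ℝ, 0 < C' ∧
    ∀ (P : Measure (Obs d)) [IsProbabilityMeasure P]
      (_ : MeasurePreserving obsX P (cubeVol d))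
      (_ : ∀ᵐ o ∂P, |obsA o| ≤ C) (_ : ∀ᵐ o ∂P, |obsY o| ≤ C) (j₁ j₂ n : ℕ), 0 < n →
    ∫⁻ D : Fin n → Obs d, ∫⁻ x, ENNReal.ofReal
        ((B.regHat obsA j₁ D x * B.regHat obsY j₂ D x) ^ 2) ∂cubeVol d ∂(Measure.pi fun _ => P)
      ≤ ENNReal.ofReal (C' * ((1 + ((2 : ℝ) ^ max j₁ j₂) ^ d / n) *
        (1 + ((2 : ℝ) ^ min j₁ j₂) ^ d / n + (((2 : ℝ) ^ min j₁ j₂) ^ d / n) ^ 2))) := by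
  obtain ⟨C₁, hC₁, h⟩ := B.exists_lintegral_sq_regHat_mul_le d C
  refine ⟨C₁, hC₁, ?_⟩
  intro P _ hX hA hY j₁ j₂ n hn
  rcases le_total j₁ j₂ with hj | hj
  · rw [min_eq_left hj, max_eq_right hj]
    simp_rw [mul_comm (B.regHat obsA j₁ _ _)]
    exact h P obsY obsA hX measurable_obsY measurable_obsA hY hA j₂ j₁ n hn
  · rw [min_eq_right hj, max_eq_left hj]
    exact h P obsA obsY hX measurable_obsA measurable_obsY hA hY j₁ j₂ n hn

/-- The risk of the Monte Carlo-based estimator: in addition to the terms of the integral-based one,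
the noise from averaging the product of the two estimators over the third subsample. -/
theorem exists_risk_MC_le (d : ℕ) (C : ℝ) : ∃ C' : ℝ, 0 < C' ∧
    ∀ (P : Measure (Obs d)) (p b : (Fin d → ℝ) → ℝ) (_ : IsRegressionLaw P C p b)
      (j₁ j₂ n : ℕ), B.J₀ ≤ j₁ → B.J₀ ≤ j₂ → 0 < n →
    ∫⁻ ω, ENNReal.ofReal ((B.psiMC j₁ j₂ ω - psi P) ^ 2) ∂(sampleLaw 3 n P)
      ≤ ENNReal.ofReal (C' * (1 / n + (∫ x, p x * b x ∂cubeVol d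
          - B.projInner (min j₁ j₂) p b) ^ 2 + (((2 : ℝ) ^ min j₁ j₂) ^ d / n) ^ 2
          + 1 / n * ((1 + ((2 : ℝ) ^ max j₁ j₂) ^ d / n) *
        (1 + ((2 : ℝ) ^ min j₁ j₂) ^ d / n + (((2 : ℝ) ^ min j₁ j₂) ^ d / n) ^ 2)))) := by
  obtain ⟨C₁, hC₁, h⟩ := B.exists_plugin_error d C
  obtain ⟨C₂, hC₂, h'⟩ := B.exists_lintegral_sq_prod_le d C
  refine ⟨2 * C ^ 4 + 4 * C₁ + 4 * C₂, by positivity, ?_⟩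
  intro P p b hP j₁ j₂ n h₁ h₂ hn
  have := hP.isProb
  have hplug := h P p b hP j₁ j₂ n h₁ h₂ hn
  have hmom := h' P hP.mp hP.regA.bound hP.regY.bound j₁ j₂ n hn
  have hmean := hP.lintegral_sq_mean_AY_le hn
  set E := ∫ x, p x * b x ∂cubeVol d with hE
  set q := ∫ o, obsA o * obsY o ∂P with hq
  set ν : Measure (Fin n → Obs d) := Measure.pi fun _ => P with hν
  set φ : (Fin n → Obs d) → Obs d → ℝ := fun D o =>
    -(B.regHat obsA j₁ D (obsX o) * B.regHat obsY j₂ D (obsX o)) with hφ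
  set F : (Fin n → Obs d) → ℝ := fun D => (1 / n : ℝ) * ∑ i, obsA (D i) * obsY (D i) - q with hF
  set G : (Fin n → Obs d) → ℝ := fun D =>
    E - ∫ x, B.regHat obsA j₁ D x * B.regHat obsY j₂ D x ∂cubeVol d with hG
  set N : (Fin n → Obs d) × (Fin n → Obs d) → ℝ := fun w =>
    (1 / n : ℝ) * ∑ i, φ w.1 (w.2 i) - ∫ z, φ w.1 z ∂P with hN
  have hprodm : ∀ D : Fin n → Obs d, MemLp (fun x => B.regHat obsA j₁ D x * B.regHat obsY j₂ D x) ⊤ (cubeVol d) :=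
    fun D => (B.memLp_regHat _ _ _).mul_top (B.memLp_regHat _ _ _)
  have hφint : ∀ D : Fin n → Obs d, ∫ z, φ D z ∂P
      = -∫ x, B.regHat obsA j₁ D x * B.regHat obsY j₂ D x ∂cubeVol d := by
    intro D
    rw [← integral_comp_obsX hP.mp (hprodm D).1, ← integral_neg]
  have hφm : Measurable fun w : (Fin n → Obs d) × Obs d => φ w.1 w.2 := by
    have e : ∀ {f : Obs d → ℝ} (_ : Measurable f) (j : ℕ),
        Measurable fun w : (Fin n → Obs d) × Obs d => B.regHat f j w.1 (obsX w.2) := fun hf j =>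
      (B.measurable_regHat hf j).comp
        (measurable_fst.prodMk (measurable_obsX.comp measurable_snd))
    exact ((e measurable_obsA j₁).mul (e measurable_obsY j₂)).neg
  have hφb : ∀ D : Fin n → Obs d, MemLp (φ D) ⊤ P := fun D => ((hprodm D).comp_measurePreserving hP.mp).neg
  have hnoise := lintegral_sq_mean_sub_le (ν := ν) hn hφm hφb
  have hφsq : ∀ D : Fin n → Obs d, ∫⁻ z, ENNReal.ofReal (φ D z ^ 2) ∂P = ∫⁻ x, ENNReal.ofReal
      ((B.regHat obsA j₁ D x * B.regHat obsY j₂ D x) ^ 2) ∂cubeVol d := by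
    intro D
    have hDm : Measurable fun x => ENNReal.ofReal
        ((B.regHat obsA j₁ D x * B.regHat obsY j₂ D x) ^ 2) := by
      have e : ∀ {f : Obs d → ℝ} (_ : Measurable f) (j : ℕ), Measurable fun x => B.regHat f j D x :=
        fun hf j => (B.measurable_regHat hf j).comp (measurable_const.prodMk measurable_id)
      exact (((e measurable_obsA j₁).mul (e measurable_obsY j₂)).pow_const 2).ennreal_ofReal
    rw [← lintegral_comp_obsX hP.mp hDm]
    simp only [hφ, neg_sq]
  simp_rw [hφsq] at hnoise
  have hFm : Measurable fun D => ENNReal.ofReal (F D ^ 2) :=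
    ((measurable_mean_AY.sub_const _).pow_const 2).ennreal_ofReal
  have hGm : Measurable fun D => ENNReal.ofReal (G D ^ 2) :=
    (((B.measurable_integral_regHat_mul measurable_obsA measurable_obsY j₁ j₂).const_sub _).pow_const
      2).ennreal_ofReal
  have hNm : Measurable fun w => ENNReal.ofReal (N w ^ 2) :=
    ((measurable_mean_sub_integral hφm).pow_const 2).ennreal_ofReal
  -- given the first subsample, the last term is an average of independent centred variables
  have hdec : ∀ ω : Sample d 3 n, B.psiMC j₁ j₂ ω - psi P
      = F (ω 1) + (G (ω 0) + N (ω 0, ω 2)) := by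
    intro ω
    simp only [psiMC, hF, hG, hN, hφint, hP.psi_eq, pHat_eq, bHat_eq]
    simp only [hφ, Finset.sum_neg_distrib]
    ring
  simp_rw [hdec]
  set R : ℝ := (E - B.projInner (min j₁ j₂) p b) ^ 2 with hR
  set Q : ℝ := (((2 : ℝ) ^ min j₁ j₂) ^ d / n) ^ 2 with hQ
  set W : ℝ := (1 + ((2 : ℝ) ^ max j₁ j₂) ^ d / n) *
        (1 + ((2 : ℝ) ^ min j₁ j₂) ^ d / n + Q) with hW
  have hR0 : 0 ≤ R := sq_nonneg _
  have hQ0 : 0 ≤ Q := sq_nonneg _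
  have hW0 : 0 ≤ W := by positivity
  have hn0 : (0 : ℝ) ≤ 1 / n := by positivity
  have hF1 : Measurable fun ω : Sample d 3 n => ENNReal.ofReal (F (ω 1) ^ 2) :=
    hFm.comp (measurable_pi_apply 1)
  have hG0 : Measurable fun ω : Sample d 3 n => ENNReal.ofReal (G (ω 0) ^ 2) :=
    hGm.comp (measurable_pi_apply 0)
  have hN0 : Measurable fun ω : Sample d 3 n => ENNReal.ofReal (N (ω 0, ω 2) ^ 2) :=
    hNm.comp ((measurable_pi_apply 0).prodMk (measurable_pi_apply 2))
  have hGN : Measurable fun ω : Sample d 3 n => 2 * ENNReal.ofReal (G (ω 0) ^ 2)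
      + 2 * ENNReal.ofReal (N (ω 0, ω 2) ^ 2) := (hG0.const_mul 2).add (hN0.const_mul 2)
  calc _ ≤ ∫⁻ ω : Sample d 3 n, (2 * ENNReal.ofReal (F (ω 1) ^ 2)
        + 2 * (2 * ENNReal.ofReal (G (ω 0) ^ 2) + 2 * ENNReal.ofReal (N (ω 0, ω 2) ^ 2)))
        ∂(sampleLaw 3 n P) :=
        lintegral_mono fun ω => (ofReal_sq_add_le _ _).trans
          (by gcongr; exact ofReal_sq_add_le _ _)
    _ = 2 * ∫⁻ D, ENNReal.ofReal (F D ^ 2) ∂ν + 2 * (2 * ∫⁻ D, ENNReal.ofReal (G D ^ 2) ∂ν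
        + 2 * ∫⁻ w, ENNReal.ofReal (N w ^ 2) ∂(ν.prod ν)) := by
        rw [lintegral_add_left (hF1.const_mul 2), lintegral_const_mul _ hF1,
          lintegral_const_mul _ hGN,
          lintegral_add_left (hG0.const_mul 2), lintegral_const_mul _ hG0,
          lintegral_const_mul _ hN0,
          lintegral_sampleLaw_eval hFm, lintegral_sampleLaw_eval hGm,
          lintegral_sampleLaw_pair hNm (by decide)]
    _ ≤ 2 * ENNReal.ofReal (C ^ 4 * (1 / n)) + 2 * (2 * ENNReal.ofReal (C₁ * (1 / n + R + Q))
        + 2 * (ENNReal.ofReal (1 / n) * ENNReal.ofReal (C₂ * W))) := by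
        gcongr
        exact hnoise.trans (by gcongr)
    _ = ENNReal.ofReal (2 * (C ^ 4 * (1 / n)) + 2 * (2 * (C₁ * (1 / n + R + Q))
        + 2 * (1 / n * (C₂ * W)))) := by
        rw [ENNReal.ofReal_add (by positivity) (by positivity),
          ENNReal.ofReal_mul (p := 2) (by positivity), ENNReal.ofReal_mul (p := 2) (by positivity),
          ENNReal.ofReal_add (by positivity) (by positivity),
          ENNReal.ofReal_mul (p := 2) (by positivity), ENNReal.ofReal_mul (p := 2) (by positivity),
          ENNReal.ofReal_mul (p := 1 / (n : ℝ)) (by positivity)]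
        simp
    _ ≤ _ := by
        refine ENNReal.ofReal_le_ofReal ?_
        have h4 : 0 ≤ C ^ 4 := by positivity
        have h5 : 0 ≤ 1 / n * W := by positivity
        have h6 : 0 ≤ 1 / (n : ℝ) + R + Q := by positivity
        have h7 : (1 / n : ℝ) ≤ 1 / n + R + Q := by linarith
        calc _ ≤ 2 * (C ^ 4 * (1 / n + R + Q)) + 2 * (2 * (C₁ * (1 / n + R + Q))
            + 2 * (1 / n * (C₂ * W))) := by gcongr
          _ ≤ _ := by
            nlinarith [mul_nonneg h4 h5, mul_nonneg hC₁.le h5, mul_nonneg hC₂.le h6]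

/-- The risk of the bias-corrected estimator. The approximation error is that of the larger space. -/
theorem exists_risk_IF_le (d : ℕ) (C : ℝ) : ∃ C' : ℝ, 0 < C' ∧
    ∀ (P : Measure (Obs d)) (p b : (Fin d → ℝ) → ℝ) (_ : IsRegressionLaw P C p b)
      (j₁ j₂ n : ℕ), B.J₀ ≤ j₁ → B.J₀ ≤ j₂ → 0 < n →
    ∫⁻ w : (Fin n → Obs d) × (Fin n → Obs d),
        ENNReal.ofReal ((B.psiIF j₁ j₂ ![w.1, w.2] - psi P) ^ 2)
        ∂((Measure.pi fun _ => P).prod (Measure.pi fun _ => P))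
      ≤ ENNReal.ofReal (C' * (1 / n + (∫ x, p x * b x ∂cubeVol d
          - B.projInner (max j₁ j₂) p b) ^ 2 + (((2 : ℝ) ^ min j₁ j₂) ^ d / n) ^ 2
          + 1 / n * ((1 + ((2 : ℝ) ^ max j₁ j₂) ^ d / n) *
        (1 + ((2 : ℝ) ^ min j₁ j₂) ^ d / n + (((2 : ℝ) ^ min j₁ j₂) ^ d / n) ^ 2)))) := by
  obtain ⟨C₁, hC₁, h⟩ := B.exists_corrected_error d C
  obtain ⟨C₂, hC₂, h'⟩ := B.exists_lintegral_sq_prod_le d C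
  obtain ⟨C₃, hC₃, h''⟩ := B.exists_lintegral_sq_regHat_le d C
  refine ⟨2 * C₁ + 8 * (C ^ 4 + 2 * C ^ 2 * C₃ + C₂), by positivity, ?_⟩
  intro P p b hP j₁ j₂ n h₁ h₂ hn
  have := hP.isProb
  have hcorr := h P p b hP j₁ j₂ n h₁ h₂ hn
  have hmom := h' P hP.mp hP.regA.bound hP.regY.bound j₁ j₂ n hn
  have hmomA := h'' P obsA hP.mp measurable_obsA hP.regA.bound j₁ n hn
  have hmomY := h'' P obsY hP.mp measurable_obsY hP.regY.bound j₂ n hn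
  set ν : Measure (Fin n → Obs d) := Measure.pi fun _ => P with hν
  set φ : (Fin n → Obs d) → Obs d → ℝ := fun D o =>
    (obsA o - B.regHat obsA j₁ D (obsX o)) * (obsY o - B.regHat obsY j₂ D (obsX o)) with hφ
  set G : (Fin n → Obs d) → ℝ := fun D => ∫ x, p x * b x ∂cubeVol d
        - ∫ x, p x * B.regHat obsY j₂ D x ∂cubeVol d - ∫ x, b x * B.regHat obsA j₁ D x ∂cubeVol d
        + ∫ x, B.regHat obsA j₁ D x * B.regHat obsY j₂ D x ∂cubeVol d with hG
  set N : (Fin n → Obs d) × (Fin n → Obs d) → ℝ := fun w =>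
    (1 / n : ℝ) * ∑ i, φ w.1 (w.2 i) - ∫ z, φ w.1 z ∂P with hN
  have hAm := hP.regA.memLp_var
  have hYm := hP.regY.memLp_var
  have hpm : ∀ D : Fin n → Obs d, MemLp (fun o => B.regHat obsA j₁ D (obsX o)) ⊤ P := fun D =>
    (B.memLp_regHat _ _ _).comp_measurePreserving hP.mp
  have hbm : ∀ D : Fin n → Obs d, MemLp (fun o => B.regHat obsY j₂ D (obsX o)) ⊤ P := fun D =>
    (B.memLp_regHat _ _ _).comp_measurePreserving hP.mp
  have hφb : ∀ D : Fin n → Obs d, MemLp (φ D) ⊤ P := fun D => (hAm.sub (hpm D)).mul_top (hYm.sub (hbm D))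
  -- the conditional mean of a summand is the functional plus the product-type bias `G D`
  have hφint : ∀ D : Fin n → Obs d, ∫ z, φ D z ∂P = psi P + G D := by
    intro D
    have i1 := hAm.integrable_mul_top hYm
    have i2 := hAm.integrable_mul_top (hbm D)
    have i3 := hYm.integrable_mul_top (hpm D)
    have i4 := (hpm D).integrable_mul_top (hbm D)
    have i12 : Integrable (fun o => obsA o * obsY o - obsA o * B.regHat obsY j₂ D (obsX o)) P :=
      i1.sub i2
    have i34 : Integrable (fun o => obsY o * B.regHat obsA j₁ D (obsX o)
      - B.regHat obsA j₁ D (obsX o) * B.regHat obsY j₂ D (obsX o)) P := i3.sub i4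
    have e : ∀ o, φ D o = (obsA o * obsY o - obsA o * B.regHat obsY j₂ D (obsX o))
        - (obsY o * B.regHat obsA j₁ D (obsX o)
          - B.regHat obsA j₁ D (obsX o) * B.regHat obsY j₂ D (obsX o)) := by
      intro o; simp only [hφ]; ring
    simp_rw [e]
    rw [integral_sub i12 i34, integral_sub i1 i2, integral_sub i3 i4,
      hP.regA.integral_mul _ (B.memLp_regHat _ _ _), hP.regY.integral_mul _ (B.memLp_regHat _ _ _),
      integral_comp_obsX hP.mp (h := fun x => B.regHat obsA j₁ D x * B.regHat obsY j₂ D x)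
        ((B.memLp_regHat _ _ _).mul_top (B.memLp_regHat _ _ _)).1, hP.psi_eq, hG]
    ring
  have hrm : ∀ {f : Obs d → ℝ} (_ : Measurable f) (j : ℕ),
        Measurable fun w : (Fin n → Obs d) × Obs d => B.regHat f j w.1 (obsX w.2) := fun hf j =>
      (B.measurable_regHat hf j).comp
        (measurable_fst.prodMk (measurable_obsX.comp measurable_snd))
  have hφm : Measurable fun w : (Fin n → Obs d) × Obs d => φ w.1 w.2 :=
    ((measurable_obsA.comp measurable_snd).sub (hrm measurable_obsA j₁)).mul
      ((measurable_obsY.comp measurable_snd).sub (hrm measurable_obsY j₂))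
  have hnoise := lintegral_sq_mean_sub_le (ν := ν) hn hφm hφb
  have hGm : Measurable fun D => ENNReal.ofReal (G D ^ 2) :=
    ((((measurable_const.sub (B.measurable_integral_mul_regHat hP.regA.memLp measurable_obsY j₂)).sub
      (B.measurable_integral_mul_regHat hP.regY.memLp measurable_obsA j₁)).add
      (B.measurable_integral_regHat_mul measurable_obsA measurable_obsY j₁ j₂)).pow_const
      2).ennreal_ofReal
  have hsqm : ∀ {f : Obs d → ℝ} (_ : Measurable f) (j : ℕ) (D : Fin n → Obs d),
      Measurable fun x => B.regHat f j D x := fun hf j D =>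
    (B.measurable_regHat hf j).comp (measurable_const.prodMk measurable_id)
  -- the conditional second moment of a summand
  have hφsq : ∀ D : Fin n → Obs d, ∫⁻ z, ENNReal.ofReal (φ D z ^ 2) ∂P ≤
      4 * (ENNReal.ofReal (C ^ 4)
        + ENNReal.ofReal (C ^ 2) * ∫⁻ x, ENNReal.ofReal (B.regHat obsA j₁ D x ^ 2) ∂cubeVol d
        + ENNReal.ofReal (C ^ 2) * ∫⁻ x, ENNReal.ofReal (B.regHat obsY j₂ D x ^ 2) ∂cubeVol d
        + ∫⁻ x, ENNReal.ofReal ((B.regHat obsA j₁ D x * B.regHat obsY j₂ D x) ^ 2) ∂cubeVol d) := by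
    intro D
    have m1 : Measurable fun x => ENNReal.ofReal (B.regHat obsA j₁ D x ^ 2) :=
      ((hsqm measurable_obsA j₁ D).pow_const 2).ennreal_ofReal
    have m2 : Measurable fun x => ENNReal.ofReal (B.regHat obsY j₂ D x ^ 2) :=
      ((hsqm measurable_obsY j₂ D).pow_const 2).ennreal_ofReal
    have m3 : Measurable fun x => ENNReal.ofReal
        ((B.regHat obsA j₁ D x * B.regHat obsY j₂ D x) ^ 2) :=
      (((hsqm measurable_obsA j₁ D).mul (hsqm measurable_obsY j₂ D)).pow_const 2).ennreal_ofReal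
    have mc : Measurable fun _ : Fin d → ℝ => ENNReal.ofReal (C ^ 4) := measurable_const
    calc ∫⁻ z, ENNReal.ofReal (φ D z ^ 2) ∂P
        ≤ ∫⁻ o, (fun x => 4 * (ENNReal.ofReal (C ^ 4)
            + ENNReal.ofReal (C ^ 2) * ENNReal.ofReal (B.regHat obsA j₁ D x ^ 2)
            + ENNReal.ofReal (C ^ 2) * ENNReal.ofReal (B.regHat obsY j₂ D x ^ 2)
            + ENNReal.ofReal ((B.regHat obsA j₁ D x * B.regHat obsY j₂ D x) ^ 2))) (obsX o) ∂P := by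
          refine lintegral_mono_ae ?_
          filter_upwards [hP.regA.bound, hP.regY.bound] with o ha hy
          have ha := sq_le_sq.2 (ha.trans (le_abs_self C))
          have hy := sq_le_sq.2 (hy.trans (le_abs_self C))
          have e4 : (4 : ℝ≥0∞) = ENNReal.ofReal 4 := by simp
          rw [← ENNReal.ofReal_mul (sq_nonneg C), ← ENNReal.ofReal_mul (sq_nonneg C),
            ← ENNReal.ofReal_add (by positivity) (by positivity),
            ← ENNReal.ofReal_add (by positivity) (by positivity),
            ← ENNReal.ofReal_add (by positivity) (by positivity), e4,
            ← ENNReal.ofReal_mul (by norm_num)]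
          refine ENNReal.ofReal_le_ofReal ?_
          simp only [hφ]
          set s := B.regHat obsA j₁ D (obsX o)
          set t := B.regHat obsY j₂ D (obsX o)
          have h1 : (obsA o - s) ^ 2 ≤ 2 * (C ^ 2 + s ^ 2) := by nlinarith [sq_nonneg (obsA o + s)]
          have h2 : (obsY o - t) ^ 2 ≤ 2 * (C ^ 2 + t ^ 2) := by nlinarith [sq_nonneg (obsY o + t)]
          calc ((obsA o - s) * (obsY o - t)) ^ 2 = (obsA o - s) ^ 2 * (obsY o - t) ^ 2 := mul_pow _ _ _
            _ ≤ (2 * (C ^ 2 + s ^ 2)) * (2 * (C ^ 2 + t ^ 2)) := by gcongr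
            _ = _ := by ring
      _ = _ := by
          have m12 : Measurable fun x => ENNReal.ofReal (C ^ 4)
              + ENNReal.ofReal (C ^ 2) * ENNReal.ofReal (B.regHat obsA j₁ D x ^ 2) :=
            mc.add (m1.const_mul _)
          have m123 : Measurable fun x => ENNReal.ofReal (C ^ 4)
              + ENNReal.ofReal (C ^ 2) * ENNReal.ofReal (B.regHat obsA j₁ D x ^ 2)
              + ENNReal.ofReal (C ^ 2) * ENNReal.ofReal (B.regHat obsY j₂ D x ^ 2) :=
            m12.add (m2.const_mul _)
          have m1234 : Measurable fun x => ENNReal.ofReal (C ^ 4)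
              + ENNReal.ofReal (C ^ 2) * ENNReal.ofReal (B.regHat obsA j₁ D x ^ 2)
              + ENNReal.ofReal (C ^ 2) * ENNReal.ofReal (B.regHat obsY j₂ D x ^ 2)
              + ENNReal.ofReal ((B.regHat obsA j₁ D x * B.regHat obsY j₂ D x) ^ 2) := m123.add m3
          have m4 : Measurable fun x => 4 * (ENNReal.ofReal (C ^ 4)
              + ENNReal.ofReal (C ^ 2) * ENNReal.ofReal (B.regHat obsA j₁ D x ^ 2)
              + ENNReal.ofReal (C ^ 2) * ENNReal.ofReal (B.regHat obsY j₂ D x ^ 2)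
              + ENNReal.ofReal ((B.regHat obsA j₁ D x * B.regHat obsY j₂ D x) ^ 2)) :=
            m1234.const_mul 4
          rw [lintegral_comp_obsX hP.mp m4, lintegral_const_mul _ m1234, lintegral_add_left m123,
            lintegral_add_left m12, lintegral_add_left mc,
            lintegral_const_mul _ m1, lintegral_const_mul _ m2]
          simp
  -- conditional bias plus conditionally centred noise
  have hdec : ∀ w : (Fin n → Obs d) × (Fin n → Obs d), B.psiIF j₁ j₂ ![w.1, w.2] - psi P
      = G w.1 + N w := by
    intro w
    simp only [psiIF, hN, hφint, pHat_eq, bHat_eq, Matrix.cons_val_zero, Matrix.cons_val_one]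
    simp only [hφ]
    ring
  simp_rw [hdec]
  set R : ℝ := (∫ x, p x * b x ∂cubeVol d - B.projInner (max j₁ j₂) p b) ^ 2 with hR
  set Q : ℝ := (((2 : ℝ) ^ min j₁ j₂) ^ d / n) ^ 2 with hQ
  set W : ℝ := (1 + ((2 : ℝ) ^ max j₁ j₂) ^ d / n) *
        (1 + ((2 : ℝ) ^ min j₁ j₂) ^ d / n + Q) with hW
  have hR0 : 0 ≤ R := sq_nonneg _
  have hQ0 : 0 ≤ Q := sq_nonneg _
  have hW1 : 1 ≤ W := by
    have a1 : 0 ≤ ((2 : ℝ) ^ max j₁ j₂) ^ d / n := by positivity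
    have a2 : 0 ≤ ((2 : ℝ) ^ min j₁ j₂) ^ d / n := by positivity
    rw [hW]; nlinarith [mul_nonneg a1 a2, mul_nonneg a1 hQ0]
  -- the second moments of the single estimators are dominated by the bound for the product
  have hkW : ∀ j, j ≤ max j₁ j₂ → 1 + ((2 : ℝ) ^ j) ^ d / n ≤ W := by
    intro j hj
    have a2 : 0 ≤ ((2 : ℝ) ^ min j₁ j₂) ^ d / n := by positivity
    have a3 : 1 + ((2 : ℝ) ^ j) ^ d / n ≤ 1 + ((2 : ℝ) ^ max j₁ j₂) ^ d / n := by
      gcongr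
      norm_num
    have a4 : 0 ≤ 1 + ((2 : ℝ) ^ max j₁ j₂) ^ d / n := by positivity
    rw [hW]
    nlinarith [mul_nonneg a4 a2, mul_nonneg a4 hQ0]
  have hW0 : 0 ≤ W := by linarith
  have hn0 : (0 : ℝ) ≤ 1 / n := by positivity
  have hmomA' : ∫⁻ D, ∫⁻ x, ENNReal.ofReal (B.regHat obsA j₁ D x ^ 2) ∂cubeVol d ∂ν
      ≤ ENNReal.ofReal (C₃ * W) :=
    hmomA.trans (ENNReal.ofReal_le_ofReal (by gcongr; exact hkW _ (le_max_left _ _)))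
  have hmomY' : ∫⁻ D, ∫⁻ x, ENNReal.ofReal (B.regHat obsY j₂ D x ^ 2) ∂cubeVol d ∂ν
      ≤ ENNReal.ofReal (C₃ * W) :=
    hmomY.trans (ENNReal.ofReal_le_ofReal (by gcongr; exact hkW _ (le_max_right _ _)))
  have hGm' : Measurable fun w : (Fin n → Obs d) × (Fin n → Obs d) =>
      ENNReal.ofReal (G w.1 ^ 2) := hGm.comp measurable_fst
  have hinner : ∀ {f : Obs d → ℝ} (_ : Measurable f) (j : ℕ), Measurable fun D : Fin n → Obs d =>
      ∫⁻ x, ENNReal.ofReal (B.regHat f j D x ^ 2) ∂cubeVol d := fun hf j =>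
    ((B.measurable_regHat hf j).pow_const 2).ennreal_ofReal.lintegral_prod_right'
  have hnoise2 : ∫⁻ D, ∫⁻ z, ENNReal.ofReal (φ D z ^ 2) ∂P ∂ν
      ≤ 4 * (ENNReal.ofReal (C ^ 4) + ENNReal.ofReal (C ^ 2) * ENNReal.ofReal (C₃ * W)
        + ENNReal.ofReal (C ^ 2) * ENNReal.ofReal (C₃ * W) + ENNReal.ofReal (C₂ * W)) := by
    refine (lintegral_mono hφsq).trans ?_
    have mc : Measurable fun _ : Fin n → Obs d => ENNReal.ofReal (C ^ 4) := measurable_const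
    have m12 : Measurable fun D : Fin n → Obs d => ENNReal.ofReal (C ^ 4) + ENNReal.ofReal (C ^ 2)
        * ∫⁻ x, ENNReal.ofReal (B.regHat obsA j₁ D x ^ 2) ∂cubeVol d :=
      mc.add ((hinner measurable_obsA j₁).const_mul _)
    have m123 : Measurable fun D : Fin n → Obs d => ENNReal.ofReal (C ^ 4)
        + ENNReal.ofReal (C ^ 2) * ∫⁻ x, ENNReal.ofReal (B.regHat obsA j₁ D x ^ 2) ∂cubeVol d
        + ENNReal.ofReal (C ^ 2) * ∫⁻ x, ENNReal.ofReal (B.regHat obsY j₂ D x ^ 2) ∂cubeVol d :=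
      m12.add ((hinner measurable_obsY j₂).const_mul _)
    rw [lintegral_const_mul' _ _ (by simp), lintegral_add_left m123, lintegral_add_left m12,
      lintegral_add_left mc, lintegral_const_mul _ (hinner measurable_obsA j₁),
      lintegral_const_mul _ (hinner measurable_obsY j₂)]
    simp only [lintegral_const, measure_univ, mul_one]
    gcongr
  calc _ ≤ ∫⁻ w, (2 * ENNReal.ofReal (G w.1 ^ 2) + 2 * ENNReal.ofReal (N w ^ 2)) ∂(ν.prod ν) :=
        lintegral_mono fun w => ofReal_sq_add_le _ _
    _ = 2 * ∫⁻ D, ENNReal.ofReal (G D ^ 2) ∂ν + 2 * ∫⁻ w, ENNReal.ofReal (N w ^ 2) ∂(ν.prod ν) := by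
        rw [lintegral_add_left (hGm'.const_mul 2), lintegral_const_mul _ hGm',
          lintegral_const_mul' _ _ (by simp)]
        congr 2
        rw [lintegral_prod _ hGm'.aemeasurable]
        simp
    _ ≤ 2 * ENNReal.ofReal (C₁ * (1 / n + R + Q)) + 2 * (ENNReal.ofReal (1 / n) *
        (4 * (ENNReal.ofReal (C ^ 4) + ENNReal.ofReal (C ^ 2) * ENNReal.ofReal (C₃ * W)
        + ENNReal.ofReal (C ^ 2) * ENNReal.ofReal (C₃ * W) + ENNReal.ofReal (C₂ * W)))) := by
        gcongr
        exact hnoise.trans (by gcongr)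
    _ = ENNReal.ofReal (2 * (C₁ * (1 / n + R + Q)) + 2 * ((1 / n) *
        (4 * (C ^ 4 + C ^ 2 * (C₃ * W) + C ^ 2 * (C₃ * W) + C₂ * W)))) := by
        have e2 : (2 : ℝ≥0∞) = ENNReal.ofReal 2 := by simp
        have e4 : (4 : ℝ≥0∞) = ENNReal.ofReal 4 := by simp
        rw [← ENNReal.ofReal_mul (sq_nonneg C), ← ENNReal.ofReal_add (by positivity) (by positivity),
          ← ENNReal.ofReal_add (by positivity) (by positivity),
          ← ENNReal.ofReal_add (by positivity) (by positivity), e4,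
          ← ENNReal.ofReal_mul (by positivity), ← ENNReal.ofReal_mul (by positivity), e2,
          ← ENNReal.ofReal_mul (by positivity), ← ENNReal.ofReal_mul (by positivity),
          ← ENNReal.ofReal_add (by positivity) (by positivity)]
    _ ≤ _ := by
        refine ENNReal.ofReal_le_ofReal ?_
        have h4 : 0 ≤ C ^ 4 := by positivity
        have h5 : 0 ≤ 1 / n * W := by positivity
        have h6 : 0 ≤ 1 / (n : ℝ) + R + Q := by positivity
        have h8 : 0 ≤ C ^ 2 * C₃ := by positivity
        calc _ ≤ 2 * (C₁ * (1 / n + R + Q)) + 2 * ((1 / n) *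
              (4 * (C ^ 4 * W + C ^ 2 * (C₃ * W) + C ^ 2 * (C₃ * W) + C₂ * W))) := by
              gcongr
              nlinarith
          _ ≤ _ := by
              nlinarith [mul_nonneg h4 h6, mul_nonneg hC₁.le h5, mul_nonneg hC₂.le h6,
                mul_nonneg h8 h6]

end CDVBasis

/-! ### Two-point laws with prescribed regression functions -/

/-- The uniform distribution on the two endpoints `C₁` and `C₂`. -/
noncomputable def endpointLaw (C₁ C₂ : ℝ) : Measure ℝ :=
  (2⁻¹ : ℝ≥0∞) • Measure.dirac C₁ + (2⁻¹ : ℝ≥0∞) • Measure.dirac C₂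

/-- The affine map that sends the endpoints `C₁` and `C₂` to `-1` and `1`. -/
noncomputable def code (C₁ C₂ t : ℝ) : ℝ := (2 * t - C₁ - C₂) / (C₂ - C₁)

/-- The inverse of `code`. -/
noncomputable def decode (C₁ C₂ s : ℝ) : ℝ := (C₁ + C₂) / 2 + (C₂ - C₁) / 2 * s

/-- The law under which `X`, `A` and `Y` are independent, `X` is uniform on the cube, and `A` and
`Y` are uniform on the endpoints. -/
noncomputable def baseLaw (d : ℕ) (C₁ C₂ : ℝ) : Measure (Obs d) :=
  (cubeVol d).prod ((endpointLaw C₁ C₂).prod (endpointLaw C₁ C₂))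

/-- The density, with respect to `baseLaw`, of the law for which, after coding the endpoints as
`-1` and `1`, the regression functions of `A`, `Y` and `A * Y` are `u`, `v` and `w`. -/
noncomputable def obsDensity {d : ℕ} (C₁ C₂ : ℝ) (u v w : (Fin d → ℝ) → ℝ) (o : Obs d) : ℝ :=
  1 + code C₁ C₂ (obsA o) * u (obsX o) + code C₁ C₂ (obsY o) * v (obsX o)
    + code C₁ C₂ (obsA o) * code C₁ C₂ (obsY o) * w (obsX o)

/-- The law with density `obsDensity`. -/
noncomputable def obsLaw {d : ℕ} (C₁ C₂ : ℝ) (u v w : (Fin d → ℝ) → ℝ) : Measure (Obs d) :=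
  (baseLaw d C₁ C₂).withDensity fun o => ENNReal.ofReal (obsDensity C₁ C₂ u v w o)

/-- The functions `u`, `v` and `w` are measurable and give a nonnegative density. -/
structure IsAdmissible {d : ℕ} (u v w : (Fin d → ℝ) → ℝ) : Prop where
  measurable_u : Measurable u
  measurable_v : Measurable v
  measurable_w : Measurable w
  nonneg : ∀ s t : ℝ, s ^ 2 = 1 → t ^ 2 = 1 → ∀ x, 0 ≤ 1 + s * u x + t * v x + s * t * w x

theorem MemLp.of_measurable_of_abs_le {Ω : Type*} [MeasurableSpace Ω] {μ : Measure Ω} {f : Ω → ℝ}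
    (hf : Measurable f) {C : ℝ} (h : ∀ x, |f x| ≤ C) : MemLp f ⊤ μ :=
  memLp_top_of_bound hf.aestronglyMeasurable C (Filter.Eventually.of_forall h)

section Admissible

variable {d : ℕ} {u v w : (Fin d → ℝ) → ℝ}

theorem IsAdmissible.abs_le_u (h : IsAdmissible u v w) (x : Fin d → ℝ) : |u x| ≤ 1 := by
  have h1 := h.nonneg 1 1 (by norm_num) (by norm_num) x
  have h2 := h.nonneg 1 (-1) (by norm_num) (by norm_num) x
  have h3 := h.nonneg (-1) 1 (by norm_num) (by norm_num) x
  have h4 := h.nonneg (-1) (-1) (by norm_num) (by norm_num) x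
  rw [abs_le]; constructor <;> linarith

theorem IsAdmissible.abs_le_v (h : IsAdmissible u v w) (x : Fin d → ℝ) : |v x| ≤ 1 := by
  have h1 := h.nonneg 1 1 (by norm_num) (by norm_num) x
  have h2 := h.nonneg 1 (-1) (by norm_num) (by norm_num) x
  have h3 := h.nonneg (-1) 1 (by norm_num) (by norm_num) x
  have h4 := h.nonneg (-1) (-1) (by norm_num) (by norm_num) x
  rw [abs_le]; constructor <;> linarith

theorem IsAdmissible.abs_le_w (h : IsAdmissible u v w) (x : Fin d → ℝ) : |w x| ≤ 1 := by
  have h1 := h.nonneg 1 1 (by norm_num) (by norm_num) x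
  have h2 := h.nonneg 1 (-1) (by norm_num) (by norm_num) x
  have h3 := h.nonneg (-1) 1 (by norm_num) (by norm_num) x
  have h4 := h.nonneg (-1) (-1) (by norm_num) (by norm_num) x
  rw [abs_le]; constructor <;> linarith

theorem IsAdmissible.memLp_u (h : IsAdmissible u v w) : MemLp u ⊤ (cubeVol d) :=
  MemLp.of_measurable_of_abs_le h.measurable_u h.abs_le_u

theorem IsAdmissible.memLp_v (h : IsAdmissible u v w) : MemLp v ⊤ (cubeVol d) :=
  MemLp.of_measurable_of_abs_le h.measurable_v h.abs_le_v

theorem IsAdmissible.memLp_w (h : IsAdmissible u v w) : MemLp w ⊤ (cubeVol d) :=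
  MemLp.of_measurable_of_abs_le h.measurable_w h.abs_le_w

end Admissible

section Base

variable {d : ℕ} {C₁ C₂ : ℝ}

instance : IsProbabilityMeasure (endpointLaw C₁ C₂) :=
  ⟨by simp [endpointLaw, ENNReal.inv_two_add_inv_two]⟩

instance : IsProbabilityMeasure (baseLaw d C₁ C₂) := by unfold baseLaw; infer_instance

theorem ae_endpointLaw {p : ℝ → Prop} (h₁ : p C₁) (h₂ : p C₂) : ∀ᵐ t ∂endpointLaw C₁ C₂, p t := by
  unfold endpointLaw
  rw [ae_add_measure_iff]
  exact ⟨Measure.ae_smul_measure ((ae_dirac_eq (a := C₁)).symm ▸ h₁) _,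
    Measure.ae_smul_measure ((ae_dirac_eq (a := C₂)).symm ▸ h₂) _⟩

theorem integral_endpointLaw (f : ℝ → ℝ) : ∫ t, f t ∂endpointLaw C₁ C₂ = (f C₁ + f C₂) / 2 := by
  have i : ∀ a, Integrable f ((2⁻¹ : ℝ≥0∞) • Measure.dirac a) := fun a =>
    (integrable_dirac (by simp)).smul_measure (by simp)
  unfold endpointLaw
  rw [integral_add_measure (i _) (i _), integral_smul_measure, integral_smul_measure,
    integral_dirac, integral_dirac]
  simp
  ring

theorem measurable_code : Measurable (code C₁ C₂) := by unfold code; fun_prop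

theorem code_left (h : C₁ < C₂) : code C₁ C₂ C₁ = -1 := by
  have : C₂ - C₁ ≠ 0 := by linarith
  unfold code; field_simp; ring

theorem code_right (h : C₁ < C₂) : code C₁ C₂ C₂ = 1 := by
  have : C₂ - C₁ ≠ 0 := by linarith
  unfold code; field_simp; ring

theorem decode_code (h : C₁ < C₂) (t : ℝ) : decode C₁ C₂ (code C₁ C₂ t) = t := by
  have : C₂ - C₁ ≠ 0 := by linarith
  unfold code decode; field_simp; ring

theorem integral_code (h : C₁ < C₂) : ∫ t, code C₁ C₂ t ∂endpointLaw C₁ C₂ = 0 := by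
  rw [integral_endpointLaw, code_left h, code_right h]; norm_num

theorem ae_baseLaw {p : ℝ → Prop} (h₁ : p C₁) (h₂ : p C₂) :
    ∀ᵐ o ∂baseLaw d C₁ C₂, p (obsA o) ∧ p (obsY o) := by
  have hA : ∀ᵐ o ∂baseLaw d C₁ C₂, p (obsA o) :=
    (Measure.quasiMeasurePreserving_fst.comp Measure.quasiMeasurePreserving_snd).ae
      (ae_endpointLaw h₁ h₂)
  have hY : ∀ᵐ o ∂baseLaw d C₁ C₂, p (obsY o) :=
    (Measure.quasiMeasurePreserving_snd.comp Measure.quasiMeasurePreserving_snd).ae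
      (ae_endpointLaw h₁ h₂)
  filter_upwards [hA, hY] with o h h' using ⟨h, h'⟩

theorem ae_sq_code (h : C₁ < C₂) :
    ∀ᵐ o ∂baseLaw d C₁ C₂, code C₁ C₂ (obsA o) ^ 2 = 1 ∧ code C₁ C₂ (obsY o) ^ 2 = 1 :=
  ae_baseLaw (p := fun t => code C₁ C₂ t ^ 2 = 1) (by simp [code_left h]) (by simp [code_right h])

theorem memLp_obsX {f : (Fin d → ℝ) → ℝ} (hf : MemLp f ⊤ (cubeVol d)) :
    MemLp (fun o => f (obsX o)) ⊤ (baseLaw d C₁ C₂) :=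
  hf.comp_measurePreserving (measurePreserving_fst (μ := cubeVol d))

theorem memLp_code_obsA (h : C₁ < C₂) :
    MemLp (fun o => code C₁ C₂ (obsA o)) ⊤ (baseLaw d C₁ C₂) := by
  refine memLp_top_of_bound (measurable_code.comp measurable_obsA).aestronglyMeasurable 1 ?_
  filter_upwards [ae_sq_code h] with o ho
  rw [Real.norm_eq_abs, ← sq_le_one_iff_abs_le_one, ho.1]

theorem memLp_code_obsY (h : C₁ < C₂) :
    MemLp (fun o => code C₁ C₂ (obsY o)) ⊤ (baseLaw d C₁ C₂) := by
  refine memLp_top_of_bound (measurable_code.comp measurable_obsY).aestronglyMeasurable 1 ?_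
  filter_upwards [ae_sq_code h] with o ho
  rw [Real.norm_eq_abs, ← sq_le_one_iff_abs_le_one, ho.2]

theorem integral_baseLaw_mul (f : (Fin d → ℝ) → ℝ) (g k : ℝ → ℝ) :
    ∫ o, f (obsX o) * (g (obsA o) * k (obsY o)) ∂baseLaw d C₁ C₂
      = (∫ x, f x ∂cubeVol d) * ((∫ t, g t ∂endpointLaw C₁ C₂) * ∫ t, k t ∂endpointLaw C₁ C₂) := by
  unfold baseLaw
  rw [← integral_prod_mul g k]
  exact integral_prod_mul f fun z : ℝ × ℝ => g z.1 * k z.2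

/-- Only the constant coefficient survives integration against the base law. -/
theorem integral_baseLaw_expansion (h : C₁ < C₂) {f₀ f₁ f₂ f₃ : (Fin d → ℝ) → ℝ}
    (h₀ : MemLp f₀ ⊤ (cubeVol d)) (h₁ : MemLp f₁ ⊤ (cubeVol d)) (h₂ : MemLp f₂ ⊤ (cubeVol d))
    (h₃ : MemLp f₃ ⊤ (cubeVol d)) :
    ∫ o, (f₀ (obsX o) + code C₁ C₂ (obsA o) * f₁ (obsX o) + code C₁ C₂ (obsY o) * f₂ (obsX o)
      + code C₁ C₂ (obsA o) * code C₁ C₂ (obsY o) * f₃ (obsX o)) ∂baseLaw d C₁ C₂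
      = ∫ x, f₀ x ∂cubeVol d := by
  have i0 : Integrable (fun o => f₀ (obsX o)) (baseLaw d C₁ C₂) := (memLp_obsX h₀).integrable le_top
  have i1 : Integrable (fun o => code C₁ C₂ (obsA o) * f₁ (obsX o)) (baseLaw d C₁ C₂) :=
    (memLp_code_obsA h).integrable_mul_top (memLp_obsX h₁)
  have i2 : Integrable (fun o => code C₁ C₂ (obsY o) * f₂ (obsX o)) (baseLaw d C₁ C₂) :=
    (memLp_code_obsY h).integrable_mul_top (memLp_obsX h₂)
  have i3 : Integrable (fun o => code C₁ C₂ (obsA o) * code C₁ C₂ (obsY o) * f₃ (obsX o))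
      (baseLaw d C₁ C₂) :=
    ((memLp_code_obsA h).mul_top (memLp_code_obsY h)).integrable_mul_top (memLp_obsX h₃)
  have i01 : Integrable (fun o => f₀ (obsX o) + code C₁ C₂ (obsA o) * f₁ (obsX o))
    (baseLaw d C₁ C₂) := i0.add i1
  have i012 : Integrable (fun o => f₀ (obsX o) + code C₁ C₂ (obsA o) * f₁ (obsX o)
    + code C₁ C₂ (obsY o) * f₂ (obsX o)) (baseLaw d C₁ C₂) := i01.add i2
  rw [integral_add i012 i3, integral_add i01 i2, integral_add i0 i1]
  have e0 := integral_baseLaw_mul (C₁ := C₁) (C₂ := C₂) f₀ (fun _ => 1) fun _ => 1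
  have e1 := integral_baseLaw_mul (C₁ := C₁) (C₂ := C₂) f₁ (code C₁ C₂) fun _ => 1
  have e2 := integral_baseLaw_mul (C₁ := C₁) (C₂ := C₂) f₂ (fun _ => 1) (code C₁ C₂)
  have e3 := integral_baseLaw_mul (C₁ := C₁) (C₂ := C₂) f₃ (code C₁ C₂) (code C₁ C₂)
  simp only [integral_code h, integral_const, probReal_univ, smul_eq_mul, mul_one, one_mul,
    mul_zero] at e0 e1 e2 e3
  simp_rw [mul_comm _ (f₁ _), mul_comm _ (f₂ _), mul_comm _ (f₃ _)]
  rw [e0, e1, e2, e3]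
  ring

end Base

section Law

variable {d : ℕ} {C₁ C₂ : ℝ} {u v w : (Fin d → ℝ) → ℝ}

theorem IsAdmissible.measurable_obsDensity (h : IsAdmissible u v w) :
    Measurable (obsDensity C₁ C₂ u v w) := by
  have hA := (measurable_code (C₁ := C₁) (C₂ := C₂)).comp (measurable_obsA (d := d))
  have hY := (measurable_code (C₁ := C₁) (C₂ := C₂)).comp (measurable_obsY (d := d))
  exact ((measurable_const.add (hA.mul (h.measurable_u.comp measurable_obsX))).add
    (hY.mul (h.measurable_v.comp measurable_obsX))).add
      ((hA.mul hY).mul (h.measurable_w.comp measurable_obsX))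

theorem IsAdmissible.ae_obsDensity_nonneg (hC : C₁ < C₂) (h : IsAdmissible u v w) :
    ∀ᵐ o ∂baseLaw d C₁ C₂, 0 ≤ obsDensity C₁ C₂ u v w o := by
  filter_upwards [ae_sq_code hC] with o ho using h.nonneg _ _ ho.1 ho.2 _

theorem integral_obsLaw (hC : C₁ < C₂) (h : IsAdmissible u v w) (f : Obs d → ℝ) :
    ∫ o, f o ∂obsLaw C₁ C₂ u v w
      = ∫ o, obsDensity C₁ C₂ u v w o * f o ∂baseLaw d C₁ C₂ := by
  unfold obsLaw
  rw [integral_withDensity_eq_integral_toReal_smul h.measurable_obsDensity.ennreal_ofReal (by simp)]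
  refine integral_congr_ae ?_
  filter_upwards [h.ae_obsDensity_nonneg hC] with o ho
  rw [ENNReal.toReal_ofReal ho, smul_eq_mul]

theorem integral_obsLaw_comp_obsX (hC : C₁ < C₂) (h : IsAdmissible u v w) {f : (Fin d → ℝ) → ℝ}
    (hf : MemLp f ⊤ (cubeVol d)) :
    ∫ o, f (obsX o) ∂obsLaw C₁ C₂ u v w = ∫ x, f x ∂cubeVol d := by
  rw [integral_obsLaw hC h, ← integral_baseLaw_expansion hC hf (h.memLp_u.mul_top hf)
    (h.memLp_v.mul_top hf) (h.memLp_w.mul_top hf)]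
  refine integral_congr_ae (Filter.Eventually.of_forall fun o => ?_)
  simp only [obsDensity]; ring

theorem integral_obsLaw_obsA (hC : C₁ < C₂) (h : IsAdmissible u v w) {f : (Fin d → ℝ) → ℝ}
    (hf : MemLp f ⊤ (cubeVol d)) :
    ∫ o, code C₁ C₂ (obsA o) * f (obsX o) ∂obsLaw C₁ C₂ u v w = ∫ x, u x * f x ∂cubeVol d := by
  rw [integral_obsLaw hC h, ← integral_baseLaw_expansion hC (h.memLp_u.mul_top hf) hf
    (h.memLp_w.mul_top hf) (h.memLp_v.mul_top hf)]
  refine integral_congr_ae ?_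
  filter_upwards [ae_sq_code hC] with o ho
  simp only [obsDensity]
  linear_combination (u (obsX o) * f (obsX o) + code C₁ C₂ (obsY o) * w (obsX o) * f (obsX o)) * ho.1

theorem integral_obsLaw_obsY (hC : C₁ < C₂) (h : IsAdmissible u v w) {f : (Fin d → ℝ) → ℝ}
    (hf : MemLp f ⊤ (cubeVol d)) :
    ∫ o, code C₁ C₂ (obsY o) * f (obsX o) ∂obsLaw C₁ C₂ u v w = ∫ x, v x * f x ∂cubeVol d := by
  rw [integral_obsLaw hC h, ← integral_baseLaw_expansion hC (h.memLp_v.mul_top hf)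
    (h.memLp_w.mul_top hf) hf (h.memLp_u.mul_top hf)]
  refine integral_congr_ae ?_
  filter_upwards [ae_sq_code hC] with o ho
  simp only [obsDensity]
  linear_combination (v (obsX o) * f (obsX o) + code C₁ C₂ (obsA o) * w (obsX o) * f (obsX o)) * ho.2

theorem isProbabilityMeasure_obsLaw (hC : C₁ < C₂) (h : IsAdmissible u v w) :
    IsProbabilityMeasure (obsLaw C₁ C₂ u v w) := by
  have h1 : MemLp (fun _ : Fin d → ℝ => (1 : ℝ)) ⊤ (cubeVol d) := memLp_const 1
  have h2 := integral_obsLaw_comp_obsX hC h h1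
  have : IsFiniteMeasure (obsLaw C₁ C₂ u v w) := by
    refine isFiniteMeasure_withDensity_ofReal ?_
    have := (((memLp_obsX (C₁ := C₁) (C₂ := C₂) h1).add ((memLp_code_obsA hC).mul_top
      (memLp_obsX h.memLp_u))).add ((memLp_code_obsY hC).mul_top (memLp_obsX h.memLp_v))).add
      (((memLp_code_obsA hC).mul_top (memLp_code_obsY hC)).mul_top (memLp_obsX h.memLp_w))
    exact (this.integrable le_top).2
  simp only [integral_const, smul_eq_mul, mul_one, probReal_univ] at h2
  exact ⟨(ENNReal.toReal_eq_one_iff _).1 h2⟩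

theorem ae_obsLaw_of_ae {p : Obs d → Prop} (h : ∀ᵐ o ∂baseLaw d C₁ C₂, p o) :
    ∀ᵐ o ∂obsLaw C₁ C₂ u v w, p o :=
  (withDensity_absolutelyContinuous _ _).ae_le h

theorem map_obsX_obsLaw (hC : C₁ < C₂) (h : IsAdmissible u v w) :
    (obsLaw C₁ C₂ u v w).map obsX = cubeVol d := by
  have := isProbabilityMeasure_obsLaw hC h
  have := Measure.isProbabilityMeasure_map (μ := obsLaw C₁ C₂ u v w) measurable_obsX.aemeasurable
  ext s hs
  have hi : MemLp (s.indicator fun _ => (1 : ℝ)) ⊤ (cubeVol d) :=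
    memLp_top_const 1 |>.indicator hs
  have e := integral_obsLaw_comp_obsX hC h hi
  have e' : ∀ o : Obs d, s.indicator (fun _ => (1 : ℝ)) (obsX o)
      = (obsX ⁻¹' s).indicator (fun _ => (1 : ℝ)) o := fun o => rfl
  simp_rw [e'] at e
  rw [integral_indicator_const _ hs, integral_indicator_const _ (measurable_obsX hs)] at e
  simp only [smul_eq_mul, mul_one] at e
  rw [Measure.map_apply measurable_obsX hs]
  exact (ENNReal.toReal_eq_toReal_iff' (measure_ne_top _ _) (measure_ne_top _ _)).1 e

theorem obsLaw_condExp (hC : C₁ < C₂) (h : IsAdmissible u v w) {f : Obs d → ℝ}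
    (hf : MemLp f ⊤ (obsLaw C₁ C₂ u v w)) {r : (Fin d → ℝ) → ℝ} (hrm : Measurable r)
    (hr : MemLp r ⊤ (cubeVol d))
    (hfr : ∀ g, MemLp g ⊤ (cubeVol d) → ∫ o, f o * g (obsX o) ∂obsLaw C₁ C₂ u v w
      = ∫ x, r x * g x ∂cubeVol d) :
    (fun o => r (obsX o)) =ᵐ[obsLaw C₁ C₂ u v w] (obsLaw C₁ C₂ u v w)[f | sigmaX d] := by
  have := isProbabilityMeasure_obsLaw hC h
  have hm : sigmaX d ≤ (inferInstance : MeasurableSpace (Obs d)) := measurable_obsX.comap_le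
  have hrX : MemLp (fun o => r (obsX o)) ⊤ (obsLaw C₁ C₂ u v w) :=
    hr.comp_measurePreserving ⟨measurable_obsX, map_obsX_obsLaw hC h⟩
  refine ae_eq_condExp_of_forall_setIntegral_eq hm (hf.integrable le_top)
    (fun _ _ _ => (hrX.integrable le_top).integrableOn) ?_
    (hrm.comp (comap_measurable obsX)).stronglyMeasurable.aestronglyMeasurable
  rintro _ ⟨s, hs, rfl⟩ -
  have hi : MemLp (s.indicator fun _ => (1 : ℝ)) ⊤ (cubeVol d) := (memLp_const 1).indicator hs
  have e1 := hfr _ hi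
  have e2 := integral_obsLaw_comp_obsX hC h (hr.mul_top hi)
  have hind : ∀ k : Obs d → ℝ, ∫ o in obsX ⁻¹' s, k o ∂obsLaw C₁ C₂ u v w
      = ∫ o, k o * s.indicator (fun _ => (1 : ℝ)) (obsX o) ∂obsLaw C₁ C₂ u v w := by
    intro k
    rw [← integral_indicator (measurable_obsX hs)]
    refine integral_congr_ae (Filter.Eventually.of_forall fun o => ?_)
    by_cases ho : obsX o ∈ s
    · simp [Set.indicator, ho]
    · simp [Set.indicator, ho]
  rw [hind, hind, e1, ← e2]

theorem ae_obsLaw_mem_Icc (hC : C₁ < C₂) :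
    ∀ᵐ o ∂obsLaw C₁ C₂ u v w, obsA o ∈ Set.Icc C₁ C₂ ∧ obsY o ∈ Set.Icc C₁ C₂ :=
  ae_obsLaw_of_ae (ae_baseLaw (Set.left_mem_Icc.2 hC.le) (Set.right_mem_Icc.2 hC.le))

theorem measurable_decode : Measurable (decode C₁ C₂) := by unfold decode; fun_prop

theorem memLp_decode {f : (Fin d → ℝ) → ℝ} (hf : MemLp f ⊤ (cubeVol d)) :
    MemLp (fun x => decode C₁ C₂ (f x)) ⊤ (cubeVol d) :=
  MemLp.add (f := fun _ => (C₁ + C₂) / 2) (memLp_const ((C₁ + C₂) / 2))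
    (hf.const_mul ((C₂ - C₁) / 2))

theorem integral_decode_mul {Ω : Type*} [MeasurableSpace Ω] {μ : Measure Ω} [IsFiniteMeasure μ]
    {f g : Ω → ℝ} (hf : MemLp f ⊤ μ) (hg : MemLp g ⊤ μ) :
    ∫ x, decode C₁ C₂ (f x) * g x ∂μ
      = (C₁ + C₂) / 2 * ∫ x, g x ∂μ + (C₂ - C₁) / 2 * ∫ x, f x * g x ∂μ := by
  rw [← integral_const_mul, ← integral_const_mul,
    ← integral_add ((hg.integrable le_top).const_mul _) ((hf.integrable_mul_top hg).const_mul _)]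
  refine integral_congr_ae (Filter.Eventually.of_forall fun o => ?_)
  simp only [decode]; ring

/-- Under `obsLaw C₁ C₂ u v w` the regression functions of `A` and `Y` are the decoded functions `u` and
`v`. -/
theorem isRegressionLaw_obsLaw (hC : C₁ < C₂) (h : IsAdmissible u v w) :
    (fun o => decode C₁ C₂ (u (obsX o))) =ᵐ[obsLaw C₁ C₂ u v w]
      (obsLaw C₁ C₂ u v w)[obsA | sigmaX d] ∧
    (fun o => decode C₁ C₂ (v (obsX o))) =ᵐ[obsLaw C₁ C₂ u v w]
      (obsLaw C₁ C₂ u v w)[obsY | sigmaX d] ∧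
    IsRegressionLaw (obsLaw C₁ C₂ u v w) (max |C₁| |C₂|) (fun x => decode C₁ C₂ (u x))
      fun x => decode C₁ C₂ (v x) := by
  have := isProbabilityMeasure_obsLaw hC h
  have hX := map_obsX_obsLaw hC h
  have hbd := ae_obsLaw_mem_Icc (u := u) (v := v) (w := w) hC
  have hA : ∀ᵐ o ∂obsLaw C₁ C₂ u v w, |obsA o| ≤ max |C₁| |C₂| := by
    filter_upwards [hbd] with o ho using abs_le_max_abs_abs ho.1.1 ho.1.2
  have hY : ∀ᵐ o ∂obsLaw C₁ C₂ u v w, |obsY o| ≤ max |C₁| |C₂| := by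
    filter_upwards [hbd] with o ho using abs_le_max_abs_abs ho.2.1 ho.2.2
  have hAm : MemLp (obsA (d := d)) ⊤ (obsLaw C₁ C₂ u v w) :=
    memLp_top_of_bound measurable_obsA.aestronglyMeasurable _ hA
  have hYm : MemLp (obsY (d := d)) ⊤ (obsLaw C₁ C₂ u v w) :=
    memLp_top_of_bound measurable_obsY.aestronglyMeasurable _ hY
  have hcA : MemLp (fun o : Obs d => code C₁ C₂ (obsA o)) ⊤ (obsLaw C₁ C₂ u v w) :=
    memLp_top_of_bound (measurable_code.comp measurable_obsA).aestronglyMeasurable 1 <| by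
      filter_upwards [ae_obsLaw_of_ae (ae_sq_code hC)] with o ho
      rw [Real.norm_eq_abs, ← sq_le_one_iff_abs_le_one, ho.1]
  have hcY : MemLp (fun o : Obs d => code C₁ C₂ (obsY o)) ⊤ (obsLaw C₁ C₂ u v w) :=
    memLp_top_of_bound (measurable_code.comp measurable_obsY).aestronglyMeasurable 1 <| by
      filter_upwards [ae_obsLaw_of_ae (ae_sq_code hC)] with o ho
      rw [Real.norm_eq_abs, ← sq_le_one_iff_abs_le_one, ho.2]
  have hgX : ∀ {g : (Fin d → ℝ) → ℝ}, MemLp g ⊤ (cubeVol d) →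
      MemLp (fun o => g (obsX o)) ⊤ (obsLaw C₁ C₂ u v w) := fun hg =>
    hg.comp_measurePreserving ⟨measurable_obsX, hX⟩
  have hdu : Measurable fun x => decode C₁ C₂ (u x) := measurable_decode.comp h.measurable_u
  have hdv : Measurable fun x => decode C₁ C₂ (v x) := measurable_decode.comp h.measurable_v
  have hdu' : MemLp (fun x => decode C₁ C₂ (u x)) ⊤ (cubeVol d) := memLp_decode h.memLp_u
  have hdv' : MemLp (fun x => decode C₁ C₂ (v x)) ⊤ (cubeVol d) := memLp_decode h.memLp_v
  have e1 : (fun o => decode C₁ C₂ (u (obsX o))) =ᵐ[obsLaw C₁ C₂ u v w]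
      (obsLaw C₁ C₂ u v w)[obsA | sigmaX d] := by
    refine obsLaw_condExp (f := obsA) (r := fun x => decode C₁ C₂ (u x)) hC h hAm hdu hdu' ?_
    intro g hg
    rw [integral_decode_mul h.memLp_u hg, ← integral_obsLaw_obsA hC h hg,
      ← integral_obsLaw_comp_obsX hC h hg, ← integral_decode_mul hcA (hgX hg)]
    simp_rw [decode_code hC]
  have e2 : (fun o => decode C₁ C₂ (v (obsX o))) =ᵐ[obsLaw C₁ C₂ u v w]
      (obsLaw C₁ C₂ u v w)[obsY | sigmaX d] := by
    refine obsLaw_condExp (f := obsY) (r := fun x => decode C₁ C₂ (v x)) hC h hYm hdv hdv' ?_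
    intro g hg
    rw [integral_decode_mul h.memLp_v hg, ← integral_obsLaw_obsY hC h hg,
      ← integral_obsLaw_comp_obsX hC h hg, ← integral_decode_mul hcY (hgX hg)]
    simp_rw [decode_code hC]
  exact ⟨e1, e2, isRegressionLaw_of_condExp (by rw [hX, restrict_cube_eq]) hA hY
    hdu' hdv' e1 e2⟩

/-- The conditional second moment of `A` and `Y` is affine in the three coefficients. -/
theorem integral_obsLaw_AY_mul (hC : C₁ < C₂) (h : IsAdmissible u v w) {g : (Fin d → ℝ) → ℝ}
    (hg : MemLp g ⊤ (cubeVol d)) :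
    ∫ o, obsA o * obsY o * g (obsX o) ∂obsLaw C₁ C₂ u v w
      = ∫ x, (decode C₁ C₂ (u x) * decode C₁ C₂ (v x)
        + ((C₂ - C₁) / 2) ^ 2 * (w x - u x * v x)) * g x ∂cubeVol d := by
  have := isProbabilityMeasure_obsLaw hC h
  have e : ∀ o : Obs d, obsDensity C₁ C₂ u v w o * (obsA o * obsY o * g (obsX o))
      = obsDensity C₁ C₂ u v w o * ((decode C₁ C₂ (code C₁ C₂ (obsA o)))
        * (decode C₁ C₂ (code C₁ C₂ (obsY o))) * g (obsX o)) := fun o => by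
    rw [decode_code hC, decode_code hC]
  rw [integral_obsLaw hC h]
  simp_rw [e]
  set c := (C₁ + C₂) / 2 with hc
  set l := (C₂ - C₁) / 2 with hl
  have mu := h.memLp_u.mul_top hg
  have mv := h.memLp_v.mul_top hg
  have mw := h.memLp_w.mul_top hg
  have m0 : MemLp (fun x => (decode C₁ C₂ (u x) * decode C₁ C₂ (v x)
      + l ^ 2 * (w x - u x * v x)) * g x) ⊤ (cubeVol d) :=
    (((memLp_decode h.memLp_u).mul_top (memLp_decode h.memLp_v)).add
      ((h.memLp_w.sub (h.memLp_u.mul_top h.memLp_v)).const_mul _)).mul_top hg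
  have m1 : MemLp (fun x => c ^ 2 * (u x * g x) + c * l * (w x * g x) + c * l * g x
      + l ^ 2 * (v x * g x)) ⊤ (cubeVol d) :=
    (((mu.const_mul _).add (mw.const_mul _)).add (hg.const_mul _)).add (mv.const_mul _)
  have m2 : MemLp (fun x => c ^ 2 * (v x * g x) + c * l * (w x * g x) + c * l * g x
      + l ^ 2 * (u x * g x)) ⊤ (cubeVol d) :=
    (((mv.const_mul _).add (mw.const_mul _)).add (hg.const_mul _)).add (mu.const_mul _)
  have m3 : MemLp (fun x => c ^ 2 * (w x * g x) + c * l * (v x * g x) + c * l * (u x * g x)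
      + l ^ 2 * g x) ⊤ (cubeVol d) :=
    (((mw.const_mul _).add (mv.const_mul _)).add (mu.const_mul _)).add (hg.const_mul _)
  rw [← integral_baseLaw_expansion hC m0 m1 m2 m3]
  refine integral_congr_ae ?_
  filter_upwards [ae_sq_code hC] with o ho
  obtain ⟨h1, h2⟩ := ho
  simp only [obsDensity, decode, ← hc, ← hl]
  set a := code C₁ C₂ (obsA o)
  set y := code C₁ C₂ (obsY o)
  generalize u (obsX o) = U
  generalize v (obsX o) = V
  generalize w (obsX o) = W
  generalize g (obsX o) = G
  have ha : a * a = 1 := by rw [← sq, h1]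
  have hy : y * y = 1 := by rw [← sq, h2]
  linear_combination G * (c * l * U + c * l * W * y + l ^ 2 * U * y + l ^ 2 * W * y * y) * ha
    + G * (c * l * V + c * l * W * a + l ^ 2 * V * a + l ^ 2 * W) * hy

theorem psi_obsLaw (hC : C₁ < C₂) (h : IsAdmissible u v w) :
    psi (obsLaw C₁ C₂ u v w) = ((C₂ - C₁) / 2) ^ 2 * ∫ x, (w x - u x * v x) ∂cubeVol d := by
  have h1 := integral_obsLaw_AY_mul hC h (g := fun _ => 1) (memLp_const 1)
  simp only [mul_one] at h1
  have i1 : Integrable (fun x => decode C₁ C₂ (u x) * decode C₁ C₂ (v x)) (cubeVol d) :=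
    (memLp_decode h.memLp_u).integrable_mul_top (memLp_decode h.memLp_v)
  have i2 : Integrable (fun x => w x - u x * v x) (cubeVol d) :=
    (h.memLp_w.integrable le_top).sub (h.memLp_u.integrable_mul_top h.memLp_v)
  rw [(isRegressionLaw_obsLaw hC h).2.2.psi_eq, h1, integral_add i1 (i2.const_mul _),
    integral_const_mul]
  ring

theorem CDVBasis.obsLaw_mem_model {S : ℕ} (B : CDVBasis S) {α β M : ℝ} (hC : C₁ < C₂)
    (h : IsAdmissible u v w) (hu : (fun x => decode C₁ C₂ (u x)) ∈ B.holderBall d α M)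
    (hv : (fun x => decode C₁ C₂ (v x)) ∈ B.holderBall d β M) :
    obsLaw C₁ C₂ u v w ∈ B.model d α β M C₁ C₂ := by
  obtain ⟨h1, h2, -⟩ := isRegressionLaw_obsLaw hC h
  exact ⟨isProbabilityMeasure_obsLaw hC h, by rw [map_obsX_obsLaw hC h, restrict_cube_eq],
    ae_obsLaw_mem_Icc hC, ⟨_, hu, h1⟩, ⟨_, hv, h2⟩⟩

end Law

/-! ### Bump functions and their wavelet coefficients -/

theorem Continuous.memLp_unitVol {f : ℝ → ℝ} (hf : Continuous f) : MemLp f ⊤ unitVol := by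
  obtain ⟨C, hC⟩ := (isCompact_Icc (a := (0 : ℝ)) (b := 1)).exists_bound_of_continuousOn
    hf.continuousOn
  refine memLp_top_of_bound hf.aestronglyMeasurable C ?_
  filter_upwards [ae_restrict_mem measurableSet_Icc] with x hx using hC x hx

section Bump

/-- A smooth function supported in `[1/4, 3/4]` and equal to `1` on `[3/8, 5/8]`. -/
noncomputable def bumpData : ContDiffBump (1 / 2 : ℝ) := ⟨1 / 8, 1 / 4, by norm_num, by norm_num⟩

/-- The function `bumpData`, as a function on the line. -/
noncomputable def bump (x : ℝ) : ℝ := bumpData x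

theorem contDiff_bump {n : ℕ} : ContDiff ℝ n bump := bumpData.contDiff

theorem continuous_bump : Continuous bump := bumpData.continuous

theorem bump_nonneg (x : ℝ) : 0 ≤ bump x := bumpData.nonneg

theorem bump_le_one (x : ℝ) : bump x ≤ 1 := bumpData.le_one

theorem abs_bump_le_one (x : ℝ) : |bump x| ≤ 1 := by
  rw [abs_of_nonneg (bump_nonneg x)]; exact bump_le_one x

theorem tsupport_bump : tsupport bump = Metric.closedBall (1 / 2) (1 / 4) :=
  bumpData.tsupport_eq

theorem bump_ne_zero {x : ℝ} (h : bump x ≠ 0) : 0 < x ∧ x < 1 := by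
  have := subset_tsupport _ h
  rw [tsupport_bump, Metric.mem_closedBall, Real.dist_eq, abs_le] at this
  constructor <;> linarith [this.1, this.2]

theorem bump_eq_one {x : ℝ} (h : |x - 1 / 2| ≤ 1 / 8) : bump x = 1 :=
  bumpData.one_of_mem_closedBall (by rw [Metric.mem_closedBall, Real.dist_eq]; exact h)

theorem iteratedDeriv_bump_ne_zero {n : ℕ} {x : ℝ} (h : iteratedDeriv n bump x ≠ 0) :
    0 < x ∧ x < 1 := by
  have h1 : x ∈ Function.support (iteratedFDeriv ℝ n bump) := by
    rw [Function.mem_support]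
    intro h0
    exact h (by rw [iteratedDeriv_eq_iteratedFDeriv, h0]; rfl)
  have := support_iteratedFDeriv_subset n h1
  rw [tsupport_bump, Metric.mem_closedBall, Real.dist_eq, abs_le] at this
  constructor <;> linarith [this.1, this.2]

theorem exists_iteratedDeriv_bump_le (n : ℕ) : ∃ C : ℝ, 1 ≤ C ∧ ∀ x, |iteratedDeriv n bump x| ≤ C := by
  have hc : Continuous (iteratedDeriv n bump) := contDiff_bump.continuous_iteratedDeriv' n
  obtain ⟨C, hC⟩ := (isCompact_Icc (a := (0 : ℝ)) (b := 1)).exists_bound_of_continuousOn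
    hc.continuousOn
  refine ⟨max C 1, le_max_right _ _, fun x => ?_⟩
  by_cases h : iteratedDeriv n bump x = 0
  · rw [h, abs_zero]; positivity
  · have := iteratedDeriv_bump_ne_zero h
    exact (hC x ⟨this.1.le, this.2.le⟩).trans (le_max_left _ _)

/-- At every point at most one translate of a function supported in `(0, 1)` is nonzero. -/
theorem abs_sum_translate_le {g : ℝ → ℝ} (hg : ∀ x, g x ≠ 0 → 0 < x ∧ x < 1) {C : ℝ}
    (hC : ∀ x, |g x| ≤ C) {N : ℕ} {s : Fin N → ℝ} (hs : ∀ m, |s m| ≤ 1) (y : ℝ) :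
    |∑ m : Fin N, s m * g (y - m)| ≤ C := by
  have hC0 : 0 ≤ C := (abs_nonneg _).trans (hC 0)
  by_cases h : ∃ m : Fin N, g (y - m) ≠ 0
  · obtain ⟨m, hm⟩ := h
    rw [Finset.sum_eq_single m]
    · rw [abs_mul]
      exact (mul_le_mul (hs m) (hC _) (abs_nonneg _) zero_le_one).trans (by simp)
    · intro m' _ hne
      by_contra h0
      have h1 := hg _ hm
      have h2 := hg _ (right_ne_zero_of_mul h0)
      apply hne
      have a1 : (m : ℝ) < (m' : ℝ) + 1 := by linarith [h1.1, h2.2]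
      have a2 : (m' : ℝ) < (m : ℝ) + 1 := by linarith [h1.2, h2.1]
      have a1' : (m : ℕ) < m' + 1 := by exact_mod_cast a1
      have a2' : (m' : ℕ) < m + 1 := by exact_mod_cast a2
      exact Fin.ext (by omega)
    · simp
  · push Not at h
    simp [h, hC0]

/-- The signed sum of the `2 ^ J` dyadic translates of `bump` at scale `2 ^ (-J)`. -/
noncomputable def comb (J : ℕ) (s : Fin (2 ^ J) → ℝ) (x : ℝ) : ℝ := ∑ m, s m * bump (2 ^ J * x - m)

theorem contDiff_comb {n : ℕ} (J : ℕ) (s : Fin (2 ^ J) → ℝ) : ContDiff ℝ n (comb J s) := by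
  unfold comb
  refine ContDiff.sum fun m _ => contDiff_const.mul (contDiff_bump.comp ?_)
  fun_prop

theorem abs_comb_le {J : ℕ} {s : Fin (2 ^ J) → ℝ} (hs : ∀ m, |s m| ≤ 1) (x : ℝ) :
    |comb J s x| ≤ 1 :=
  abs_sum_translate_le (fun _ h => bump_ne_zero h) abs_bump_le_one hs _

theorem iteratedDeriv_comb (n J : ℕ) (s : Fin (2 ^ J) → ℝ) (x : ℝ) :
    iteratedDeriv n (comb J s) x
      = (2 ^ J) ^ n * ∑ m, s m * iteratedDeriv n bump (2 ^ J * x - m) := by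
  have hd : ∀ m : Fin (2 ^ J), ContDiff ℝ n fun z : ℝ => bump (2 ^ J * z - m) := fun m =>
    contDiff_bump.comp (by fun_prop)
  unfold comb
  rw [iteratedDeriv_fun_sum fun m _ => (contDiff_const.mul (hd m)).contDiffAt, Finset.mul_sum]
  refine Finset.sum_congr rfl fun m _ => ?_
  have hb : ContDiff ℝ n fun z : ℝ => bump (z - m) := contDiff_bump.comp (by fun_prop)
  rw [iteratedDeriv_const_mul _ (hd m).contDiffAt,
    congr_fun (iteratedDeriv_comp_const_mul hb (2 ^ J)) x]
  simp only [iteratedDeriv_comp_sub_const]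
  ring

theorem exists_iteratedDeriv_comb_le (n : ℕ) : ∃ C : ℝ, 1 ≤ C ∧ ∀ (J : ℕ) (s : Fin (2 ^ J) → ℝ),
    (∀ m, |s m| ≤ 1) → ∀ x, |iteratedDeriv n (comb J s) x| ≤ C * (2 ^ J) ^ n := by
  obtain ⟨C, hC, h⟩ := exists_iteratedDeriv_bump_le n
  refine ⟨C, hC, fun J s hs x => ?_⟩
  rw [iteratedDeriv_comb, abs_mul, abs_of_nonneg (by positivity), mul_comm]
  gcongr
  exact abs_sum_translate_le (fun _ h => iteratedDeriv_bump_ne_zero h) h hs _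

end Bump

namespace CDVBasis

variable {S : ℕ} (B : CDVBasis S) {d : ℕ}

theorem mother_moment_sub {l : ℕ} (hl : B.J₀ ≤ l) (m : Fin (2 ^ l)) {r : ℕ} (hr : r < S) (a : ℝ) :
    ∫ x, (x - a) ^ r * B.mother.level l m x ∂unitVol = 0 := by
  have hi : ∀ i, Integrable (fun x => x ^ i * B.mother.level l m x) unitVol := fun i =>
    (continuous_pow i).memLp_unitVol.integrable_mul_top (B.mother.memLp_level l m)
  have e : ∀ x, (x - a) ^ r * B.mother.level l m x = ∑ i ∈ Finset.range (r + 1),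
      ((-a) ^ (r - i) * r.choose i) * (x ^ i * B.mother.level l m x) := by
    intro x
    rw [sub_eq_add_neg, add_pow, Finset.sum_mul]
    exact Finset.sum_congr rfl fun i _ => by ring
  simp_rw [e]
  rw [integral_finsetSum _ fun i _ => (hi i).const_mul _]
  refine Finset.sum_eq_zero fun i hi' => ?_
  rw [integral_const_mul, B.mother_moment hl m (by have := Finset.mem_range.1 hi'; omega), mul_zero]

/-- Vanishing moments turn smoothness into decay of the wavelet coefficients. -/
theorem abs_integral_mul_mother_le {l : ℕ} (hl : B.J₀ ≤ l) (m : Fin (2 ^ l)) (hS : 0 < S)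
    {f : ℝ → ℝ} (hf : ContDiff ℝ S f) {K D : ℝ} (hK : ∀ x, |iteratedDeriv S f x| ≤ K)
    (hD : ∀ x y, B.mother.level l m x ≠ 0 → B.mother.level l m y ≠ 0 → |x - y| ≤ D) :
    |∫ x, f x * B.mother.level l m x ∂unitVol|
      ≤ K * (2 * D) ^ S * ∫ x, |B.mother.level l m x| ∂unitVol := by
  by_cases h0 : ∀ x, B.mother.level l m x = 0
  · simp [h0]
  push Not at h0
  obtain ⟨x₀, hx₀⟩ := h0
  have hD0 : 0 ≤ D := (abs_nonneg _).trans (hD x₀ x₀ hx₀ hx₀)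
  have hK0 : 0 ≤ K := (abs_nonneg _).trans (hK 0)
  obtain ⟨n, rfl⟩ : ∃ n, S = n + 1 := ⟨S - 1, by omega⟩
  rcases hD0.eq_or_lt with hD0' | hD0'
  · -- a function supported at a single point integrates to zero
    have hz : ∀ᵐ x ∂unitVol, B.mother.level l m x = 0 := by
      have : ∀ᵐ x ∂unitVol, x ≠ x₀ := by
        rw [ae_iff]; simp
      filter_upwards [this] with x hx
      by_contra hne
      have := hD x x₀ hne hx₀
      rw [← hD0'] at this
      exact hx (sub_eq_zero.1 (abs_nonpos_iff.1 this))
    rw [integral_congr_ae (g := fun _ => 0) (by filter_upwards [hz] with x hx; rw [hx, mul_zero])]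
    simp only [integral_zero, abs_zero]
    positivity
  set a := x₀ - D with ha
  set b := x₀ + D with hb
  have hab : a < b := by linarith
  -- the Taylor polynomial of degree `S - 1` at the left end of the support is orthogonal to the wavelet
  set T : ℝ → ℝ := fun x => taylorWithinEval f n (Set.Icc a b) a x with hT
  have hTe : ∀ x, T x = ∑ k ∈ Finset.range (n + 1),
      ((k.factorial : ℝ)⁻¹ * iteratedDerivWithin k f (Set.Icc a b) a) * (x - a) ^ k := by
    intro x
    rw [hT]; simp only [taylor_within_apply, smul_eq_mul]
    exact Finset.sum_congr rfl fun k _ => by ring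
  have hTc : Continuous T := by
    rw [show T = fun x => _ from funext hTe]
    fun_prop
  have hψ := B.mother.memLp_level l m
  have hTi : Integrable (fun x => T x * B.mother.level l m x) unitVol :=
    hTc.memLp_unitVol.integrable_mul_top hψ
  have hfi : Integrable (fun x => f x * B.mother.level l m x) unitVol :=
    hf.continuous.memLp_unitVol.integrable_mul_top hψ
  have hT0 : ∫ x, T x * B.mother.level l m x ∂unitVol = 0 := by
    simp_rw [hTe, Finset.sum_mul, mul_assoc _ (_ ^ _)]
    have hpi : ∀ k : ℕ, Integrable (fun x => (x - a) ^ k * B.mother.level l m x) unitVol :=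
      fun k => Continuous.memLp_unitVol (f := fun x => (x - a) ^ k) (by fun_prop)
        |>.integrable_mul_top hψ
    rw [integral_finsetSum _ fun k _ => (hpi k).const_mul _]
    refine Finset.sum_eq_zero fun k hk => ?_
    rw [integral_const_mul, B.mother_moment_sub hl m (Finset.mem_range.1 hk), mul_zero]
  have hrem : ∀ x, |(f x - T x) * B.mother.level l m x|
      ≤ K * (2 * D) ^ (n + 1) * |B.mother.level l m x| := by
    intro x
    by_cases hx : B.mother.level l m x = 0
    · simp [hx]
    have hxD := abs_le.1 (hD x x₀ hx hx₀)
    have hxI : x ∈ Set.Icc a b := ⟨by linarith [hxD.1], by linarith [hxD.2]⟩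
    have hbd := taylor_mean_remainder_bound (C := K) hab.le (n := n)
      (by exact_mod_cast hf.contDiffOn) hxI (fun y hy => by
        rw [iteratedDerivWithin_eq_iteratedDeriv (uniqueDiffOn_Icc hab) hf.contDiffAt hy]
        exact hK y)
    rw [abs_mul]
    gcongr
    refine hbd.trans ?_
    calc K * (x - a) ^ (n + 1) / n.factorial ≤ K * (x - a) ^ (n + 1) / 1 := by
          gcongr
          · exact mul_nonneg hK0 (pow_nonneg (by linarith [hxI.1]) _)
          · exact_mod_cast Nat.factorial_pos n
      _ ≤ _ := by
          rw [div_one]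
          gcongr
          · linarith [hxI.1]
          · linarith [hxD.2]
  calc |∫ x, f x * B.mother.level l m x ∂unitVol|
      = |∫ x, (f x - T x) * B.mother.level l m x ∂unitVol| := by
        simp_rw [sub_mul]
        rw [integral_sub hfi hTi, hT0, sub_zero]
    _ ≤ ∫ x, |(f x - T x) * B.mother.level l m x| ∂unitVol := abs_integral_le_integral_abs
    _ ≤ ∫ x, K * (2 * D) ^ (n + 1) * |B.mother.level l m x| ∂unitVol := by
        refine integral_mono_of_nonneg (Filter.Eventually.of_forall fun _ => abs_nonneg _)
          ((hψ.integrable le_top).abs.const_mul _) (Filter.Eventually.of_forall hrem)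
    _ = _ := integral_const_mul _ _

end CDVBasis

/-- The bump function that lives on the dyadic cell with index `m` at scale `2 ^ (-J)`. -/
noncomputable def cellBump {d : ℕ} (J : ℕ) (m : Fin d → Fin (2 ^ J)) (x : Fin d → ℝ) : ℝ :=
  ∏ i, bump (2 ^ J * x i - m i)

/-- The sum of the cell bumps with coefficients `s`. -/
noncomputable def bumpSum {d : ℕ} (J : ℕ) (s : (Fin d → Fin (2 ^ J)) → ℝ) (x : Fin d → ℝ) : ℝ :=
  ∑ m, s m * cellBump J m x

section BumpSum

variable {d : ℕ}

theorem continuous_cellBump (J : ℕ) (m : Fin d → Fin (2 ^ J)) : Continuous (cellBump J m) := by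
  unfold cellBump
  refine continuous_finsetProd _ fun i _ => continuous_bump.comp ?_
  fun_prop

theorem continuous_bumpSum (J : ℕ) (s : (Fin d → Fin (2 ^ J)) → ℝ) : Continuous (bumpSum J s) := by
  unfold bumpSum
  exact continuous_finsetSum _ fun m _ => continuous_const.mul (continuous_cellBump J m)

theorem cellBump_nonneg (J : ℕ) (m : Fin d → Fin (2 ^ J)) (x : Fin d → ℝ) : 0 ≤ cellBump J m x :=
  Finset.prod_nonneg fun _ _ => bump_nonneg _

theorem cellBump_le_one (J : ℕ) (m : Fin d → Fin (2 ^ J)) (x : Fin d → ℝ) : cellBump J m x ≤ 1 :=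
  Finset.prod_le_one (fun _ _ => bump_nonneg _) fun _ _ => bump_le_one _

/-- The open dyadic cell. -/
def dyadicCell {d : ℕ} (J : ℕ) (m : Fin d → Fin (2 ^ J)) : Set (Fin d → ℝ) :=
  {x | ∀ i, 0 < 2 ^ J * x i - m i ∧ 2 ^ J * x i - m i < 1}

theorem mem_dyadicCell_of_cellBump_ne_zero {J : ℕ} {m : Fin d → Fin (2 ^ J)} {x : Fin d → ℝ}
    (h : cellBump J m x ≠ 0) : x ∈ dyadicCell J m := fun i =>
  bump_ne_zero (Finset.prod_ne_zero_iff.1 h i (Finset.mem_univ i))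

theorem eq_of_mem_dyadicCell {J : ℕ} {m m' : Fin d → Fin (2 ^ J)} {x : Fin d → ℝ}
    (h : x ∈ dyadicCell J m) (h' : x ∈ dyadicCell J m') : m = m' := by
  funext i
  have h1 := h i
  have h2 := h' i
  have a1 : ((m i : ℕ) : ℝ) < (m' i : ℕ) + 1 := by linarith [h1.1, h2.2]
  have a2 : ((m' i : ℕ) : ℝ) < (m i : ℕ) + 1 := by linarith [h1.2, h2.1]
  have a1' : (m i : ℕ) < m' i + 1 := by exact_mod_cast a1
  have a2' : (m' i : ℕ) < m i + 1 := by exact_mod_cast a2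
  exact Fin.ext (by omega)

theorem measurableSet_dyadicCell (J : ℕ) (m : Fin d → Fin (2 ^ J)) :
    MeasurableSet (dyadicCell J m) := by
  unfold dyadicCell
  simp only [Set.ofPred_forall]
  refine MeasurableSet.iInter fun i => ?_
  have hm : Measurable fun x : Fin d → ℝ => 2 ^ J * x i - m i := by fun_prop
  exact (measurableSet_lt measurable_const hm).inter (measurableSet_lt hm measurable_const)

theorem cubeVol_dyadicCell_le (J : ℕ) (m : Fin d → Fin (2 ^ J)) :
    (cubeVol d).real (dyadicCell J m) ≤ 1 / (2 ^ J) ^ d := by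
  have hs : dyadicCell J m ⊆ Set.univ.pi fun i =>
      Set.Icc ((m i : ℝ) / 2 ^ J) (((m i : ℝ) + 1) / 2 ^ J) := by
    intro x hx i _
    have := hx i
    constructor
    · rw [div_le_iff₀ (by positivity)]; linarith [this.1]
    · rw [le_div_iff₀ (by positivity)]; linarith [this.2]
  refine (measureReal_mono hs).trans ?_
  rw [measureReal_def, Measure.pi_pi, ENNReal.toReal_prod]
  calc _ ≤ ∏ _i : Fin d, (1 : ℝ) / 2 ^ J := by
        refine Finset.prod_le_prod (fun _ _ => ENNReal.toReal_nonneg) fun i _ => ?_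
        refine ENNReal.toReal_le_of_le_ofReal (by positivity) ?_
        refine (Measure.restrict_apply_le _ _).trans ?_
        rw [Real.volume_Icc]
        exact ENNReal.ofReal_le_ofReal (by rw [← sub_div]; simp)
    _ = _ := by simp

theorem abs_sum_mul_cellBump_le {J : ℕ} {s : (Fin d → Fin (2 ^ J)) → ℝ} (hs : ∀ m, |s m| ≤ 1)
    (x : Fin d → ℝ) : |bumpSum J s x| ≤ 1 := by
  unfold bumpSum
  by_cases h : ∃ m : Fin d → Fin (2 ^ J), cellBump J m x ≠ 0
  · obtain ⟨m, hm⟩ := h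
    rw [Finset.sum_eq_single m]
    · rw [abs_mul, abs_of_nonneg (cellBump_nonneg J m x)]
      exact mul_le_one₀ (hs m) (cellBump_nonneg J m x) (cellBump_le_one J m x)
    · intro m' _ hne
      by_contra h0
      exact hne (eq_of_mem_dyadicCell
        (mem_dyadicCell_of_cellBump_ne_zero (right_ne_zero_of_mul h0))
        (mem_dyadicCell_of_cellBump_ne_zero hm))
    · simp
  · push Not at h
    simp [h]

end BumpSum

theorem Continuous.memLp_cubeVol {d : ℕ} {f : (Fin d → ℝ) → ℝ} (hf : Continuous f) :
    MemLp f ⊤ (cubeVol d) := by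
  obtain ⟨C, hC⟩ := (isCompact_Icc (a := (0 : Fin d → ℝ)) (b := 1)).exists_bound_of_continuousOn
    hf.continuousOn
  refine memLp_top_of_bound hf.aestronglyMeasurable C ?_
  filter_upwards [ae_mem_cube d] with x hx using hC x hx

namespace CDVBasis

variable {S : ℕ} (B : CDVBasis S) {d : ℕ}

/-- One-dimensional wavelet coefficients of the translates of the bump. -/
theorem exists_sum_abs_integral_bump_le (hS : 0 < S) : ∃ C : ℝ, 1 ≤ C ∧ ∀ (J l : ℕ), B.J₀ ≤ l →
    (∀ r, ∑ k : Fin (2 ^ J), |∫ t, bump (2 ^ J * t - k) * B.pairLevel l r t ∂unitVol|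
      ≤ C / √(2 ^ l)) ∧
    (∀ m, ∑ k : Fin (2 ^ J), |∫ t, bump (2 ^ J * t - k) * B.pairLevel l (true, m) t ∂unitVol|
      ≤ C / √(2 ^ l) * ((2 : ℝ) ^ J / 2 ^ l) ^ S) := by
  obtain ⟨C, hC, h⟩ := B.exists_pair_bound
  obtain ⟨K, hK, hK'⟩ := exists_iteratedDeriv_comb_le S
  have h2C : (1 : ℝ) ≤ (2 * C) ^ S := one_le_pow₀ (by linarith)
  have hKC : 1 ≤ K * (2 * C) ^ S := by nlinarith
  refine ⟨K * (2 * C) ^ S * C, by nlinarith, fun J l hl => ?_⟩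
  obtain ⟨-, -, hsupp, hint⟩ := h l
  -- choosing the signs turns the sum of absolute values into one coefficient of a signed comb
  have key : ∀ r, ∃ s : Fin (2 ^ J) → ℝ, (∀ k, |s k| ≤ 1) ∧
      ∑ k : Fin (2 ^ J), |∫ t, bump (2 ^ J * t - k) * B.pairLevel l r t ∂unitVol|
        = ∫ t, comb J s t * B.pairLevel l r t ∂unitVol := by
    intro r
    have hi : ∀ k : Fin (2 ^ J),
        Integrable (fun t => bump (2 ^ J * t - k) * B.pairLevel l r t) unitVol := fun k =>
      Continuous.memLp_unitVol (f := fun t => bump (2 ^ J * t - k))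
        (continuous_bump.comp (by fun_prop)) |>.integrable_mul_top (B.memLp_pairLevel l r)
    refine ⟨fun k => if 0 ≤ ∫ t, bump (2 ^ J * t - k) * B.pairLevel l r t ∂unitVol then 1 else -1,
      fun k => by dsimp only; split_ifs <;> simp, ?_⟩
    simp only [comb, Finset.sum_mul, mul_assoc]
    rw [integral_finsetSum _ fun k _ => (hi k).const_mul _]
    refine Finset.sum_congr rfl fun k _ => ?_
    rw [integral_const_mul]
    split_ifs with h0
    · rw [abs_of_nonneg h0, one_mul]
    · rw [abs_of_neg (not_le.1 h0), neg_one_mul]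
  constructor
  · intro r
    obtain ⟨s, hs, e⟩ := key r
    rw [e]
    calc _ ≤ ∫ t, |B.pairLevel l r t| ∂unitVol := by
          refine integral_mono ((contDiff_comb (n := 0) J s).continuous.memLp_unitVol
            |>.integrable_mul_top (B.memLp_pairLevel l r))
            ((B.memLp_pairLevel l r).integrable le_top).abs fun t => ?_
          refine (le_abs_self _).trans ?_
          rw [abs_mul]
          exact mul_le_of_le_one_left (abs_nonneg _) (abs_comb_le hs t)
      _ ≤ C / √(2 ^ l) := hint r
      _ ≤ _ := by gcongr; nlinarith
  · intro m
    obtain ⟨s, hs, e⟩ := key (true, m)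
    rw [e]
    have hp : B.pairLevel l (true, m) = B.mother.level l m := by simp [pairLevel]
    have hsupp' := hsupp (true, m)
    have hint' := hint (true, m)
    rw [hp] at hsupp' hint' ⊢
    refine (le_abs_self _).trans ((B.abs_integral_mul_mother_le hl m hS (contDiff_comb J s)
      (hK' J s hs) hsupp').trans ?_)
    calc _ ≤ K * (2 ^ J) ^ S * (2 * (C / 2 ^ l)) ^ S * (C / √(2 ^ l)) := by gcongr
      _ = _ := by rw [div_pow, ← mul_div_assoc 2 C, div_pow (2 * C)]; ring

/-- The wavelet coefficients of a signed sum of bumps at scale `2 ^ (-J)`. -/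
theorem exists_abs_innerC_bumpSum_le (d : ℕ) (hS : 0 < S) : ∃ C : ℝ, 1 ≤ C ∧
    ∀ (J l : ℕ), B.J₀ ≤ l → ∀ s : (Fin d → Fin (2 ^ J)) → ℝ, (∀ m, |s m| ≤ 1) →
    (∀ ι m, |innerC (bumpSum J s) (B.Psi l ι m)| ≤ C / √(2 ^ l) ^ d) ∧
    (∀ ι m, (∃ i, ι i = true) →
      |innerC (bumpSum J s) (B.Psi l ι m)| ≤ C / √(2 ^ l) ^ d * ((2 : ℝ) ^ J / 2 ^ l) ^ S) := by
  obtain ⟨C, hC, h⟩ := B.exists_sum_abs_integral_bump_le hS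
  refine ⟨C ^ d, one_le_pow₀ hC, fun J l hl s hs => ?_⟩
  obtain ⟨h1, h2⟩ := h J l hl
  have key : ∀ ι m, |innerC (bumpSum J s) (B.Psi l ι m)| ≤ ∏ i, ∑ k : Fin (2 ^ J),
      |∫ t, bump (2 ^ J * t - k) * B.pairLevel l (ι i, m i) t ∂unitVol| := by
    intro ι m
    have hi : ∀ k, Integrable (fun x => cellBump J k x * B.Psi l ι m x) (cubeVol d) := fun k =>
      (continuous_cellBump J k).memLp_cubeVol.integrable_mul_top (B.memLp_Psi l ι m)
    rw [innerC_eq]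
    simp_rw [bumpSum, Finset.sum_mul, mul_assoc]
    rw [integral_finsetSum _ fun k _ => (hi k).const_mul _,
      ← sum_prod_pi (fun i (k : Fin (2 ^ J)) =>
        |∫ t, bump (2 ^ J * t - k) * B.pairLevel l (ι i, m i) t ∂unitVol|)]
    refine (Finset.abs_sum_le_sum_abs _ _).trans (Finset.sum_le_sum fun k _ => ?_)
    rw [integral_const_mul, abs_mul]
    refine (mul_le_of_le_one_left (abs_nonneg _) (hs k)).trans (le_of_eq ?_)
    simp_rw [cellBump, Psi_eq, ← Finset.prod_mul_distrib]
    rw [integral_cubeVol_prod (fun i t => bump (2 ^ J * t - k i) * B.pairLevel l (ι i, m i) t),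
      Finset.abs_prod]
  have hpos : ∀ r, 0 ≤ ∑ k : Fin (2 ^ J),
      |∫ t, bump (2 ^ J * t - k) * B.pairLevel l r t ∂unitVol| := fun r =>
    Finset.sum_nonneg fun _ _ => abs_nonneg _
  constructor
  · intro ι m
    refine (key ι m).trans ((Finset.prod_le_prod (fun i _ => hpos _) fun i _ => h1 _).trans ?_)
    simp
  · rintro ι m ⟨i, hi⟩
    refine (key ι m).trans ?_
    rw [← Finset.mul_prod_erase _ _ (Finset.mem_univ i), hi]
    calc _ ≤ (C / √(2 ^ l) * ((2 : ℝ) ^ J / 2 ^ l) ^ S)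
          * ∏ _j ∈ Finset.univ.erase i, C / √(2 ^ l) :=
          mul_le_mul (h2 _) (Finset.prod_le_prod (fun j _ => hpos _) fun j _ => h1 _)
            (Finset.prod_nonneg fun j _ => hpos _) (by positivity)
      _ = _ := by
          rw [Finset.prod_const, Finset.card_erase_of_mem (Finset.mem_univ i), Finset.card_univ,
            Fintype.card_fin]
          obtain ⟨e, rfl⟩ : ∃ e, d = e + 1 := ⟨d - 1, by have := i.pos; omega⟩
          rw [Nat.add_sub_cancel, ← div_pow, pow_succ]
          ring

theorem holderNorm_le_of_coef_le {a R : ℝ} {h : (Fin d → ℝ) → ℝ}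
    (h₁ : ∀ m, (2 : ℝ) ^ ((B.J₀ : ℝ) * (a + d / 2)) * |innerC h (B.Phi B.J₀ m)| ≤ R)
    (h₂ : ∀ l, B.J₀ ≤ l → ∀ ι m, (∃ i, ι i = true) →
      (2 : ℝ) ^ ((l : ℝ) * (a + d / 2)) * |innerC h (B.Psi l ι m)| ≤ R) :
    B.holderNorm a h ≤ ENNReal.ofReal R + ENNReal.ofReal R :=
  add_le_add (iSup_le fun m => ENNReal.ofReal_le_ofReal (h₁ m))
    (iSup₂_le fun l hl => iSup₂_le fun ι hι => iSup_le fun m =>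
      ENNReal.ofReal_le_ofReal (h₂ l hl ι m hι))

theorem holderNorm_add_le {a : ℝ} {f g : (Fin d → ℝ) → ℝ} (hf : MemLp f ⊤ (cubeVol d))
    (hg : MemLp g ⊤ (cubeVol d)) :
    B.holderNorm a (fun x => f x + g x) ≤ B.holderNorm a f + B.holderNorm a g := by
  have key : ∀ (φ : (Fin d → ℝ) → ℝ) (_ : MemLp φ ⊤ (cubeVol d)) (w : ℝ) (_ : 0 ≤ w),
      ENNReal.ofReal (w * |innerC (fun x => f x + g x) φ|)
        ≤ ENNReal.ofReal (w * |innerC f φ|) + ENNReal.ofReal (w * |innerC g φ|) := by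
    intro φ hφ w hw
    rw [← ENNReal.ofReal_add (by positivity) (by positivity), ← mul_add]
    refine ENNReal.ofReal_le_ofReal (mul_le_mul_of_nonneg_left ?_ hw)
    rw [innerC_eq, innerC_eq, innerC_eq]
    simp_rw [add_mul]
    rw [integral_add (hf.integrable_mul_top hφ) (hg.integrable_mul_top hφ)]
    exact abs_add_le _ _
  unfold holderNorm
  rw [add_add_add_comm]
  refine add_le_add (iSup_le fun m => ?_) (iSup₂_le fun l hl => iSup₂_le fun ι hι =>
    iSup_le fun m => ?_)
  · exact (key _ (B.memLp_Phi _ m) _ (by positivity)).trans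
      (add_le_add (le_iSup (fun m => ENNReal.ofReal (2 ^ (↑B.J₀ * (a + ↑d / 2))
        * |innerC f (B.Phi B.J₀ m)|)) m)
        (le_iSup (fun m => ENNReal.ofReal (2 ^ (↑B.J₀ * (a + ↑d / 2))
        * |innerC g (B.Phi B.J₀ m)|)) m))
  · refine (key _ (B.memLp_Psi l ι m) _ (by positivity)).trans (add_le_add ?_ ?_)
    · exact le_iSup₂_of_le l hl (le_iSup₂_of_le ι hι (le_iSup_of_le m le_rfl))
    · exact le_iSup₂_of_le l hl (le_iSup₂_of_le ι hι (le_iSup_of_le m le_rfl))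

/-- A signed sum of bumps of height `ε` at scale `2 ^ (-J)` has Hölder norm `O(ε * 2 ^ (J * a))`. -/
theorem exists_holderNorm_bumpSum_le (d : ℕ) {a : ℝ} (ha : 0 < a) (haS : a < S) : ∃ C : ℝ, 1 ≤ C ∧
    ∀ J, B.J₀ ≤ J → ∀ s : (Fin d → Fin (2 ^ J)) → ℝ, (∀ m, |s m| ≤ 1) → ∀ ε : ℝ,
    B.holderNorm a (fun x => ε * bumpSum J s x) ≤ ENNReal.ofReal (C * |ε| * (2 ^ J) ^ a) := by
  have hS : 0 < S := by exact_mod_cast ha.trans haS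
  obtain ⟨C, hC, h⟩ := B.exists_abs_innerC_bumpSum_le d hS
  refine ⟨2 * C, by linarith, fun J hJ s hs ε => ?_⟩
  have hw : ∀ l : ℕ, (2 : ℝ) ^ ((l : ℝ) * (a + d / 2)) = (2 ^ l) ^ a * √(2 ^ l) ^ d := by
    intro l
    rw [mul_add, Real.rpow_add (by norm_num), Real.rpow_mul (by norm_num), Real.rpow_natCast]
    congr 1
    rw [Real.sqrt_eq_rpow, ← Real.rpow_natCast _ d, ← Real.rpow_mul (by positivity),
      ← Real.rpow_natCast 2 l, ← Real.rpow_mul (by norm_num)]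
    congr 1; ring
  have hin : ∀ φ : (Fin d → ℝ) → ℝ,
      |innerC (fun x => ε * bumpSum J s x) φ| = |ε| * |innerC (bumpSum J s) φ| := by
    intro φ
    rw [← abs_mul, innerC_eq, innerC_eq, ← integral_const_mul]
    simp_rw [mul_assoc]
  refine (B.holderNorm_le_of_coef_le (R := C * |ε| * (2 ^ J) ^ a) (fun m => ?_)
    fun l hl ι m hι => ?_).trans ?_
  · rw [hin, hw, Phi_eq_Psi]
    have h1 := (h J B.J₀ le_rfl s hs).1 (fun _ => false) m
    have h0 : (0 : ℝ) < √(2 ^ B.J₀) ^ d := by positivity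
    calc _ ≤ (2 ^ B.J₀) ^ a * √(2 ^ B.J₀) ^ d * (|ε| * (C / √(2 ^ B.J₀) ^ d)) := by gcongr
      _ = C * |ε| * (2 ^ B.J₀) ^ a := by field_simp
      _ ≤ _ := by gcongr; norm_num
  · rw [hin, hw]
    obtain ⟨h1, h2⟩ := h J l hl s hs
    have h0 : (0 : ℝ) < √(2 ^ l) ^ d := by positivity
    have h3 : |innerC (bumpSum J s) (B.Psi l ι m)|
        ≤ C / √(2 ^ l) ^ d * ((2 : ℝ) ^ J / 2 ^ l) ^ a := by
      -- coarse wavelets: the size of the bumps suffices; fine wavelets: their smoothness, as `a < S`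
      rcases le_total ((2 : ℝ) ^ l) (2 ^ J) with hle | hle
      · refine (h1 ι m).trans (le_mul_of_one_le_right (by positivity) ?_)
        exact Real.one_le_rpow ((one_le_div (by positivity)).2 hle) ha.le
      · refine (h2 ι m hι).trans ?_
        gcongr
        rw [← Real.rpow_natCast]
        exact Real.rpow_le_rpow_of_exponent_ge (by positivity)
          ((div_le_one (by positivity)).2 hle) haS.le
    calc _ ≤ (2 ^ l) ^ a * √(2 ^ l) ^ d
          * (|ε| * (C / √(2 ^ l) ^ d * ((2 : ℝ) ^ J / 2 ^ l) ^ a)) := by gcongr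
      _ = _ := by
          rw [Real.div_rpow (by positivity) (by positivity)]
          have : ((2 : ℝ) ^ l) ^ a ≠ 0 := by positivity
          field_simp
  · rw [← ENNReal.ofReal_add (by positivity) (by positivity)]
    exact ENNReal.ofReal_le_ofReal (le_of_eq (by ring))

/-- Bumps of the height allowed by the smoothness class can be added to an interior point of the
ball. -/
theorem exists_add_bumpSum_mem_holderBall (d : ℕ) {a M M₀ : ℝ} (ha : 0 < a) (haS : a < S)
    (hM : 0 < M) (hM₀ : M₀ < M) : ∃ c : ℝ, 0 < c ∧ ∀ h ∈ B.holderBall d a M₀, ∀ J, B.J₀ ≤ J →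
    ∀ s : (Fin d → Fin (2 ^ J)) → ℝ, (∀ m, |s m| ≤ 1) → ∀ ε : ℝ, |ε| ≤ c / (2 ^ J) ^ a →
    (fun x => h x + ε * bumpSum J s x) ∈ B.holderBall d a M := by
  obtain ⟨C, hC, hb⟩ := B.exists_holderNorm_bumpSum_le d ha haS
  have hpos : 0 < M - max M₀ 0 := by
    rw [sub_pos]; exact max_lt hM₀ hM
  refine ⟨(M - max M₀ 0) / C, by positivity, fun h hh J hJ s hs ε hε => ⟨?_, ?_⟩⟩
  · have hc : ContinuousOn (fun x => ε * bumpSum J s x) (cube d) :=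
      (continuous_const.mul (continuous_bumpSum J s)).continuousOn
    have hu : UniformContinuousOn (fun x => ε * bumpSum J s x) (cube d) :=
      (isCompact_Icc (a := (0 : Fin d → ℝ)) (b := 1)).uniformContinuousOn_of_continuous hc
    have h1 := uniformContinuousOn_iff_restrict.1 hh.1
    have h2 := uniformContinuousOn_iff_restrict.1 hu
    exact uniformContinuousOn_iff_restrict.2 (h1.add h2)
  · have hm : MemLp (fun x => ε * bumpSum J s x) ⊤ (cubeVol d) :=
      (continuous_const.mul (continuous_bumpSum J s)).memLp_cubeVol
    refine (B.holderNorm_add_le hh.1.memLp_cubeVol hm).trans ?_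
    refine (add_le_add hh.2 (hb J hJ s hs ε)).trans ?_
    have hle : ENNReal.ofReal M₀ = ENNReal.ofReal (max M₀ 0) := by
      rw [ENNReal.ofReal_max]; simp
    rw [hle, ← ENNReal.ofReal_add (le_max_right _ _) (by positivity)]
    refine ENNReal.ofReal_le_ofReal ?_
    have h2 : C * |ε| * (2 ^ J) ^ a ≤ M - max M₀ 0 := by
      have h0 : (0 : ℝ) < (2 ^ J) ^ a := by positivity
      calc _ ≤ C * ((M - max M₀ 0) / C / (2 ^ J) ^ a) * (2 ^ J) ^ a := by gcongr
        _ = _ := by field_simp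
    linarith

end CDVBasis

/-! ### Even parts of products of perturbed factors -/

theorem prod_one_add_of_disjoint {ι : Type*} [Fintype ι] {x : ι → ℝ}
    (h : ∀ m m', x m ≠ 0 → x m' ≠ 0 → m = m') : ∏ m, (1 + x m) = 1 + ∑ m, x m := by
  classical
  by_cases h0 : ∃ m, x m ≠ 0
  · obtain ⟨m, hm⟩ := h0
    have hz : ∀ m' ≠ m, x m' = 0 := fun m' hne => by
      by_contra h1; exact hne (h _ _ h1 hm)
    rw [Finset.prod_eq_single m (fun m' _ hne => by rw [hz m' hne, add_zero]) (by simp),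
      Finset.sum_eq_single m (fun m' _ hne => hz m' hne) (by simp)]
  · push Not at h0
    simp [h0]

/-- The even part of `∏ (1 + a i)` under the reversal of all signs. -/
noncomputable def evenProd {I : Type*} (s : Finset I) (a : I → ℝ) : ℝ :=
  (∏ i ∈ s, (1 + a i) + ∏ i ∈ s, (1 - a i)) / 2

/-- The odd part of `∏ (1 + a i)` under the reversal of all signs. -/
noncomputable def oddProd {I : Type*} (s : Finset I) (a : I → ℝ) : ℝ :=
  (∏ i ∈ s, (1 + a i) - ∏ i ∈ s, (1 - a i)) / 2

section EvenProd

variable {I : Type*} {A : Finset I} {a b : I → ℝ} {η η' : ℝ}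

theorem evenProd_insert [DecidableEq I] {s : Finset I} {i : I} (hi : i ∉ s) (a : I → ℝ) :
    evenProd (insert i s) a = evenProd s a + a i * oddProd s a := by
  unfold evenProd oddProd
  rw [Finset.prod_insert hi, Finset.prod_insert hi]; ring

theorem oddProd_insert [DecidableEq I] {s : Finset I} {i : I} (hi : i ∉ s) (a : I → ℝ) :
    oddProd (insert i s) a = oddProd s a + a i * evenProd s a := by
  unfold evenProd oddProd
  rw [Finset.prod_insert hi, Finset.prod_insert hi]; ring

theorem evenProd_eq_of_subset {s : Finset I} (hA : A ⊆ s) (ha : ∀ i, i ∉ A → a i = 0) :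
    evenProd s a = evenProd A a := by
  unfold evenProd
  rw [Finset.prod_subset hA fun i _ hi => by rw [ha i hi, add_zero],
    Finset.prod_subset hA fun i _ hi => by rw [ha i hi, sub_zero]]

theorem evenProd_ge (ha : ∀ i, |a i| ≤ 1 / 2) : (1 / 2) ^ A.card ≤ evenProd A a := by
  have h1 : (1 / 2 : ℝ) ^ A.card ≤ ∏ i ∈ A, (1 + a i) := by
    rw [← Finset.prod_const]
    exact Finset.prod_le_prod (fun _ _ => by norm_num) fun i _ => by
      have := (abs_le.1 (ha i)).1; linarith
  have h2 : (1 / 2 : ℝ) ^ A.card ≤ ∏ i ∈ A, (1 - a i) := by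
    rw [← Finset.prod_const]
    exact Finset.prod_le_prod (fun _ _ => by norm_num) fun i _ => by
      have := (abs_le.1 (ha i)).2; linarith
  unfold evenProd; linarith

theorem abs_evenProd_oddProd_le (hη : η ≤ 1 / 2) (ha : ∀ i, |a i| ≤ η) (A : Finset I) :
    |evenProd A a| ≤ 2 ^ A.card ∧ |oddProd A a| ≤ η * (2 ^ A.card - 1) := by
  classical
  induction A using Finset.induction_on with
  | empty => simp [evenProd, oddProd]
  | insert i s hi ih =>
    obtain ⟨h1, h2⟩ := ih
    have hη0 : 0 ≤ η := (abs_nonneg _).trans (ha i)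
    rw [evenProd_insert hi, oddProd_insert hi, Finset.card_insert_of_notMem hi, pow_succ]
    have hp : (1 : ℝ) ≤ 2 ^ s.card := one_le_pow₀ (by norm_num)
    have e1 : |a i * oddProd s a| ≤ η * (η * (2 ^ s.card - 1)) := by
      rw [abs_mul]; gcongr; exact ha i
    have e2 : |a i * evenProd s a| ≤ η * 2 ^ s.card := by
      rw [abs_mul]; gcongr; exact ha i
    constructor
    · refine (abs_add_le _ _).trans ?_
      have : η * (η * ((2 : ℝ) ^ s.card - 1)) ≤ 1 / 2 * (1 / 2 * (2 ^ s.card - 1)) := by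
        gcongr
      nlinarith
    · refine (abs_add_le _ _).trans ?_
      nlinarith

/-- The even parts of two perturbed products differ only at second order: the bound has the factor
`η * η'`, and it vanishes when there is at most one factor. -/
theorem abs_evenProd_sub_le (hη : η ≤ 1 / 2) (ha : ∀ i, |a i| ≤ η) (hb : ∀ i, |b i| ≤ η)
    (hab : ∀ i, |b i - a i| ≤ η') (A : Finset I) :
    |evenProd A b - evenProd A a| ≤ η * η' * (4 ^ A.card - 1 - 3 * A.card) ∧
      |oddProd A b - oddProd A a| ≤ η' * (4 ^ A.card - 1) := by
  classical
  induction A using Finset.induction_on with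
  | empty => simp [evenProd, oddProd]
  | insert i s hi ih =>
    obtain ⟨h1, h2⟩ := ih
    obtain ⟨b1, b2⟩ := abs_evenProd_oddProd_le hη hb s
    have hη0 : 0 ≤ η := (abs_nonneg _).trans (ha i)
    have hη'0 : 0 ≤ η' := (abs_nonneg _).trans (hab i)
    rw [evenProd_insert hi, oddProd_insert hi, evenProd_insert hi, oddProd_insert hi,
      Finset.card_insert_of_notMem hi, pow_succ]
    push_cast
    set r := s.card
    have hp : (1 : ℝ) ≤ 2 ^ r := one_le_pow₀ (by norm_num)
    have h4 : (4 : ℝ) ^ r = 2 ^ r * 2 ^ r := by rw [← mul_pow]; norm_num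
    have e1 : |(b i - a i) * oddProd s b| ≤ η' * (η * (2 ^ r - 1)) := by
      rw [abs_mul]; gcongr; exact hab i
    have e2 : |(b i - a i) * evenProd s b| ≤ η' * 2 ^ r := by
      rw [abs_mul]; gcongr; exact hab i
    have e3 : |a i * (oddProd s b - oddProd s a)| ≤ η * (η' * (4 ^ r - 1)) := by
      rw [abs_mul]; gcongr; exact ha i
    have hq : (4 : ℝ) ^ r - 1 - 3 * r ≤ 4 ^ r := by
      have : (0 : ℝ) ≤ r := Nat.cast_nonneg _
      linarith
    have e4 : |a i * (evenProd s b - evenProd s a)| ≤ 1 / 2 * (1 / 2 * η' * 4 ^ r) := by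
      rw [abs_mul]
      have : |evenProd s b - evenProd s a| ≤ 1 / 2 * η' * 4 ^ r := by
        refine h1.trans ?_
        calc _ ≤ η * η' * 4 ^ r := by gcongr
          _ ≤ _ := by gcongr
      gcongr
      exact (ha i).trans hη
    constructor
    · have e : evenProd s b + b i * oddProd s b - (evenProd s a + a i * oddProd s a)
          = (evenProd s b - evenProd s a) + (b i - a i) * oddProd s b
            + a i * (oddProd s b - oddProd s a) := by ring
      rw [e]
      refine (abs_add_le _ _).trans ?_
      refine (add_le_add (abs_add_le _ _) le_rfl).trans ?_
      refine (add_le_add (add_le_add h1 e1) e3).trans ?_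
      rw [h4]
      have h5 : 0 ≤ η * η' := mul_nonneg hη0 hη'0
      have h6 : 0 ≤ 2 * ((2 : ℝ) ^ r * 2 ^ r) - 2 ^ r - 1 := by nlinarith
      have := mul_nonneg h5 h6
      nlinarith
    · have e : oddProd s b + b i * evenProd s b - (oddProd s a + a i * evenProd s a)
          = (oddProd s b - oddProd s a) + (b i - a i) * evenProd s b
            + a i * (evenProd s b - evenProd s a) := by ring
      rw [e]
      refine (abs_add_le _ _).trans ?_
      refine (add_le_add (abs_add_le _ _) le_rfl).trans ?_
      refine (add_le_add (add_le_add h2 e2) e4).trans ?_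
      rw [h4]
      have h6 : 0 ≤ 7 / 4 * ((2 : ℝ) ^ r * 2 ^ r) + ((2 : ℝ) ^ r * 2 ^ r - 2 ^ r) := by nlinarith
      have := mul_nonneg hη'0 h6
      nlinarith

theorem sq_quartic_le (r : ℕ) :
    ((4 : ℝ) ^ r - 1 - 3 * r) ^ 2 * 4 ^ r ≤ 2 * (64 ^ r - 63 * 2 ^ r + 62) := by
  rcases r with _ | _ | r
  · norm_num
  · norm_num
  have hp : (4 : ℝ) ≤ 2 ^ (r + 2) := by
    rw [pow_add]; have : (1 : ℝ) ≤ 2 ^ r := one_le_pow₀ (by norm_num); linarith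
  have h4 : (4 : ℝ) ^ (r + 2) = (2 ^ (r + 2)) ^ 2 := by rw [← pow_mul, mul_comm, pow_mul]; norm_num
  have h64 : (64 : ℝ) ^ (r + 2) = (2 ^ (r + 2)) ^ 6 := by
    rw [← pow_mul, mul_comm, pow_mul]; norm_num
  have hr : ((r + 2 : ℕ) : ℝ) < 2 ^ (r + 2) := by exact_mod_cast Nat.lt_two_pow_self
  have hr0 : (0 : ℝ) ≤ (r + 2 : ℕ) := Nat.cast_nonneg _
  rw [show r + 1 + 1 = r + 2 from rfl, h4, h64]
  set x : ℝ := 2 ^ (r + 2)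
  set k : ℝ := ((r + 2 : ℕ) : ℝ)
  have h1 : 0 ≤ x ^ 2 - 1 - 3 * k := by nlinarith
  have h2 : x ^ 2 - 1 - 3 * k ≤ x ^ 2 := by linarith
  have h3 : (x ^ 2 - 1 - 3 * k) ^ 2 * x ^ 2 ≤ (x ^ 2) ^ 2 * x ^ 2 := by gcongr
  have h5 : 4 ^ 5 * x ≤ x ^ 5 * x := by gcongr
  nlinarith

end EvenProd

/-! ### Indistinguishability of symmetric mixtures -/

/-- The maps `e i` are independent and have law `P` under `μ`. -/
structure IsSampling {Ω 𝒳 I : Type*} [Fintype I] [MeasurableSpace Ω] [MeasurableSpace 𝒳]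
    (μ : Measure 𝒳) (P : Measure Ω) (e : I → 𝒳 → Ω) : Prop where
  isProb : IsProbabilityMeasure μ
  measurable : ∀ i, Measurable (e i)
  integral_prod : ∀ f : I → Ω → ℝ, ∫ x, ∏ i, f i (e i x) ∂μ = ∏ i, ∫ z, f i z ∂P

theorem MemLp.finset_prod_top {Ω κ : Type*} [MeasurableSpace Ω] {μ : Measure Ω}
    [IsFiniteMeasure μ] {f : κ → Ω → ℝ} (s : Finset κ) (h : ∀ i ∈ s, MemLp (f i) ⊤ μ) :
    MemLp (fun x => ∏ i ∈ s, f i x) ⊤ μ := by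
  classical
  induction s using Finset.induction_on with
  | empty => simpa using memLp_const (1 : ℝ)
  | insert i s hi ih =>
    simp_rw [Finset.prod_insert hi]
    exact (h i (by simp)).mul_top (ih fun j hj => h j (by simp [hj]))

/-- The density, at the sample point `x`, of the mixture over random signs of the product laws
with density `1 + ∑ m, ± g m`, where the functions `g m` have disjoint supports. -/
noncomputable def mixDensity {Ω 𝒳 I ι : Type*} [Fintype I] [Fintype ι] (e : I → 𝒳 → Ω)
    (g : ι → Ω → ℝ) (x : 𝒳) : ℝ :=
  ∏ m, evenProd Finset.univ fun i => g m (e i x)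

/-- The sign attached to a Boolean. -/
def boolSign (b : Bool) : ℝ := if b then 1 else -1

theorem abs_boolSign (b : Bool) : |boolSign b| = 1 := by cases b <;> simp [boolSign]

section Mixture

variable {Ω 𝒳 I ι : Type*} [MeasurableSpace Ω] [MeasurableSpace 𝒳] {μ : Measure 𝒳} {P : Measure Ω} {e : I → 𝒳 → Ω} {A : ι → Set Ω}
  {g g₀ g₁ : ι → Ω → ℝ} {η η' κ : ℝ}

/-- A family of bounded centred perturbations supported on disjoint sets. -/
structure IsPerturbation (P : Measure Ω) (A : ι → Set Ω) (η : ℝ) (g : ι → Ω → ℝ) : Prop where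
  measurableSet : ∀ m, MeasurableSet (A m)
  disjoint : ∀ m m' z, z ∈ A m → z ∈ A m' → m = m'
  measurable : ∀ m, Measurable (g m)
  support : ∀ m z, z ∉ A m → g m z = 0
  bound : ∀ m z, |g m z| ≤ η
  centred : ∀ m, ∫ z, g m z ∂P = 0

theorem IsPerturbation.memLp (hg : IsPerturbation P A η g) (m : ι) : MemLp (g m) ⊤ P :=
  MemLp.of_measurable_of_abs_le (hg.measurable m) (hg.bound m)

theorem IsPerturbation.update [DecidableEq ι] (h₀ : IsPerturbation P A η g₀) (h₁ : IsPerturbation P A η g₁)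
    (m : ι) : IsPerturbation P A η (Function.update g₀ m (g₁ m)) := by
  have key : ∀ m', (Function.update g₀ m (g₁ m) m' = g₀ m' ∨
      Function.update g₀ m (g₁ m) m' = g₁ m') := by
    intro m'
    by_cases h : m' = m
    · subst h; right; simp
    · left; simp [h]
  refine ⟨h₀.measurableSet, h₀.disjoint, fun m' => ?_, fun m' => ?_, fun m' => ?_, fun m' => ?_⟩
  · rcases key m' with h | h <;> rw [h]
    exacts [h₀.measurable m', h₁.measurable m']
  · rcases key m' with h | h <;> rw [h]
    exacts [h₀.support m', h₁.support m']
  · rcases key m' with h | h <;> rw [h]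
    exacts [h₀.bound m', h₁.bound m']
  · rcases key m' with h | h <;> rw [h]
    exacts [h₀.centred m', h₁.centred m']

/-- The product of even parts is the average over all choices of signs, since at most one perturbation is
nonzero at each observation. -/
theorem mixDensity_eq_sum {𝒴 : Type*} [Fintype I] [Fintype ι] [DecidableEq ι]
    {e : I → 𝒴 → Ω} (hg : IsPerturbation P A η g) (x : 𝒴) :
    mixDensity e g x = (1 / 2) ^ Fintype.card ι *
      ∑ s : ι → Bool, ∏ i, (1 + ∑ m, boolSign (s m) * g m (e i x)) := by
  have h1 : ∀ m, evenProd Finset.univ (fun i => g m (e i x))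
      = ∑ b : Bool, 1 / 2 * ∏ i, (1 + boolSign b * g m (e i x)) := by
    intro m
    rw [Fintype.sum_bool]
    simp only [evenProd, boolSign, if_true, Bool.false_eq_true, if_false, one_mul, neg_mul,
      ← sub_eq_add_neg]
    ring
  unfold mixDensity
  simp_rw [h1]
  rw [Finset.prod_univ_sum, Fintype.piFinset_univ, Finset.mul_sum]
  refine Finset.sum_congr rfl fun s _ => ?_
  rw [Finset.prod_mul_distrib, Finset.prod_const, Finset.card_univ, Finset.prod_comm]
  congr 1
  refine Finset.prod_congr rfl fun i _ => ?_
  refine prod_one_add_of_disjoint fun m m' h h' => ?_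
  have hm : e i x ∈ A m := by
    by_contra h0; exact h (by rw [hg.support m _ h0, mul_zero])
  have hm' : e i x ∈ A m' := by
    by_contra h0; exact h' (by rw [hg.support m' _ h0, mul_zero])
  exact hg.disjoint m m' _ hm hm'

theorem memLp_mixDensity [Fintype I] [Fintype ι] (hμ : IsSampling μ P e) (hg : IsPerturbation P A η g) :
    MemLp (mixDensity e g) ⊤ μ := by
  have := hμ.isProb
  have h : ∀ m i, MemLp (fun x => g m (e i x)) ⊤ μ := fun m i =>
    MemLp.of_measurable_of_abs_le ((hg.measurable m).comp (hμ.measurable i)) fun x => hg.bound m _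
  unfold mixDensity evenProd
  refine MemLp.finset_prod_top _ fun m _ => ?_
  have h1 : MemLp (fun x => ∏ i, (1 + g m (e i x))) ⊤ μ :=
    MemLp.finset_prod_top _ fun i _ => MemLp.add (f := fun _ => (1 : ℝ)) (memLp_const 1) (h m i)
  have h2 : MemLp (fun x => ∏ i, (1 - g m (e i x))) ⊤ μ :=
    MemLp.finset_prod_top _ fun i _ => MemLp.sub (f := fun _ => (1 : ℝ)) (memLp_const 1) (h m i)
  simp_rw [div_eq_mul_inv]
  exact (h1.add h2).mul_const _

/-- Integration of a mixture against a product of functions of the observations. -/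
theorem integral_mixDensity_mul [Fintype I] [Fintype ι] (hμ : IsSampling μ P e) [IsFiniteMeasure P]
    (hg : IsPerturbation P A η g) {k : I → Ω → ℝ} (hk : ∀ i, MemLp (k i) ⊤ P)
    (hkm : ∀ i, Measurable (k i)) {K : ℝ} (hkb : ∀ i z, |k i z| ≤ K)
    (hgk : ∀ m i, ∫ z, g m z * k i z ∂P = 0) :
    ∫ x, mixDensity e g x * ∏ i, k i (e i x) ∂μ = ∏ i, ∫ z, k i z ∂P := by
  classical
  have := hμ.isProb
  simp_rw [mixDensity_eq_sum hg, mul_assoc, Finset.sum_mul, ← Finset.prod_mul_distrib]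
  have hm : ∀ (s : ι → Bool) (i : I),
      MemLp (fun z => (1 + ∑ m, boolSign (s m) * g m z) * k i z) ⊤ P := fun s i =>
    (MemLp.add (f := fun _ => (1 : ℝ)) (memLp_const 1)
      (memLp_finsetSum _ fun m _ => (hg.memLp m).const_mul _)).mul_top (hk i)
  have hint : ∀ s : ι → Bool, Integrable
      (fun x => ∏ i, (1 + ∑ m, boolSign (s m) * g m (e i x)) * k i (e i x)) μ := by
    intro s
    refine (MemLp.finset_prod_top _ fun i _ => ?_).integrable le_top
    refine MemLp.mul_top (MemLp.add (f := fun _ => (1 : ℝ)) (memLp_const 1)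
      (memLp_finsetSum _ fun m _ => MemLp.const_mul ?_ _)) ?_
    · exact MemLp.of_measurable_of_abs_le ((hg.measurable m).comp (hμ.measurable i))
        fun x => hg.bound m _
    · exact MemLp.of_measurable_of_abs_le ((hkm i).comp (hμ.measurable i)) fun x => hkb i _
  rw [integral_const_mul, integral_finsetSum _ fun s _ => hint s]
  have hval : ∀ s : ι → Bool,
      ∫ x, ∏ i, (1 + ∑ m, boolSign (s m) * g m (e i x)) * k i (e i x) ∂μ = ∏ i, ∫ z, k i z ∂P := by
    intro s
    rw [hμ.integral_prod fun i z => (1 + ∑ m, boolSign (s m) * g m z) * k i z]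
    refine Finset.prod_congr rfl fun i _ => ?_
    have hi : ∀ m, Integrable (fun z => boolSign (s m) * (g m z * k i z)) P := fun m =>
      ((hg.memLp m).integrable_mul_top (hk i)).const_mul _
    simp_rw [add_mul, one_mul, Finset.sum_mul, mul_assoc]
    rw [integral_add ((hk i).integrable le_top) (integrable_finsetSum _ fun m _ => hi m),
      integral_finsetSum _ fun m _ => hi m]
    simp_rw [integral_const_mul, hgk]
    simp
  simp_rw [hval]
  rw [Finset.sum_const, Finset.card_univ, Fintype.card_fun, Fintype.card_bool, nsmul_eq_mul,
    ← mul_assoc]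
  push_cast
  rw [← mul_pow]
  norm_num

theorem integral_mixDensity [Fintype I] [Fintype ι] (hμ : IsSampling μ P e) [IsProbabilityMeasure P]
    (hg : IsPerturbation P A η g) : ∫ x, mixDensity e g x ∂μ = 1 := by
  have := integral_mixDensity_mul hμ hg (k := fun _ _ => 1) (fun _ => memLp_const 1)
    (fun _ => measurable_const) (K := 1) (fun _ _ => by simp) (fun m _ => by simp [hg.centred])
  simpa using this

/-- The number of observations in a given set. -/
noncomputable def hitCount {Ω 𝒳 I : Type*} [Fintype I] (e : I → 𝒳 → Ω) (A : Set Ω) (x : 𝒳) : ℕ :=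
  open Classical in (Finset.univ.filter fun i => e i x ∈ A).card

theorem pow_hitCount {Ω 𝒳 I : Type*} [Fintype I] {e : I → 𝒳 → Ω} (B : Set Ω) (D : ℝ) (x : 𝒳) :
    D ^ hitCount e B x = ∏ i, (1 + B.indicator (fun _ => D - 1) (e i x)) := by
  classical
  unfold hitCount
  rw [← Finset.prod_const, Finset.prod_filter]
  refine Finset.prod_congr rfl fun i _ => ?_
  by_cases h : e i x ∈ B <;> simp [h]

/-- The number of observations in a cell is binomial under the mixture. -/
theorem integral_mixDensity_mul_pow [Fintype I] [Fintype ι] (hμ : IsSampling μ P e) [IsProbabilityMeasure P]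
    (hg : IsPerturbation P A η g) (m : ι) (D : ℝ) :
    Integrable (fun x => mixDensity e g x * D ^ hitCount e (A m) x) μ ∧
    ∫ x, mixDensity e g x * D ^ hitCount e (A m) x ∂μ
      = (1 + (D - 1) * P.real (A m)) ^ Fintype.card I := by
  have := hμ.isProb
  set k : Ω → ℝ := fun z => 1 + (A m).indicator (fun _ => D - 1) z with hk
  have hkm : Measurable k := measurable_const.add (measurable_const.indicator (hg.measurableSet m))
  have hkb : ∀ z, |k z| ≤ 1 + |D - 1| := fun z => by
    refine (abs_add_le _ _).trans ?_
    rw [abs_one, add_le_add_iff_left]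
    by_cases h : z ∈ A m <;> simp [h]
  have hkL : MemLp k ⊤ P := MemLp.of_measurable_of_abs_le hkm hkb
  have hgk : ∀ m', ∫ z, g m' z * k z ∂P = 0 := by
    intro m'
    classical
    have : ∀ z, g m' z * k z = (if m' = m then D else 1) * g m' z := by
      intro z
      by_cases hz : z ∈ A m
      · by_cases hmm : m' = m
        · simp [hk, hz, hmm]; ring
        · have : g m' z = 0 := hg.support m' z fun hz' => hmm (hg.disjoint _ _ _ hz' hz)
          simp [this]
      · by_cases hmm : m' = m
        · subst hmm; simp [hg.support m' z hz]
        · simp [hk, hz, hmm]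
    simp_rw [this]
    rw [integral_const_mul, hg.centred, mul_zero]
  have hv : ∫ z, k z ∂P = 1 + (D - 1) * P.real (A m) := by
    rw [hk, integral_add (integrable_const _)
      ((integrable_const _).indicator (hg.measurableSet m)),
      integral_indicator_const _ (hg.measurableSet m)]
    simp [mul_comm]
  have hkI : MemLp (fun x => ∏ i, k (e i x)) ⊤ μ := MemLp.finset_prod_top _ fun i _ =>
    MemLp.of_measurable_of_abs_le (hkm.comp (hμ.measurable i)) fun x => hkb _
  have e := integral_mixDensity_mul hμ hg (k := fun _ => k) (fun _ => hkL) (fun _ => hkm)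
    (fun _ => hkb) fun m' _ => hgk m'
  simp_rw [pow_hitCount]
  refine ⟨(memLp_mixDensity hμ hg).integrable_mul_top hkI, ?_⟩
  rw [e]
  simp [hv]

end Mixture

section Mixture

variable {Ω 𝒳 I ι : Type*} [MeasurableSpace Ω] [MeasurableSpace 𝒳] {μ : Measure 𝒳} {P : Measure Ω}
  {e : I → 𝒳 → Ω} {A : ι → Set Ω} {g g₀ g₁ : ι → Ω → ℝ} {η η' κ : ℝ}

/-- A pointwise lower bound for the affinity, through `log y ≥ 1 - 1 / y`. -/
theorem min_one_ge {y : ℝ} (hy : 0 < y) : 3 / 2 - y + Real.log y ≤ min 1 y := by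
  refine le_min ?_ ?_
  · linarith [Real.log_le_sub_one_of_pos hy]
  · -- the tangent of the logarithm at `1 / 2`
    have h2 := Real.log_le_sub_one_of_pos (show 0 < 2 * y by positivity)
    rw [Real.log_mul (by norm_num) hy.ne'] at h2
    have h3 : (1 : ℝ) / 2 ≤ Real.log 2 := by
      have := Real.log_two_gt_d9; norm_num at this ⊢; linarith
    linarith

/-- The relative squared difference of the even parts on one cell. With at most one observation in
the cell it vanishes; the exponential polynomial in the number of observations is chosen to have a
binomial expectation of second order. -/
theorem exists_evenProd_compare {Ω 𝒳 I ι : Type*} [Fintype I] {e : I → 𝒳 → Ω} {A : ι → Set Ω}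
    {g₀ g₁ : ι → Ω → ℝ} (hη : η ≤ 1 / 2) (h0 : ∀ m z, z ∉ A m → g₀ m z = 0)
    (h1 : ∀ m z, z ∉ A m → g₁ m z = 0) (hb0 : ∀ m z, |g₀ m z| ≤ η) (hb1 : ∀ m z, |g₁ m z| ≤ η)
    (hd : ∀ m z, |g₁ m z - g₀ m z| ≤ η') (m : ι) (x : 𝒳) :
    (evenProd Finset.univ (fun i => g₁ m (e i x)) - evenProd Finset.univ fun i => g₀ m (e i x)) ^ 2
      ≤ (η * η') ^ 2 * (2 * (64 ^ hitCount e (A m) x - 63 * 2 ^ hitCount e (A m) x + 62))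
        * (evenProd Finset.univ (fun i => g₀ m (e i x))
          * evenProd Finset.univ fun i => g₁ m (e i x)) := by
  classical
  set F : Finset I := Finset.univ.filter fun i => e i x ∈ A m with hF
  have hc : hitCount e (A m) x = F.card := by
    unfold hitCount; rw [hF]
  have e0 : evenProd Finset.univ (fun i => g₀ m (e i x)) = evenProd F fun i => g₀ m (e i x) :=
    evenProd_eq_of_subset (Finset.subset_univ _) fun i hi => h0 _ _ (by simpa [hF] using hi)
  have e1 : evenProd Finset.univ (fun i => g₁ m (e i x)) = evenProd F fun i => g₁ m (e i x) :=
    evenProd_eq_of_subset (Finset.subset_univ _) fun i hi => h1 _ _ (by simpa [hF] using hi)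
  rw [e0, e1, hc]
  have l0 := evenProd_ge (A := F) (a := fun i => g₀ m (e i x)) fun i => (hb0 _ _).trans hη
  have l1 := evenProd_ge (A := F) (a := fun i => g₁ m (e i x)) fun i => (hb1 _ _).trans hη
  have hdiff := (abs_evenProd_sub_le hη (fun i => hb0 m (e i x)) (fun i => hb1 m (e i x))
    (fun i => hd m (e i x)) F).1
  have hq := sq_quartic_le F.card
  have hpos : (0 : ℝ) ≤ 2 * (64 ^ F.card - 63 * 2 ^ F.card + 62) := le_trans (by positivity) hq
  have p0 : 0 ≤ evenProd F fun i => g₀ m (e i x) := le_trans (by positivity) l0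
  have h4 : (4 : ℝ) ^ F.card * ((1 / 2) ^ F.card * (1 / 2) ^ F.card) = 1 := by
    rw [← mul_pow, ← mul_pow]; norm_num
  calc _ ≤ (η * η' * (4 ^ F.card - 1 - 3 * F.card)) ^ 2 := by
        rw [← sq_abs]; exact pow_le_pow_left₀ (abs_nonneg _) hdiff 2
    _ = (η * η') ^ 2 * (((4 ^ F.card - 1 - 3 * F.card) ^ 2 * 4 ^ F.card)
        * ((1 / 2) ^ F.card * (1 / 2) ^ F.card)) := by
        rw [mul_assoc (_ ^ 2) (4 ^ F.card), h4]; ring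
    _ ≤ (η * η') ^ 2 * ((2 * (64 ^ F.card - 63 * 2 ^ F.card + 62))
        * ((1 / 2) ^ F.card * (1 / 2) ^ F.card)) := by gcongr
    _ ≤ (η * η') ^ 2 * ((2 * (64 ^ F.card - 63 * 2 ^ F.card + 62))
        * (evenProd F (fun i => g₀ m (e i x)) * evenProd F fun i => g₁ m (e i x))) := by gcongr
    _ = _ := by ring

theorem mixDensity_pos {𝒴 : Type*} [Fintype I] [Fintype ι] {e : I → 𝒴 → Ω} (hη : η ≤ 1 / 2)
    (hg : IsPerturbation P A η g) (x : 𝒴) : 0 < mixDensity e g x :=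
  Finset.prod_pos fun m _ => lt_of_lt_of_le (by positivity)
    (evenProd_ge (A := Finset.univ) fun i => (hg.bound m (e i x)).trans hη)

/-- A lower bound for the overlap of two mixtures in which the log-likelihood ratio is a sum over the
cells: each summand compares `g₀` with its modification on a single cell, whose mixture again
integrates to one. -/
theorem min_mixDensity_ge {𝒴 : Type*} [Fintype I] [Fintype ι] [DecidableEq ι] {e : I → 𝒴 → Ω}
    (hη : η ≤ 1 / 2)
    (h₀ : IsPerturbation P A η g₀)
    (h₁ : IsPerturbation P A η g₁) (hd : ∀ m z, |g₁ m z - g₀ m z| ≤ η') (x : 𝒴) :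
    3 / 2 * mixDensity e g₀ x - mixDensity e g₁ x
      + ∑ m, (mixDensity e (Function.update g₀ m (g₁ m)) x - mixDensity e g₀ x
        - (η * η') ^ 2 * 2 * (mixDensity e g₀ x * 64 ^ hitCount e (A m) x
          - 63 * (mixDensity e g₀ x * 2 ^ hitCount e (A m) x) + 62 * mixDensity e g₀ x))
      ≤ min (mixDensity e g₀ x) (mixDensity e g₁ x) := by
  set a : ι → ℝ := fun m => evenProd Finset.univ fun i => g₀ m (e i x) with ha
  set b : ι → ℝ := fun m => evenProd Finset.univ fun i => g₁ m (e i x) with hb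
  have ha0 : ∀ m, 0 < a m := fun m => lt_of_lt_of_le (by positivity)
    (evenProd_ge (A := Finset.univ) fun i => (h₀.bound m (e i x)).trans hη)
  have hb0 : ∀ m, 0 < b m := fun m => lt_of_lt_of_le (by positivity)
    (evenProd_ge (A := Finset.univ) fun i => (h₁.bound m (e i x)).trans hη)
  set F := mixDensity e g₀ x with hF
  set G := mixDensity e g₁ x with hG
  have hFp : 0 < F := mixDensity_pos hη h₀ x
  have hGp : 0 < G := mixDensity_pos hη h₁ x
  have hFa : F = ∏ m, a m := rfl
  have hGb : G = ∏ m, b m := rfl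
  -- exchanging the perturbation on a single cell multiplies the density by one likelihood ratio
  have hupd : ∀ m, mixDensity e (Function.update g₀ m (g₁ m)) x = F * (b m / a m) := by
    intro m
    rw [mixDensity, hFa, ← Finset.mul_prod_erase _ _ (Finset.mem_univ m),
      ← Finset.mul_prod_erase _ a (Finset.mem_univ m)]
    have : ∀ m' ∈ Finset.univ.erase m,
        evenProd Finset.univ (fun i => Function.update g₀ m (g₁ m) m' (e i x)) = a m' := by
      intro m' hm'
      simp [ha, (Finset.mem_erase.1 hm').1]
    rw [Finset.prod_congr rfl this]
    have := (ha0 m).ne'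
    have e : evenProd Finset.univ (fun i => Function.update g₀ m (g₁ m) m (e i x)) = b m := by
      simp [hb]
    rw [e]
    field_simp
  have hlog : Real.log (G / F) = ∑ m, Real.log (b m / a m) := by
    rw [hFa, hGb, ← Finset.prod_div_distrib, Real.log_prod fun m _ => (div_pos (hb0 m) (ha0 m)).ne']
  have hm : ∀ m, b m / a m - 1 - (η * η') ^ 2 * 2 * (64 ^ hitCount e (A m) x
      - 63 * 2 ^ hitCount e (A m) x + 62) ≤ Real.log (b m / a m) := by
    intro m
    have h1 := Real.one_sub_inv_le_log_of_pos (div_pos (hb0 m) (ha0 m))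
    have h2 := exists_evenProd_compare (e := e) hη h₀.support h₁.support h₀.bound h₁.bound hd m x
    have h3 : (b m - a m) ^ 2 / (a m * b m) ≤ (η * η') ^ 2 * (2 * (64 ^ hitCount e (A m) x
      - 63 * 2 ^ hitCount e (A m) x + 62)) :=
      (div_le_iff₀ (mul_pos (ha0 m) (hb0 m))).2 h2
    have h4 : 1 - (b m / a m)⁻¹ = b m / a m - 1 - (b m - a m) ^ 2 / (a m * b m) := by
      have := (ha0 m).ne'
      have := (hb0 m).ne'
      field_simp
      ring
    linarith
  have hmin := min_one_ge (div_pos hGp hFp)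
  have hs := Finset.sum_le_sum fun m (_ : m ∈ Finset.univ) => hm m
  rw [← hlog] at hs
  have hmul : F * min 1 (G / F) = min F G := by
    rw [mul_min_of_nonneg _ _ hFp.le, mul_one, mul_div_cancel₀ _ hFp.ne']
  rw [← hmul]
  have hFs : F * ∑ m, (b m / a m - 1 - (η * η') ^ 2 * 2 * (64 ^ hitCount e (A m) x
      - 63 * 2 ^ hitCount e (A m) x + 62)) = ∑ m, (mixDensity e (Function.update g₀ m (g₁ m)) x - F
        - (η * η') ^ 2 * 2 * (F * 64 ^ hitCount e (A m) x
          - 63 * (F * 2 ^ hitCount e (A m) x) + 62 * F)) := by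
    rw [Finset.mul_sum]
    refine Finset.sum_congr rfl fun m _ => ?_
    rw [hupd]; ring
  rw [← hFs]
  calc _ ≤ F * (3 / 2 - G / F + Real.log (G / F)) := by
        have : F * (G / F) = G := mul_div_cancel₀ _ hFp.ne'
        have := mul_le_mul_of_nonneg_left hs hFp.le
        linarith
    _ ≤ _ := by gcongr

/-- Two symmetric mixtures over signs attached to small cells cannot be told apart from few
observations. -/
theorem integral_min_mixDensity_ge [Fintype I] [Fintype ι] (hμ : IsSampling μ P e)
    [IsProbabilityMeasure P] (hη : η ≤ 1 / 2)
    (h₀ : IsPerturbation P A η g₀) (h₁ : IsPerturbation P A η g₁)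
    (hd : ∀ m z, |g₁ m z - g₀ m z| ≤ η') (hκ : ∀ m, P.real (A m) ≤ κ)
    (hN : 63 * Fintype.card I * κ ≤ 1) :
    1 / 2 - 2 * Fintype.card ι * (η * η' * (63 * Fintype.card I * κ)) ^ 2
      ≤ ∫ x, min (mixDensity e g₀ x) (mixDensity e g₁ x) ∂μ := by
  classical
  have := hμ.isProb
  have i0 := (memLp_mixDensity hμ h₀).integrable le_top
  have i1 := (memLp_mixDensity hμ h₁).integrable le_top
  have iu := fun m => (memLp_mixDensity hμ (h₀.update h₁ m)).integrable le_top
  have ip := fun m D => (integral_mixDensity_mul_pow hμ h₀ m D).1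
  set q : ι → 𝒳 → ℝ := fun m x => mixDensity e g₀ x * 64 ^ hitCount e (A m) x
          - 63 * (mixDensity e g₀ x * 2 ^ hitCount e (A m) x) + 62 * mixDensity e g₀ x with hq
  have iq : ∀ m, Integrable (q m) μ := fun m =>
    ((ip m 64).sub ((ip m 2).const_mul 63)).add (i0.const_mul 62)
  have im : ∀ m, Integrable (fun x => mixDensity e (Function.update g₀ m (g₁ m)) x
      - mixDensity e g₀ x - (η * η') ^ 2 * 2 * q m x) μ := fun m =>
    ((iu m).sub i0).sub ((iq m).const_mul _)
  have hlow : ∫ x, (3 / 2 * mixDensity e g₀ x - mixDensity e g₁ x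
      + ∑ m, (mixDensity e (Function.update g₀ m (g₁ m)) x - mixDensity e g₀ x
        - (η * η') ^ 2 * 2 * q m x)) ∂μ
      ≤ ∫ x, min (mixDensity e g₀ x) (mixDensity e g₁ x) ∂μ :=
    integral_mono (((i0.const_mul _).sub i1).add (integrable_finsetSum _ fun m _ => im m))
      (i0.inf i1) fun x => min_mixDensity_ge hη h₀ h₁ hd x
  refine le_trans ?_ hlow
  have j1 : Integrable (fun x => 3 / 2 * mixDensity e g₀ x - mixDensity e g₁ x) μ :=
    (i0.const_mul _).sub i1
  have j2 : ∀ m, Integrable (fun x => mixDensity e (Function.update g₀ m (g₁ m)) x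
      - mixDensity e g₀ x) μ := fun m => (iu m).sub i0
  rw [integral_add j1 (integrable_finsetSum _ fun m _ => im m), integral_finsetSum _ fun m _ => im m,
    integral_sub (i0.const_mul _) i1, integral_const_mul, integral_mixDensity hμ h₀,
    integral_mixDensity hμ h₁]
  have hqv : ∀ m, ∫ x, q m x ∂μ ≤ (63 * Fintype.card I * κ) ^ 2 := by
    intro m
    have j3 : Integrable (fun x => mixDensity e g₀ x * 64 ^ hitCount e (A m) x
          - 63 * (mixDensity e g₀ x * 2 ^ hitCount e (A m) x)) μ :=
      (ip m 64).sub ((ip m 2).const_mul 63)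
    rw [hq, integral_add j3 (i0.const_mul 62), integral_sub (ip m 64) ((ip m 2).const_mul 63),
      integral_const_mul, integral_const_mul, (integral_mixDensity_mul_pow hμ h₀ m 64).2,
      (integral_mixDensity_mul_pow hμ h₀ m 2).2, integral_mixDensity hμ h₀]
    set p := P.real (A m) with hp
    set N := Fintype.card I
    have hp0 : 0 ≤ p := measureReal_nonneg
    have hpκ : p ≤ κ := hκ m
    have hN0 : (0 : ℝ) ≤ N := Nat.cast_nonneg _
    -- Bernoulli's inequality and `exp x - 1 - x ≤ x ^ 2`: the terms of order zero and one cancel,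
    -- since `64 - 63 * 2 + 62 = 0` and `63 - 63 = 0`
    have b1 : 1 + (N : ℝ) * p ≤ (1 + (2 - 1) * p) ^ N := by
      have := one_add_mul_le_pow (a := p) (by linarith) N
      norm_num; linarith
    have b2 : (1 + (64 - 1) * p) ^ N ≤ Real.exp (63 * N * p) := by
      calc (1 + (64 - 1) * p) ^ N ≤ Real.exp (63 * p) ^ N := by
            gcongr
            linarith [Real.add_one_le_exp (63 * p)]
        _ = _ := by rw [← Real.exp_nat_mul]; ring_nf
    have hx0 : 0 ≤ 63 * N * p := by positivity
    have hxκ : 63 * N * p ≤ 63 * N * κ := by gcongr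
    have b3 := Real.abs_exp_sub_one_sub_id_le (x := 63 * N * p)
      (by rw [abs_of_nonneg hx0]; linarith)
    have b4 := (abs_le.1 b3).2
    have b5 : (63 * N * p) ^ 2 ≤ (63 * N * κ) ^ 2 := pow_le_pow_left₀ hx0 hxκ 2
    linarith
  have hval : ∀ m, -((η * η') ^ 2 * 2 * (63 * Fintype.card I * κ) ^ 2)
      ≤ ∫ x, (mixDensity e (Function.update g₀ m (g₁ m)) x - mixDensity e g₀ x
        - (η * η') ^ 2 * 2 * q m x) ∂μ := by
    intro m
    rw [integral_sub (j2 m) ((iq m).const_mul _), integral_sub (iu m) i0, integral_const_mul,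
      integral_mixDensity hμ h₀, integral_mixDensity hμ (h₀.update h₁ m)]
    have := mul_le_mul_of_nonneg_left (hqv m) (show 0 ≤ (η * η') ^ 2 * 2 by positivity)
    linarith
  have hsum := Finset.sum_le_sum fun m (_ : m ∈ Finset.univ) => hval m
  rw [Finset.sum_const, Finset.card_univ, nsmul_eq_mul] at hsum
  have e : 1 / 2 - 2 * Fintype.card ι * (η * η' * (63 * Fintype.card I * κ)) ^ 2
      = (3 / 2 * 1 - 1) + Fintype.card ι
        * -((η * η') ^ 2 * 2 * (63 * Fintype.card I * κ) ^ 2) := by ring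
  rw [e]
  linarith

end Mixture

/-! ### From indistinguishability to lower bounds on the risk -/

theorem pi_withDensity {J Z : Type*} [Fintype J] [MeasurableSpace Z] {P : Measure Z}
    [IsProbabilityMeasure P] {f : Z → ℝ≥0∞} (hf : Measurable f) [SigmaFinite (P.withDensity f)] :
    (Measure.pi fun _ : J => P.withDensity f)
      = (Measure.pi fun _ => P).withDensity fun ω => ∏ i, f (ω i) := by
  refine Measure.pi_eq fun s hs => ?_
  have hind : ∀ ω : J → Z, (Set.univ.pi s).indicator (fun ω => ∏ i, f (ω i)) ω
      = ∏ i, (s i).indicator f (ω i) := by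
    intro ω
    by_cases h : ω ∈ Set.univ.pi s
    · rw [Set.indicator_of_mem h]
      exact Finset.prod_congr rfl fun i _ => (Set.indicator_of_mem (h i (Set.mem_univ i)) _).symm
    · rw [Set.indicator_of_notMem h]
      simp only [Set.mem_pi, Set.mem_univ, true_imp_iff, not_forall] at h
      obtain ⟨i, hi⟩ := h
      exact (Finset.prod_eq_zero (Finset.mem_univ i) (Set.indicator_of_notMem hi f)).symm
  have hm : ∀ i, Measurable ((s i).indicator f) := fun i => hf.indicator (hs i)
  rw [withDensity_apply _ (MeasurableSet.univ_pi hs), ← lintegral_indicator (MeasurableSet.univ_pi hs)]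
  simp_rw [hind]
  rw [ProbabilityTheory.lintegral_prod_eq_prod_lintegral_of_indepFun Finset.univ
    (fun i (ω : J → Z) => (s i).indicator f (ω i))
    (iIndepFun_eval.comp (fun i z => (s i).indicator f z) hm)
    fun i => (hm i).comp (measurable_pi_apply i)]
  refine Finset.prod_congr rfl fun i _ => ?_
  rw [lintegral_eval (hm i), lintegral_indicator (hs i), withDensity_apply _ (hs i)]

theorem sampleLaw_withDensity {d : ℕ} {P : Measure (Obs d)} [IsProbabilityMeasure P]
    {f : Obs d → ℝ≥0∞} (hf : Measurable f) [IsProbabilityMeasure (P.withDensity f)] (m n : ℕ) :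
    sampleLaw m n (P.withDensity f)
      = (sampleLaw m n P).withDensity fun ω => ∏ r : Fin m × Fin n, f (ω r.1 r.2) := by
  have hF : Measurable fun D : Fin n → Obs d => ∏ j, f (D j) :=
    Finset.measurable_fun_prod _ fun j _ => hf.comp (measurable_pi_apply j)
  have h1 := pi_withDensity (J := Fin n) (P := P) hf
  have : IsProbabilityMeasure ((Measure.pi fun _ : Fin n => P).withDensity
      fun D => ∏ j, f (D j)) := by rw [← h1]; infer_instance
  unfold sampleLaw
  rw [h1, pi_withDensity hF]
  simp_rw [Fintype.prod_prod_type]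

theorem isSampling_sampleLaw {d : ℕ} (m n : ℕ) (P : Measure (Obs d)) [IsProbabilityMeasure P] :
    IsSampling (sampleLaw m n P) P
      (fun (r : Fin m × Fin n) (ω : Sample d m n) => ω r.1 r.2) := by
  refine ⟨by unfold sampleLaw; infer_instance,
    fun r => (measurable_pi_apply r.2).comp (measurable_pi_apply r.1), fun f => ?_⟩
  simp_rw [Fintype.prod_prod_type]
  unfold sampleLaw
  rw [integral_fintype_prod_eq_prod (𝕜 := ℝ) fun i (D : Fin n → Obs d) => ∏ j, f (i, j) (D j)]
  refine Finset.prod_congr rfl fun i _ => ?_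
  rw [integral_fintype_prod_eq_prod (𝕜 := ℝ) fun j z => f (i, j) z]

section Testing

variable {𝒳 : Type*} [MeasurableSpace 𝒳] {μ : Measure 𝒳}

/-- The risk at a mixture is at most the maximal risk. -/
theorem lintegral_mixture_le {σ : Type*} [Fintype σ] [Nonempty σ] {W : ℝ≥0∞} {T : 𝒳 → ℝ} {v : ℝ}
    {F : σ → 𝒳 → ℝ} (hT : Measurable T) (hF : ∀ s, Measurable (F s)) (hF0 : ∀ s x, 0 ≤ F s x)
    (h : ∀ s, ∫⁻ x, ENNReal.ofReal ((T x - v) ^ 2 * F s x) ∂μ ≤ W) :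
    ∫⁻ x, ENNReal.ofReal ((T x - v) ^ 2 * ((Fintype.card σ : ℝ)⁻¹ * ∑ s, F s x)) ∂μ ≤ W := by
  have e : ∀ x, ENNReal.ofReal ((T x - v) ^ 2 * ((Fintype.card σ : ℝ)⁻¹ * ∑ s, F s x))
      = (Fintype.card σ : ℝ≥0∞)⁻¹ * ∑ s, ENNReal.ofReal ((T x - v) ^ 2 * F s x) := by
    intro x
    rw [← ENNReal.ofReal_sum_of_nonneg fun s _ => mul_nonneg (sq_nonneg _) (hF0 s x),
      ← ENNReal.ofReal_natCast, ← ENNReal.ofReal_inv_of_pos (by positivity),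
      ← ENNReal.ofReal_mul (by positivity), ← Finset.mul_sum]
    congr 1; ring
  have hm : ∀ s, Measurable fun x => ENNReal.ofReal ((T x - v) ^ 2 * F s x) := fun s =>
    (((hT.sub_const v).pow_const 2).mul (hF s)).ennreal_ofReal
  simp_rw [e]
  rw [lintegral_const_mul _ (Finset.measurable_fun_sum _ fun s _ => hm s),
    lintegral_finsetSum _ fun s _ => hm s]
  calc _ ≤ (Fintype.card σ : ℝ≥0∞)⁻¹ * ∑ _s : σ, W := by gcongr with s; exact h s
    _ = W := by
      rw [Finset.sum_const, Finset.card_univ, nsmul_eq_mul, ← mul_assoc,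
        ENNReal.inv_mul_cancel (by simp) (by simp), one_mul]

/-- Le Cam's two-point bound: if the two (mixture) densities overlap, then no estimator is close to
both values of the functional. -/
theorem ofReal_sq_sub_le_of_overlap {W : ℝ≥0∞} {T : 𝒳 → ℝ} {v₀ v₁ : ℝ} {F₀ F₁ : 𝒳 → ℝ}
    (hT : Measurable T) (hF₀ : Measurable F₀) (hp₀ : ∀ x, 0 ≤ F₀ x) (hp₁ : ∀ x, 0 ≤ F₁ x)
    (hi : Integrable (fun x => min (F₀ x) (F₁ x)) μ)
    (h₀ : ∫⁻ x, ENNReal.ofReal ((T x - v₀) ^ 2 * F₀ x) ∂μ ≤ W)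
    (h₁ : ∫⁻ x, ENNReal.ofReal ((T x - v₁) ^ 2 * F₁ x) ∂μ ≤ W)
    (hov : 1 / 4 ≤ ∫ x, min (F₀ x) (F₁ x) ∂μ) :
    ENNReal.ofReal ((v₁ - v₀) ^ 2 / 16) ≤ W := by
  have hm : Measurable fun x => ENNReal.ofReal ((T x - v₀) ^ 2 * F₀ x) :=
    (((hT.sub_const v₀).pow_const 2).mul hF₀).ennreal_ofReal
  have key : ENNReal.ofReal ((v₁ - v₀) ^ 2 / 8) ≤ W + W := by
    calc ENNReal.ofReal ((v₁ - v₀) ^ 2 / 8)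
        ≤ ENNReal.ofReal (∫ x, (v₁ - v₀) ^ 2 / 2 * min (F₀ x) (F₁ x) ∂μ) := by
          refine ENNReal.ofReal_le_ofReal ?_
          rw [integral_const_mul]
          nlinarith [sq_nonneg (v₁ - v₀)]
      _ = ∫⁻ x, ENNReal.ofReal ((v₁ - v₀) ^ 2 / 2 * min (F₀ x) (F₁ x)) ∂μ :=
          ofReal_integral_eq_lintegral_ofReal (hi.const_mul _) (Filter.Eventually.of_forall fun x =>
            mul_nonneg (by positivity) (le_min (hp₀ x) (hp₁ x)))
      _ ≤ ∫⁻ x, (ENNReal.ofReal ((T x - v₀) ^ 2 * F₀ x)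
          + ENNReal.ofReal ((T x - v₁) ^ 2 * F₁ x)) ∂μ := by
          refine lintegral_mono fun x => ?_
          rw [← ENNReal.ofReal_add (mul_nonneg (sq_nonneg _) (hp₀ x))
            (mul_nonneg (sq_nonneg _) (hp₁ x))]
          refine ENNReal.ofReal_le_ofReal ?_
          set k := min (F₀ x) (F₁ x)
          have hk : 0 ≤ k := le_min (hp₀ x) (hp₁ x)
          have a0 := mul_le_mul_of_nonneg_left (min_le_left (F₀ x) (F₁ x)) (sq_nonneg (T x - v₀))
          have a1 := mul_le_mul_of_nonneg_left (min_le_right (F₀ x) (F₁ x)) (sq_nonneg (T x - v₁))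
          have a2 := mul_nonneg hk (sq_nonneg ((T x - v₀) + (T x - v₁)))
          nlinarith
      _ ≤ W + W := by
          rw [lintegral_add_left hm]
          exact add_le_add h₀ h₁
  rw [← two_mul] at key
  have e : ENNReal.ofReal ((v₁ - v₀) ^ 2 / 8) = 2 * ENNReal.ofReal ((v₁ - v₀) ^ 2 / 16) := by
    rw [show (2 : ℝ≥0∞) = ENNReal.ofReal 2 by simp, ← ENNReal.ofReal_mul (by norm_num)]
    congr 1; ring
  rw [e] at key
  exact (ENNReal.mul_le_mul_iff_right (by simp) (by simp)).1 key

theorem IsSampling.integral_eval {Ω I : Type*} [Fintype I] [MeasurableSpace Ω] {P : Measure Ω}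
    [IsProbabilityMeasure P] {e : I → 𝒳 → Ω} (hμ : IsSampling μ P e) (g : Ω → ℝ) (i : I) :
    ∫ x, g (e i x) ∂μ = ∫ z, g z ∂P := by
  classical
  have h := hμ.integral_prod fun i' => if i' = i then g else fun _ => 1
  rw [Finset.prod_eq_single i (by intro i' _ hne; simp [hne]) (by simp)] at h
  rw [if_pos rfl] at h
  rw [← h]
  congr 1; ext x
  rw [Finset.prod_eq_single i (by intro i' _ hne; simp [hne]) (by simp), if_pos rfl]

/-- A perturbation of the density by `η` cannot be detected from fewer than order `η ^ (-2)`
observations. -/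
theorem integral_min_prod_ge {Ω I : Type*} [Fintype I] [MeasurableSpace Ω] {P : Measure Ω}
    [IsProbabilityMeasure P] {e : I → 𝒳 → Ω} (hμ : IsSampling μ P e) {g : Ω → ℝ}
    (hg : Measurable g) {η : ℝ} (hη : η ≤ 1 / 2) (hb : ∀ z, |g z| ≤ η) (hc : ∫ z, g z ∂P = 0)
    (hN : 8 * Fintype.card I * η ^ 2 ≤ 1) :
    Integrable (fun x => min 1 (∏ i, (1 + g (e i x)))) μ ∧
    1 / 4 ≤ ∫ x, min 1 (∏ i, (1 + g (e i x))) ∂μ := by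
  have := hμ.isProb
  have hgi : ∀ i, MemLp (fun x => g (e i x)) ⊤ μ := fun i =>
    MemLp.of_measurable_of_abs_le (hg.comp (hμ.measurable i)) fun x => hb _
  have hpi : MemLp (fun x => ∏ i, (1 + g (e i x))) ⊤ μ := MemLp.finset_prod_top _ fun i _ =>
    MemLp.add (f := fun _ => (1 : ℝ)) (memLp_const 1) (hgi i)
  have i1 := hpi.integrable le_top
  have hmin : Integrable (fun x => min 1 (∏ i, (1 + g (e i x)))) μ := (integrable_const 1).inf i1
  have i0 : ∀ i, Integrable (fun x => g (e i x) - 2 * η ^ 2) μ := fun i =>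
    ((hgi i).integrable le_top).sub (integrable_const _)
  have i2 : Integrable (fun x => ∑ i, (g (e i x) - 2 * η ^ 2)) μ :=
    integrable_finsetSum _ fun i _ => i0 i
  have i3 : Integrable (fun x => 3 / 2 - ∏ i, (1 + g (e i x))) μ := (integrable_const _).sub i1
  have hv : ∫ x, ∏ i, (1 + g (e i x)) ∂μ = 1 := by
    rw [hμ.integral_prod fun _ z => 1 + g z]
    have : ∫ z, (1 + g z) ∂P = 1 := by
      rw [integral_add (integrable_const _)
        ((MemLp.of_measurable_of_abs_le hg hb).integrable le_top), hc]
      simp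
    simp [this]
  refine ⟨hmin, ?_⟩
  -- from `log (1 + t) ≥ t - 2 * t ^ 2` for `|t| ≤ 1 / 2`
  have hpt : ∀ x, 3 / 2 - ∏ i, (1 + g (e i x)) + ∑ i, (g (e i x) - 2 * η ^ 2)
      ≤ min 1 (∏ i, (1 + g (e i x))) := by
    intro x
    have hpos : ∀ i, 0 < 1 + g (e i x) := fun i => by
      have := (abs_le.1 (hb (e i x))).1; linarith
    refine le_trans ?_ (min_one_ge (Finset.prod_pos fun i _ => hpos i))
    rw [Real.log_prod fun i _ => (hpos i).ne']
    gcongr with i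
    refine le_trans ?_ (Real.one_sub_inv_le_log_of_pos (hpos i))
    have h1 := abs_le.1 (hb (e i x))
    have hp := hpos i
    have hsq : g (e i x) ^ 2 ≤ η ^ 2 := by
      rw [← sq_abs]; exact pow_le_pow_left₀ (abs_nonneg _) (hb _) 2
    have e1 : 1 - (1 + g (e i x))⁻¹ = g (e i x) - g (e i x) ^ 2 / (1 + g (e i x)) := by
      field_simp; ring
    rw [e1]
    have : g (e i x) ^ 2 / (1 + g (e i x)) ≤ 2 * η ^ 2 := by
      rw [div_le_iff₀ hp]
      nlinarith [sq_nonneg η]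
    linarith
  have i4 : Integrable (fun x => 3 / 2 - ∏ i, (1 + g (e i x))
      + ∑ i, (g (e i x) - 2 * η ^ 2)) μ := i3.add i2
  have := integral_mono i4 hmin hpt
  have e1 : ∫ x, (3 / 2 - ∏ i, (1 + g (e i x)) + ∑ i, (g (e i x) - 2 * η ^ 2)) ∂μ
      = 1 / 2 - 2 * Fintype.card I * η ^ 2 := by
    rw [integral_add i3 i2, integral_sub (integrable_const _) i1, hv,
      integral_finsetSum _ fun i _ => i0 i]
    have : ∀ i, ∫ x, (g (e i x) - 2 * η ^ 2) ∂μ = -(2 * η ^ 2) := fun i => by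
      rw [integral_sub ((hgi i).integrable le_top) (integrable_const _), hμ.integral_eval, hc]
      simp
    simp_rw [this]
    simp
    ring
  rw [e1] at this
  linarith

end Testing

/-! ### Perturbations of an interior point of the model -/

/-- Coded regression functions `u₀` and `v₀` of an interior point of the model: they are bounded
away from the endpoints `-1` and `1`, and the regression functions lie in a smaller ball. -/
structure CDVBasis.IsCenter {S : ℕ} (B : CDVBasis S) {d : ℕ} (α β M₀ C₁ C₂ δ : ℝ)
    (u₀ v₀ : (Fin d → ℝ) → ℝ) : Prop where
  lt : C₁ < C₂
  pos : 0 < δ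
  le_one : δ ≤ 1
  measurable_u : Measurable u₀
  measurable_v : Measurable v₀
  bound_u : ∀ x, |u₀ x| ≤ 1 - δ
  bound_v : ∀ x, |v₀ x| ≤ 1 - δ
  mem_u : (fun x => decode C₁ C₂ (u₀ x)) ∈ B.holderBall d α M₀
  mem_v : (fun x => decode C₁ C₂ (v₀ x)) ∈ B.holderBall d β M₀

namespace CDVBasis

variable {S : ℕ} (B : CDVBasis S) {d : ℕ}

variable {B} in
theorem holderBall_congr {a M : ℝ} {f g : (Fin d → ℝ) → ℝ} (h : Set.EqOn f g (cube d))
    (hf : f ∈ B.holderBall d a M) : g ∈ B.holderBall d a M := by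
  have hin : ∀ φ, innerC f φ = innerC g φ := fun φ =>
    setIntegral_congr_fun (by rw [cube]; exact measurableSet_Icc) fun x hx => by
      simp only [h hx]
  refine ⟨hf.1.congr h, ?_⟩
  have := hf.2
  unfold holderNorm at this ⊢
  simp_rw [← hin]
  exact this

/-- A regression function with values away from the endpoints, coded and extended by zero outside the
cube. -/
theorem exists_coded {a M₀ C₁ C₂ δ : ℝ} (hC : C₁ < C₂) {p : (Fin d → ℝ) → ℝ}
    (hp : p ∈ B.holderBall d a M₀) (hδ1 : 2 * δ / (C₂ - C₁) ≤ 1)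
    (hb : ∀ x ∈ cube d, p x ∈ Set.Icc (C₁ + δ) (C₂ - δ)) :
    ∃ u : (Fin d → ℝ) → ℝ, Measurable u ∧ (∀ x, |u x| ≤ 1 - 2 * δ / (C₂ - C₁)) ∧
      (fun x => decode C₁ C₂ (u x)) ∈ B.holderBall d a M₀ := by
  classical
  have hL : 0 < C₂ - C₁ := by linarith
  have hms : MeasurableSet (cube d) := by rw [cube]; exact measurableSet_Icc
  refine ⟨(cube d).piecewise (fun x => code C₁ C₂ (p x)) fun _ => 0, ?_, fun x => ?_, ?_⟩
  · refine ContinuousOn.measurable_piecewise ?_ continuousOn_const hms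
    unfold code
    exact (((continuousOn_const.mul hp.1.continuousOn).sub continuousOn_const).sub
      continuousOn_const).div_const _
  · by_cases hx : x ∈ cube d
    · rw [Set.piecewise_eq_of_mem _ _ _ hx]
      have h1 := (hb x hx).1
      have h2 := (hb x hx).2
      have e : 1 - 2 * δ / (C₂ - C₁) = (C₂ - C₁ - 2 * δ) / (C₂ - C₁) := by field_simp
      rw [e, code, abs_div, abs_of_pos hL]
      gcongr
      rw [abs_le]
      constructor <;> linarith
    · rw [Set.piecewise_eq_of_notMem _ _ _ hx, abs_zero]; linarith
  · refine holderBall_congr (fun x hx => ?_) hp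
    simp only [Set.piecewise_eq_of_mem _ _ _ hx]
    have : C₂ - C₁ ≠ 0 := hL.ne'
    unfold decode code; field_simp; ring

theorem exists_isCenter {α β M C₁ C₂ : ℝ}
    (hint : ∃ M₀ < M, ∃ δ > 0, ∃ p₀ ∈ B.holderBall d α M₀, ∃ b₀ ∈ B.holderBall d β M₀,
      ∀ x ∈ cube d, p₀ x ∈ Set.Icc (C₁ + δ) (C₂ - δ) ∧ b₀ x ∈ Set.Icc (C₁ + δ) (C₂ - δ)) :
    ∃ M₀ < M, ∃ δ u₀ v₀, B.IsCenter (d := d) α β M₀ C₁ C₂ δ u₀ v₀ := by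
  obtain ⟨M₀, hM, δ, hδ, p, hp, b, hb, hpb⟩ := hint
  have h0 : (0 : Fin d → ℝ) ∈ cube d := ⟨le_rfl, zero_le_one⟩
  have h1 := (hpb 0 h0).1
  have hC : C₁ < C₂ := by linarith [h1.1, h1.2]
  have hδ1 : 2 * δ / (C₂ - C₁) ≤ 1 := (div_le_one (by linarith)).2 (by linarith [h1.1, h1.2])
  obtain ⟨u, hu, hu', hum⟩ := B.exists_coded hC hp hδ1 fun x hx => (hpb x hx).1
  obtain ⟨v, hv, hv', hvm⟩ := B.exists_coded hC hb hδ1 fun x hx => (hpb x hx).2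
  exact ⟨M₀, hM, 2 * δ / (C₂ - C₁), u, v, hC, div_pos (by linarith) (by linarith), hδ1, hu, hv, hu',
    hv', hum, hvm⟩

end CDVBasis

/-- The observations whose variables `A` and `Y` are at the endpoints. -/
def endpointSet (d : ℕ) (C₁ C₂ : ℝ) : Set (Obs d) :=
  {o | code C₁ C₂ (obsA o) ^ 2 = 1 ∧ code C₁ C₂ (obsY o) ^ 2 = 1}

theorem measurableSet_endpointSet (d : ℕ) (C₁ C₂ : ℝ) : MeasurableSet (endpointSet d C₁ C₂) := by
  have hA := (measurable_code (C₁ := C₁) (C₂ := C₂)).comp (measurable_obsA (d := d))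
  have hY := (measurable_code (C₁ := C₁) (C₂ := C₂)).comp (measurable_obsY (d := d))
  exact (measurableSet_eq_fun (hA.pow_const 2) measurable_const).inter
    (measurableSet_eq_fun (hY.pow_const 2) measurable_const)

/-- The relative change of the density when the coded regression functions of `A`, `Y` and `A * Y`
change by `a`, `b` and `c`, starting from `u`, `v` and `u * v`. -/
noncomputable def relChange {d : ℕ} (C₁ C₂ : ℝ) (u v a b c : (Fin d → ℝ) → ℝ) : Obs d → ℝ :=
  (endpointSet d C₁ C₂).indicator fun o =>
    (code C₁ C₂ (obsA o) * a (obsX o) + code C₁ C₂ (obsY o) * b (obsX o)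
      + code C₁ C₂ (obsA o) * code C₁ C₂ (obsY o) * c (obsX o))
      / obsDensity C₁ C₂ u v (fun x => u x * v x) o

section Center

variable {S : ℕ} {B : CDVBasis S} {d : ℕ} {α β M M₀ C₁ C₂ δ : ℝ} {u v a b c : (Fin d → ℝ) → ℝ}

namespace CDVBasis.IsCenter

theorem density_ge (h : B.IsCenter α β M₀ C₁ C₂ δ u v) {s t : ℝ} (hs : s ^ 2 = 1) (ht : t ^ 2 = 1)
    (x : Fin d → ℝ) : δ ^ 2 ≤ 1 + s * u x + t * v x + s * t * (u x * v x) := by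
  have hsa : |s| = 1 := by rw [← abs_one, ← sq_eq_sq_iff_abs_eq_abs, hs, one_pow]
  have hta : |t| = 1 := by rw [← abs_one, ← sq_eq_sq_iff_abs_eq_abs, ht, one_pow]
  have h1 : |s * u x| ≤ 1 - δ := by rw [abs_mul, hsa, one_mul]; exact h.bound_u x
  have h2 : |t * v x| ≤ 1 - δ := by rw [abs_mul, hta, one_mul]; exact h.bound_v x
  have h3 : δ ≤ 1 + s * u x := by linarith [(abs_le.1 h1).1]
  have h4 : δ ≤ 1 + t * v x := by linarith [(abs_le.1 h2).1]
  have := h.pos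
  calc δ ^ 2 = δ * δ := sq δ
    _ ≤ (1 + s * u x) * (1 + t * v x) := mul_le_mul h3 h4 this.le (by linarith)
    _ = _ := by ring

theorem admissible (h : B.IsCenter α β M₀ C₁ C₂ δ u v) (ha : Measurable a) (hb : Measurable b)
    (hc : Measurable c) (hle : ∀ x, |a x| + |b x| + |c x| ≤ δ ^ 2) :
    IsAdmissible (fun x => u x + a x) (fun x => v x + b x) fun x => u x * v x + c x := by
  refine ⟨h.measurable_u.add ha, h.measurable_v.add hb,
    (h.measurable_u.mul h.measurable_v).add hc, fun s t hs ht x => ?_⟩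
  have h1 := h.density_ge hs ht x
  have hsa : |s| = 1 := by rw [← abs_one, ← sq_eq_sq_iff_abs_eq_abs, hs, one_pow]
  have hta : |t| = 1 := by rw [← abs_one, ← sq_eq_sq_iff_abs_eq_abs, ht, one_pow]
  have e1 : |s * a x| = |a x| := by rw [abs_mul, hsa, one_mul]
  have e2 : |t * b x| = |b x| := by rw [abs_mul, hta, one_mul]
  have e3 : |s * t * c x| = |c x| := by rw [abs_mul, abs_mul, hsa, hta, one_mul, one_mul]
  have := hle x
  have := neg_abs_le (s * a x)
  have := neg_abs_le (t * b x)
  have := neg_abs_le (s * t * c x)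
  linarith

theorem admissible_self (h : B.IsCenter α β M₀ C₁ C₂ δ u v) :
    IsAdmissible u v fun x => u x * v x := by
  have := h.admissible (a := fun _ => 0) (b := fun _ => 0) (c := fun _ => 0) measurable_const
    measurable_const measurable_const (fun x => by simp; positivity)
  simpa using this

theorem abs_relChange_le (h : B.IsCenter α β M₀ C₁ C₂ δ u v) {K : ℝ}
    (hle : ∀ x, |a x| + |b x| + |c x| ≤ K) (o : Obs d) :
    |relChange C₁ C₂ u v a b c o| ≤ K / δ ^ 2 := by
  have hK : 0 ≤ K := le_trans (by positivity) (hle 0)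
  have hδ := h.pos
  unfold relChange
  by_cases ho : o ∈ endpointSet d C₁ C₂
  · rw [Set.indicator_of_mem ho]
    obtain ⟨hs, ht⟩ := ho
    have h1 : δ ^ 2 ≤ obsDensity C₁ C₂ u v (fun x => u x * v x) o := h.density_ge hs ht _
    rw [abs_div]
    gcongr
    · refine le_trans ?_ (hle (obsX o))
      have hsa : |code C₁ C₂ (obsA o)| = 1 := by
        rw [← abs_one, ← sq_eq_sq_iff_abs_eq_abs, hs, one_pow]
      have hta : |code C₁ C₂ (obsY o)| = 1 := by
        rw [← abs_one, ← sq_eq_sq_iff_abs_eq_abs, ht, one_pow]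
      refine (abs_add_le _ _).trans ((add_le_add (abs_add_le _ _) le_rfl).trans ?_)
      simp only [abs_mul, hsa, hta, one_mul, le_refl]
    · exact h1.trans (le_abs_self _)
  · rw [Set.indicator_of_notMem ho, abs_zero]; positivity

theorem measurable_relChange (h : B.IsCenter α β M₀ C₁ C₂ δ u v) (ha : Measurable a)
    (hb : Measurable b) (hc : Measurable c) : Measurable (relChange C₁ C₂ u v a b c) := by
  have hA := (measurable_code (C₁ := C₁) (C₂ := C₂)).comp (measurable_obsA (d := d))
  have hY := (measurable_code (C₁ := C₁) (C₂ := C₂)).comp (measurable_obsY (d := d))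
  exact ((((hA.mul (ha.comp measurable_obsX)).add (hY.mul (hb.comp measurable_obsX))).add
    ((hA.mul hY).mul (hc.comp measurable_obsX))).div
    h.admissible_self.measurable_obsDensity).indicator (measurableSet_endpointSet d C₁ C₂)

theorem ae_density_mul_relChange (h : B.IsCenter α β M₀ C₁ C₂ δ u v) :
    ∀ᵐ o ∂baseLaw d C₁ C₂, 0 < obsDensity C₁ C₂ u v (fun x => u x * v x) o ∧
      obsDensity C₁ C₂ u v (fun x => u x * v x) o * relChange C₁ C₂ u v a b c o
      = code C₁ C₂ (obsA o) * a (obsX o) + code C₁ C₂ (obsY o) * b (obsX o)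
        + code C₁ C₂ (obsA o) * code C₁ C₂ (obsY o) * c (obsX o) := by
  filter_upwards [ae_sq_code h.lt] with o ho
  have h1 : δ ^ 2 ≤ obsDensity C₁ C₂ u v (fun x => u x * v x) o := h.density_ge ho.1 ho.2 _
  have h2 : 0 < obsDensity C₁ C₂ u v (fun x => u x * v x) o :=
    lt_of_lt_of_le (pow_pos h.pos 2) h1
  refine ⟨h2, ?_⟩
  unfold relChange
  rw [Set.indicator_of_mem (show o ∈ endpointSet d C₁ C₂ from ho), mul_div_cancel₀ _ h2.ne']

theorem integral_relChange (h : B.IsCenter α β M₀ C₁ C₂ δ u v) (ha : MemLp a ⊤ (cubeVol d))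
    (hb : MemLp b ⊤ (cubeVol d)) (hc : MemLp c ⊤ (cubeVol d)) :
    ∫ o, relChange C₁ C₂ u v a b c o ∂obsLaw C₁ C₂ u v (fun x => u x * v x) = 0 := by
  rw [integral_obsLaw h.lt h.admissible_self]
  have h0 : MemLp (fun _ : Fin d → ℝ => (0 : ℝ)) ⊤ (cubeVol d) := memLp_const 0
  have e := integral_baseLaw_expansion h.lt h0 ha hb hc
  rw [integral_zero] at e
  rw [← e]
  refine integral_congr_ae ?_
  filter_upwards [h.ae_density_mul_relChange (a := a) (b := b) (c := c)] with o ho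
  rw [ho.2, zero_add]

theorem obsLaw_eq_withDensity (h : B.IsCenter α β M₀ C₁ C₂ δ u v) (ha : Measurable a)
    (hb : Measurable b) (hc : Measurable c) :
    obsLaw C₁ C₂ (fun x => u x + a x) (fun x => v x + b x) (fun x => u x * v x + c x)
      = (obsLaw C₁ C₂ u v fun x => u x * v x).withDensity
        fun o => ENNReal.ofReal (1 + relChange C₁ C₂ u v a b c o) := by
  have hm := h.admissible_self.measurable_obsDensity (C₁ := C₁) (C₂ := C₂)
  have hr := h.measurable_relChange ha hb hc
  have hr' : Measurable fun o : Obs d => ENNReal.ofReal (1 + relChange C₁ C₂ u v a b c o) :=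
    (measurable_const.add hr).ennreal_ofReal
  unfold obsLaw
  rw [← withDensity_mul _ hm.ennreal_ofReal hr']
  refine withDensity_congr_ae ?_
  filter_upwards [h.ae_density_mul_relChange (a := a) (b := b) (c := c)] with o ho
  rw [Pi.mul_apply, ← ENNReal.ofReal_mul ho.1.le, mul_add, mul_one, ho.2]
  congr 1
  simp only [obsDensity]
  ring

/-- The maximal risk dominates the risk at a perturbed law, computed under the central law. -/
theorem lintegral_le_worstRisk (h : B.IsCenter α β M₀ C₁ C₂ δ u v) (ha : Measurable a)
    (hb : Measurable b) (hc : Measurable c) (hle : ∀ x, |a x| + |b x| + |c x| ≤ δ ^ 2)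
    (hu : (fun x => decode C₁ C₂ (u x + a x)) ∈ B.holderBall d α M)
    (hv : (fun x => decode C₁ C₂ (v x + b x)) ∈ B.holderBall d β M) {m n : ℕ}
    {T : Sample d m n → ℝ} (hT : Measurable T) :
    ∫⁻ ω, ENNReal.ofReal ((T ω - ((C₂ - C₁) / 2) ^ 2
        * ∫ x, (u x * v x + c x - (u x + a x) * (v x + b x)) ∂cubeVol d) ^ 2
        * ∏ r : Fin m × Fin n, (1 + relChange C₁ C₂ u v a b c (ω r.1 r.2)))
        ∂(sampleLaw m n (obsLaw C₁ C₂ u v fun x => u x * v x))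
      ≤ worstRisk (B.model d α β M C₁ C₂) m n T := by
  have hadm := h.admissible ha hb hc hle
  have hmem := B.obsLaw_mem_model h.lt hadm hu hv
  have hpsi := psi_obsLaw h.lt hadm
  have hr := h.measurable_relChange ha hb hc
  have := isProbabilityMeasure_obsLaw h.lt h.admissible_self
  have := isProbabilityMeasure_obsLaw h.lt hadm
  have hdm : Measurable fun o : Obs d => ENNReal.ofReal (1 + relChange C₁ C₂ u v a b c o) :=
    (measurable_const.add hr).ennreal_ofReal
  have hwd := h.obsLaw_eq_withDensity ha hb hc
  have hpw : IsProbabilityMeasure ((obsLaw C₁ C₂ u v fun x => u x * v x).withDensity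
        fun o => ENNReal.ofReal (1 + relChange C₁ C₂ u v a b c o)) := by
    rw [← hwd]; infer_instance
  refine le_trans (le_of_eq ?_) (le_iSup₂ (f := fun P (_ : P ∈ B.model d α β M C₁ C₂) =>
    ∫⁻ ω, ENNReal.ofReal ((T ω - psi P) ^ 2) ∂(sampleLaw m n P)) _ hmem)
  rw [hpsi, hwd, sampleLaw_withDensity hdm m n, lintegral_withDensity_eq_lintegral_mul]
  · refine lintegral_congr fun ω => ?_
    have h1 : ∀ o, 0 ≤ 1 + relChange C₁ C₂ u v a b c o := fun o => by
      have h2 := h.abs_relChange_le hle o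
      rw [div_self (pow_pos h.pos 2).ne'] at h2
      linarith [(abs_le.1 h2).1]
    rw [Pi.mul_apply, mul_comm, ENNReal.ofReal_mul (Finset.prod_nonneg fun r _ => h1 _),
      ENNReal.ofReal_prod_of_nonneg fun r _ => h1 _]
  · exact Finset.measurable_fun_prod _ fun r _ => hdm.comp
      ((measurable_pi_apply r.2).comp (measurable_pi_apply r.1))
  · exact ((hT.sub_const _).pow_const 2).ennreal_ofReal

end CDVBasis.IsCenter

end Center

/-! ### Minimax lower bounds -/

/-- The squared `L²` norm of a signed sum of the cell bumps at scale `2 ^ (-J)`. -/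
noncomputable def bumpEnergy (d J : ℕ) : ℝ :=
  ∫ x, ∑ m : Fin d → Fin (2 ^ J), cellBump J m x ^ 2 ∂cubeVol d

theorem bumpSum_mul_bumpSum {d J : ℕ} (s t : (Fin d → Fin (2 ^ J)) → ℝ) (x : Fin d → ℝ) :
    bumpSum J s x * bumpSum J t x = ∑ m, s m * t m * cellBump J m x ^ 2 := by
  unfold bumpSum
  rw [Finset.sum_mul_sum]
  refine Finset.sum_congr rfl fun m _ => ?_
  rw [Finset.sum_eq_single m]
  · ring
  · intro m' _ hne
    by_contra h0
    have h1 := left_ne_zero_of_mul h0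
    have h2 := right_ne_zero_of_mul h0
    exact hne (eq_of_mem_dyadicCell
      (mem_dyadicCell_of_cellBump_ne_zero (right_ne_zero_of_mul h2))
      (mem_dyadicCell_of_cellBump_ne_zero (right_ne_zero_of_mul h1)))
  · simp

theorem integral_bumpSum_sq {d J : ℕ} {s : (Fin d → Fin (2 ^ J)) → ℝ} (hs : ∀ m, s m ^ 2 = 1) :
    ∫ x, bumpSum J s x * bumpSum J s x ∂cubeVol d = bumpEnergy d J := by
  unfold bumpEnergy
  simp_rw [bumpSum_mul_bumpSum, ← sq, hs, one_mul]

/-- On a quarter of each edge of a dyadic cell the bump function is equal to one. -/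
theorem quarter_pow_le_bumpEnergy (d J : ℕ) : (1 / 4 : ℝ) ^ d ≤ bumpEnergy d J := by
  have e : ∀ x : Fin d → ℝ, ∑ m : Fin d → Fin (2 ^ J), cellBump J m x ^ 2
      = ∏ i, ∑ k : Fin (2 ^ J), bump (2 ^ J * x i - k) ^ 2 := by
    intro x
    rw [← sum_prod_pi (fun i (k : Fin (2 ^ J)) => bump (2 ^ J * x i - k) ^ 2)]
    simp_rw [cellBump, Finset.prod_pow]
  unfold bumpEnergy
  simp_rw [e]
  rw [integral_cubeVol_prod (fun _ t => ∑ k : Fin (2 ^ J), bump (2 ^ J * t - k) ^ 2),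
    Finset.prod_const, Finset.card_univ, Fintype.card_fin]
  refine pow_le_pow_left₀ (by norm_num) ?_ d
  have hc : ∀ k : Fin (2 ^ J), Continuous fun t : ℝ => bump (2 ^ J * t - k) ^ 2 := fun k =>
    (continuous_bump.comp (by fun_prop)).pow 2
  rw [integral_finsetSum _ fun k _ => (hc k).memLp_unitVol.integrable le_top]
  have hk : ∀ k : Fin (2 ^ J), 1 / 4 / 2 ^ J ≤ ∫ t, bump (2 ^ J * t - k) ^ 2 ∂unitVol := by
    intro k
    have hp : (0 : ℝ) < 2 ^ J := by positivity
    set I : Set ℝ := Set.Icc ((k + 3 / 8) / 2 ^ J) ((k + 5 / 8) / 2 ^ J) with hI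
    have hIm : MeasurableSet I := measurableSet_Icc
    have hkl : ((k : ℕ) : ℝ) + 1 ≤ 2 ^ J := by exact_mod_cast k.isLt
    have hsub : I ⊆ Set.Icc 0 1 := by
      intro t ht
      have h1 := (div_le_iff₀ hp).1 ht.1
      have h2 := (le_div_iff₀ hp).1 ht.2
      have h3 : (0 : ℝ) ≤ (k : ℕ) := Nat.cast_nonneg _
      constructor
      · by_contra h; push Not at h; nlinarith
      · by_contra h; push Not at h; nlinarith
    have hvol : unitVol.real I = 1 / 4 / 2 ^ J := by
      rw [measureReal_def, unitVol, Measure.restrict_apply hIm, Set.inter_eq_left.2 hsub,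
        Real.volume_Icc, ENNReal.toReal_ofReal]
      · ring
      · rw [sub_nonneg]; gcongr; norm_num
    rw [← hvol, ← mul_one (unitVol.real I), ← smul_eq_mul, ← integral_indicator_const _ hIm]
    refine integral_mono ((integrable_const _).indicator hIm)
      ((hc k).memLp_unitVol.integrable le_top) fun t => ?_
    by_cases ht : t ∈ I
    · have h1 := (div_le_iff₀ hp).1 ht.1
      have h2 := (le_div_iff₀ hp).1 ht.2
      simp only [Set.indicator_of_mem ht]
      rw [bump_eq_one (by rw [abs_le]; constructor <;> linarith)]
      norm_num
    · simp only [Set.indicator_of_notMem ht]; positivity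
  refine le_trans (le_of_eq ?_) (Finset.sum_le_sum fun k _ => hk k)
  rw [Finset.sum_const, Finset.card_univ, Fintype.card_fin, nsmul_eq_mul]
  push_cast
  field_simp

theorem decode_add {C₁ C₂ s t : ℝ} :
    decode C₁ C₂ (s + t) = decode C₁ C₂ s + (C₂ - C₁) / 2 * t := by unfold decode; ring

section Center

variable {S : ℕ} {B : CDVBasis S} {d : ℕ} {α β M M₀ C₁ C₂ δ : ℝ} {u v : (Fin d → ℝ) → ℝ}

namespace CDVBasis.IsCenter

/-- Heights of bumps that keep the regression functions in the model. -/
theorem exists_height (h : B.IsCenter α β M₀ C₁ C₂ δ u v) (hα : 0 < α) (hβ : 0 < β) (hM : 0 < M)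
    (hαS : α < S) (hβS : β < S) (hM₀ : M₀ < M) : ∃ c : ℝ, 0 < c ∧ c ≤ δ ^ 2 / 8 ∧
    ∀ J, B.J₀ ≤ J → ∀ s : (Fin d → Fin (2 ^ J)) → ℝ, (∀ m, |s m| ≤ 1) →
      (∀ ε : ℝ, |ε| ≤ c / (2 ^ J) ^ α →
        (fun x => decode C₁ C₂ (u x + ε * bumpSum J s x)) ∈ B.holderBall d α M) ∧
      (∀ ε : ℝ, |ε| ≤ c / (2 ^ J) ^ β →
        (fun x => decode C₁ C₂ (v x + ε * bumpSum J s x)) ∈ B.holderBall d β M) := by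
  obtain ⟨c₁, hc₁, h₁⟩ := B.exists_add_bumpSum_mem_holderBall d hα hαS hM hM₀
  obtain ⟨c₂, hc₂, h₂⟩ := B.exists_add_bumpSum_mem_holderBall d hβ hβS hM hM₀
  have hL : 0 < (C₂ - C₁) / 2 := by linarith [h.lt]
  have hδ := h.pos
  set l := (C₂ - C₁) / 2 with hl
  refine ⟨min (δ ^ 2 / 8) (min (c₁ / l) (c₂ / l)), by positivity, min_le_left _ _,
    fun J hJ s hs => ⟨fun ε hε => ?_, fun ε hε => ?_⟩⟩
  · have hle : min (δ ^ 2 / 8) (min (c₁ / l) (c₂ / l)) ≤ c₁ / l :=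
      (min_le_right _ _).trans (min_le_left _ _)
    have := h₁ _ h.mem_u J hJ s hs (l * ε) (by
      rw [abs_mul, abs_of_pos hL]
      calc l * |ε| ≤ l * (c₁ / l / (2 ^ J) ^ α) := by gcongr; exact hε.trans (by gcongr)
        _ = _ := by field_simp)
    simp_rw [decode_add, ← mul_assoc]
    exact this
  · have hle : min (δ ^ 2 / 8) (min (c₁ / l) (c₂ / l)) ≤ c₂ / l :=
      (min_le_right _ _).trans (min_le_right _ _)
    have := h₂ _ h.mem_v J hJ s hs (l * ε) (by
      rw [abs_mul, abs_of_pos hL]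
      calc l * |ε| ≤ l * (c₂ / l / (2 ^ J) ^ β) := by gcongr; exact hε.trans (by gcongr)
        _ = _ := by field_simp)
    simp_rw [decode_add, ← mul_assoc]
    exact this

theorem zero_mem (h : B.IsCenter α β M₀ C₁ C₂ δ u v) (hM₀ : M₀ < M) :
    (fun x => decode C₁ C₂ (u x + 0)) ∈ B.holderBall d α M ∧
    (fun x => decode C₁ C₂ (v x + 0)) ∈ B.holderBall d β M := by
  simp only [add_zero]
  exact ⟨⟨h.mem_u.1, h.mem_u.2.trans (ENNReal.ofReal_le_ofReal hM₀.le)⟩,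
    ⟨h.mem_v.1, h.mem_v.2.trans (ENNReal.ofReal_le_ofReal hM₀.le)⟩⟩

/-- The parametric lower bound: the conditional covariance is shifted by a constant. -/
theorem exists_minimaxRisk_ge_parametric (h : B.IsCenter α β M₀ C₁ C₂ δ u v) (hM₀ : M₀ < M) :
    ∃ c : ℝ, 0 < c ∧ ∀ m n : ℕ, 0 < m → 0 < n →
      ENNReal.ofReal (c / (m * n)) ≤ minimaxRisk (B.model d α β M C₁ C₂) m n := by
  have hL : 0 < (C₂ - C₁) / 2 := by linarith [h.lt]
  have hδ := h.pos
  refine ⟨(((C₂ - C₁) / 2) ^ 2 * δ ^ 2) ^ 2 / 128, by positivity, fun m n hm hn => ?_⟩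
  refine le_iInf₂ fun T hT => ?_
  have hN : (0 : ℝ) < m * n := by positivity
  have hN1 : (1 : ℝ) ≤ m * n := by exact_mod_cast Nat.mul_pos hm hn
  -- the largest relative perturbation that `m * n` observations cannot detect
  set r : ℝ := 1 / √(8 * (m * n)) with hr
  have hs0 : 0 < √(8 * ((m : ℝ) * n)) := by positivity
  have hr0 : 0 < r := by positivity
  have hr2 : 8 * (m * n) * r ^ 2 = 1 := by
    rw [hr, div_pow, Real.sq_sqrt (by positivity)]; field_simp
  have hrh : r ≤ 1 / 2 := by nlinarith
  set t : ℝ := δ ^ 2 * r with ht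
  have ht0 : 0 < t := by positivity
  have htδ : t ≤ δ ^ 2 := by nlinarith [sq_nonneg δ]
  obtain ⟨hu, hv⟩ := h.zero_mem hM₀
  have m0 : Measurable fun _ : Fin d → ℝ => (0 : ℝ) := measurable_const
  have mt : Measurable fun _ : Fin d → ℝ => t := measurable_const
  have hb : ∀ x : Fin d → ℝ, |(0 : ℝ)| + |(0 : ℝ)| + |t| ≤ t := fun x => by
    simp [abs_of_pos ht0]
  -- the functional vanishes at the central law, where `w = u * v`
  have R0 := h.lintegral_le_worstRisk m0 m0 m0 (fun x => by simp; positivity) hu hv hT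
  have R1 := h.lintegral_le_worstRisk m0 m0 mt (fun x => (hb x).trans htδ) hu hv hT
  have hz : ∀ o, relChange C₁ C₂ u v (fun _ => 0) (fun _ => 0) (fun _ => 0) o = 0 := fun o => by
    simp [relChange]
  simp only [hz, add_zero, Finset.prod_const_one, mul_one, sub_self, integral_zero, mul_zero,
    sub_zero] at R0
  simp only [add_zero, add_sub_cancel_left, integral_const, probReal_univ, smul_eq_mul,
    one_mul] at R1
  set g := relChange C₁ C₂ u v (fun _ => 0) (fun _ => 0) (fun _ => t) with hg
  have hgm : Measurable g := h.measurable_relChange m0 m0 mt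
  have hgb : ∀ o, |g o| ≤ r := fun o => by
    have := h.abs_relChange_le hb o
    rwa [ht, mul_div_cancel_left₀ _ (pow_pos hδ 2).ne'] at this
  have hgc := h.integral_relChange (a := fun _ => 0) (b := fun _ => 0) (c := fun _ => t)
    (memLp_const 0) (memLp_const 0) (memLp_const t)
  have := isProbabilityMeasure_obsLaw h.lt h.admissible_self
  have hsamp := isSampling_sampleLaw m n (obsLaw C₁ C₂ u v fun x => u x * v x)
  obtain ⟨hi, hov⟩ := integral_min_prod_ge hsamp hgm hrh hgb hgc (by
    rw [Fintype.card_prod, Fintype.card_fin, Fintype.card_fin]; push_cast; exact hr2.le)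
  have key := ofReal_sq_sub_le_of_overlap (v₀ := 0) (F₀ := fun _ => 1)
    (F₁ := fun ω : Sample d m n => ∏ r : Fin m × Fin n, (1 + g (ω r.1 r.2))) hT measurable_const
    (fun _ => zero_le_one) (fun ω => Finset.prod_nonneg fun r' _ => by
      linarith [(abs_le.1 (hgb (ω r'.1 r'.2))).1]) hi (by simpa using R0) R1 hov
  refine le_trans (ENNReal.ofReal_le_ofReal (le_of_eq ?_)) key
  rw [ht, sub_zero]
  have : r ^ 2 = 1 / (8 * (m * n)) := by rw [hr, div_pow, Real.sq_sqrt (by positivity)]; norm_num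
  rw [show (((C₂ - C₁) / 2) ^ 2 * (δ ^ 2 * r)) ^ 2 = (((C₂ - C₁) / 2) ^ 2 * δ ^ 2) ^ 2 * r ^ 2 by ring,
    this]
  field_simp
  ring

end CDVBasis.IsCenter

end Center

/-- The perturbation of the density on the `m`-th dyadic cell, when the coded regression functions
change by `x` and `y` times the cell bump and the conditional covariance changes to second order
only. -/
noncomputable def cellChange {d : ℕ} (C₁ C₂ : ℝ) (u v : (Fin d → ℝ) → ℝ) (J : ℕ) (x y : ℝ)
    (m : Fin d → Fin (2 ^ J)) : Obs d → ℝ :=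
  relChange C₁ C₂ u v (fun z => x * cellBump J m z) (fun z => y * cellBump J m z)
    fun z => (x * v z + y * u z) * cellBump J m z

section Center

variable {S : ℕ} {B : CDVBasis S} {d : ℕ} {α β M M₀ C₁ C₂ δ : ℝ} {u v : (Fin d → ℝ) → ℝ}

theorem sum_mul_cellChange {J : ℕ} (s : (Fin d → Fin (2 ^ J)) → ℝ) (x y : ℝ) (o : Obs d) :
    ∑ m, s m * cellChange C₁ C₂ u v J x y m o
      = relChange C₁ C₂ u v (fun z => x * bumpSum J s z) (fun z => y * bumpSum J s z)
        (fun z => (x * v z + y * u z) * bumpSum J s z) o := by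
  unfold cellChange relChange
  by_cases ho : o ∈ endpointSet d C₁ C₂
  · simp only [Set.indicator_of_mem ho, bumpSum]
    simp only [Finset.mul_sum, ← Finset.sum_add_distrib, Finset.sum_div]
    exact Finset.sum_congr rfl fun m _ => by ring
  · simp only [Set.indicator_of_notMem ho, mul_zero, Finset.sum_const_zero]

theorem cellChange_sub {J : ℕ} (x y x' y' : ℝ) (m : Fin d → Fin (2 ^ J)) (o : Obs d) :
    cellChange C₁ C₂ u v J x' y' m o - cellChange C₁ C₂ u v J x y m o
      = cellChange C₁ C₂ u v J (x' - x) (y' - y) m o := by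
  unfold cellChange relChange
  by_cases ho : o ∈ endpointSet d C₁ C₂
  · simp only [Set.indicator_of_mem ho]; ring
  · simp only [Set.indicator_of_notMem ho, sub_zero]

namespace CDVBasis.IsCenter

theorem abs_change_le (h : B.IsCenter α β M₀ C₁ C₂ δ u v) (x y t : ℝ) (ht : |t| ≤ 1)
    (z : Fin d → ℝ) : |x * t| + |y * t| + |(x * v z + y * u z) * t| ≤ 2 * (|x| + |y|) := by
  have hδ := h.pos
  have h1 : |u z| ≤ 1 := (h.bound_u z).trans (by linarith)
  have h2 : |v z| ≤ 1 := (h.bound_v z).trans (by linarith)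
  have h3 : |x * v z + y * u z| ≤ |x| + |y| := by
    refine (abs_add_le _ _).trans ?_
    rw [abs_mul, abs_mul]
    exact add_le_add (mul_le_of_le_one_right (abs_nonneg x) h2)
      (mul_le_of_le_one_right (abs_nonneg y) h1)
  have h4 : |(x * v z + y * u z) * t| ≤ |x| + |y| := by
    rw [abs_mul]; exact (mul_le_of_le_one_right (abs_nonneg _) ht).trans h3
  have h5 : |x * t| ≤ |x| := by rw [abs_mul]; exact mul_le_of_le_one_right (abs_nonneg _) ht
  have h6 : |y * t| ≤ |y| := by rw [abs_mul]; exact mul_le_of_le_one_right (abs_nonneg _) ht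
  linarith

theorem abs_cellChange_le (h : B.IsCenter α β M₀ C₁ C₂ δ u v) {J : ℕ} (x y : ℝ)
    (m : Fin d → Fin (2 ^ J)) (o : Obs d) :
    |cellChange C₁ C₂ u v J x y m o| ≤ 2 * (|x| + |y|) / δ ^ 2 :=
  h.abs_relChange_le (fun z => h.abs_change_le x y _ (by
    rw [abs_of_nonneg (cellBump_nonneg J m z)]; exact cellBump_le_one J m z) z) o

/-- The changes of the density on the single dyadic cells are bounded, centred and have disjoint
supports. -/
theorem isPerturbation_cellChange (h : B.IsCenter α β M₀ C₁ C₂ δ u v) (J : ℕ) {x y η : ℝ}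
    (hη : 2 * (|x| + |y|) / δ ^ 2 ≤ η) :
    IsPerturbation (obsLaw C₁ C₂ u v fun z => u z * v z) (fun m => obsX ⁻¹' dyadicCell J m) η
      (cellChange C₁ C₂ u v J x y) := by
  have mφ : ∀ m, Measurable (cellBump (d := d) J m) := fun m => (continuous_cellBump J m).measurable
  have hmc : ∀ m : Fin d → Fin (2 ^ J),
      Measurable fun z => (x * v z + y * u z) * cellBump J m z := fun m =>
    ((h.measurable_v.const_mul x).add (h.measurable_u.const_mul y)).mul (mφ m)
  have hb : ∀ (m : Fin d → Fin (2 ^ J)) z, |cellBump J m z| ≤ 1 := fun m z => by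
    rw [abs_of_nonneg (cellBump_nonneg J m z)]; exact cellBump_le_one J m z
  refine ⟨fun m => measurable_obsX (measurableSet_dyadicCell J m),
    fun m m' o ho ho' => eq_of_mem_dyadicCell ho ho', fun m => ?_, fun m o ho => ?_,
    fun m o => (h.abs_cellChange_le x y m o).trans hη, fun m => ?_⟩
  · exact h.measurable_relChange ((mφ m).const_mul x) ((mφ m).const_mul y) (hmc m)
  · have h0 : cellBump J m (obsX o) = 0 := by
      by_contra h0; exact ho (mem_dyadicCell_of_cellBump_ne_zero h0)
    unfold cellChange relChange
    by_cases hm : o ∈ endpointSet d C₁ C₂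
    · simp [Set.indicator_of_mem hm, h0]
    · rw [Set.indicator_of_notMem hm]
  · refine h.integral_relChange
      (MemLp.of_measurable_of_abs_le (C := 2 * (|x| + |y|)) ((mφ m).const_mul x) fun z => ?_)
      (MemLp.of_measurable_of_abs_le (C := 2 * (|x| + |y|)) ((mφ m).const_mul y) fun z => ?_)
      (MemLp.of_measurable_of_abs_le (C := 2 * (|x| + |y|)) (hmc m) fun z => ?_)
    all_goals
      have := h.abs_change_le x y _ (hb m z) z
      have := abs_nonneg (x * cellBump J m z)
      have := abs_nonneg (y * cellBump J m z)
      have := abs_nonneg ((x * v z + y * u z) * cellBump J m z)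
      linarith

/-- For each choice of the signs the law is in the model, and the value of the functional does not depend
on the signs. -/
theorem lintegral_bumpSum_le_worstRisk (h : B.IsCenter α β M₀ C₁ C₂ δ u v) {J : ℕ} {x y : ℝ}
    (hη : 2 * (|x| + |y|) ≤ δ ^ 2) {s : (Fin d → Fin (2 ^ J)) → ℝ} (hs : ∀ m, |s m| = 1)
    (hu : (fun z => decode C₁ C₂ (u z + x * bumpSum J s z)) ∈ B.holderBall d α M)
    (hv : (fun z => decode C₁ C₂ (v z + y * bumpSum J s z)) ∈ B.holderBall d β M) {m n : ℕ}
    {T : Sample d m n → ℝ} (hT : Measurable T) :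
    (Measurable fun ω : Sample d m n =>
      ∏ r : Fin m × Fin n, (1 + ∑ k, s k * cellChange C₁ C₂ u v J x y k (ω r.1 r.2))) ∧
    (∀ ω : Sample d m n,
      0 ≤ ∏ r : Fin m × Fin n, (1 + ∑ k, s k * cellChange C₁ C₂ u v J x y k (ω r.1 r.2))) ∧
    ∫⁻ ω, ENNReal.ofReal ((T ω - -(((C₂ - C₁) / 2) ^ 2 * (x * y * bumpEnergy d J))) ^ 2
        * ∏ r : Fin m × Fin n, (1 + ∑ k, s k * cellChange C₁ C₂ u v J x y k (ω r.1 r.2)))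
        ∂(sampleLaw m n (obsLaw C₁ C₂ u v fun z => u z * v z))
      ≤ worstRisk (B.model d α β M C₁ C₂) m n T := by
  have hδ := h.pos
  simp_rw [sum_mul_cellChange]
  have mh : Measurable (bumpSum J s) := (continuous_bumpSum J _).measurable
  have mc : Measurable fun z => (x * v z + y * u z) * bumpSum J s z :=
    ((h.measurable_v.const_mul x).add (h.measurable_u.const_mul y)).mul mh
  have hle : ∀ z, |x * bumpSum J s z| + |y * bumpSum J s z|
      + |(x * v z + y * u z) * bumpSum J s z| ≤ δ ^ 2 := fun z =>
    (h.abs_change_le x y _ (abs_sum_mul_cellBump_le (fun m => (hs m).le) z) z).trans hη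
  have hr := h.measurable_relChange (mh.const_mul x) (mh.const_mul y) mc
  refine ⟨?_, fun ω => ?_, ?_⟩
  · exact Finset.measurable_fun_prod _ fun r _ => measurable_const.add (hr.comp
      ((measurable_pi_apply r.2).comp (measurable_pi_apply r.1)))
  · refine Finset.prod_nonneg fun r _ => ?_
    have h2 := h.abs_relChange_le hle (ω r.1 r.2)
    rw [div_self (pow_pos hδ 2).ne'] at h2
    linarith [(abs_le.1 h2).1]
  · have key := h.lintegral_le_worstRisk (mh.const_mul x) (mh.const_mul y) mc hle hu hv hT
    have e : ∫ z, (u z * v z + (x * v z + y * u z) * bumpSum J s z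
        - (u z + x * bumpSum J s z) * (v z + y * bumpSum J s z)) ∂cubeVol d
        = -(x * y * bumpEnergy d J) := by
      rw [← integral_bumpSum_sq (s := s) fun m => by rw [← sq_abs, hs, one_pow],
        ← integral_const_mul, ← integral_neg]
      congr 1; ext z; ring
    rw [e, mul_neg] at key
    exact key

/-- The maximal risk dominates the risk at a mixture, over the signs of the bumps, of laws with the
same value of the functional. -/
theorem lintegral_mixDensity_le_worstRisk (h : B.IsCenter α β M₀ C₁ C₂ δ u v) {J : ℕ} {x y : ℝ}
    (hη : 2 * (|x| + |y|) ≤ δ ^ 2)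
    (hu : ∀ s : (Fin d → Fin (2 ^ J)) → ℝ, (∀ m, |s m| ≤ 1) →
      (fun z => decode C₁ C₂ (u z + x * bumpSum J s z)) ∈ B.holderBall d α M)
    (hv : ∀ s : (Fin d → Fin (2 ^ J)) → ℝ, (∀ m, |s m| ≤ 1) →
      (fun z => decode C₁ C₂ (v z + y * bumpSum J s z)) ∈ B.holderBall d β M) {m n : ℕ}
    {T : Sample d m n → ℝ} (hT : Measurable T) :
    ∫⁻ ω, ENNReal.ofReal ((T ω - -(((C₂ - C₁) / 2) ^ 2 * (x * y * bumpEnergy d J))) ^ 2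
        * mixDensity (fun (r : Fin m × Fin n) (ω : Sample d m n) => ω r.1 r.2)
          (cellChange C₁ C₂ u v J x y) ω)
        ∂(sampleLaw m n (obsLaw C₁ C₂ u v fun z => u z * v z))
      ≤ worstRisk (B.model d α β M C₁ C₂) m n T := by
  classical
  have hpert := h.isPerturbation_cellChange J (x := x) (y := y) le_rfl
  have hcard : ((1 : ℝ) / 2) ^ Fintype.card (Fin d → Fin (2 ^ J))
      = (Fintype.card ((Fin d → Fin (2 ^ J)) → Bool) : ℝ)⁻¹ := by
    rw [Fintype.card_fun (β := Bool), Fintype.card_bool, Nat.cast_pow, one_div, inv_pow,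
      Nat.cast_ofNat]
  have key := fun s : (Fin d → Fin (2 ^ J)) → Bool =>
    h.lintegral_bumpSum_le_worstRisk (M := M) hη (s := fun m => boolSign (s m))
      (fun m => abs_boolSign _) (hu _ fun m => (abs_boolSign _).le)
      (hv _ fun m => (abs_boolSign _).le) hT
  refine le_trans (le_of_eq (lintegral_congr fun ω => ?_)) (lintegral_mixture_le hT
    (fun s => (key s).1) (fun s => (key s).2.1) fun s => (key s).2.2)
  rw [mixDensity_eq_sum hpert, hcard]

/-- The lower bound from perturbations at a given scale: the conditional covariance of the alternative is
of second order, and is invisible as long as `N ^ 2` is below the order of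
`(2 ^ J) ^ (2 * (α + β) + d)`. -/
theorem ofReal_sq_le_worstRisk (h : B.IsCenter α β M₀ C₁ C₂ δ u v) {J : ℕ} {ε ε' : ℝ}
    (hε : 0 ≤ ε) (hε' : 0 ≤ ε') (hle : 4 * (ε + ε') ≤ δ ^ 2)
    (hu : ∀ x, |x| ≤ ε → ∀ s : (Fin d → Fin (2 ^ J)) → ℝ, (∀ m, |s m| ≤ 1) →
      (fun z => decode C₁ C₂ (u z + x * bumpSum J s z)) ∈ B.holderBall d α M)
    (hv : ∀ y, |y| ≤ ε' → ∀ s : (Fin d → Fin (2 ^ J)) → ℝ, (∀ m, |s m| ≤ 1) →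
      (fun z => decode C₁ C₂ (v z + y * bumpSum J s z)) ∈ B.holderBall d β M) {m n : ℕ}
    (hN : 63 * ((m : ℝ) * n) ≤ (2 ^ J) ^ d)
    (hov : 2 * (2 ^ J) ^ d * (8 * (ε * ε') / δ ^ 4 * (63 * ((m : ℝ) * n) / (2 ^ J) ^ d)) ^ 2
      ≤ 1 / 4)
    {T : Sample d m n → ℝ} (hT : Measurable T) :
    ENNReal.ofReal ((((C₂ - C₁) / 2) ^ 2 * (ε * ε' * bumpEnergy d J)) ^ 2 / 16)
      ≤ worstRisk (B.model d α β M C₁ C₂) m n T := by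
  have hδ := h.pos
  -- under the null hypothesis only the larger of the two bumps is present, so that the functional
  -- vanishes and the two densities differ by the order of the smaller bump
  obtain ⟨x, y, hx, hx0, hy, hy0, hxy, hmin⟩ : ∃ x y : ℝ, x ≤ ε ∧ 0 ≤ x ∧ y ≤ ε' ∧ 0 ≤ y ∧
      x * y = 0 ∧ 2 * (ε + ε') * (2 * ((ε - x) + (ε' - y))) ≤ 8 * (ε * ε') := by
    rcases le_total ε' ε with hc | hc
    · exact ⟨ε, 0, le_rfl, hε, hε', le_rfl, mul_zero _, by nlinarith⟩
    · exact ⟨0, ε', hε, le_rfl, le_rfl, hε', zero_mul _, by nlinarith⟩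
  set η := 2 * (ε + ε') / δ ^ 2 with hη
  have hη1 : η ≤ 1 / 2 := by rw [hη, div_le_iff₀ (by positivity)]; linarith
  have := isProbabilityMeasure_obsLaw h.lt h.admissible_self
  have hsamp := isSampling_sampleLaw m n (obsLaw C₁ C₂ u v fun x => u x * v x)
  have p₁ := h.isPerturbation_cellChange J (x := ε) (y := ε') (η := η)
    (by rw [abs_of_nonneg hε, abs_of_nonneg hε'])
  have p₀ := h.isPerturbation_cellChange J (x := x) (y := y) (η := η)
    (by rw [abs_of_nonneg hx0, abs_of_nonneg hy0, hη]; gcongr)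
  have hκ : ∀ m, (obsLaw C₁ C₂ u v fun x => u x * v x).real (obsX ⁻¹' dyadicCell J m)
      ≤ 1 / (2 ^ J) ^ d := fun m => by
    rw [← map_measureReal_apply measurable_obsX (measurableSet_dyadicCell J m),
      map_obsX_obsLaw h.lt h.admissible_self]
    exact cubeVol_dyadicCell_le J m
  have hcI : (Fintype.card (Fin m × Fin n) : ℝ) = m * n := by simp
  have hcι : (Fintype.card (Fin d → Fin (2 ^ J)) : ℝ) = (2 ^ J) ^ d := by simp
  have hK : (0 : ℝ) < (2 ^ J) ^ d := by positivity
  have ov := integral_min_mixDensity_ge hsamp hη1 p₀ p₁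
    (η' := 2 * ((ε - x) + (ε' - y)) / δ ^ 2) (fun m o => by
      rw [cellChange_sub]
      refine (h.abs_cellChange_le _ _ m o).trans (le_of_eq ?_)
      rw [abs_of_nonneg (sub_nonneg.2 hx), abs_of_nonneg (sub_nonneg.2 hy)]) hκ (by
      rw [hcI, mul_one_div, div_le_one hK]; exact hN)
  have hov' : 1 / 4 ≤ ∫ ω, min
      (mixDensity (fun (r : Fin m × Fin n) (ω : Sample d m n) => ω r.1 r.2)
        (cellChange C₁ C₂ u v J x y) ω)
      (mixDensity (fun (r : Fin m × Fin n) (ω : Sample d m n) => ω r.1 r.2)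
        (cellChange C₁ C₂ u v J ε ε') ω)
        ∂sampleLaw m n (obsLaw C₁ C₂ u v fun x => u x * v x) := by
    refine le_trans ?_ ov
    rw [hcI, hcι]
    have e : η * (2 * ((ε - x) + (ε' - y)) / δ ^ 2) ≤ 8 * (ε * ε') / δ ^ 4 := by
      rw [hη, div_mul_div_comm, ← pow_add]
      exact div_le_div_of_nonneg_right hmin (by positivity)
    have e0 : 0 ≤ η * (2 * ((ε - x) + (ε' - y)) / δ ^ 2) := by
      have := sub_nonneg.2 hx; have := sub_nonneg.2 hy; positivity
    have : (η * (2 * ((ε - x) + (ε' - y)) / δ ^ 2) * (63 * ((m : ℝ) * n) * (1 / (2 ^ J) ^ d))) ^ 2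
        ≤ (8 * (ε * ε') / δ ^ 4 * (63 * ((m : ℝ) * n) / (2 ^ J) ^ d)) ^ 2 := by
      rw [mul_one_div]
      gcongr
    have := mul_le_mul_of_nonneg_left this (show (0 : ℝ) ≤ 2 * (2 ^ J) ^ d by positivity)
    linarith
  have R₁ := h.lintegral_mixDensity_le_worstRisk (M := M) (x := ε) (y := ε')
    (by rw [abs_of_nonneg hε, abs_of_nonneg hε']; linarith)
    (hu ε (abs_of_nonneg hε).le) (hv ε' (abs_of_nonneg hε').le) hT
  have R₀ := h.lintegral_mixDensity_le_worstRisk (M := M) (x := x) (y := y)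
    (by rw [abs_of_nonneg hx0, abs_of_nonneg hy0]; linarith)
    (hu x (by rwa [abs_of_nonneg hx0])) (hv y (by rwa [abs_of_nonneg hy0])) hT
  have hmeas : Measurable (mixDensity (fun (r : Fin m × Fin n) (ω : Sample d m n) => ω r.1 r.2)
        (cellChange C₁ C₂ u v J x y)) := by
    have hgm : ∀ (k : Fin d → Fin (2 ^ J)) (r : Fin m × Fin n),
        Measurable fun ω : Sample d m n => cellChange C₁ C₂ u v J x y k (ω r.1 r.2) := fun k r =>
      (p₀.measurable k).comp (hsamp.measurable r)
    unfold mixDensity evenProd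
    exact Finset.measurable_fun_prod _ fun k _ =>
      ((Finset.measurable_fun_prod _ fun r _ => measurable_const.add (hgm k r)).add
        (Finset.measurable_fun_prod _ fun r _ => measurable_const.sub (hgm k r))).div_const 2
  have := hsamp.isProb
  have key := ofReal_sq_sub_le_of_overlap hT hmeas (fun ω => (mixDensity_pos hη1 p₀ ω).le)
    (fun ω => (mixDensity_pos hη1 p₁ ω).le)
    (((memLp_mixDensity hsamp p₀).integrable le_top).inf
      ((memLp_mixDensity hsamp p₁).integrable le_top)) R₀ R₁ hov'
  refine le_trans (le_of_eq ?_) key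
  rw [hxy]
  congr 1; ring

set_option maxHeartbeats 1000000 in
/-- The nonparametric lower bound, in the regime of low smoothness. -/
theorem exists_minimaxRisk_ge_nonparametric (h : B.IsCenter α β M₀ C₁ C₂ δ u v) (hα : 0 < α)
    (hβ : 0 < β) (hM : 0 < M) (hαS : α < S) (hβS : β < S) (hM₀ : M₀ < M)
    (hs : 2 * (α + β) ≤ d) :
    ∃ c : ℝ, 0 < c ∧ ∀ m n : ℕ, 0 < m → 0 < n →
      ENNReal.ofReal (c * ((m : ℝ) * n) ^ (-((4 * α + 4 * β) / (2 * α + 2 * β + d))))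
        ≤ minimaxRisk (B.model d α β M C₁ C₂) m n := by
  obtain ⟨c, hc, hcδ, hball⟩ := h.exists_height hα hβ hM hαS hβS hM₀
  have hδ := h.pos
  have hL : 0 < (C₂ - C₁) / 2 := by linarith [h.lt]
  set L := (C₂ - C₁) / 2 with hLd
  set q : ℝ := 2 * α + 2 * β + d with hq
  have hq0 : 0 < q := by positivity
  set a : ℝ := (2 * 2 ^ B.J₀) ^ (α + β) with ha
  have ha0 : 0 < a := by positivity
  set b : ℝ := (4000 : ℝ) ^ (-(α + β) / q) with hb
  refine ⟨(L ^ 2 * (c ^ 2 / a * b * (1 / 4) ^ d)) ^ 2 / 16, by positivity,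
    fun m n hm hn => le_iInf₂ fun T hT => ?_⟩
  set N : ℝ := (m : ℝ) * n with hN
  have hN1 : 1 ≤ N := by rw [hN]; exact_mod_cast Nat.mul_pos hm hn
  have hN0 : 0 < N := by linarith
  -- the scale at which `(2 ^ J) ^ q` is of the order `N ^ 2`; `4000` exceeds `63 ^ 2` and leaves room
  -- for the overlap condition
  set y : ℝ := (4000 * N ^ 2) ^ (1 / q) with hy
  have hy1 : 1 ≤ y := Real.one_le_rpow (by nlinarith) (by positivity)
  obtain ⟨k, hk1, hk2⟩ := exists_nat_pow_near hy1 (one_lt_two)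
  set J := B.J₀ + (k + 1) with hJ
  have hJJ : (2 : ℝ) ^ J = 2 ^ B.J₀ * 2 ^ (k + 1) := by rw [hJ, pow_add]
  have hJ0 : (1 : ℝ) ≤ 2 ^ B.J₀ := one_le_pow₀ (by norm_num)
  have hyJ : y ≤ 2 ^ J := by rw [hJJ]; nlinarith
  have hJy : (2 : ℝ) ^ J ≤ 2 * 2 ^ B.J₀ * y := by
    rw [hJJ, pow_succ]; nlinarith
  have hJp : (0 : ℝ) < 2 ^ J := by positivity
  have hJ1 : (1 : ℝ) ≤ 2 ^ J := one_le_pow₀ (by norm_num)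
  set X : ℝ := (2 ^ J) ^ (α + β) with hX
  set K : ℝ := (2 ^ J) ^ d with hK
  have hX0 : 0 < X := by positivity
  have hK0 : 0 < K := by positivity
  have hKX : 4000 * N ^ 2 ≤ K * X ^ 2 := by
    have e : K * X ^ 2 = (2 ^ J : ℝ) ^ q := by
      rw [hK, hX, ← Real.rpow_natCast (2 ^ J) d, ← Real.rpow_natCast _ 2, ← Real.rpow_mul hJp.le,
        ← Real.rpow_add hJp, hq]
      congr 1; push_cast; ring
    rw [e]
    calc 4000 * N ^ 2 = y ^ q := by
          rw [hy, ← Real.rpow_mul (by positivity), one_div_mul_cancel hq0.ne', Real.rpow_one]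
      _ ≤ _ := Real.rpow_le_rpow (by positivity) hyJ hq0.le
  -- this is the place where `2 * (α + β) ≤ d` enters: there are more cells than observations
  have hXK : X ^ 2 ≤ K := by
    rw [hK, hX, ← Real.rpow_natCast (2 ^ J) d, ← Real.rpow_natCast _ 2, ← Real.rpow_mul hJp.le]
    exact Real.rpow_le_rpow_of_exponent_le hJ1 (by push_cast; linarith)
  have h63 : 63 * N ≤ K := by
    refine le_of_sq_le_sq ?_ hK0.le
    calc (63 * N) ^ 2 ≤ 4000 * N ^ 2 := by nlinarith [sq_nonneg N]
      _ ≤ K * X ^ 2 := hKX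
      _ ≤ K ^ 2 := by rw [sq K]; gcongr
  have hεε : c / (2 ^ J) ^ α * (c / (2 ^ J) ^ β) = c ^ 2 / X := by
    rw [hX, Real.rpow_add hJp, div_mul_div_comm, sq]
  have hle1 : c / (2 ^ J) ^ α ≤ c := div_le_self hc.le (Real.one_le_rpow hJ1 hα.le)
  have hle2 : c / (2 ^ J) ^ β ≤ c := div_le_self hc.le (Real.one_le_rpow hJ1 hβ.le)
  have key := h.ofReal_sq_le_worstRisk (M := M) (J := J) (ε := c / (2 ^ J) ^ α)
    (ε' := c / (2 ^ J) ^ β) (by positivity) (by positivity) (by linarith)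
    (fun x hx s hs => (hball J (by omega) s hs).1 x hx)
    (fun x hx s hs => (hball J (by omega) s hs).2 x hx) (m := m) (n := n) h63 (by
      rw [hεε]
      have e1 : 8 * (c ^ 2 / X) / δ ^ 4 ≤ 1 / (8 * X) := by
        rw [div_le_div_iff₀ (by positivity) (by positivity)]
        have : c ^ 2 ≤ (δ ^ 2 / 8) ^ 2 := pow_le_pow_left₀ hc.le hcδ 2
        calc 8 * (c ^ 2 / X) * (8 * X) = 64 * c ^ 2 := by field_simp; ring
          _ ≤ 1 * δ ^ 4 := by nlinarith
      calc 2 * K * (8 * (c ^ 2 / X) / δ ^ 4 * (63 * N / K)) ^ 2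
          ≤ 2 * K * (1 / (8 * X) * (63 * N / K)) ^ 2 := by gcongr
        _ = 3969 * N ^ 2 / (32 * (K * X ^ 2)) := by field_simp; ring
        _ ≤ 1 / 4 := by
          rw [div_le_div_iff₀ (by positivity) (by positivity)]
          nlinarith [sq_nonneg N]) hT
  refine le_trans (ENNReal.ofReal_le_ofReal ?_) key
  rw [hεε]
  have hXy : X ≤ a * y ^ (α + β) := by
    rw [hX, ha, ← Real.mul_rpow (by positivity) (by positivity)]
    exact Real.rpow_le_rpow hJp.le hJy (by positivity)
  have hyN : y ^ (α + β) = b⁻¹ * (N ^ (-((4 * α + 4 * β) / q) / 2))⁻¹ := by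
    rw [hy, ← Real.rpow_mul (by positivity), Real.mul_rpow (by positivity) (by positivity), hb,
      ← Real.rpow_neg (by norm_num), ← Real.rpow_neg hN0.le, ← Real.rpow_natCast N 2,
      ← Real.rpow_mul hN0.le]
    congr 2 <;> (push_cast; ring)
  have hsplit : N ^ (-((4 * α + 4 * β) / q)) = (N ^ (-((4 * α + 4 * β) / q) / 2)) ^ 2 := by
    rw [← Real.rpow_natCast, ← Real.rpow_mul hN0.le]; congr 1; push_cast; ring
  set R := N ^ (-((4 * α + 4 * β) / q) / 2) with hR
  have hR0 : 0 < R := by positivity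
  have hb0 : 0 < b := by positivity
  have hE := quarter_pow_le_bumpEnergy d J
  rw [hsplit, div_mul_eq_mul_div, ← mul_pow]
  have e2 : c ^ 2 / a * b * R ≤ c ^ 2 / X := by
    rw [le_div_iff₀ hX0]
    calc c ^ 2 / a * b * R * X ≤ c ^ 2 / a * b * R * (a * (b⁻¹ * R⁻¹)) := by
          rw [← hyN]; gcongr
      _ = c ^ 2 := by field_simp
  have e3 : L ^ 2 * (c ^ 2 / a * b * (1 / 4) ^ d) * R ≤ L ^ 2 * (c ^ 2 / X * bumpEnergy d J) := by
    calc _ = L ^ 2 * ((c ^ 2 / a * b * R) * (1 / 4) ^ d) := by ring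
      _ ≤ _ := by gcongr
  gcongr

end CDVBasis.IsCenter

end Center

/-! ### The bias of the plug-in estimators -/

instance isProbabilityMeasure_sampleLaw {d m n : ℕ} {P : Measure (Obs d)} [IsProbabilityMeasure P] :
    IsProbabilityMeasure (sampleLaw m n P) := by unfold sampleLaw; infer_instance

theorem ofReal_sq_integral_le {Ω : Type*} {mΩ : MeasurableSpace Ω} {μ : Measure Ω}
    [IsProbabilityMeasure μ] {F : Ω → ℝ} (hF : MemLp F ⊤ μ) :
    ENNReal.ofReal ((∫ x, F x ∂μ) ^ 2) ≤ ∫⁻ x, ENNReal.ofReal (F x ^ 2) ∂μ := by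
  rw [lintegral_ofReal_sq_eq hF]
  refine ENNReal.ofReal_le_ofReal ?_
  have h := CDVBasis.sq_integral_mul_le (f := F) (g := fun _ => 1) ((hF.mul_top hF).integrable le_top)
    (integrable_const _) (by simpa using hF.integrable le_top)
  simpa [sq] using h

/-- The mean of a product of two sums over the same sample: diagonal and off-diagonal terms. -/
theorem integral_sum_mul_sum_eval {Z J : Type*} [MeasurableSpace Z] [Fintype J] {P : Measure Z}
    [IsProbabilityMeasure P] {φ χ : Z → ℝ} (hφ : MemLp φ ⊤ P) (hχ : MemLp χ ⊤ P) :
    ∫ ω : J → Z, (∑ i, φ (ω i)) * ∑ i, χ (ω i) ∂(Measure.pi fun _ => P)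
      = Fintype.card J * ∫ z, φ z * χ z ∂P
        + (Fintype.card J * (Fintype.card J - 1) : ℝ) * ((∫ z, φ z ∂P) * ∫ z, χ z ∂P) := by
  classical
  have hm : ∀ i i' : J, MemLp (fun ω : J → Z => φ (ω i) * χ (ω i')) ⊤ (Measure.pi fun _ => P) :=
    fun i i' => (memLp_eval hφ i).mul_top (memLp_eval hχ i')
  have hint : ∀ i i' : J, ∫ ω : J → Z, φ (ω i) * χ (ω i') ∂(Measure.pi fun _ => P)
      = (if i = i' then ∫ z, φ z * χ z ∂P - (∫ z, φ z ∂P) * ∫ z, χ z ∂P else 0)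
        + (∫ z, φ z ∂P) * ∫ z, χ z ∂P := by
    intro i i'
    split_ifs with h
    · subst h
      rw [integral_eval (f := fun z => φ z * χ z) (hφ.1.mul hχ.1), sub_add_cancel]
    · have hpm : AEStronglyMeasurable (fun w : Z × Z => φ w.1 * χ w.2)
          ((Measure.pi fun _ : J => P).map fun ω => (ω i, ω i')) := by
        rw [map_pair_eval h]; exact hφ.1.comp_fst.mul hχ.1.comp_snd
      rw [zero_add, ← integral_prod_mul, ← map_pair_eval (J := J) h,
        integral_map ((measurable_pi_apply i).prodMk (measurable_pi_apply i')).aemeasurable hpm]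
  simp_rw [Finset.sum_mul_sum]
  rw [integral_finsetSum _ fun i _ => integrable_finsetSum _ fun i' _ =>
    (hm i i').integrable le_top]
  simp_rw [integral_finsetSum Finset.univ fun i' (_ : i' ∈ Finset.univ) =>
    (hm _ i').integrable le_top, hint]
  simp only [Finset.sum_add_distrib, Finset.sum_ite_eq, Finset.mem_univ, if_true,
    Finset.sum_const, Finset.card_univ, nsmul_eq_mul]
  ring

namespace CDVBasis

variable {S : ℕ} (B : CDVBasis S) {d : ℕ}

theorem integral_projKernel_diag (d : ℕ) {j : ℕ} (hj : B.J₀ ≤ j) :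
    ∫ x : Fin d → ℝ, B.projKernel j x x ∂cubeVol d = (2 ^ j) ^ d := by
  unfold projKernel
  rw [integral_finsetSum _ fun m _ => (B.memLp_Phi j m).integrable_mul_top (B.memLp_Phi j m)]
  simp [B.integral_Phi_mul_Phi hj]

theorem memLp_projKernel_diag (j : ℕ) :
    MemLp (fun x : Fin d → ℝ => B.projKernel j x x) ⊤ (cubeVol d) :=
  memLp_finsetSum _ fun m _ => (B.memLp_Phi j m).mul_top (B.memLp_Phi j m)

/-- The mean of the plug-in estimator `∫ p̂ b̂` with single sample splitting: the use of the same
subsample for both estimators contributes the integral of the diagonal of the kernel. -/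
theorem integral_integral_regHat_mul {P : Measure (Obs d)} {C : ℝ} {p b : (Fin d → ℝ) → ℝ}
    (hP : IsRegressionLaw P C p b) {j₁ j₂ n : ℕ} (h₁ : B.J₀ ≤ j₁) (h₂ : B.J₀ ≤ j₂) (hn : 0 < n) :
    MemLp (fun D : Fin n → Obs d => ∫ x, B.regHat obsA j₁ D x * B.regHat obsY j₂ D x ∂cubeVol d)
      ⊤ (Measure.pi fun _ => P) ∧
    ∫ D : Fin n → Obs d, (∫ x, B.regHat obsA j₁ D x * B.regHat obsY j₂ D x ∂cubeVol d)
        ∂(Measure.pi fun _ => P)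
      = (1 - 1 / n) * B.projInner (min j₁ j₂) p b
        + 1 / n * ∫ o, obsA o * obsY o * B.projKernel (min j₁ j₂) (obsX o) (obsX o) ∂P := by
  have := hP.isProb
  have hae := B.integral_regHat_mul_regHat (n := n) hP.mp h₁ h₂ obsA obsY
  set j := min j₁ j₂
  have hmem : ∀ m, MemLp (fun D : Fin n → Obs d => B.empCoef obsA j D m * B.empCoef obsY j D m) ⊤
      (Measure.pi fun _ => P) := fun m =>
    (B.memLp_empCoef hP.mp hP.regA j m).mul_top (B.memLp_empCoef hP.mp hP.regY j m)
  have hΦ : ∀ m, MemLp (fun o => B.Phi j m (obsX o)) ⊤ P := fun m =>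
    (B.memLp_Phi j m).comp_measurePreserving hP.mp
  have hA : ∀ m, MemLp (fun o => obsA o * B.Phi j m (obsX o)) ⊤ P := fun m =>
    hP.regA.memLp_var.mul_top (hΦ m)
  have hY : ∀ m, MemLp (fun o => obsY o * B.Phi j m (obsX o)) ⊤ P := fun m =>
    hP.regY.memLp_var.mul_top (hΦ m)
  refine ⟨(memLp_congr_ae hae).2 (memLp_finsetSum _ fun m _ => hmem m), ?_⟩
  rw [integral_congr_ae hae, integral_finsetSum _ fun m _ => (hmem m).integrable le_top]
  have hn' : (n : ℝ) ≠ 0 := by positivity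
  have hm : ∀ m, ∫ D : Fin n → Obs d, B.empCoef obsA j D m * B.empCoef obsY j D m
        ∂(Measure.pi fun _ => P)
      = (1 - 1 / n) * (innerC p (B.Phi j m) * innerC b (B.Phi j m))
        + 1 / n * ∫ o, obsA o * B.Phi j m (obsX o) * (obsY o * B.Phi j m (obsX o)) ∂P := by
    intro m
    have e : ∀ D : Fin n → Obs d, B.empCoef obsA j D m * B.empCoef obsY j D m
        = (1 / n : ℝ) ^ 2 * ((∑ i, obsA (D i) * B.Phi j m (obsX (D i)))
          * ∑ i, obsY (D i) * B.Phi j m (obsX (D i))) := fun D => by unfold empCoef; ring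
    simp_rw [e]
    rw [integral_const_mul, integral_sum_mul_sum_eval (hA m) (hY m), Fintype.card_fin,
      hP.regA.integral_mul _ (B.memLp_Phi j m), hP.regY.integral_mul _ (B.memLp_Phi j m),
      innerC_eq, innerC_eq]
    field_simp
    ring
  simp_rw [hm]
  rw [Finset.sum_add_distrib, ← Finset.mul_sum, ← Finset.mul_sum,
    ← integral_finsetSum _ fun m _ => ((hA m).mul_top (hY m)).integrable le_top]
  congr 3
  ext o
  rw [projKernel, Finset.mul_sum]
  exact Finset.sum_congr rfl fun m _ => by ring

theorem memLp_mean_AY {P : Measure (Obs d)} {C : ℝ} {p b : (Fin d → ℝ) → ℝ}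
    (hP : IsRegressionLaw P C p b) {n : ℕ} (hn : 0 < n) :
    MemLp (fun D : Fin n → Obs d => (1 / n : ℝ) * ∑ i, obsA (D i) * obsY (D i)) ⊤
      (Measure.pi fun _ => P) ∧
    ∫ D : Fin n → Obs d, (1 / n : ℝ) * ∑ i, obsA (D i) * obsY (D i) ∂(Measure.pi fun _ => P)
      = ∫ o, obsA o * obsY o ∂P := by
  have := hP.isProb
  have hm : MemLp (fun o => obsA o * obsY o) ⊤ P := hP.regA.memLp_var.mul_top hP.regY.memLp_var
  refine ⟨(memLp_finsetSum _ fun i _ => memLp_eval hm i).const_mul _, ?_⟩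
  rw [integral_const_mul, integral_finsetSum _ fun i _ => (memLp_eval hm i).integrable le_top]
  simp_rw [integral_eval hm.1]
  have hn' : (n : ℝ) ≠ 0 := by positivity
  simp [hn']

/-- The risk of the integral-based estimator is at least its squared bias. -/
theorem sq_bias_le_risk_INT {P : Measure (Obs d)} {C : ℝ} {p b : (Fin d → ℝ) → ℝ}
    (hP : IsRegressionLaw P C p b) {j₁ j₂ n : ℕ} (h₁ : B.J₀ ≤ j₁) (h₂ : B.J₀ ≤ j₂) (hn : 0 < n) :
    ENNReal.ofReal ((∫ x, p x * b x ∂cubeVol d - ∫ D : Fin n → Obs d,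
        (∫ x, B.regHat obsA j₁ D x * B.regHat obsY j₂ D x ∂cubeVol d) ∂(Measure.pi fun _ => P)) ^ 2)
      ≤ ∫⁻ ω, ENNReal.ofReal ((B.psiINT j₁ j₂ ω - psi P) ^ 2) ∂(sampleLaw 2 n P) := by
  have := hP.isProb
  obtain ⟨m₁, e₁⟩ := memLp_mean_AY hP hn
  obtain ⟨m₂, -⟩ := B.integral_integral_regHat_mul hP h₁ h₂ hn
  have k₁ : MemLp (fun ω : Sample d 2 n => (1 / n : ℝ) * ∑ i, obsA (ω 1 i) * obsY (ω 1 i)) ⊤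
      (sampleLaw 2 n P) := memLp_eval (J := Fin 2) m₁ 1
  have k₂ : MemLp (fun ω : Sample d 2 n =>
      ∫ x, B.regHat obsA j₁ (ω 0) x * B.regHat obsY j₂ (ω 0) x ∂cubeVol d) ⊤ (sampleLaw 2 n P) :=
    memLp_eval (J := Fin 2) m₂ 0
  have e : ∀ ω : Sample d 2 n, B.psiINT j₁ j₂ ω - psi P
      = (1 / n : ℝ) * ∑ i, obsA (ω 1 i) * obsY (ω 1 i)
        - (∫ x, B.regHat obsA j₁ (ω 0) x * B.regHat obsY j₂ (ω 0) x ∂cubeVol d) - psi P := by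
    intro ω
    simp only [psiINT, pHat_eq, bHat_eq, restrict_cube_eq]
  have k₃ : MemLp (fun ω : Sample d 2 n => (1 / n : ℝ) * ∑ i, obsA (ω 1 i) * obsY (ω 1 i)
        - ∫ x, B.regHat obsA j₁ (ω 0) x * B.regHat obsY j₂ (ω 0) x ∂cubeVol d) ⊤
        (sampleLaw 2 n P) := k₁.sub k₂
  have k : MemLp (fun ω => B.psiINT j₁ j₂ ω - psi P) ⊤ (sampleLaw 2 n P) := by
    simp_rw [e]; exact k₃.sub (memLp_const _)
  refine le_trans (le_of_eq ?_) (ofReal_sq_integral_le k)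
  simp_rw [e]
  rw [integral_sub (k₃.integrable le_top) (integrable_const _),
    integral_sub (k₁.integrable le_top) (k₂.integrable le_top)]
  unfold sampleLaw
  rw [integral_eval m₁.1, integral_eval m₂.1, e₁, hP.psi_eq]
  simp only [integral_const, probReal_univ, one_smul]
  congr 2; ring

/-- The risk of the Monte Carlo-based estimator is at least its squared bias, which is the bias of
the integral-based estimator. -/
theorem sq_bias_le_risk_MC {P : Measure (Obs d)} {C : ℝ} {p b : (Fin d → ℝ) → ℝ}
    (hP : IsRegressionLaw P C p b) {j₁ j₂ n : ℕ} (hn : 0 < n) :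
    ENNReal.ofReal ((∫ x, p x * b x ∂cubeVol d - ∫ D : Fin n → Obs d,
        (∫ x, B.regHat obsA j₁ D x * B.regHat obsY j₂ D x ∂cubeVol d) ∂(Measure.pi fun _ => P)) ^ 2)
      ≤ ∫⁻ ω, ENNReal.ofReal ((B.psiMC j₁ j₂ ω - psi P) ^ 2) ∂(sampleLaw 3 n P) := by
  have := hP.isProb
  have hn' : (n : ℝ) ≠ 0 := by positivity
  obtain ⟨m₁, e₁⟩ := memLp_mean_AY hP hn
  have k₁ : MemLp (fun ω : Sample d 3 n => (1 / n : ℝ) * ∑ i, obsA (ω 1 i) * obsY (ω 1 i)) ⊤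
      (sampleLaw 3 n P) := memLp_eval (J := Fin 3) m₁ 1
  have hreg : ∀ {f : Obs d → ℝ} {r : (Fin d → ℝ) → ℝ} (_ : IsRegression P C f r) (j : ℕ)
      (i : Fin n), MemLp (fun ω : Sample d 3 n => B.regHat f j (ω 0) (obsX (ω 2 i))) ⊤
        (sampleLaw 3 n P) := by
    intro f r hf j i
    simp_rw [B.regHat_eq]
    refine memLp_finsetSum _ fun m _ => (memLp_eval (J := Fin 3) (B.memLp_empCoef hP.mp hf j m)
      0).mul_top ?_
    exact memLp_eval (J := Fin 3) (memLp_eval (J := Fin n)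
      ((B.memLp_Phi j m).comp_measurePreserving hP.mp) i) 2
  set H : (Fin n → Obs d) × (Fin n → Obs d) → ℝ := fun w => (1 / n : ℝ) *
    ∑ i, B.regHat obsA j₁ w.1 (obsX (w.2 i)) * B.regHat obsY j₂ w.1 (obsX (w.2 i)) with hH
  have hHm : Measurable H := by
    have e : ∀ {f : Obs d → ℝ} (_ : Measurable f) (j : ℕ) (i : Fin n),
        Measurable fun w : (Fin n → Obs d) × (Fin n → Obs d) => B.regHat f j w.1 (obsX (w.2 i)) :=
      fun hf j i => (B.measurable_regHat hf j).comp (measurable_fst.prodMk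
        (measurable_obsX.comp ((measurable_pi_apply i).comp measurable_snd)))
    exact (Finset.measurable_fun_sum _ fun i _ =>
      (e measurable_obsA j₁ i).mul (e measurable_obsY j₂ i)).const_mul _
  have k₂ : MemLp (fun ω : Sample d 3 n => H (ω 0, ω 2)) ⊤ (sampleLaw 3 n P) :=
    (memLp_finsetSum _ fun i _ => (hreg hP.regA j₁ i).mul_top (hreg hP.regY j₂ i)).const_mul _
  have hpm : Measurable fun ω : Sample d 3 n => (ω 0, ω 2) :=
    (measurable_pi_apply 0).prodMk (measurable_pi_apply 2)
  have hmap : (sampleLaw 3 n P).map (fun ω : Sample d 3 n => (ω 0, ω 2))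
      = (Measure.pi fun _ => P).prod (Measure.pi fun _ => P) :=
    map_pair_eval (J := Fin 3) (P := Measure.pi fun _ : Fin n => P) (by decide)
  have e₂ : ∫ ω : Sample d 3 n, H (ω 0, ω 2) ∂(sampleLaw 3 n P) = ∫ D : Fin n → Obs d,
      (∫ x, B.regHat obsA j₁ D x * B.regHat obsY j₂ D x ∂cubeVol d) ∂(Measure.pi fun _ => P) := by
    have hi : Integrable H ((Measure.pi fun _ => P).prod (Measure.pi fun _ => P)) := by
      rw [← hmap, integrable_map_measure hHm.aestronglyMeasurable hpm.aemeasurable]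
      exact k₂.integrable le_top
    rw [← integral_map hpm.aemeasurable hHm.aestronglyMeasurable, hmap, integral_prod _ hi]
    refine integral_congr_ae (Filter.Eventually.of_forall fun D => ?_)
    have hD : MemLp (fun x => B.regHat obsA j₁ D x * B.regHat obsY j₂ D x) ⊤ (cubeVol d) :=
      (B.memLp_regHat _ _ _).mul_top (B.memLp_regHat _ _ _)
    have hD' : MemLp (fun o => B.regHat obsA j₁ D (obsX o) * B.regHat obsY j₂ D (obsX o)) ⊤ P :=
      hD.comp_measurePreserving hP.mp
    simp only [hH]
    rw [integral_const_mul, integral_finsetSum _ fun i _ => (memLp_eval hD' i).integrable le_top]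
    simp_rw [integral_eval hD'.1]
    rw [integral_comp_obsX hP.mp (h := fun x => B.regHat obsA j₁ D x * B.regHat obsY j₂ D x) hD.1]
    simp [hn']
  have e : ∀ ω : Sample d 3 n, B.psiMC j₁ j₂ ω - psi P
      = (1 / n : ℝ) * ∑ i, obsA (ω 1 i) * obsY (ω 1 i) - H (ω 0, ω 2) - psi P := by
    intro ω
    simp only [psiMC, pHat_eq, bHat_eq, hH]
  have k₃ : MemLp (fun ω : Sample d 3 n => (1 / n : ℝ) * ∑ i, obsA (ω 1 i) * obsY (ω 1 i)
        - H (ω 0, ω 2)) ⊤ (sampleLaw 3 n P) := k₁.sub k₂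
  have k : MemLp (fun ω => B.psiMC j₁ j₂ ω - psi P) ⊤ (sampleLaw 3 n P) := by
    simp_rw [e]; exact k₃.sub (memLp_const _)
  refine le_trans (le_of_eq ?_) (ofReal_sq_integral_le k)
  simp_rw [e]
  rw [integral_sub (k₃.integrable le_top) (integrable_const _),
    integral_sub (k₁.integrable le_top) (k₂.integrable le_top), e₂]
  unfold sampleLaw
  rw [integral_eval m₁.1, e₁, hP.psi_eq]
  simp only [integral_const, probReal_univ, one_smul]
  congr 2; ring

end CDVBasis

/-! ### Lower bounds for the plug-in estimators -/

/-- Some signed sum of vectors has at most the Euclidean length that orthogonality would give. -/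
theorem exists_signs_sum_sq_le {ι κ : Type*} [Fintype κ] (x : ι → κ → ℝ) (t : Finset ι) :
    ∃ s : ι → ℝ, (∀ m, |s m| = 1) ∧
      ∑ k, (∑ m ∈ t, s m * x m k) ^ 2 ≤ ∑ m ∈ t, ∑ k, x m k ^ 2 := by
  classical
  induction t using Finset.induction_on with
  | empty => exact ⟨fun _ => 1, fun _ => abs_one, by simp⟩
  | insert a t ha ih =>
    obtain ⟨s, hs, hle⟩ := ih
    set l := ∑ k, x a k * ∑ m ∈ t, s m * x m k with hl
    -- the sign of the new vector makes its inner product with the sum nonpositive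
    obtain ⟨σ, hσ, hσl⟩ : ∃ σ : ℝ, |σ| = 1 ∧ σ * l ≤ 0 := by
      rcases le_total l 0 with h | h
      · exact ⟨1, abs_one, by linarith⟩
      · exact ⟨-1, by simp, by linarith⟩
    refine ⟨Function.update s a σ, fun m => ?_, ?_⟩
    · by_cases h : m = a
      · subst h; simpa using hσ
      · simpa [h] using hs m
    · have e : ∀ k, (∑ m ∈ insert a t, Function.update s a σ m * x m k) ^ 2
          = x a k ^ 2 + 2 * σ * (x a k * ∑ m ∈ t, s m * x m k)
            + (∑ m ∈ t, s m * x m k) ^ 2 := by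
        intro k
        have : ∑ m ∈ t, Function.update s a σ m * x m k = ∑ m ∈ t, s m * x m k :=
          Finset.sum_congr rfl fun m hm => by
            rw [Function.update_of_ne (ne_of_mem_of_not_mem hm ha)]
        rw [Finset.sum_insert ha, this, Function.update_self]
        have : σ ^ 2 = 1 := by rw [← sq_abs, hσ, one_pow]
        linear_combination x a k ^ 2 * this
      simp_rw [e]
      rw [Finset.sum_insert ha, Finset.sum_add_distrib, Finset.sum_add_distrib, ← Finset.mul_sum,
        ← hl]
      linarith

namespace CDVBasis

variable {S : ℕ} (B : CDVBasis S) {d : ℕ}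

/-- A single cell bump has little energy in `V_j` when its scale is finer than `2 ^ (-j)`. -/
theorem exists_projInner_cellBump_le (d : ℕ) : ∃ C : ℝ, 1 ≤ C ∧ ∀ (j J : ℕ)
    (m : Fin d → Fin (2 ^ J)), B.projInner j (cellBump J m) (cellBump J m)
      ≤ C * (2 ^ j) ^ d / ((2 ^ J) ^ d * (2 ^ J) ^ d) := by
  obtain ⟨C, hC, H⟩ := B.exists_projKernel_bound d
  refine ⟨C, hC, fun j J m => ?_⟩
  have hφ := (continuous_cellBump J m).memLp_cubeVol
  have hφi := hφ.integrable (μ := cubeVol d) le_top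
  set q := ∫ x, cellBump J m x ∂cubeVol d with hq
  have hq0 : 0 ≤ q := integral_nonneg fun x => cellBump_nonneg J m x
  have hq1 : q ≤ 1 / (2 ^ J) ^ d := by
    refine le_trans ?_ (cubeVol_dyadicCell_le J m)
    rw [← mul_one ((cubeVol d).real _), ← smul_eq_mul,
      ← integral_indicator_const _ (measurableSet_dyadicCell J m)]
    refine integral_mono hφi ((integrable_const _).indicator (measurableSet_dyadicCell J m))
      fun x => ?_
    by_cases h : cellBump J m x = 0
    · rw [h]; exact Set.indicator_nonneg (fun _ _ => zero_le_one) x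
    · rw [Set.indicator_of_mem (mem_dyadicCell_of_cellBump_ne_zero h)]
      exact cellBump_le_one J m x
  have hproj : ∀ x, B.proj j (cellBump J m) x ≤ C * (2 ^ j) ^ d * q := by
    intro x
    rw [B.proj_eq_integral hφ, hq, ← integral_const_mul]
    have hK : MemLp (fun y => B.projKernel j x y) ⊤ (cubeVol d) :=
      memLp_finsetSum _ fun m _ => (B.memLp_Phi j m).const_mul _
    refine integral_mono (hK.integrable_mul_top hφ) (hφi.const_mul _) fun y => ?_
    exact mul_le_mul_of_nonneg_right ((le_abs_self _).trans ((H j).1 x y)) (cellBump_nonneg J m y)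
  rw [← B.integral_mul_proj _ hφ]
  calc ∫ x, cellBump J m x * B.proj j (cellBump J m) x ∂cubeVol d
      ≤ ∫ x, cellBump J m x * (C * (2 ^ j) ^ d * q) ∂cubeVol d := by
        refine integral_mono (hφ.integrable_mul_top (B.memLp_proj j _)) (hφi.mul_const _) fun x => ?_
        exact mul_le_mul_of_nonneg_left (hproj x) (cellBump_nonneg J m x)
    _ = C * (2 ^ j) ^ d * (q * q) := by rw [integral_mul_const, ← hq]; ring
    _ ≤ C * (2 ^ j) ^ d * (1 / (2 ^ J) ^ d * (1 / (2 ^ J) ^ d)) := by gcongr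
    _ = _ := by field_simp

/-- There are sums of bumps, at a scale finer than that of `V_j` by a constant factor, which are far
from `V_j`. -/
theorem exists_bumpSum_projInner_le (hd : 0 < d) : ∃ r : ℕ, ∀ j : ℕ,
    ∃ s : (Fin d → Fin (2 ^ (j + r))) → ℝ, (∀ m, |s m| = 1) ∧
      B.projInner j (bumpSum (j + r) s) (bumpSum (j + r) s) ≤ bumpEnergy d (j + r) / 2 := by
  obtain ⟨C, hC, H⟩ := B.exists_projInner_cellBump_le d
  obtain ⟨r, hr⟩ := pow_unbounded_of_one_lt (2 * C * 4 ^ d) (one_lt_two (α := ℝ))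
  refine ⟨r, fun j => ?_⟩
  set J := j + r with hJ
  obtain ⟨s, hs, hle⟩ := exists_signs_sum_sq_le
    (fun (m : Fin d → Fin (2 ^ J)) k => innerC (cellBump J m) (B.Phi j k)) Finset.univ
  refine ⟨s, hs, ?_⟩
  have e : ∀ k, innerC (bumpSum J s) (B.Phi j k)
      = ∑ m, s m * innerC (cellBump J m) (B.Phi j k) := by
    intro k
    simp_rw [innerC_eq, bumpSum, Finset.sum_mul, mul_assoc]
    rw [integral_finsetSum _ fun m _ => ((continuous_cellBump J m).memLp_cubeVol.integrable_mul_top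
      (B.memLp_Phi j k)).const_mul _]
    simp_rw [integral_const_mul]
  have e2 : ∀ m : Fin d → Fin (2 ^ J), ∑ k, innerC (cellBump J m) (B.Phi j k) ^ 2
      = B.projInner j (cellBump J m) (cellBump J m) := fun m =>
    Finset.sum_congr rfl fun k _ => sq _
  have hK : (0 : ℝ) < (2 ^ J) ^ d := by positivity
  calc B.projInner j (bumpSum J s) (bumpSum J s)
      = ∑ k, (∑ m, s m * innerC (cellBump J m) (B.Phi j k)) ^ 2 :=
        Finset.sum_congr rfl fun k _ => by rw [e, sq]
    _ ≤ ∑ m : Fin d → Fin (2 ^ J), C * (2 ^ j) ^ d / ((2 ^ J) ^ d * (2 ^ J) ^ d) := by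
        refine hle.trans (Finset.sum_le_sum fun m _ => ?_)
        rw [e2]; exact H j J m
    _ = C / (2 ^ r) ^ d := by
        rw [Finset.sum_const, Finset.card_univ, Fintype.card_fun, Fintype.card_fin, Fintype.card_fin,
          nsmul_eq_mul, hJ, pow_add, mul_pow]
        push_cast
        rw [pow_add, mul_pow]
        field_simp
    _ ≤ (1 / 4) ^ d / 2 := by
        have h1 : (2 : ℝ) ^ r ≤ (2 ^ r) ^ d := le_self_pow₀ (one_le_pow₀ (by norm_num)) hd.ne'
        rw [div_le_iff₀ (by positivity), one_div, inv_pow]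
        have h4 : (0 : ℝ) < 4 ^ d := by positivity
        field_simp
        linarith
    _ ≤ _ := by gcongr; exact quarter_pow_le_bumpEnergy d J


theorem innerC_add_mul {f g φ : (Fin d → ℝ) → ℝ} (hf : MemLp f ⊤ (cubeVol d))
    (hg : MemLp g ⊤ (cubeVol d)) (hφ : MemLp φ ⊤ (cubeVol d)) (c : ℝ) :
    innerC (fun x => f x + c * g x) φ = innerC f φ + c * innerC g φ := by
  simp_rw [innerC_eq, add_mul, mul_assoc]
  rw [integral_add (hf.integrable_mul_top hφ) ((hg.integrable_mul_top hφ).const_mul c),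
    integral_const_mul]

theorem projInner_add_mul {f g h : (Fin d → ℝ) → ℝ} (hf : MemLp f ⊤ (cubeVol d))
    (hg : MemLp g ⊤ (cubeVol d)) (hh : MemLp h ⊤ (cubeVol d)) (j : ℕ) (x y : ℝ) :
    B.projInner j (fun z => f z + x * h z) (fun z => g z + y * h z)
      = B.projInner j f g + x * B.projInner j h g + y * B.projInner j f h
        + x * y * B.projInner j h h := by
  unfold projInner
  simp_rw [innerC_add_mul hf hh (B.memLp_Phi j _), innerC_add_mul hg hh (B.memLp_Phi j _),
    Finset.mul_sum, ← Finset.sum_add_distrib]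
  exact Finset.sum_congr rfl fun m _ => by ring

/-- The bias of the plug-in estimator of `∫ p b` under the law `P`. -/
noncomputable def pluginBias (j₁ j₂ n : ℕ) (P : Measure (Obs d)) (p b : (Fin d → ℝ) → ℝ) : ℝ :=
  ∫ x, p x * b x ∂cubeVol d - ∫ D : Fin n → Obs d,
    (∫ x, B.regHat obsA j₁ D x * B.regHat obsY j₂ D x ∂cubeVol d) ∂(Measure.pi fun _ => P)

variable {B} {α β M M₀ C₁ C₂ δ : ℝ} {u v : (Fin d → ℝ) → ℝ}

/-- The bias is a bilinear polynomial in the perturbations of the two regression functions. When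
the mean of `A * Y` is perturbed separately, the diagonal of the kernel enters. -/
theorem IsCenter.exists_pluginBias_eq (h : B.IsCenter α β M₀ C₁ C₂ δ u v) {j₁ j₂ n : ℕ}
    (h₁ : B.J₀ ≤ j₁) (h₂ : B.J₀ ≤ j₂) (hn : 0 < n) {f : (Fin d → ℝ) → ℝ}
    (hf : MemLp f ⊤ (cubeVol d)) : ∃ a₀ a₁ a₂ : ℝ, ∀ x y t : ℝ,
      IsAdmissible (fun z => u z + x * f z) (fun z => v z + y * f z) (fun z => u z * v z + t) →
      B.pluginBias j₁ j₂ n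
        (obsLaw C₁ C₂ (fun z => u z + x * f z) (fun z => v z + y * f z) fun z => u z * v z + t)
        (fun z => decode C₁ C₂ (u z + x * f z)) (fun z => decode C₁ C₂ (v z + y * f z))
      = a₀ + x * a₁ + y * a₂
        + x * y * (((C₂ - C₁) / 2) ^ 2 * (∫ z, f z * f z ∂cubeVol d
          - (1 - 1 / n) * B.projInner (min j₁ j₂) f f))
        - t * (((C₂ - C₁) / 2) ^ 2 * ((2 ^ min j₁ j₂) ^ d / n)) := by
  set j := min j₁ j₂ with hj
  set L := (C₂ - C₁) / 2 with hL
  set a := (C₁ + C₂) / 2 with ha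
  set p : (Fin d → ℝ) → ℝ := fun z => decode C₁ C₂ (u z) with hp
  set b : (Fin d → ℝ) → ℝ := fun z => decode C₁ C₂ (v z) with hb
  set K : (Fin d → ℝ) → ℝ := fun z => B.projKernel j z z with hK
  have hpm : MemLp p ⊤ (cubeVol d) := memLp_decode h.admissible_self.memLp_u
  have hbm : MemLp b ⊤ (cubeVol d) := memLp_decode h.admissible_self.memLp_v
  have hKm : MemLp K ⊤ (cubeVol d) := B.memLp_projKernel_diag j
  set G₀ : (Fin d → ℝ) → ℝ := fun z => p z * b z - 1 / n * (p z * b z * K z) with hG₀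
  set G₁ : (Fin d → ℝ) → ℝ := fun z => L * (f z * b z) - 1 / n * (a * L * (f z * K z)) with hG₁
  set G₂ : (Fin d → ℝ) → ℝ := fun z => L * (p z * f z) - 1 / n * (a * L * (f z * K z)) with hG₂
  have mpb := hpm.mul_top hbm
  have mfK := hf.mul_top hKm
  have m₀ : MemLp G₀ ⊤ (cubeVol d) := mpb.sub ((mpb.mul_top hKm).const_mul _)
  have m₁ : MemLp G₁ ⊤ (cubeVol d) :=
    ((hf.mul_top hbm).const_mul _).sub ((mfK.const_mul _).const_mul _)
  have m₂ : MemLp G₂ ⊤ (cubeVol d) :=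
    ((hpm.mul_top hf).const_mul _).sub ((mfK.const_mul _).const_mul _)
  -- only the coefficients of `x * y` and `t` matter below
  refine ⟨∫ z, G₀ z ∂cubeVol d - (1 - 1 / n) * B.projInner j p b,
    ∫ z, G₁ z ∂cubeVol d - (1 - 1 / n) * (L * B.projInner j f b),
    ∫ z, G₂ z ∂cubeVol d - (1 - 1 / n) * (L * B.projInner j p f), fun x y t hadm => ?_⟩
  obtain ⟨-, -, hlaw⟩ := isRegressionLaw_obsLaw h.lt hadm
  have hd1 : ∀ z, decode C₁ C₂ (u z + x * f z) = p z + x * L * f z := fun z => by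
    rw [decode_add, ← hL]; ring
  have hd2 : ∀ z, decode C₁ C₂ (v z + y * f z) = b z + y * L * f z := fun z => by
    rw [decode_add, ← hL]; ring
  unfold pluginBias
  rw [(B.integral_integral_regHat_mul hlaw h₁ h₂ hn).2, integral_obsLaw_AY_mul h.lt hadm hKm, ← hL]
  simp_rw [hd1, hd2]
  rw [← hj, B.projInner_add_mul hpm hbm hf, ← B.integral_projKernel_diag d (le_min h₁ h₂), ← hj]
  have mp' : MemLp (fun z => p z + x * L * f z) ⊤ (cubeVol d) := hpm.add (hf.const_mul _)
  have mb' : MemLp (fun z => b z + y * L * f z) ⊤ (cubeVol d) := hbm.add (hf.const_mul _)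
  have i₁ := mp'.integrable_mul_top (μ := cubeVol d) mb'
  -- the mean of `A * Y` given the covariate has no term `x * y`: `w` stays equal to `u * v + t`
  have eQ : ∀ z, ((p z + x * L * f z) * (b z + y * L * f z)
      + L ^ 2 * (u z * v z + t - (u z + x * f z) * (v z + y * f z))) * K z
      = (p z * b z + (x + y) * (a * L) * f z + L ^ 2 * t) * K z := fun z => by
    simp only [hp, hb, decode, ← hL, ← ha]; ring
  simp_rw [eQ]
  have mQ : MemLp (fun z => p z * b z + (x + y) * (a * L) * f z + L ^ 2 * t) ⊤ (cubeVol d) :=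
    (mpb.add (hf.const_mul _)).add (memLp_const _)
  have i₂ := (mQ.integrable_mul_top (μ := cubeVol d) hKm).const_mul (1 / n)
  have key : ∫ z, (p z + x * L * f z) * (b z + y * L * f z) ∂cubeVol d
      - 1 / n * ∫ z, (p z * b z + (x + y) * (a * L) * f z + L ^ 2 * t) * K z ∂cubeVol d
      = ∫ z, G₀ z ∂cubeVol d + x * ∫ z, G₁ z ∂cubeVol d + y * ∫ z, G₂ z ∂cubeVol d
        + x * y * L ^ 2 * ∫ z, f z * f z ∂cubeVol d - t * L ^ 2 / n * ∫ z, K z ∂cubeVol d := by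
    have k₀ := m₀.integrable (μ := cubeVol d) le_top
    have k₁ := (m₁.integrable (μ := cubeVol d) le_top).const_mul x
    have k₂ := (m₂.integrable (μ := cubeVol d) le_top).const_mul y
    have k₃ := (hf.integrable_mul_top (μ := cubeVol d) hf).const_mul (x * y * L ^ 2)
    have k₄ := (hKm.integrable (μ := cubeVol d) le_top).const_mul (t * L ^ 2 / n)
    have k₀₁ : Integrable (fun z => G₀ z + x * G₁ z) (cubeVol d) := k₀.add k₁
    have k₀₂ : Integrable (fun z => G₀ z + x * G₁ z + y * G₂ z) (cubeVol d) := k₀₁.add k₂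
    have k₀₃ : Integrable (fun z => G₀ z + x * G₁ z + y * G₂ z + x * y * L ^ 2 * (f z * f z))
      (cubeVol d) := k₀₂.add k₃
    rw [← integral_const_mul, ← integral_sub i₁ i₂, ← integral_const_mul x,
      ← integral_const_mul y, ← integral_const_mul (x * y * L ^ 2),
      ← integral_const_mul (t * L ^ 2 / n), ← integral_add k₀ k₁, ← integral_add k₀₁ k₂,
      ← integral_add k₀₂ k₃, ← integral_sub k₀₃ k₄]
    refine integral_congr_ae (Filter.Eventually.of_forall fun z => ?_)
    simp only [hG₀, hG₁, hG₂]
    ring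
  linear_combination key

/-- The squared bias of the plug-in estimators cannot be small uniformly over the model: the
approximation error of `V_j` forces `j` to be large, and the diagonal of the kernel forces it to be
small. -/
theorem IsCenter.exists_sq_pluginBias_ge (h : B.IsCenter α β M₀ C₁ C₂ δ u v) (hd : 0 < d)
    (hα : 0 < α) (hβ : 0 < β) (hM : 0 < M) (hαS : α < S) (hβS : β < S) (hM₀ : M₀ < M) :
    ∃ c : ℝ, 0 < c ∧ ∀ (j₁ j₂ n : ℕ), B.J₀ ≤ j₁ → B.J₀ ≤ j₂ → 0 < n → ∀ W : ℝ≥0∞,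
      (∀ P ∈ B.model d α β M C₁ C₂, ∀ p b, IsRegressionLaw P (max |C₁| |C₂|) p b →
        ENNReal.ofReal (B.pluginBias j₁ j₂ n P p b ^ 2) ≤ W) →
      ENNReal.ofReal (c * (n : ℝ) ^ (-((2 * α + 2 * β) / (α + β + d)))) ≤ W := by
  obtain ⟨c, hc, hcδ, hball⟩ := h.exists_height hα hβ hM hαS hβS hM₀
  obtain ⟨r, hr⟩ := B.exists_bumpSum_projInner_le hd
  have hδ := h.pos
  have hL : 0 < (C₂ - C₁) / 2 := by linarith [h.lt]
  set L := (C₂ - C₁) / 2 with hLd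
  set κ : ℝ := min (L ^ 2 * (c ^ 2 / (2 ^ r) ^ (α + β)) * ((1 / 4) ^ d / 2)) (L ^ 2 * δ ^ 2 / 2)
    with hκ
  have hκ0 : 0 < κ := by positivity
  refine ⟨κ ^ 2, by positivity, fun j₁ j₂ n h₁ h₂ hn W hW => ?_⟩
  rcases eq_or_ne W ⊤ with hWt | hWt
  · rw [hWt]; exact le_top
  set j := min j₁ j₂ with hj
  have hjJ : B.J₀ ≤ j := le_min h₁ h₂
  set J := j + r with hJ
  obtain ⟨s, hs, hsP⟩ := hr j
  set f := bumpSum J s with hf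
  set w := √W.toReal with hw
  have hw0 : 0 ≤ w := Real.sqrt_nonneg _
  have hJp : (0 : ℝ) < 2 ^ J := by positivity
  have hJ1 : (1 : ℝ) ≤ 2 ^ J := one_le_pow₀ (by norm_num)
  set ε := c / (2 ^ J) ^ α with hε
  set ε' := c / (2 ^ J) ^ β with hε'
  have hε0 : 0 < ε := by positivity
  have hε0' : 0 < ε' := by positivity
  have hεc : ε ≤ c := div_le_self hc.le (Real.one_le_rpow hJ1 hα.le)
  have hεc' : ε' ≤ c := div_le_self hc.le (Real.one_le_rpow hJ1 hβ.le)
  have hfm : Measurable f := (continuous_bumpSum J s).measurable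
  have hf1 : ∀ z, |f z| ≤ 1 := abs_sum_mul_cellBump_le fun m => (hs m).le
  obtain ⟨a₀, a₁, a₂, hbias⟩ := h.exists_pluginBias_eq h₁ h₂ hn
    (continuous_bumpSum J s).memLp_cubeVol
  rw [← hf, ← hj, integral_bumpSum_sq fun m => by rw [← sq_abs, hs, one_pow]] at hbias
  have hle : ∀ x y t : ℝ, |x| ≤ ε → |y| ≤ ε' → |x| + |y| + |t| ≤ δ ^ 2 →
      |a₀ + x * a₁ + y * a₂ + x * y * (L ^ 2 * (bumpEnergy d J
        - (1 - 1 / n) * B.projInner j f f)) - t * (L ^ 2 * ((2 ^ j) ^ d / n))| ≤ w := by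
    intro x y t hx hy hxyt
    have hadm := h.admissible (a := fun z => x * f z) (b := fun z => y * f z) (c := fun _ => t)
      (hfm.const_mul x) (hfm.const_mul y) measurable_const (fun z => by
        refine le_trans ?_ hxyt
        have e1 : |x * f z| ≤ |x| := by
          rw [abs_mul]; exact mul_le_of_le_one_right (abs_nonneg _) (hf1 z)
        have e2 : |y * f z| ≤ |y| := by
          rw [abs_mul]; exact mul_le_of_le_one_right (abs_nonneg _) (hf1 z)
        linarith)
    have hb := hball J (by omega) s fun m => (hs m).le
    have := hW _ (B.obsLaw_mem_model h.lt hadm (hb.1 x hx) (hb.2 y hy)) _ _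
      (isRegressionLaw_obsLaw h.lt hadm).2.2
    rw [hbias x y t hadm] at this
    exact Real.abs_le_sqrt ((ENNReal.ofReal_le_iff_le_toReal hWt).1 this)
  have hPI := B.projInner_self_nonneg j f
  have hn0 : (0 : ℝ) < n := by exact_mod_cast hn
  have hn1 : (1 : ℝ) ≤ n := by exact_mod_cast hn
  have hE := quarter_pow_le_bumpEnergy d J
  -- the approximation error, from the second difference in the two regression functions
  have hA : L ^ 2 * (c ^ 2 / (2 ^ r) ^ (α + β)) * ((1 / 4) ^ d / 2) / (2 ^ j) ^ (α + β) ≤ w := by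
    have hsm : ∀ x y : ℝ, |x| = ε → |y| = ε' → |x| + |y| + |(0 : ℝ)| ≤ δ ^ 2 := fun x y hx hy => by
      rw [hx, hy, abs_zero]; nlinarith [sq_nonneg δ]
    have a1 : |ε| = ε := abs_of_pos hε0
    have a2 : |ε'| = ε' := abs_of_pos hε0'
    have b1 : |-ε| = ε := by rw [abs_neg, a1]
    have b2 : |-ε'| = ε' := by rw [abs_neg, a2]
    have q1 := (abs_le.1 (hle ε ε' 0 a1.le a2.le (hsm _ _ a1 a2))).2
    have q2 := (abs_le.1 (hle ε (-ε') 0 a1.le b2.le (hsm _ _ a1 b2))).1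
    have q3 := (abs_le.1 (hle (-ε) ε' 0 b1.le a2.le (hsm _ _ b1 a2))).1
    have q4 := (abs_le.1 (hle (-ε) (-ε') 0 b1.le b2.le (hsm _ _ b1 b2))).2
    have hq : ε * ε' * (L ^ 2 * (bumpEnergy d J - (1 - 1 / n) * B.projInner j f f)) ≤ w := by
      linarith
    refine le_trans ?_ hq
    have e1 : ε * ε' = c ^ 2 / (2 ^ r) ^ (α + β) / (2 ^ j) ^ (α + β) := by
      rw [hε, hε', div_mul_div_comm, ← Real.rpow_add hJp, div_div,
        ← Real.mul_rpow (by positivity) (by positivity), ← pow_add, hJ, add_comm r, sq]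
    have e2 : (1 - 1 / (n : ℝ)) * B.projInner j f f ≤ B.projInner j f f :=
      mul_le_of_le_one_left hPI (by rw [sub_le_self_iff]; positivity)
    rw [e1]
    calc _ = c ^ 2 / (2 ^ r) ^ (α + β) / (2 ^ j) ^ (α + β) * (L ^ 2 * ((1 / 4) ^ d / 2)) := by ring
      _ ≤ _ := by gcongr; linarith
  -- the diagonal of the kernel, from a constant shift of the conditional covariance
  have hB : L ^ 2 * δ ^ 2 / 2 * ((2 ^ j) ^ d / n) ≤ w := by
    have q1 := (abs_le.1 (hle 0 0 0 (by simpa using hε0.le) (by simpa using hε0'.le)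
      (by simp; positivity))).2
    have q2 := (abs_le.1 (hle 0 0 (δ ^ 2) (by simpa using hε0.le) (by simpa using hε0'.le)
      (by simp))).1
    linarith
  have hjp : (0 : ℝ) < 2 ^ j := by positivity
  have hsd : 0 < α + β + d := by positivity
  -- the two bounds balance at `2 ^ j = n ^ (1 / (α + β + d))`
  have hfin : κ * (n : ℝ) ^ (-((α + β) / (α + β + d))) ≤ w := by
    rcases le_total (2 ^ j : ℝ) ((n : ℝ) ^ (1 / (α + β + d))) with hc | hc
    · refine le_trans ?_ hA
      rw [div_eq_mul_inv _ ((2 ^ j : ℝ) ^ (α + β)), ← Real.rpow_neg hjp.le]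
      refine mul_le_mul (min_le_left _ _) ?_ (by positivity) (by positivity)
      calc (n : ℝ) ^ (-((α + β) / (α + β + d))) = ((n : ℝ) ^ (1 / (α + β + d))) ^ (-(α + β)) := by
            rw [← Real.rpow_mul hn0.le]; congr 1; ring
        _ ≤ _ := Real.rpow_le_rpow_of_nonpos hjp hc (by linarith)
    · refine le_trans ?_ hB
      refine mul_le_mul (min_le_right _ _) ?_ (by positivity) (by positivity)
      rw [le_div_iff₀ hn0]
      calc (n : ℝ) ^ (-((α + β) / (α + β + d))) * n = ((n : ℝ) ^ (1 / (α + β + d))) ^ d := by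
            rw [← Real.rpow_natCast _ d, ← Real.rpow_mul hn0.le]
            nth_rewrite 2 [← Real.rpow_one (n : ℝ)]
            rw [← Real.rpow_add hn0]
            congr 1; field_simp; ring
        _ ≤ _ := by gcongr
  have hsq : κ ^ 2 * (n : ℝ) ^ (-((2 * α + 2 * β) / (α + β + d)))
      = (κ * (n : ℝ) ^ (-((α + β) / (α + β + d)))) ^ 2 := by
    rw [mul_pow, ← Real.rpow_natCast ((n : ℝ) ^ _) 2, ← Real.rpow_mul hn0.le]
    congr 2; push_cast; ring
  rw [ENNReal.ofReal_le_iff_le_toReal hWt, hsq, ← Real.sq_sqrt (ENNReal.toReal_nonneg (a := W))]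
  exact pow_le_pow_left₀ (by positivity) hfin 2

end CDVBasis

/-! ### Upper bounds over the model -/

namespace CDVBasis

variable {S : ℕ} (B : CDVBasis S) {d : ℕ} {α β M C₁ C₂ : ℝ}

theorem exists_sq_integral_sub_projInner_le (hd : 0 < d) (hα : 0 < α) (hβ : 0 < β) (hM : 0 < M)
    (hαS : α < S) : ∃ C : ℝ, 0 < C ∧ ∀ p ∈ B.holderBall d α M, ∀ b ∈ B.holderBall d β M, ∀ j,
      B.J₀ ≤ j → (∫ x, p x * b x ∂cubeVol d - B.projInner j p b) ^ 2
        ≤ C * (((2 : ℝ) ^ j) ^ d) ^ (-(2 * (α + β) / d)) := by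
  have hS : 0 < S := by exact_mod_cast hα.trans hαS
  obtain ⟨c₁, hc₁, H₁⟩ := B.exists_approx hS hα d hM.le
  obtain ⟨c₂, hc₂, H₂⟩ := B.exists_approx hS hβ d hM.le
  refine ⟨c₁ * c₂, by positivity, fun p hp b hb j hj => ?_⟩
  have hb0 : 0 ≤ ∫ x, b x * b x ∂cubeVol d - B.projInner j b b :=
    sub_nonneg.2 (B.projInner_self_le hj hb.1.memLp_cubeVol)
  refine (B.sq_integral_sub_projInner_le hj hp.1.memLp_cubeVol hb.1.memLp_cubeVol).trans
    ((mul_le_mul (H₁ p hp j hj) (H₂ b hb j hj) hb0 (by positivity)).trans (le_of_eq ?_))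
  have hd' : (d : ℝ) ≠ 0 := by positivity
  have e : (((2 : ℝ) ^ j) ^ d) ^ (-(2 * (α + β) / d))
      = ((2 : ℝ) ^ (-(2 * α))) ^ j * ((2 : ℝ) ^ (-(2 * β))) ^ j := by
    rw [← mul_pow, ← Real.rpow_add two_pos, ← pow_mul, ← Real.rpow_natCast, ← Real.rpow_natCast,
      ← Real.rpow_mul two_pos.le, ← Real.rpow_mul two_pos.le]
    congr 1; push_cast; field_simp; ring
  rw [e]; ring

theorem worstRisk_le {C₀ c : ℝ} (hC₀ : 0 < C₀) (hc : 0 ≤ c) {m n j : ℕ} {T : Sample d m n → ℝ}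
    {A Q k : ℝ} (hk : 0 ≤ k) (hA : 0 ≤ A) (hQ : 0 ≤ Q)
    (hbias : ∀ p ∈ B.holderBall d α M, ∀ b ∈ B.holderBall d β M,
      (∫ x, p x * b x ∂cubeVol d - B.projInner j p b) ^ 2 ≤ c * k)
    (hT : ∀ P p b, IsRegressionLaw P (max |C₁| |C₂|) p b →
      ∫⁻ ω, ENNReal.ofReal ((T ω - psi P) ^ 2) ∂(sampleLaw m n P)
        ≤ ENNReal.ofReal (C₀ * (A + (∫ x, p x * b x ∂cubeVol d - B.projInner j p b) ^ 2 + Q))) :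
    worstRisk (B.model d α β M C₁ C₂) m n T ≤ ENNReal.ofReal (C₀ * (c + 1) * (A + k + Q)) := by
  refine iSup₂_le fun P hP => ?_
  obtain ⟨p, hp, b, hb, hreg⟩ := B.exists_isRegressionLaw hP
  refine (hT P p b hreg).trans (ENNReal.ofReal_le_ofReal ?_)
  rw [mul_assoc]
  have := hbias p hp b hb
  have h1 := mul_nonneg hc hA
  have h2 := mul_nonneg hc hQ
  exact mul_le_mul_of_nonneg_left (by nlinarith) hC₀.le

end CDVBasis

/-- The order of the risk: `k` and `K` are the smaller and the larger resolution, and `k₁` is the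
resolution that governs the bias. -/
noncomputable def rateBound (d : ℕ) (s : ℝ) (n : ℕ) (k K k₁ : ℝ) : ℝ :=
  1 / n + k₁ ^ (-(2 * s / d)) + ((k / n) ^ 2 + 1 / n * ((1 + K / n) * (1 + k / n + (k / n) ^ 2)))

namespace CDVBasis

variable {S : ℕ} (B : CDVBasis S) {d : ℕ} {α β M C₁ C₂ : ℝ}

theorem exists_worstRisk_INT_le (hd : 0 < d) (hα : 0 < α) (hβ : 0 < β) (hM : 0 < M)
    (hαS : α < S) : ∃ C : ℝ, 0 < C ∧ ∀ j₁ j₂ n : ℕ, B.J₀ ≤ j₁ → B.J₀ ≤ j₂ → 0 < n →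
      worstRisk (B.model d α β M C₁ C₂) 2 n (B.psiINT j₁ j₂)
        ≤ ENNReal.ofReal (C * rateBound d (α + β) n (((2 : ℝ) ^ min j₁ j₂) ^ d) 0
          (((2 : ℝ) ^ min j₁ j₂) ^ d)) := by
  obtain ⟨c, hc, hbias⟩ := B.exists_sq_integral_sub_projInner_le (β := β) hd hα hβ hM hαS
  obtain ⟨C₀, hC₀, hrisk⟩ := B.exists_risk_INT_le d (max |C₁| |C₂|)
  refine ⟨C₀ * (c + 1), by positivity, fun j₁ j₂ n h₁ h₂ hn => B.worstRisk_le hC₀ hc.le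
    (j := min j₁ j₂) (by positivity) (by positivity) (by positivity)
    (fun p hp b hb => hbias p hp b hb _ (le_min h₁ h₂))
    fun P p b hP => (hrisk P p b hP j₁ j₂ n h₁ h₂ hn).trans (ENNReal.ofReal_le_ofReal ?_)⟩
  rw [← add_assoc _ ((_ : ℝ) ^ 2)]
  exact mul_le_mul_of_nonneg_left (le_add_of_nonneg_right (by positivity)) hC₀.le

theorem exists_worstRisk_MC_le (hd : 0 < d) (hα : 0 < α) (hβ : 0 < β) (hM : 0 < M)
    (hαS : α < S) : ∃ C : ℝ, 0 < C ∧ ∀ j₁ j₂ n : ℕ, B.J₀ ≤ j₁ → B.J₀ ≤ j₂ → 0 < n →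
      worstRisk (B.model d α β M C₁ C₂) 3 n (B.psiMC j₁ j₂)
        ≤ ENNReal.ofReal (C * rateBound d (α + β) n (((2 : ℝ) ^ min j₁ j₂) ^ d)
          (((2 : ℝ) ^ max j₁ j₂) ^ d) (((2 : ℝ) ^ min j₁ j₂) ^ d)) := by
  obtain ⟨c, hc, hbias⟩ := B.exists_sq_integral_sub_projInner_le (β := β) hd hα hβ hM hαS
  obtain ⟨C₀, hC₀, hrisk⟩ := B.exists_risk_MC_le d (max |C₁| |C₂|)
  refine ⟨C₀ * (c + 1), by positivity, fun j₁ j₂ n h₁ h₂ hn => B.worstRisk_le hC₀ hc.le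
    (j := min j₁ j₂) (by positivity) (by positivity) (by positivity)
    (fun p hp b hb => hbias p hp b hb _ (le_min h₁ h₂))
    fun P p b hP => (hrisk P p b hP j₁ j₂ n h₁ h₂ hn).trans (le_of_eq ?_)⟩
  rw [← add_assoc _ ((_ : ℝ) ^ 2)]

theorem measurable_psiIF (j₁ j₂ n : ℕ) : Measurable fun w : (Fin n → Obs d) × (Fin n → Obs d) =>
    B.psiIF j₁ j₂ ![w.1, w.2] := by
  have e : ∀ {f : Obs d → ℝ} (_ : Measurable f) (j : ℕ) (i : Fin n),
      Measurable fun w : (Fin n → Obs d) × (Fin n → Obs d) =>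
        f (w.2 i) - B.regHat f j w.1 (obsX (w.2 i)) := fun hf j i =>
    (hf.comp ((measurable_pi_apply i).comp measurable_snd)).sub
      ((B.measurable_regHat hf j).comp (measurable_fst.prodMk
        (measurable_obsX.comp ((measurable_pi_apply i).comp measurable_snd))))
  exact (Finset.measurable_fun_sum _ fun i _ =>
    (e measurable_obsA j₁ i).mul (e measurable_obsY j₂ i)).const_mul _

/-- The risk bound for the bias-corrected estimator, applied to two of the subsamples. -/
theorem exists_worstRisk_IF_le (hd : 0 < d) (hα : 0 < α) (hβ : 0 < β) (hM : 0 < M)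
    (hαS : α < S) : ∃ C : ℝ, 0 < C ∧ ∀ (j₁ j₂ m n : ℕ) (i i' : Fin m), i ≠ i' → B.J₀ ≤ j₁ →
      B.J₀ ≤ j₂ → 0 < n →
      worstRisk (B.model d α β M C₁ C₂) m n (fun ω => B.psiIF j₁ j₂ ![ω i, ω i'])
        ≤ ENNReal.ofReal (C * rateBound d (α + β) n (((2 : ℝ) ^ min j₁ j₂) ^ d)
          (((2 : ℝ) ^ max j₁ j₂) ^ d) (((2 : ℝ) ^ max j₁ j₂) ^ d)) := by
  obtain ⟨c, hc, hbias⟩ := B.exists_sq_integral_sub_projInner_le (β := β) hd hα hβ hM hαS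
  obtain ⟨C₀, hC₀, hrisk⟩ := B.exists_risk_IF_le d (max |C₁| |C₂|)
  refine ⟨C₀ * (c + 1), by positivity, fun j₁ j₂ m n i i' hii h₁ h₂ hn => B.worstRisk_le hC₀ hc.le
    (j := max j₁ j₂) (by positivity) (by positivity) (by positivity)
    (fun p hp b hb => hbias p hp b hb _ (h₁.trans (le_max_left _ _))) fun P p b hP => ?_⟩
  have := hP.isProb
  have hm : Measurable fun w : (Fin n → Obs d) × (Fin n → Obs d) =>
      ENNReal.ofReal ((B.psiIF j₁ j₂ ![w.1, w.2] - psi P) ^ 2) :=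
    (((B.measurable_psiIF j₁ j₂ n).sub_const _).pow_const 2).ennreal_ofReal
  rw [lintegral_sampleLaw_pair (P := P) hm hii]
  refine (hrisk P p b hP j₁ j₂ n h₁ h₂ hn).trans (le_of_eq ?_)
  rw [← add_assoc _ ((_ : ℝ) ^ 2)]

end CDVBasis

/-! ### Asymptotic comparison -/

section Asymptotics

open Filter Asymptotics

theorem isBigO_natCast_rpow {a b : ℝ} (h : a ≤ b) :
    (fun n : ℕ => (n : ℝ) ^ a) =O[atTop] fun n : ℕ => (n : ℝ) ^ b := by
  refine IsBigO.of_bound 1 ?_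
  filter_upwards [eventually_ge_atTop 1] with n hn
  have hn1 : (1 : ℝ) ≤ n := by exact_mod_cast hn
  rw [one_mul, Real.norm_of_nonneg (by positivity), Real.norm_of_nonneg (by positivity)]
  exact Real.rpow_le_rpow_of_exponent_le hn1 h

theorem Asymptotics.IsBigO.mul_natCast_rpow {f g : ℕ → ℝ} {a b c : ℝ}
    (hf : f =O[atTop] fun n : ℕ => (n : ℝ) ^ a) (hg : g =O[atTop] fun n : ℕ => (n : ℝ) ^ b)
    (h : a + b ≤ c) : (fun n => f n * g n) =O[atTop] fun n : ℕ => (n : ℝ) ^ c := by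
  refine (hf.mul hg).trans (IsBigO.trans (EventuallyEq.isBigO ?_) (isBigO_natCast_rpow h))
  filter_upwards [eventually_gt_atTop 0] with n hn
  rw [Real.rpow_add (by exact_mod_cast hn)]

/-- The rate of the risk bound, when `k` and `K` are at most of the orders `n ^ a` and `n ^ b`, and
`k₁` is at least of the order `n ^ l`. -/
theorem isBigO_rateBound {d : ℕ} {s a b l τ : ℝ} {k K k₁ : ℕ → ℝ} (hs : 0 ≤ s)
    (hk₀ : ∀ n, 0 < k₁ n)
    (hk : k =O[atTop] fun n : ℕ => (n : ℝ) ^ a) (hK : K =O[atTop] fun n : ℕ => (n : ℝ) ^ b)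
    (hk₁ : (fun n : ℕ => (n : ℝ) ^ l) =O[atTop] k₁) (ha : a ≤ 1) (hτ : τ ≤ 1)
    (ha' : 2 * a - 2 ≤ -τ) (hb : b - 2 ≤ -τ) (hl : τ ≤ 2 * s * l / d) :
    (fun n => rateBound d s n (k n) (K n) (k₁ n)) =O[atTop] fun n : ℕ => (n : ℝ) ^ (-τ) := by
  have hinv : (fun n : ℕ => (1 : ℝ) / n) =O[atTop] fun n : ℕ => (n : ℝ) ^ (-1 : ℝ) := by
    simp_rw [Real.rpow_neg_one, one_div]
    exact isBigO_refl _ _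
  have hkn : (fun n : ℕ => k n / n) =O[atTop] fun n : ℕ => (n : ℝ) ^ (a - 1) := by
    have := hk.mul_natCast_rpow hinv (c := a - 1) (by linarith)
    simpa only [mul_one_div] using this
  have hKn : (fun n : ℕ => K n / n) =O[atTop] fun n : ℕ => (n : ℝ) ^ (b - 1) := by
    have := hK.mul_natCast_rpow hinv (c := b - 1) (by linarith)
    simpa only [mul_one_div] using this
  have hkn2 : (fun n : ℕ => (k n / n) ^ 2) =O[atTop] fun n : ℕ => (n : ℝ) ^ (2 * a - 2) := by
    simp_rw [sq]
    exact hkn.mul_natCast_rpow hkn (by linarith)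
  have one : (fun _ : ℕ => (1 : ℝ)) =O[atTop] fun n : ℕ => (n : ℝ) ^ (0 : ℝ) := by
    simp_rw [Real.rpow_zero]; exact isBigO_refl _ _
  have hsum : (fun n : ℕ => 1 + k n / n + (k n / n) ^ 2) =O[atTop]
      fun n : ℕ => (n : ℝ) ^ (0 : ℝ) :=
    (one.add (hkn.trans (isBigO_natCast_rpow (by linarith)))).add
      (hkn2.trans (isBigO_natCast_rpow (by linarith)))
  have hnoise : (fun n : ℕ => (1 : ℝ) / n * (1 + K n / n)) =O[atTop]
      fun n : ℕ => (n : ℝ) ^ (-τ) := by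
    simp_rw [mul_add, mul_one]
    exact (hinv.trans (isBigO_natCast_rpow (by linarith))).add
      (hinv.mul_natCast_rpow hKn (by linarith))
  have hbias : (fun n => k₁ n ^ (-(2 * s / d))) =O[atTop] fun n : ℕ => (n : ℝ) ^ (-τ) := by
    have h1 := hk₁.rpow (r := 2 * s / d) (by positivity) (Eventually.of_forall fun n => (hk₀ n).le)
    have h2 := h1.inv_rev (by
      filter_upwards [eventually_gt_atTop 0] with n hn h0
      have : (0 : ℝ) < n := by exact_mod_cast hn
      exact absurd h0 (by positivity))
    simp_rw [fun n => Real.rpow_neg (hk₀ n).le]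
    refine h2.trans (IsBigO.trans (EventuallyEq.isBigO ?_) (isBigO_natCast_rpow
      (show -(l * (2 * s / d)) ≤ -τ by rw [neg_le_neg_iff]; convert hl using 1; ring)))
    refine Eventually.of_forall fun n => ?_
    simp only
    rw [← Real.rpow_mul n.cast_nonneg, Real.rpow_neg n.cast_nonneg]
  refine ((hinv.trans (isBigO_natCast_rpow (by linarith))).add hbias).add
    ((hkn2.trans (isBigO_natCast_rpow ha')).add ?_)
  simp_rw [← mul_assoc]
  exact hnoise.mul_natCast_rpow hsum (by linarith)

theorem AsympLE.trans {a b c : ℕ → ℝ≥0∞} (h₁ : AsympLE a b) (h₂ : AsympLE b c) : AsympLE a c := by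
  obtain ⟨C, hC, n₀, h⟩ := h₁
  obtain ⟨C', hC', n₁, h'⟩ := h₂
  refine ⟨C * C', mul_pos hC hC', max n₀ n₁, fun n hn => ?_⟩
  calc a n ≤ C * b n := h n (le_of_max_le_left hn)
    _ ≤ C * (C' * c n) := by gcongr; exact h' n (le_of_max_le_right hn)
    _ = _ := by push_cast; ring

theorem isBigO_of_asympLE {f g : ℕ → ℝ} (hf : ∀ n, 0 ≤ f n) (hg : ∀ n, 0 ≤ g n)
    (h : AsympLE (fun n => ENNReal.ofReal (f n)) fun n => ENNReal.ofReal (g n)) :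
    f =O[atTop] g := by
  obtain ⟨C, hC, n₀, h⟩ := h
  refine IsBigO.of_bound C ?_
  filter_upwards [eventually_ge_atTop n₀] with n hn
  rw [Real.norm_of_nonneg (hf n), Real.norm_of_nonneg (hg n)]
  have := h n hn
  rwa [← ENNReal.ofReal_coe_nnreal, ← ENNReal.ofReal_mul C.coe_nonneg,
    ENNReal.ofReal_le_ofReal_iff (mul_nonneg C.coe_nonneg (hg n))] at this

theorem asympLE_powSeq_of_isBigO {W : ℕ → ℝ≥0∞} {f : ℕ → ℝ} {C e : ℝ} (hC : 0 < C)
    (h : ∀ n, 0 < n → W n ≤ ENNReal.ofReal (C * f n))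
    (hf : f =O[atTop] fun n : ℕ => (n : ℝ) ^ e) : AsympLE W (powSeq e) := by
  obtain ⟨c, hc, hcf⟩ := hf.exists_pos
  rw [IsBigOWith] at hcf
  obtain ⟨n₀, hn₀⟩ := eventually_atTop.1 hcf
  refine ⟨(C * c).toNNReal, Real.toNNReal_pos.2 (by positivity), max n₀ 1, fun n hn => ?_⟩
  refine (h n (by have := le_of_max_le_right hn; omega)).trans ?_
  have h1 := hn₀ n (le_of_max_le_left hn)
  rw [Real.norm_of_nonneg (by positivity : (0 : ℝ) ≤ (n : ℝ) ^ e)] at h1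
  change _ ≤ ENNReal.ofReal (C * c) * ENNReal.ofReal ((n : ℝ) ^ e)
  rw [← ENNReal.ofReal_mul (by positivity), mul_assoc]
  refine ENNReal.ofReal_le_ofReal ?_
  exact mul_le_mul_of_nonneg_left ((le_abs_self _).trans h1) hC.le

theorem asympLE_of_ofReal_le {W : ℕ → ℝ≥0∞} {c e : ℝ} (hc : 0 < c)
    (h : ∀ n : ℕ, 0 < n → ENNReal.ofReal (c * (n : ℝ) ^ e) ≤ W n) : AsympLE (powSeq e) W := by
  refine ⟨c⁻¹.toNNReal, Real.toNNReal_pos.2 (by positivity), 1, fun n hn => ?_⟩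
  calc powSeq e n = ENNReal.ofReal c⁻¹ * ENNReal.ofReal (c * (n : ℝ) ^ e) := by
        rw [← ENNReal.ofReal_mul (by positivity), inv_mul_cancel_left₀ hc.ne', powSeq]
    _ ≤ ENNReal.ofReal c⁻¹ * W n := by gcongr; exact h n hn
    _ = _ := rfl

theorem le_of_asympLE_powSeq {a b : ℝ} (h : AsympLE (powSeq a) (powSeq b)) : a ≤ b := by
  have h1 := isBigO_of_asympLE (fun n => by positivity) (fun n => by positivity) h
  by_contra! hlt
  have h2 := h1.mul_natCast_rpow (isBigO_refl (fun n : ℕ => (n : ℝ) ^ (-b)) atTop) (c := 0)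
    (by linarith)
  have h3 : Tendsto (fun n : ℕ => (n : ℝ) ^ (a - b)) atTop atTop :=
    (tendsto_rpow_atTop (sub_pos.2 hlt)).comp tendsto_natCast_atTop_atTop
  obtain ⟨C, hC⟩ := h2.bound
  obtain ⟨n, hn, hn1, hn0⟩ := (hC.and ((h3.eventually_gt_atTop C).and
    (eventually_gt_atTop 0))).exists
  have hn' : (0 : ℝ) < n := by exact_mod_cast hn0
  rw [← Real.rpow_add hn', Real.rpow_zero, norm_one, mul_one, ← sub_eq_add_neg] at hn
  exact absurd ((le_abs_self _).trans hn) (not_le.2 hn1)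

theorem kMin_eq (d : ℕ) (j₁ j₂ : ℕ → ℕ) :
    kMin d j₁ j₂ = fun n => ENNReal.ofReal (((2 : ℝ) ^ min (j₁ n) (j₂ n)) ^ d) := by
  funext n
  have hmono : Monotone fun j : ℕ => (2 : ℝ≥0∞) ^ (d * j) := fun i j h =>
    pow_le_pow_right₀ (by norm_num) (Nat.mul_le_mul_left d h)
  rw [kMin, ← hmono.map_min, ← pow_mul, ENNReal.ofReal_pow (by norm_num), ENNReal.ofReal_ofNat,
    mul_comm]

theorem kMax_eq (d : ℕ) (j₁ j₂ : ℕ → ℕ) :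
    kMax d j₁ j₂ = fun n => ENNReal.ofReal (((2 : ℝ) ^ max (j₁ n) (j₂ n)) ^ d) := by
  funext n
  have hmono : Monotone fun j : ℕ => (2 : ℝ≥0∞) ^ (d * j) := fun i j h =>
    pow_le_pow_right₀ (by norm_num) (Nat.mul_le_mul_left d h)
  rw [kMax, ← hmono.map_max, ← pow_mul, ENNReal.ofReal_pow (by norm_num), ENNReal.ofReal_ofNat,
    mul_comm]

/-- Resolutions `2 ^ (j d)` of a given order. -/
theorem exists_resolution {d : ℕ} (hd : 0 < d) (J₀ : ℕ) {l : ℝ} (hl : 0 ≤ l) :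
    ∃ j : ℕ → ℕ, (∀ n, J₀ ≤ j n) ∧
      (fun n => ((2 : ℝ) ^ j n) ^ d) =O[atTop] (fun n : ℕ => (n : ℝ) ^ l) ∧
      (fun n : ℕ => (n : ℝ) ^ l) =O[atTop] fun n => ((2 : ℝ) ^ j n) ^ d := by
  have hex : ∀ n : ℕ, ∃ i : ℕ, 0 < n →
      (2 : ℝ) ^ i ≤ (n : ℝ) ^ (l / d) ∧ (n : ℝ) ^ (l / d) < 2 ^ (i + 1) := fun n => by
    by_cases hn : 0 < n
    · have hn1 : (1 : ℝ) ≤ n := by exact_mod_cast hn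
      obtain ⟨i, hi⟩ := exists_nat_pow_near (Real.one_le_rpow hn1 (div_nonneg hl d.cast_nonneg))
        (one_lt_two (α := ℝ))
      exact ⟨i, fun _ => hi⟩
    · exact ⟨0, fun h => absurd h hn⟩
  choose i hi using hex
  have hpow : ∀ n : ℕ, (n : ℝ) ^ l = ((n : ℝ) ^ (l / d)) ^ d := fun n => by
    have hd' : (d : ℝ) ≠ 0 := by positivity
    rw [← Real.rpow_natCast _ d, ← Real.rpow_mul n.cast_nonneg, div_mul_cancel₀ _ hd']
  refine ⟨fun n => J₀ + 1 + i n, fun n => by dsimp only; omega, IsBigO.of_bound (((2 : ℝ) ^ (J₀ + 1)) ^ d) ?_,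
    IsBigO.of_bound 1 ?_⟩
  all_goals
    filter_upwards [eventually_gt_atTop 0] with n hn
    obtain ⟨h1, h2⟩ := hi n hn
    rw [Real.norm_of_nonneg (by positivity), Real.norm_of_nonneg (by positivity), hpow]
  · rw [pow_add, mul_pow]
    gcongr
  · rw [one_mul]
    gcongr
    refine h2.le.trans (pow_le_pow_right₀ (by norm_num) (by omega))

end Asymptotics

/-! ### Rates of convergence -/

namespace CDVBasis

open Filter Asymptotics

variable {S : ℕ} (B : CDVBasis S) {d : ℕ} {α β M C₁ C₂ : ℝ}

section Upper

variable {a b l τ : ℝ} {j₁ j₂ : ℕ → ℕ}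

theorem isBigO_of_kMin_le (h : AsympLE (kMin d j₁ j₂) (powSeq a)) :
    (fun n => ((2 : ℝ) ^ min (j₁ n) (j₂ n)) ^ d) =O[atTop] fun n : ℕ => (n : ℝ) ^ a := by
  rw [kMin_eq] at h
  exact isBigO_of_asympLE (fun n => by positivity) (fun n => by positivity) h

theorem isBigO_of_kMax_le (h : AsympLE (kMax d j₁ j₂) (powSeq a)) :
    (fun n => ((2 : ℝ) ^ max (j₁ n) (j₂ n)) ^ d) =O[atTop] fun n : ℕ => (n : ℝ) ^ a := by
  rw [kMax_eq] at h
  exact isBigO_of_asympLE (fun n => by positivity) (fun n => by positivity) h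

theorem isBigO_of_le_kMin (h : AsympLE (powSeq l) (kMin d j₁ j₂)) :
    (fun n : ℕ => (n : ℝ) ^ l) =O[atTop] fun n => ((2 : ℝ) ^ min (j₁ n) (j₂ n)) ^ d := by
  rw [kMin_eq] at h
  exact isBigO_of_asympLE (fun n => by positivity) (fun n => by positivity) h

theorem isBigO_of_le_kMax (h : AsympLE (powSeq l) (kMax d j₁ j₂)) :
    (fun n : ℕ => (n : ℝ) ^ l) =O[atTop] fun n => ((2 : ℝ) ^ max (j₁ n) (j₂ n)) ^ d := by
  rw [kMax_eq] at h
  exact isBigO_of_asympLE (fun n => by positivity) (fun n => by positivity) h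

theorem asympLE_worstRisk_INT (hd : 0 < d) (hα : 0 < α) (hβ : 0 < β) (hM : 0 < M) (hαS : α < S)
    (h₁ : ∀ n, B.J₀ ≤ j₁ n) (h₂ : ∀ n, B.J₀ ≤ j₂ n)
    (hl : AsympLE (powSeq l) (kMin d j₁ j₂)) (hk : AsympLE (kMin d j₁ j₂) (powSeq a))
    (ha : a ≤ 1) (hτ : τ ≤ 1) (ha' : 2 * a - 2 ≤ -τ) (hlτ : τ ≤ 2 * (α + β) * l / d) :
    AsympLE (fun n => worstRisk (B.model d α β M C₁ C₂) 2 n (B.psiINT (j₁ n) (j₂ n)))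
      (powSeq (-τ)) := by
  obtain ⟨C, hC, H⟩ := B.exists_worstRisk_INT_le (C₁ := C₁) (C₂ := C₂) hd hα hβ hM hαS
  exact asympLE_powSeq_of_isBigO hC (fun n hn => H _ _ n (h₁ n) (h₂ n) hn)
    (isBigO_rateBound (b := 2 - τ) (by positivity) (fun n => by positivity) (isBigO_of_kMin_le hk)
      (isBigO_zero _ _) (isBigO_of_le_kMin hl) ha hτ ha' (by linarith) hlτ)

theorem asympLE_worstRisk_MC (hd : 0 < d) (hα : 0 < α) (hβ : 0 < β) (hM : 0 < M) (hαS : α < S)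
    (h₁ : ∀ n, B.J₀ ≤ j₁ n) (h₂ : ∀ n, B.J₀ ≤ j₂ n)
    (hl : AsympLE (powSeq l) (kMin d j₁ j₂)) (hk : AsympLE (kMin d j₁ j₂) (powSeq a))
    (hK : AsympLE (kMax d j₁ j₂) (powSeq b))
    (ha : a ≤ 1) (hτ : τ ≤ 1) (ha' : 2 * a - 2 ≤ -τ) (hb : b - 2 ≤ -τ)
    (hlτ : τ ≤ 2 * (α + β) * l / d) :
    AsympLE (fun n => worstRisk (B.model d α β M C₁ C₂) 3 n (B.psiMC (j₁ n) (j₂ n)))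
      (powSeq (-τ)) := by
  obtain ⟨C, hC, H⟩ := B.exists_worstRisk_MC_le (C₁ := C₁) (C₂ := C₂) hd hα hβ hM hαS
  exact asympLE_powSeq_of_isBigO hC (fun n hn => H _ _ n (h₁ n) (h₂ n) hn)
    (isBigO_rateBound (by positivity) (fun n => by positivity) (isBigO_of_kMin_le hk)
      (isBigO_of_kMax_le hK) (isBigO_of_le_kMin hl) ha hτ ha' hb hlτ)

theorem asympLE_worstRisk_IF (hd : 0 < d) (hα : 0 < α) (hβ : 0 < β) (hM : 0 < M) (hαS : α < S)
    (h₁ : ∀ n, B.J₀ ≤ j₁ n) (h₂ : ∀ n, B.J₀ ≤ j₂ n)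
    (hk : AsympLE (kMin d j₁ j₂) (powSeq a)) (hl : AsympLE (powSeq l) (kMax d j₁ j₂))
    (hK : AsympLE (kMax d j₁ j₂) (powSeq b))
    (ha : a ≤ 1) (hτ : τ ≤ 1) (ha' : 2 * a - 2 ≤ -τ) (hb : b - 2 ≤ -τ)
    (hlτ : τ ≤ 2 * (α + β) * l / d) :
    AsympLE (fun n => worstRisk (B.model d α β M C₁ C₂) 2 n (B.psiIF (j₁ n) (j₂ n)))
      (powSeq (-τ)) := by
  obtain ⟨C, hC, H⟩ := B.exists_worstRisk_IF_le (C₁ := C₁) (C₂ := C₂) hd hα hβ hM hαS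
  exact asympLE_powSeq_of_isBigO hC
    (fun n hn => H _ _ 2 n 0 1 (by decide) (h₁ n) (h₂ n) hn)
    (isBigO_rateBound (by positivity) (fun n => by positivity) (isBigO_of_kMin_le hk)
      (isBigO_of_kMax_le hK) (isBigO_of_le_kMax hl) ha hτ ha' hb hlτ)

theorem minimaxRisk_le_worstRisk {Q : Set (Measure (Obs d))} {m n : ℕ} {T : Sample d m n → ℝ}
    (hT : Measurable T) : minimaxRisk Q m n ≤ worstRisk Q m n T :=
  iInf₂_le (f := fun (T : Sample d m n → ℝ) (_ : Measurable T) => worstRisk Q m n T) T hT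

/-- The bias-corrected estimator with a fixed resolution for one regression function, and one of the
order `n ^ l` for the other, bounds the minimax risk. -/
theorem asympLE_minimaxRisk (hd : 0 < d) (hα : 0 < α) (hβ : 0 < β) (hM : 0 < M) (hαS : α < S)
    {m : ℕ} (hm : 2 ≤ m) (hl : 0 ≤ l) (hτ : τ ≤ 1) (hb : l - 2 ≤ -τ)
    (hlτ : τ ≤ 2 * (α + β) * l / d) :
    AsympLE (fun n => minimaxRisk (B.model d α β M C₁ C₂) m n) (powSeq (-τ)) := by
  obtain ⟨C, hC, H⟩ := B.exists_worstRisk_IF_le (C₁ := C₁) (C₂ := C₂) hd hα hβ hM hαS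
  obtain ⟨j, hj, hj₁, hj₂⟩ := exists_resolution hd B.J₀ hl
  obtain ⟨i, i', hii⟩ : ∃ i i' : Fin m, i ≠ i' :=
    ⟨⟨0, by omega⟩, ⟨1, by omega⟩, fun h => absurd (congrArg Fin.val h) zero_ne_one⟩
  have hmeas : ∀ n, Measurable fun ω : Sample d m n => B.psiIF B.J₀ (j n) ![ω i, ω i'] := fun n =>
    (B.measurable_psiIF B.J₀ (j n) n).comp
      (g := fun w : (Fin n → Obs d) × (Fin n → Obs d) => B.psiIF B.J₀ (j n) ![w.1, w.2])
      (f := fun ω : Sample d m n => (ω i, ω i'))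
      ((measurable_pi_apply i).prodMk (measurable_pi_apply i'))
  have hle : ∀ n, 0 < n → minimaxRisk (B.model d α β M C₁ C₂) m n
      ≤ ENNReal.ofReal (C * rateBound d (α + β) n (((2 : ℝ) ^ B.J₀) ^ d) (((2 : ℝ) ^ j n) ^ d)
        (((2 : ℝ) ^ j n) ^ d)) := fun n hn => by
    have := H B.J₀ (j n) m n i i' hii le_rfl (hj n) hn
    rw [min_eq_left (hj n), max_eq_right (hj n)] at this
    exact (minimaxRisk_le_worstRisk (hmeas n)).trans this
  have hconst : (fun _ : ℕ => ((2 : ℝ) ^ B.J₀) ^ d) =O[atTop] fun n : ℕ => (n : ℝ) ^ (0 : ℝ) := by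
    simp only [Real.rpow_zero]
    exact isBigO_const_const _ one_ne_zero _
  exact asympLE_powSeq_of_isBigO hC hle (isBigO_rateBound (a := 0) (by positivity)
    (fun n => by positivity) hconst hj₁ hj₂ zero_le_one hτ (by linarith) hb hlτ)

end Upper

section Lower

variable {B} {M₀ δ : ℝ} {u v : (Fin d → ℝ) → ℝ}

theorem IsCenter.parametric_le_minimaxRisk (h : B.IsCenter α β M₀ C₁ C₂ δ u v) (hM₀ : M₀ < M)
    {m : ℕ} (hm : 0 < m) :
    AsympLE (powSeq (-1)) fun n => minimaxRisk (B.model d α β M C₁ C₂) m n := by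
  obtain ⟨c, hc, H⟩ := h.exists_minimaxRisk_ge_parametric hM₀
  refine asympLE_of_ofReal_le (c := c / m) (by positivity) fun n hn => ?_
  refine le_trans (le_of_eq ?_) (H m n hm hn)
  rw [Real.rpow_neg_one, ← div_eq_mul_inv, div_div]

theorem IsCenter.nonparametric_le_minimaxRisk (h : B.IsCenter α β M₀ C₁ C₂ δ u v) (hα : 0 < α)
    (hβ : 0 < β) (hM : 0 < M) (hαS : α < S) (hβS : β < S) (hM₀ : M₀ < M)
    (hs : 2 * (α + β) ≤ d) {m : ℕ} (hm : 0 < m) :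
    AsympLE (powSeq (-((4 * α + 4 * β) / (2 * α + 2 * β + d))))
      fun n => minimaxRisk (B.model d α β M C₁ C₂) m n := by
  obtain ⟨c, hc, H⟩ := h.exists_minimaxRisk_ge_nonparametric hα hβ hM hαS hβS hM₀ hs
  refine asympLE_of_ofReal_le
    (c := c * (m : ℝ) ^ (-((4 * α + 4 * β) / (2 * α + 2 * β + d)))) (by positivity) fun n hn => ?_
  refine le_trans (le_of_eq ?_) (H m n hm hn)
  rw [Real.mul_rpow m.cast_nonneg n.cast_nonneg, mul_assoc]

/-- The lower bound for the integral-based and the Monte Carlo-based estimators. -/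
theorem IsCenter.le_worstRisk_plugin (h : B.IsCenter α β M₀ C₁ C₂ δ u v) (hd : 0 < d) (hα : 0 < α)
    (hβ : 0 < β) (hM : 0 < M) (hαS : α < S) (hβS : β < S) (hM₀ : M₀ < M) {j₁ j₂ : ℕ → ℕ}
    (h₁ : ∀ n, B.J₀ ≤ j₁ n) (h₂ : ∀ n, B.J₀ ≤ j₂ n) :
    AsympLE (powSeq (-((2 * α + 2 * β) / (α + β + d))))
      (fun n => worstRisk (B.model d α β M C₁ C₂) 2 n (B.psiINT (j₁ n) (j₂ n))) ∧
    AsympLE (powSeq (-((2 * α + 2 * β) / (α + β + d))))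
      (fun n => worstRisk (B.model d α β M C₁ C₂) 3 n (B.psiMC (j₁ n) (j₂ n))) := by
  obtain ⟨c, hc, H⟩ := h.exists_sq_pluginBias_ge hd hα hβ hM hαS hβS hM₀
  constructor <;> refine asympLE_of_ofReal_le hc fun n hn => H _ _ n (h₁ n) (h₂ n) hn _
    fun P hP p b hreg => le_trans ?_ (le_iSup₂ (f := fun P (_ : P ∈ B.model d α β M C₁ C₂) =>
      ∫⁻ ω, ENNReal.ofReal ((_ - psi P) ^ 2) ∂(sampleLaw _ n P)) P hP)
  · exact B.sq_bias_le_risk_INT hreg (h₁ n) (h₂ n) hn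
  · exact B.sq_bias_le_risk_MC hreg hn

end Lower

end CDVBasis

theorem mainTheorem10 {d S : ℕ} (hd : 0 < d) (B : CDVBasis S) {α β M C₁ C₂ : ℝ}
    (hα : 0 < α) (hβ : 0 < β) (hM : 0 < M) (hαS : α < S) (hβS : β < S)
    -- the model has an interior point (for instance, this holds whenever `C₁ < 0 < C₂`)
    (hint : ∃ M₀ < M, ∃ δ > 0, ∃ p₀ ∈ B.holderBall d α M₀, ∃ b₀ ∈ B.holderBall d β M₀,
      ∀ x ∈ cube d, p₀ x ∈ Set.Icc (C₁ + δ) (C₂ - δ) ∧ b₀ x ∈ Set.Icc (C₁ + δ) (C₂ - δ)) :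
    -- the minimax rate
    (∀ m : ℕ, 2 ≤ m →
      ((α + β) / 2 ≥ d / 4 →
        AsympEq (fun n => minimaxRisk (B.model d α β M C₁ C₂) m n) (powSeq (-1))) ∧
      ((α + β) / 2 < d / 4 →
        AsympEq (fun n => minimaxRisk (B.model d α β M C₁ C₂) m n)
          (powSeq (-((4 * α + 4 * β) / (2 * α + 2 * β + d)))))) ∧
    -- the estimators, for every choice of the resolutions
    ∀ j₁ j₂ : ℕ → ℕ, (∀ n, B.J₀ ≤ j₁ n) → (∀ n, B.J₀ ≤ j₂ n) →
      ((α + β) / 2 ≥ d / 2 →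
        -- INT
        (AsympLE (powSeq (d / (2 * α + 2 * β))) (kMin d j₁ j₂) →
          AsympLE (kMin d j₁ j₂) (powSeq (1 / 2)) →
          MinimaxRateOptimal (B.model d α β M C₁ C₂) 2 (fun n => B.psiINT (j₁ n) (j₂ n))) ∧
        -- MC
        (AsympLE (powSeq (d / (2 * α + 2 * β))) (kMin d j₁ j₂) →
          AsympLE (kMin d j₁ j₂) (powSeq (1 / 2)) →
          AsympLE (kMax d j₁ j₂) (powSeq 1) →
          MinimaxRateOptimal (B.model d α β M C₁ C₂) 3 (fun n => B.psiMC (j₁ n) (j₂ n))) ∧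
        -- IF
        (AsympLE (kMin d j₁ j₂) (powSeq (1 / 2)) →
          AsympLE (powSeq (d / (2 * α + 2 * β))) (kMax d j₁ j₂) →
          AsympLE (kMax d j₁ j₂) (powSeq 1) →
          MinimaxRateOptimal (B.model d α β M C₁ C₂) 2 (fun n => B.psiIF (j₁ n) (j₂ n)))) ∧
      ((α + β) / 2 < d / 2 →
        -- INT: never optimal; lower bound for all resolutions; attained by the stated choice
        (¬ MinimaxRateOptimal (B.model d α β M C₁ C₂) 2 (fun n => B.psiINT (j₁ n) (j₂ n)) ∧
          AsympLE (powSeq (-((2 * α + 2 * β) / (α + β + d))))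
            (fun n => worstRisk (B.model d α β M C₁ C₂) 2 n (B.psiINT (j₁ n) (j₂ n))) ∧
          (AsympEq (kMin d j₁ j₂) (powSeq (d / (α + β + d))) →
            AsympEq (fun n => worstRisk (B.model d α β M C₁ C₂) 2 n (B.psiINT (j₁ n) (j₂ n)))
              (powSeq (-((2 * α + 2 * β) / (α + β + d)))))) ∧
        -- MC: never optimal; lower bound for all resolutions; attained by the stated choice
        (¬ MinimaxRateOptimal (B.model d α β M C₁ C₂) 3 (fun n => B.psiMC (j₁ n) (j₂ n)) ∧
          AsympLE (powSeq (-((2 * α + 2 * β) / (α + β + d))))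
            (fun n => worstRisk (B.model d α β M C₁ C₂) 3 n (B.psiMC (j₁ n) (j₂ n))) ∧
          (AsympEq (kMin d j₁ j₂) (powSeq (d / (α + β + d))) →
            AsympLE (kMax d j₁ j₂) (powSeq (2 * d / (α + β + d))) →
            AsympEq (fun n => worstRisk (B.model d α β M C₁ C₂) 3 n (B.psiMC (j₁ n) (j₂ n)))
              (powSeq (-((2 * α + 2 * β) / (α + β + d)))))) ∧
        -- IF
        ((α + β) / 2 ≥ d / 4 →
          AsympLE (kMin d j₁ j₂) (powSeq (1 / 2)) →
          AsympLE (powSeq (d / (2 * α + 2 * β))) (kMax d j₁ j₂) →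
          AsympLE (kMax d j₁ j₂) (powSeq 1) →
          MinimaxRateOptimal (B.model d α β M C₁ C₂) 2 (fun n => B.psiIF (j₁ n) (j₂ n))) ∧
        ((α + β) / 2 < d / 4 →
          AsympLE (kMin d j₁ j₂) (powSeq (d / (2 * α + 2 * β + d))) →
          AsympEq (kMax d j₁ j₂) (powSeq (2 * d / (2 * α + 2 * β + d))) →
          MinimaxRateOptimal (B.model d α β M C₁ C₂) 2 (fun n => B.psiIF (j₁ n) (j₂ n)))) := by
  obtain ⟨M₀, hM₀, δ, u, v, hc⟩ := B.exists_isCenter hint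
  have hd0 : (0 : ℝ) < d := by exact_mod_cast hd
  have low := fun m (hm : 2 ≤ m) => hc.parametric_le_minimaxRisk (M := M) hM₀ (m := m) (by omega)
  have up : ∀ m, 2 ≤ m → (α + β) / 2 ≥ d / 4 →
      AsympLE (fun n => minimaxRisk (B.model d α β M C₁ C₂) m n) (powSeq (-1)) := fun m hm hs =>
    B.asympLE_minimaxRisk hd hα hβ hM hαS hm (l := 1) zero_le_one le_rfl (by norm_num)
      (by rw [le_div_iff₀ hd0]; linarith)
  have hq : 0 < 2 * α + 2 * β + d := by positivity
  have hq' : 0 < α + β + d := by positivity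
  have low' := fun m (hm : 2 ≤ m) (hs : (α + β) / 2 < d / 4) =>
    hc.nonparametric_le_minimaxRisk hα hβ hM hαS hβS hM₀ (by linarith) (m := m) (by omega)
  have up' : ∀ m, 2 ≤ m → (α + β) / 2 < d / 4 →
      AsympLE (fun n => minimaxRisk (B.model d α β M C₁ C₂) m n)
        (powSeq (-((4 * α + 4 * β) / (2 * α + 2 * β + d)))) := fun m hm hs =>
    B.asympLE_minimaxRisk hd hα hβ hM hαS hm (l := 2 * d / (2 * α + 2 * β + d)) (by positivity)
      (by rw [div_le_one hq]; linarith) (by field_simp; linarith)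
      (by field_simp; linarith)
  refine ⟨fun m hm => ⟨fun hs => ⟨up m hm hs, low m hm⟩, fun hs => ⟨up' m hm hs, low' m hm hs⟩⟩,
    fun j₁ j₂ h₁ h₂ => ?_⟩
  have hl1 : (1 : ℝ) ≤ 2 * (α + β) * (d / (2 * α + 2 * β)) / d := by field_simp; linarith
  have hIF : AsympLE (kMin d j₁ j₂) (powSeq (1 / 2)) →
      AsympLE (powSeq (d / (2 * α + 2 * β))) (kMax d j₁ j₂) →
      AsympLE (kMax d j₁ j₂) (powSeq 1) →
      MinimaxRateOptimal (B.model d α β M C₁ C₂) 2 (fun n => B.psiIF (j₁ n) (j₂ n)) :=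
    fun hk hl hK => (B.asympLE_worstRisk_IF hd hα hβ hM hαS h₁ h₂ hk hl hK (by norm_num) le_rfl
      (by norm_num) (by norm_num) hl1).trans (low 2 le_rfl)
  obtain ⟨lowINT, lowMC⟩ := hc.le_worstRisk_plugin hd hα hβ hM hαS hβS hM₀ h₁ h₂
  refine ⟨fun hs => ⟨fun hl hk => ?_, fun hl hk hK => ?_, hIF⟩, fun hs => ?_⟩
  · exact (B.asympLE_worstRisk_INT hd hα hβ hM hαS h₁ h₂ hl hk (by norm_num) le_rfl (by norm_num)
      hl1).trans (low 2 le_rfl)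
  · exact (B.asympLE_worstRisk_MC hd hα hβ hM hαS h₁ h₂ hl hk hK (by norm_num) le_rfl (by norm_num)
      (by norm_num) hl1).trans (low 3 (by norm_num))
  · have hτ : (2 * α + 2 * β) / (α + β + d) ≤ 1 := by rw [div_le_one hq']; linarith
    -- the rate of the plug-in estimators is slower than the minimax rate
    have hslow : ∀ m, 2 ≤ m → ∀ W : ℕ → ℝ≥0∞,
        AsympLE (powSeq (-((2 * α + 2 * β) / (α + β + d)))) W →
        ¬ AsympLE W fun n => minimaxRisk (B.model d α β M C₁ C₂) m n := by
      intro m hm W hW hopt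
      rcases le_or_gt ((d : ℝ) / 4) ((α + β) / 2) with h4 | h4
      · have := le_of_asympLE_powSeq ((hW.trans hopt).trans (up m hm h4))
        rw [neg_le_neg_iff, le_div_iff₀ hq'] at this
        linarith
      · have := le_of_asympLE_powSeq ((hW.trans hopt).trans (up' m hm h4))
        rw [neg_le_neg_iff, div_le_div_iff₀ hq hq'] at this
        nlinarith [mul_pos hα hd0, mul_pos hβ hd0, mul_pos hα hβ]
    have hab : 2 * (d / (α + β + d)) - 2 ≤ -((2 * α + 2 * β) / (α + β + d)) := by
      field_simp; linarith
    have hlτ : (2 * α + 2 * β) / (α + β + d) ≤ 2 * (α + β) * (d / (α + β + d)) / d := by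
      field_simp; linarith
    have ha : d / (α + β + d) ≤ 1 := by rw [div_le_one hq']; linarith
    refine ⟨⟨hslow 2 le_rfl _ lowINT, lowINT, fun hk => ⟨?_, lowINT⟩⟩,
      ⟨hslow 3 (by norm_num) _ lowMC, lowMC, fun hk hK => ⟨?_, lowMC⟩⟩, fun _ => hIF,
      fun h4 hk hK => ?_⟩
    · exact B.asympLE_worstRisk_INT hd hα hβ hM hαS h₁ h₂ hk.2 hk.1 ha hτ hab hlτ
    · exact B.asympLE_worstRisk_MC hd hα hβ hM hαS h₁ h₂ hk.2 hk.1 hK ha hτ hab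
        (by rw [mul_div_assoc]; exact hab) hlτ
    · exact (B.asympLE_worstRisk_IF hd hα hβ hM hαS h₁ h₂ hk hK.2 hK.1
        (τ := (4 * α + 4 * β) / (2 * α + 2 * β + d)) (by rw [div_le_one hq]; linarith)
        (by rw [div_le_one hq]; linarith) (by field_simp; linarith) (by field_simp; linarith)
        (by field_simp; linarith)).trans (low' 2 le_rfl h4)
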